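/- **Setting.** Let $D$ be a positive integer with $D\ge \exp(\exp(\exp(10^6)))$ and let $\chi$ be a real primitive Dirichlet character of modulus $D$. Write $\mathcal L=\log D$, $Q=\exp(\mathcal L^2)$, $\alpha=\mathcal L^{-2}$, $s_0=\tfrac12+iD$. Let $\nu(n)$, $\upsilon(n)$ be the Dirichlet coefficients of $\zeta(s)L(s,\chi)$ and $\zeta(s)^{-1}L(s,\chi)^{-1}$, and for a Dirichlet character $\psi$ put $$F(s,\psi)=\sum_{n\le D^5}\frac{\nu(n)\psi(n)}{n^s},\qquad G(s,\psi)=\sum_{n\le D^5}\frac{\upsilon(n)\psi(n)}{n^s}.$$ Let $\mathcal Q$ be the set of square-free integers $q$ with $Q<q<2Q$ and $(6,q)=1$; for $q\in\mathcal Q$ let $\Psi_q$ be the set of primitive characters $\psi$ mod $q$ such that $\psi\chi$ is a primitive character mod $[q,D]$, and let $\Psi=\bigcup_{q\in\mathcal Q}\Psi_q$. For a primitive character $\psi$ let $\Delta(s,\psi)$ be the meromorphic function $L(s,\psi)/L(1-s,\bar\psi)$, and for $\psi\in\Psi$ put $\Delta_1(s,\psi)=\Delta(s,\psi)\Delta(s,\psi\chi)$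 and $$\mathcal F(s,\psi)=F(s,\psi)+\Delta_1(s,\psi)F(1-s,\bar\psi).$$ Let $$\Omega_1=\{s:\ -2\alpha^{1/2}<\Re(s-s_0)<1,\ |\Im(s-s_0)|<1+20\mathcal L\},$$ $$\Omega_2=\{s:\ -\tfrac1{10}\alpha\log\mathcal L<\Re(s-s_0)<\tfrac12,\ |\Im(s-s_0)|<1+10\mathcal L\}.$$ Let $\Psi^*$ be the set of $\psi\in\Psi$ for which the following three inequalities all hold: $$\sup_{s\in\Omega_1}\{|F(s,\psi)|+|G(s,\psi)|\}<\mathcal L^3\log\mathcal L,\tag{I1}$$ $$\sup_{s\in\Omega_1}|F(s,\psi)G(s,\psi)-1|<\tfrac12,\tag{I2}$$ $$\sup_{s\in\Omega_2}|L(s,\psi)L(s,\psi\chi)-\mathcal F(s,\psi)|<\mathcal L^{-24/5}.\tag{I3}$$ For $\psi\in\Psi^*$ let $S(\psi)$ be the set of zeros $\rho$ of $L(s,\psi)L(s,\psi\chi)$ with $|\Im\rho-D|<1$. **Proposition 13.1.** Assume $$L(1,\chi)<(\log D)^{-17}(\log\log D)^{-1}.\tag{A1}$$ Then the set of pairs $(\psi,\rho)$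 with $\psi\in\Psi^*$ and $\rho\in S(\psi)$ is finite, and $$\sum_{\psi\in\Psi^*}\ \sum_{\rho\in S(\psi)}1\ \ge\ \tfrac1{100}\,\mathcal L^2Q^2.$$ -/

import Mathlib

open Complex DirichletCharacter

namespace LandauSiegel

noncomputable section

/-! ### Parameters attached to a modulus `D` -/

/-- `ℒ = log D`. -/
def ell (D : ℕ) : ℝ := Real.log D

/-- `Q = exp (ℒ²)`. -/
def Q (D : ℕ) : ℝ := Real.exp (ell D ^ 2)

/-- `α = ℒ⁻² = (log Q)⁻¹`. -/
def alpha (D : ℕ) : ℝ := (ell D ^ 2)⁻¹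

/-- `s₀ = 1/2 + iD`. -/
def s0 (D : ℕ) : ℂ := 1 / 2 + I * (D : ℂ)

/-- The domain `Ω₁`. -/
def Omega1 (D : ℕ) : Set ℂ :=
  {s | -2 * Real.sqrt (alpha D) < (s - s0 D).re ∧ (s - s0 D).re < 1 ∧
    |(s - s0 D).im| < 1 + 20 * ell D}

/-- The domain `Ω₂`. -/
def Omega2 (D : ℕ) : Set ℂ :=
  {s | -(1 / 10) * alpha D * Real.log (ell D) < (s - s0 D).re ∧ (s - s0 D).re < 1 / 2 ∧
    |(s - s0 D).im| < 1 + 10 * ell D}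

/-- The strict inequality `sup_{s ∈ Ω} f s < B`: the supremum is finite and smaller than `B`,
i.e. some number smaller than `B` is an upper bound for `f` on `Ω`. -/
def SupLT (Ω : Set ℂ) (f : ℂ → ℝ) (B : ℝ) : Prop := ∃ M < B, ∀ s ∈ Ω, f s ≤ M

/-! ### The coefficients `ν`, `υ` and the Dirichlet polynomials `F`, `G` -/

/-- The coefficients of `ζ(s) L(s,χ)`, that is, the Dirichlet convolution of `1` and `χ`. -/
def nu {D : ℕ} (χ : DirichletCharacter ℂ D) (n : ℕ) : ℂ :=
  ∑ d ∈ n.divisors, χ (d : ZMod D)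

/-- The coefficients of `ζ(s)⁻¹ L(s,χ)⁻¹`, that is, the Dirichlet convolution of `μ` and `μχ`. -/
def upsilon {D : ℕ} (χ : DirichletCharacter ℂ D) (n : ℕ) : ℂ :=
  ∑ d ∈ n.divisorsAntidiagonal,
    (ArithmeticFunction.moebius d.1 : ℂ) *
      ((ArithmeticFunction.moebius d.2 : ℂ) * χ (d.2 : ZMod D))

/-- `F(s,ψ) = ∑_{n ≤ D⁵} ν(n) ψ(n) n^{-s}`. -/
def F {D : ℕ} (χ : DirichletCharacter ℂ D) {q : ℕ} (ψ : DirichletCharacter ℂ q) (s : ℂ) : ℂ :=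
  ∑ n ∈ Finset.Icc 1 (D ^ 5), nu χ n * ψ (n : ZMod q) / (n : ℂ) ^ s

/-- `G(s,ψ) = ∑_{n ≤ D⁵} υ(n) ψ(n) n^{-s}`. -/
def G {D : ℕ} (χ : DirichletCharacter ℂ D) {q : ℕ} (ψ : DirichletCharacter ℂ q) (s : ℂ) : ℂ :=
  ∑ n ∈ Finset.Icc 1 (D ^ 5), upsilon χ n * ψ (n : ZMod q) / (n : ℂ) ^ s

/-! ### The factor of the functional equation -/

/-- For a primitive character `ψ` of modulus `k` this is the meromorphic function
`Δ(s,ψ) = L(s,ψ) / L(1-s,ψ̄) = C(ψ) (k/π)^{1/2-s} Γ((1-s+a)/2) / Γ((s+a)/2)`, where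
`a = (1 - ψ(-1))/2` and `C(ψ)` is the root number; here `gammaFactor ψ s` is
`π^{-(s+a)/2} Γ((s+a)/2)`.  The right-hand side is used, so that the values at the common zeros of
`L(s,ψ)` and `L(1-s,ψ̄)` are the right ones. See `LFunction_eq_Delta_mul`. -/
def Delta {k : ℕ} [NeZero k] (ψ : DirichletCharacter ℂ k) (s : ℂ) : ℂ :=
  rootNumber ψ * (k : ℂ) ^ (1 / 2 - s) * gammaFactor ψ (1 - s) / gammaFactor ψ s

/-- `Δ(s,ψ) = L(s,ψ) / L(1-s,ψ̄)` off the real axis (for a Dirichlet character, the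
complex conjugate `ψ̄` is the inverse `ψ⁻¹`). -/
theorem LFunction_eq_Delta_mul {k : ℕ} [NeZero k] {ψ : DirichletCharacter ℂ k}
    (hψ : ψ.IsPrimitive) {s : ℂ} (hs : s.im ≠ 0) :
    LFunction ψ s = Delta ψ s * LFunction ψ⁻¹ (1 - s) := by
  have hs0 : s ≠ 0 := by rintro rfl; simp at hs
  have hs1 : 1 - s ≠ 0 := by
    intro h
    apply hs
    have := congrArg Complex.im h
    simpa using this
  have hpar : gammaFactor ψ⁻¹ (1 - s) = gammaFactor ψ (1 - s) := by
    have : ψ⁻¹.Even ↔ ψ.Even := by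
      rw [DirichletCharacter.Even, DirichletCharacter.Even, MulChar.inv_apply_eq_inv']
      exact inv_eq_one
    unfold gammaFactor
    by_cases h : ψ.Even
    · rw [if_pos h, if_pos (this.mpr h)]
    · rw [if_neg h, if_neg (fun h' => h (this.mp h'))]
  have hg : gammaFactor ψ (1 - s) ≠ 0 := by
    have key : ∀ z : ℂ, z.im ≠ 0 → Gammaℝ z ≠ 0 := by
      intro z hz h
      obtain ⟨n, hn⟩ := Gammaℝ_eq_zero_iff.mp h
      apply hz
      rw [hn]
      simp
    unfold gammaFactor
    split_ifs
    · exact key _ (by simpa using hs)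
    · exact key _ (by simpa using hs)
  have hfe := hψ.completedLFunction_one_sub (1 - s)
  rw [sub_sub_cancel] at hfe
  rw [LFunction_eq_completed_div_gammaFactor ψ s (Or.inl hs0),
    LFunction_eq_completed_div_gammaFactor ψ⁻¹ (1 - s) (Or.inl hs1), hfe, hpar, Delta]
  have he : (1 - s - 1 / 2 : ℂ) = 1 / 2 - s := by ring
  rw [he]
  field_simp

/-- The character `ψχ` of modulus `[q,D]`. -/
abbrev twist {D : ℕ} (χ : DirichletCharacter ℂ D) {q : ℕ} (ψ : DirichletCharacter ℂ q) :
    DirichletCharacter ℂ (Nat.lcm q D) :=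
  ψ.mul χ

instance neZero_lcm (q D : ℕ) [NeZero q] [NeZero D] : NeZero (Nat.lcm q D) :=
  ⟨Nat.lcm_ne_zero (NeZero.ne q) (NeZero.ne D)⟩

/-- `Δ₁(s,ψ) = Δ(s,ψ) Δ(s,ψχ)`. -/
def Delta1 {D : ℕ} [NeZero D] (χ : DirichletCharacter ℂ D) {q : ℕ} [NeZero q]
    (ψ : DirichletCharacter ℂ q) (s : ℂ) : ℂ :=
  Delta ψ s * Delta (twist χ ψ) s

/-- `ℱ(s,ψ) = F(s,ψ) + Δ₁(s,ψ) F(1-s,ψ̄)`. -/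
def calF {D : ℕ} [NeZero D] (χ : DirichletCharacter ℂ D) {q : ℕ} [NeZero q]
    (ψ : DirichletCharacter ℂ q) (s : ℂ) : ℂ :=
  F χ ψ s + Delta1 χ ψ s * F χ ψ⁻¹ (1 - s)

/-- `L(s,ψ) L(s,ψχ)`. -/
def LL {D : ℕ} [NeZero D] (χ : DirichletCharacter ℂ D) {q : ℕ} [NeZero q]
    (ψ : DirichletCharacter ℂ q) (s : ℂ) : ℂ :=
  LFunction ψ s * LFunction (twist χ ψ) s

/-! ### The families of characters -/

/-- The set `𝒬` of moduli. -/
def calQ (D : ℕ) : Set ℕ :=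
  {q | Q D < (q : ℝ) ∧ (q : ℝ) < 2 * Q D ∧ Nat.Coprime 6 q ∧ Squarefree q}

/-- `Ψ_q`: the primitive characters `ψ` mod `q` such that `ψχ` is primitive mod `[q,D]`. -/
def PsiMod {D : ℕ} (χ : DirichletCharacter ℂ D) (q : ℕ) : Set (DirichletCharacter ℂ q) :=
  {ψ | ψ.IsPrimitive ∧ (twist χ ψ).IsPrimitive}

/-- Inequality (I1). -/
def I1 {D : ℕ} (χ : DirichletCharacter ℂ D) {q : ℕ} (ψ : DirichletCharacter ℂ q) : Prop :=
  SupLT (Omega1 D) (fun s => ‖F χ ψ s‖ + ‖G χ ψ s‖) (ell D ^ 3 * Real.log (ell D))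

/-- Inequality (I2). -/
def I2 {D : ℕ} (χ : DirichletCharacter ℂ D) {q : ℕ} (ψ : DirichletCharacter ℂ q) : Prop :=
  SupLT (Omega1 D) (fun s => ‖F χ ψ s * G χ ψ s - 1‖) (1 / 2)

/-- Inequality (I3). -/
def I3 {D : ℕ} [NeZero D] (χ : DirichletCharacter ℂ D) {q : ℕ} [NeZero q]
    (ψ : DirichletCharacter ℂ q) : Prop :=
  SupLT (Omega2 D) (fun s => ‖LL χ ψ s - calF χ ψ s‖) (ell D ^ (-(24 / 5) : ℝ))

/-- The set `Ψ = ⋃_{q ∈ 𝒬} Ψ_q`; its elements are characters together with their moduli. -/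
def Psi {D : ℕ} (χ : DirichletCharacter ℂ D) : Set (Σ q : ℕ+, DirichletCharacter ℂ (q : ℕ)) :=
  {x | (x.1 : ℕ) ∈ calQ D ∧ x.2 ∈ PsiMod χ (x.1 : ℕ)}

/-- The set `Ψ*` of the `ψ ∈ Ψ` that satisfy (I1), (I2) and (I3). -/
def PsiStar {D : ℕ} [NeZero D] (χ : DirichletCharacter ℂ D) :
    Set (Σ q : ℕ+, DirichletCharacter ℂ (q : ℕ)) :=
  {x | x ∈ Psi χ ∧ I1 χ x.2 ∧ I2 χ x.2 ∧ I3 χ x.2}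

/-- `S(ψ)`: the set of zeros of `L(s,ψ) L(s,ψχ)` in the strip `|t - D| < 1`. -/
def S {D : ℕ} [NeZero D] (χ : DirichletCharacter ℂ D) {q : ℕ} [NeZero q]
    (ψ : DirichletCharacter ℂ q) : Set ℂ :=
  {ρ | LL χ ψ ρ = 0 ∧ |ρ.im - D| < 1}

/-- The set of pairs `(ψ,ρ)` with `ψ ∈ Ψ*` and `ρ ∈ S(ψ)`. -/
def pairs {D : ℕ} [NeZero D] (χ : DirichletCharacter ℂ D) :
    Set ((Σ q : ℕ+, DirichletCharacter ℂ (q : ℕ)) × ℂ) :=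
  {x | x.1 ∈ PsiStar χ ∧ x.2 ∈ S χ x.1.2}

/-- Assumption (A1): `L(1,χ) < (log D)^{-17} (log log D)^{-1}`. For a real character `L(1,χ)` is a
real number, so it equals its real part. -/
def A1 {D : ℕ} [NeZero D] (χ : DirichletCharacter ℂ D) : Prop :=
  (LFunction χ 1).re < (Real.log D ^ 17)⁻¹ * (Real.log (Real.log D))⁻¹

end

end LandauSiegel

namespace LandauSiegel

/-! ### Contour integrals over rectangles -/

/-! Write `ℒ = log D`. The bound is a product: at least `47/1000 · Q²` characters belong to `Ψ*`,
and each contributes at least `3/5 · ℒ²` zeros lying on the critical line.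

Zeros for one character. On the line, `Δ₁` is unimodular and `1 - s` is the conjugate of `s`, so `ℱ
= F + Δ₁ · conj F`. Choose `ω` with `F / (Δ₁ conj F) = exp(2iω)`. Multiplication by `exp(iω)/F`
turns `ℱ` into `2 cos ω` and, by the functional equation, turns `L(s,ψ)L(s,ψχ)` into a real function
`Z`. By (I1) and (I2), `1/|F| ≤ 2ℒ³ log ℒ`, so (I3) gives `|Z - 2 cos ω| < 2`: `Z` has the sign of
`cos ω` wherever `ω` is a multiple of `π`, and vanishes in between (`phase_identities`,
`exists_zeros`). The phase moves at speed `ω' = Re F'/F - (1/2) Δ₁'/Δ₁`, where `Δ₁'/Δ₁ = -2ℒ² +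
O(ℒ)` and `F'/F = O(ℒ log ℒ)` by Borel–Carathéodory. Over an ordinate interval of length almost 2
this gives about `2ℒ²/π` zeros (`exists_critical_zeros`).

Few exceptions. The large sieve bounds the mean square over `Ψ` of a Dirichlet polynomial with
coefficients `ν(n)` or `υ(n)` by `Q² ∑ ν(n)²/n`. Cauchy's formula on a slightly larger rectangle
passes from mean values at points to suprema (`card_exceed_le`). This settles (I1). For (I2) and
(I3), hypothesis (A1) enters: by the hyperbola method `ν` has mean value `≪ ℒ⁻¹⁷/log ℒ` beyond
`D^{9/8}`, and since `ν² ≤ ν * ν`, the sum of `ν(n)²/n` beyond `D^{23/10}` is `≪ ℒ⁻¹³/log ℒ`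
(`sum_nuRe_sq_div_tail_le`). A Gaussian-smoothed contour integral (`norm_le_of_kern`) expresses `FG
- 1`, and the error of the approximate functional equation, through Dirichlet polynomials supported
in that sparse range; their mean squares are therefore tiny. In (I3) the powers of `ℒ` balance
exactly and the remaining `1/log ℒ` makes the exceptional set small.

Size of the family. For squarefree `q ≡ 1 (mod 6)`, a union bound over the primes dividing `q` shows
that at least `q (1 - 3 ∑_{p ∣ q} 1/p)` characters mod `q` lie in `Ψ_q`. Averaging over `q` with all
odd integers at least 5 in place of primes leaves a mean weight of at least about 1/2, whence `|Ψ| ≥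
Q²/20` (`card_Psi_ge`). -/

theorem log_sub_log_neg_I_mul {w : ℂ} (hre : 0 < w.re) (him : 0 < w.im) :
    Complex.log w - Complex.log (-I * w) = Real.pi / 2 * I := by
  have hw : w ≠ 0 := by rintro rfl; simp at hre
  have h1 : -I * w ≠ 0 := by simp [hw]
  have hz : w = I * (-I * w) := by rw [← mul_assoc]; simp
  have hb : |(-I * w).arg| < Real.pi / 2 := by
    rw [Complex.abs_arg_lt_pi_div_two_iff]; left; simpa using him
  have hc : (-I * w).arg < 0 := by
    rw [Complex.arg_neg_iff]; simpa using hre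
  have hb' := abs_lt.mp hb
  have := (Complex.log_mul_eq_add_log_iff I_ne_zero h1).mpr (by
    rw [Complex.arg_I]
    constructor <;> linarith [Real.pi_pos])
  rw [← hz, Complex.log_I] at this
  rw [this]; ring

/-- The integral of `f` over the boundary of the rectangle `[a,b] × [c,d]`, counterclockwise. -/
noncomputable def rectIntegral (f : ℂ → ℂ) (a b c d : ℝ) : ℂ :=
  (∫ x : ℝ in a..b, f (x + c * I)) - (∫ x : ℝ in a..b, f (x + d * I)) +
      I * (∫ y : ℝ in c..d, f (b + y * I)) - I * (∫ y : ℝ in c..d, f (a + y * I))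

theorem rectIntegral_eq_zero {f : ℂ → ℂ} {a b c d : ℝ} (hab : a ≤ b) (hcd : c ≤ d)
    (hf : DifferentiableOn ℂ f (Set.Icc a b ×ℂ Set.Icc c d)) : rectIntegral f a b c d = 0 := by
  have := integral_boundary_rect_eq_zero_of_differentiableOn f ⟨a, c⟩ ⟨b, d⟩
    (by simpa [Set.uIcc_of_le hab, Set.uIcc_of_le hcd] using hf)
  simpa [rectIntegral] using this

theorem continuous_horizontal (c : ℝ) : Continuous fun x : ℝ => (x : ℂ) + c * I := by fun_prop

theorem continuous_vertical (a : ℝ) : Continuous fun y : ℝ => (a : ℂ) + y * I := by fun_prop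

theorem intervalIntegrable_horizontal {E : Type*} [NormedAddCommGroup E] {f : ℂ → E}
    {R : Set ℂ} (hf : ContinuousOn f R) {a b c : ℝ} (hab : a ≤ b)
    (h : ∀ x ∈ Set.Icc a b, (x : ℂ) + c * I ∈ R) :
    IntervalIntegrable (fun x : ℝ => f (x + c * I)) MeasureTheory.volume a b := by
  apply ContinuousOn.intervalIntegrable
  rw [Set.uIcc_of_le hab]
  exact hf.comp (continuous_horizontal c).continuousOn h

theorem intervalIntegrable_vertical {E : Type*} [NormedAddCommGroup E] {f : ℂ → E}
    {R : Set ℂ} (hf : ContinuousOn f R) {a c d : ℝ} (hcd : c ≤ d)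
    (h : ∀ y ∈ Set.Icc c d, (a : ℂ) + y * I ∈ R) :
    IntervalIntegrable (fun y : ℝ => f (a + y * I)) MeasureTheory.volume c d := by
  apply ContinuousOn.intervalIntegrable
  rw [Set.uIcc_of_le hcd]
  exact hf.comp (continuous_vertical a).continuousOn h

theorem hasDerivAt_log_mul {u z v : ℂ} (hu : u ≠ 0) {e : ℝ → ℂ} {x : ℝ} (he : HasDerivAt e v x)
    (hz : e x = z) (h : 0 < (u * z).re) : HasDerivAt (fun t => Complex.log (u * e t)) (v / z) x := by
  have h1 : HasDerivAt (fun t => u * e t) (u * v) x := he.const_mul u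
  have h2 := h1.clog_real (by rw [hz]; exact Or.inl h)
  rw [hz] at h2
  have hz0 : z ≠ 0 := by rintro rfl; simp at h
  convert h2 using 1
  field_simp

/-- On each side the primitive `log(u(w - s))` is used, with `u` a fourth root of unity rotating
that side into the right half-plane. At each corner the two adjacent branches differ by `πi/2`, and
the four jumps add up to `2πi`. -/
theorem rectIntegral_inv {a b c d : ℝ} {s : ℂ} (ha : a < s.re) (hb : s.re < b) (hc : c < s.im)
    (hd : s.im < d) : rectIntegral (fun w => (w - s)⁻¹) a b c d = 2 * Real.pi * I := by
  have hh : ∀ (u : ℂ) (y : ℝ), u ≠ 0 → (∀ x : ℝ, 0 < (u * (x + y * I - s)).re) →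
      (∫ x : ℝ in a..b, ((x : ℂ) + y * I - s)⁻¹) =
        Complex.log (u * (b + y * I - s)) - Complex.log (u * (a + y * I - s)) := by
    intro u y hu hpos
    have hder : ∀ x : ℝ, HasDerivAt (fun t : ℝ => Complex.log (u * (t + y * I - s)))
        (1 / ((x : ℂ) + y * I - s)) x := fun x =>
      hasDerivAt_log_mul hu (e := fun t : ℝ => (t : ℂ) + y * I - s)
        (((hasDerivAt_id x).ofReal_comp.add_const _).sub_const _) rfl (hpos x)
    rw [← intervalIntegral.integral_eq_sub_of_hasDerivAt (fun x _ => hder x)]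
    · simp
    · apply Continuous.intervalIntegrable
      apply Continuous.div continuous_const (by fun_prop)
      intro x h0
      have := hpos x
      rw [h0] at this; simp at this
  have hv : ∀ (u : ℂ) (x : ℝ), u ≠ 0 → (∀ y : ℝ, 0 < (u * (x + y * I - s)).re) →
      I * (∫ y : ℝ in c..d, ((x : ℂ) + y * I - s)⁻¹) =
        Complex.log (u * (x + d * I - s)) - Complex.log (u * (x + c * I - s)) := by
    intro u x hu hpos
    have hder : ∀ y : ℝ, HasDerivAt (fun t : ℝ => Complex.log (u * (x + t * I - s)))
        (I / ((x : ℂ) + y * I - s)) y := fun y => by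
      refine hasDerivAt_log_mul hu (e := fun t : ℝ => (x : ℂ) + t * I - s)
        ((HasDerivAt.const_add _ ?_).sub_const _) rfl (hpos y)
      simpa using (hasDerivAt_id y).ofReal_comp.mul_const I
    rw [← intervalIntegral.integral_eq_sub_of_hasDerivAt (fun x _ => hder x),
      ← intervalIntegral.integral_const_mul]
    · simp [div_eq_mul_inv]
    · apply Continuous.intervalIntegrable
      apply Continuous.div continuous_const (by fun_prop)
      intro x h0
      have := hpos x
      rw [h0] at this; simp at this
  rw [rectIntegral, hh I c I_ne_zero (by intro x; simp; linarith),
    hh (-I) d (by simp) (by intro x; simp; linarith),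
    hv 1 b one_ne_zero (by intro x; simp; linarith),
    hv (-1) a (by simp) (by intro x; simp; linarith)]
  have k1 := log_sub_log_neg_I_mul (w := b + d * I - s) (by simp; linarith) (by simp; linarith)
  have k2 := log_sub_log_neg_I_mul (w := -I * (a + d * I - s)) (by simp; linarith)
    (by simp; linarith)
  have k3 := log_sub_log_neg_I_mul (w := -1 * (a + c * I - s)) (by simp; linarith)
    (by simp; linarith)
  have k4 := log_sub_log_neg_I_mul (w := I * (b + c * I - s)) (by simp; linarith)
    (by simp; linarith)
  have e2 : -I * (-I * (a + d * I - s)) = -1 * (a + d * I - s) := by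
    linear_combination (a + d * I - s) * I_mul_I
  have e3 : -I * (-1 * (a + c * I - s)) = I * (a + c * I - s) := by ring
  have e4 : -I * (I * (b + c * I - s)) = 1 * (b + c * I - s) := by
    linear_combination -(b + c * I - s) * I_mul_I
  rw [e2] at k2
  rw [e3] at k3
  rw [e4] at k4
  rw [one_mul]
  linear_combination k1 + k2 + k3 + k4

theorem mem_rect {a b c d x y : ℝ} (hx : x ∈ Set.Icc a b) (hy : y ∈ Set.Icc c d) :
    (x : ℂ) + y * I ∈ Set.Icc a b ×ℂ Set.Icc c d := by
  simp only [Complex.mem_reProdIm]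
  constructor <;> simpa

theorem rectIntegral_add {f g : ℂ → ℂ} {a b c d : ℝ} (hab : a ≤ b) (hcd : c ≤ d) {R R' : Set ℂ}
    (hf : ContinuousOn f R) (hg : ContinuousOn g R')
    (hR : ∀ x ∈ Set.Icc a b, ∀ y ∈ Set.Icc c d, (x = a ∨ x = b ∨ y = c ∨ y = d) →
      (x : ℂ) + y * I ∈ R ∩ R') :
    rectIntegral (fun w => f w + g w) a b c d = rectIntegral f a b c d + rectIntegral g a b c d := by
  have ia := Set.left_mem_Icc.mpr hab
  have ib := Set.right_mem_Icc.mpr hab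
  have ic := Set.left_mem_Icc.mpr hcd
  have id := Set.right_mem_Icc.mpr hcd
  unfold rectIntegral
  rw [intervalIntegral.integral_add, intervalIntegral.integral_add, intervalIntegral.integral_add,
    intervalIntegral.integral_add]
  · ring
  · exact intervalIntegrable_vertical hf hcd fun y hy => (hR a ia y hy (by simp)).1
  · exact intervalIntegrable_vertical hg hcd fun y hy => (hR a ia y hy (by simp)).2
  · exact intervalIntegrable_vertical hf hcd fun y hy => (hR b ib y hy (by simp)).1
  · exact intervalIntegrable_vertical hg hcd fun y hy => (hR b ib y hy (by simp)).2
  · exact intervalIntegrable_horizontal hf hab fun y hy => (hR y hy d id (by simp)).1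
  · exact intervalIntegrable_horizontal hg hab fun y hy => (hR y hy d id (by simp)).2
  · exact intervalIntegrable_horizontal hf hab fun y hy => (hR y hy c ic (by simp)).1
  · exact intervalIntegrable_horizontal hg hab fun y hy => (hR y hy c ic (by simp)).2

/-- Cauchy's integral formula for a rectangle. -/
theorem rectIntegral_div_sub {f : ℂ → ℂ} {a b c d : ℝ} {s : ℂ} (ha : a < s.re) (hb : s.re < b)
    (hc : c < s.im) (hd : s.im < d) (hf : DifferentiableOn ℂ f (Set.Icc a b ×ℂ Set.Icc c d)) :
    rectIntegral (fun w => f w / (w - s)) a b c d = 2 * Real.pi * I * f s := by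
  have hab : a ≤ b := (ha.trans hb).le
  have hcd : c ≤ d := (hc.trans hd).le
  have hnhds : Set.Icc a b ×ℂ Set.Icc c d ∈ nhds s := by
    refine Filter.mem_of_superset ((isOpen_Ioo.reProdIm isOpen_Ioo).mem_nhds
      (show s ∈ Set.Ioo a b ×ℂ Set.Ioo c d from ⟨⟨ha, hb⟩, ⟨hc, hd⟩⟩)) ?_
    exact Set.inter_subset_inter (Set.preimage_mono Set.Ioo_subset_Icc_self)
      (Set.preimage_mono Set.Ioo_subset_Icc_self)
  -- The difference quotient of `f` at `s` extends holomorphically over `s`, so only the term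
  -- `f(s)/(w - s)` contributes to the contour integral.
  have hg := (Complex.differentiableOn_dslope hnhds).mpr hf
  have h0 := rectIntegral_eq_zero hab hcd hg
  have hne : ∀ x ∈ Set.Icc a b, ∀ y ∈ Set.Icc c d, (x = a ∨ x = b ∨ y = c ∨ y = d) →
      (x : ℂ) + y * I ≠ s := by
    rintro x hx y hy h rfl
    simp at ha hb hc hd
    rcases h with h | h | h | h <;> linarith
  have hcongr : ∀ {F G : ℂ → ℂ}, (∀ w, w ≠ s → F w = G w) →
      rectIntegral F a b c d = rectIntegral G a b c d := by
    intro F G h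
    have ia := Set.left_mem_Icc.mpr hab
    have ib := Set.right_mem_Icc.mpr hab
    have ic := Set.left_mem_Icc.mpr hcd
    have id := Set.right_mem_Icc.mpr hcd
    unfold rectIntegral
    congr 1
    · congr 1
      · congr 1
        · apply intervalIntegral.integral_congr
          intro x hx
          rw [Set.uIcc_of_le hab] at hx
          exact h _ (hne x hx c ic (by simp))
        · apply intervalIntegral.integral_congr
          intro x hx
          rw [Set.uIcc_of_le hab] at hx
          exact h _ (hne x hx d id (by simp))
      · congr 1
        apply intervalIntegral.integral_congr
        intro x hx
        rw [Set.uIcc_of_le hcd] at hx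
        exact h _ (hne b ib x hx (by simp))
    · congr 1
      apply intervalIntegral.integral_congr
      intro x hx
      rw [Set.uIcc_of_le hcd] at hx
      exact h _ (hne a ia x hx (by simp))
  rw [hcongr (G := fun w => dslope f s w + f s * (w - s)⁻¹)]
  · have hcont : ContinuousOn (fun w => f s * (w - s)⁻¹) {s}ᶜ := by
      refine continuousOn_const.mul (ContinuousOn.inv₀ (by fun_prop) ?_)
      intro x hx; exact sub_ne_zero.mpr hx
    rw [rectIntegral_add hab hcd hg.continuousOn hcont, h0, zero_add]
    · have : rectIntegral (fun w => f s * (w - s)⁻¹) a b c d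
          = f s * rectIntegral (fun w => (w - s)⁻¹) a b c d := by
        simp only [rectIntegral, intervalIntegral.integral_const_mul]
        ring
      rw [this, rectIntegral_inv ha hb hc hd]
      ring
    · intro x hx y hy h
      exact ⟨mem_rect hx hy, hne x hx y hy h⟩
  · intro w hw
    rw [dslope_of_ne _ hw, slope_def_field]
    field_simp [sub_ne_zero.mpr hw]
    ring

theorem norm_rectIntegral_le {f : ℂ → ℂ} {a b c d : ℝ} (hab : a ≤ b) (hcd : c ≤ d) :
    ‖rectIntegral f a b c d‖ ≤ (∫ x : ℝ in a..b, ‖f (x + c * I)‖) +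
      (∫ x : ℝ in a..b, ‖f (x + d * I)‖) + (∫ y : ℝ in c..d, ‖f (b + y * I)‖) +
      (∫ y : ℝ in c..d, ‖f (a + y * I)‖) := by
  unfold rectIntegral
  refine (norm_sub_le _ _).trans (add_le_add ((norm_add_le _ _).trans (add_le_add
    ((norm_sub_le _ _).trans (add_le_add ?_ ?_)) ?_)) ?_)
  · exact intervalIntegral.norm_integral_le_integral_norm hab
  · exact intervalIntegral.norm_integral_le_integral_norm hab
  · rw [norm_mul, norm_I, one_mul]
    exact intervalIntegral.norm_integral_le_integral_norm hcd
  · rw [norm_mul, norm_I, one_mul]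
    exact intervalIntegral.norm_integral_le_integral_norm hcd

/-- The integral of `‖f‖` over the boundary of a rectangle. -/
noncomputable def rectNorm (f : ℂ → ℂ) (a b c d : ℝ) : ℝ :=
  (∫ x : ℝ in a..b, ‖f (x + c * I)‖) + (∫ x : ℝ in a..b, ‖f (x + d * I)‖) +
    (∫ y : ℝ in c..d, ‖f (b + y * I)‖) + (∫ y : ℝ in c..d, ‖f (a + y * I)‖)

/-- A value of a holomorphic function is bounded by the mean of its modulus over the boundary of a
rectangle. -/
theorem norm_le_rectNorm {f : ℂ → ℂ} {a b c d δ : ℝ} {s : ℂ} (hδ : 0 < δ) (ha : a + δ ≤ s.re)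
    (hb : s.re + δ ≤ b) (hc : c + δ ≤ s.im) (hd : s.im + δ ≤ d)
    (hf : DifferentiableOn ℂ f (Set.Icc a b ×ℂ Set.Icc c d)) :
    ‖f s‖ ≤ (2 * Real.pi * δ)⁻¹ * rectNorm f a b c d := by
  have hab : a ≤ b := by linarith
  have hcd : c ≤ d := by linarith
  have h1 := rectIntegral_div_sub (by linarith) (by linarith) (by linarith) (by linarith) hf
  have h2 := norm_rectIntegral_le (f := fun w => f w / (w - s)) hab hcd
  rw [h1] at h2
  have hcont := hf.continuousOn.norm
  have key : ∀ w : ℂ, δ ≤ ‖w - s‖ → ‖f w / (w - s)‖ ≤ δ⁻¹ * ‖f w‖ := by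
    intro w hw
    rw [norm_div, div_eq_inv_mul]
    gcongr
  have ia := Set.left_mem_Icc.mpr hab
  have ib := Set.right_mem_Icc.mpr hab
  have ic := Set.left_mem_Icc.mpr hcd
  have id := Set.right_mem_Icc.mpr hcd
  have him : ∀ x y : ℝ, δ ≤ |y - s.im| → δ ≤ ‖(x : ℂ) + y * I - s‖ := by
    intro x y h
    refine h.trans ((le_of_eq ?_).trans (Complex.abs_im_le_norm _))
    simp
  have hre : ∀ x y : ℝ, δ ≤ |x - s.re| → δ ≤ ‖(x : ℂ) + y * I - s‖ := by
    intro x y h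
    refine h.trans ((le_of_eq ?_).trans (Complex.abs_re_le_norm _))
    simp
  have hdiv : ContinuousOn (fun w => ‖f w / (w - s)‖) (Set.Icc a b ×ℂ Set.Icc c d \ {s}) := by
    refine ((hf.continuousOn.mono Set.sdiff_subset).div (by fun_prop) ?_).norm
    rintro x ⟨-, hx⟩
    exact sub_ne_zero.mpr hx
  have hH : ∀ y ∈ Set.Icc c d, δ ≤ |y - s.im| → (∫ x : ℝ in a..b, ‖f (x + y * I) / (x + y * I - s)‖)
      ≤ δ⁻¹ * ∫ x : ℝ in a..b, ‖f (x + y * I)‖ := by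
    intro y hy hyδ
    rw [← intervalIntegral.integral_const_mul]
    refine intervalIntegral.integral_mono_on hab ?_ ?_ fun x _ => key _ (him x y hyδ)
    · refine intervalIntegrable_horizontal hdiv hab fun x hx => ⟨mem_rect hx hy, ?_⟩
      intro h
      have := him x y hyδ
      rw [h, sub_self, norm_zero] at this
      linarith
    · exact (intervalIntegrable_horizontal hcont hab fun x hx => mem_rect hx hy).const_mul _
  have hV : ∀ x ∈ Set.Icc a b, δ ≤ |x - s.re| → (∫ y : ℝ in c..d, ‖f (x + y * I) / (x + y * I - s)‖)
      ≤ δ⁻¹ * ∫ y : ℝ in c..d, ‖f (x + y * I)‖ := by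
    intro x hx hxδ
    rw [← intervalIntegral.integral_const_mul]
    refine intervalIntegral.integral_mono_on hcd ?_ ?_ fun y _ => key _ (hre x y hxδ)
    · refine intervalIntegrable_vertical hdiv hcd fun y hy => ⟨mem_rect hx hy, ?_⟩
      intro h
      have := hre x y hxδ
      rw [h, sub_self, norm_zero] at this
      linarith
    · exact (intervalIntegrable_vertical hcont hcd fun y hy => mem_rect hx hy).const_mul _
  have b1 := hH c ic (by rw [abs_sub_comm]; exact le_trans (by linarith) (le_abs_self _))
  have b2 := hH d id (le_trans (by linarith) (le_abs_self _))
  have b3 := hV b ib (le_trans (by linarith) (le_abs_self _))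
  have b4 := hV a ia (by rw [abs_sub_comm]; exact le_trans (by linarith) (le_abs_self _))
  have h3 : ‖2 * (Real.pi : ℂ) * I * f s‖ = 2 * Real.pi * ‖f s‖ := by
    simp [abs_of_pos Real.pi_pos]
  rw [h3] at h2
  have h4 : 2 * Real.pi * ‖f s‖ ≤ δ⁻¹ * rectNorm f a b c d := by
    refine h2.trans ?_
    unfold rectNorm
    linarith
  rw [mul_inv, mul_assoc, inv_mul_eq_div, le_div_iff₀ (by positivity)]
  linarith

/-! ### A smoothing kernel -/

theorem norm_exp_sq_add_mul (Λ u v : ℝ) :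
    ‖Complex.exp ((u + v * I) ^ 2 + Λ * (u + v * I))‖ = Real.exp (u ^ 2 - v ^ 2 + Λ * u) := by
  rw [Complex.norm_exp]
  congr 1
  simp [sq]

/-- The smoothing kernel `exp(w² + Λw) / w`. -/
noncomputable def kern (Λ : ℝ) (w : ℂ) : ℂ := Complex.exp (w ^ 2 + Λ * w) / w

theorem norm_kern (Λ u v : ℝ) :
    ‖kern Λ (u + v * I)‖ = Real.exp (u ^ 2 - v ^ 2 + Λ * u) / ‖(u : ℂ) + v * I‖ := by
  rw [kern, norm_div, norm_exp_sq_add_mul]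

theorem differentiableOn_kern (Λ : ℝ) : DifferentiableOn ℂ (kern Λ) {0}ᶜ := by
  intro w hw
  apply DifferentiableAt.differentiableWithinAt
  unfold kern
  fun_prop (disch := exact hw)

theorem norm_kern_le_of_re {Λ u v : ℝ} (hu : u ≠ 0) :
    ‖kern Λ (u + v * I)‖ ≤ Real.exp (u ^ 2 + Λ * u) / |u| := by
  rw [norm_kern]
  have h1 : |u| ≤ ‖(u : ℂ) + v * I‖ := (le_of_eq (by simp)).trans (Complex.abs_re_le_norm _)
  have := abs_pos.mpr hu
  gcongr
  nlinarith [sq_nonneg v]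

theorem norm_kern_le_of_im {Λ u T c : ℝ} (hΛ : 0 ≤ Λ) (hT : T ≠ 0) (hu : |u| ≤ c) :
    ‖kern Λ (u + T * I)‖ ≤ Real.exp (c ^ 2 - T ^ 2 + Λ * c) / |T| := by
  rw [norm_kern]
  have h1 : |T| ≤ ‖(u : ℂ) + T * I‖ := (le_of_eq (by simp)).trans (Complex.abs_im_le_norm _)
  have := abs_pos.mpr hT
  have h2 := abs_le.mp hu
  have h3 : u ^ 2 - T ^ 2 + Λ * u ≤ c ^ 2 - T ^ 2 + Λ * c := by
    nlinarith [mul_le_mul_of_nonneg_left h2.2 hΛ, sq_le_sq' h2.1 h2.2]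
  gcongr

/-- Since `|w| ≥ (κ + |v|)/2`, the kernel costs only a logarithm when integrated along the line. The
6 is `2 · 3`, with `3 ≥ e` bounding the Gaussian factor. -/
theorem norm_kern_le_near {Λ u v κ : ℝ} (hκ : 0 < κ) (hκ1 : κ ≤ 1) (hu : |u| = κ) :
    ‖kern Λ (u + v * I)‖ ≤ Real.exp (Λ * u) * (6 / (κ + |v|)) := by
  rw [norm_kern]
  have h1 : |u| ≤ ‖(u : ℂ) + v * I‖ := (le_of_eq (by simp)).trans (Complex.abs_re_le_norm _)
  have h2 : |v| ≤ ‖(u : ℂ) + v * I‖ := (le_of_eq (by simp)).trans (Complex.abs_im_le_norm _)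
  have h3 : (κ + |v|) / 2 ≤ ‖(u : ℂ) + v * I‖ := by linarith
  have h4 : 0 < κ + |v| := by positivity
  have h5 : Real.exp (u ^ 2 - v ^ 2 + Λ * u) ≤ Real.exp (Λ * u) * 3 := by
    rw [Real.exp_add, mul_comm]
    gcongr
    have : u ^ 2 - v ^ 2 ≤ 1 := by
      rw [← sq_abs u, hu]; nlinarith [sq_nonneg v]
    exact (Real.exp_le_exp.mpr this).trans (by linarith [Real.exp_one_lt_d9])
  calc _ ≤ Real.exp (Λ * u) * 3 / ((κ + |v|) / 2) := by gcongr
    _ = _ := by field_simp; ring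

theorem norm_verticalIntegral_sub_le {g : ℂ → ℂ} {a b T B : ℝ} (hab : a ≤ b) (hT : 0 ≤ T)
    (hg : DifferentiableOn ℂ g (Set.Icc a b ×ℂ Set.Icc (-T) T))
    (hB : ∀ x ∈ Set.Icc a b, ‖g (x + T * I)‖ ≤ B ∧ ‖g (x + (-T : ℝ) * I)‖ ≤ B) :
    ‖∫ y : ℝ in -T..T, g (b + y * I)‖ ≤ ‖∫ y : ℝ in -T..T, g (a + y * I)‖ + 2 * (b - a) * B ∧
    ‖∫ y : ℝ in -T..T, g (a + y * I)‖ ≤ ‖∫ y : ℝ in -T..T, g (b + y * I)‖ + 2 * (b - a) * B := by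
  have h0 := rectIntegral_eq_zero hab (by linarith) hg
  unfold rectIntegral at h0
  have h1 : ‖∫ x : ℝ in a..b, g (x + T * I)‖ ≤ B * (b - a) := by
    rw [← abs_of_nonneg (sub_nonneg.mpr hab)]
    refine intervalIntegral.norm_integral_le_of_norm_le_const fun x hx => ?_
    rw [Set.uIoc_of_le hab] at hx
    exact (hB x ⟨hx.1.le, hx.2⟩).1
  have h2 : ‖∫ x : ℝ in a..b, g (x + (-T : ℝ) * I)‖ ≤ B * (b - a) := by
    rw [← abs_of_nonneg (sub_nonneg.mpr hab)]
    refine intervalIntegral.norm_integral_le_of_norm_le_const fun x hx => ?_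
    rw [Set.uIoc_of_le hab] at hx
    exact (hB x ⟨hx.1.le, hx.2⟩).2
  set b1 := ∫ x : ℝ in a..b, g (x + (-T : ℝ) * I)
  set t1 := ∫ x : ℝ in a..b, g (x + T * I)
  set r1 := ∫ y : ℝ in -T..T, g (b + y * I)
  set l1 := ∫ y : ℝ in -T..T, g (a + y * I)
  have h3 : ‖r1 - l1‖ ≤ 2 * (b - a) * B := by
    have : I * (r1 - l1) = t1 - b1 := by linear_combination h0
    have h4 : ‖I * (r1 - l1)‖ ≤ ‖t1‖ + ‖b1‖ := by rw [this]; exact norm_sub_le _ _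
    rw [norm_mul, norm_I, one_mul] at h4
    linarith
  constructor
  · linarith [norm_sub_norm_le r1 l1]
  · linarith [norm_sub_norm_le l1 r1, norm_sub_rev r1 l1]

/-- If `f` is close to `A` on the line `Re w = c` and close to `A'` on the line `Re w = -c`, then
`f 0` is controlled by the values of `A` and `A'` near the imaginary axis. -/
theorem norm_le_of_kern {f A A' : ℂ → ℂ} {κ c T Λ δ M : ℝ} (hκ : 0 < κ) (hκ1 : κ ≤ 1) (hκc : κ < c)
    (hT : 0 < T) (hΛ : 0 ≤ Λ)
    (hf : DifferentiableOn ℂ f (Set.Icc (-c) c ×ℂ Set.Icc (-T) T))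
    (hA : DifferentiableOn ℂ A (Set.Icc κ c ×ℂ Set.Icc (-T) T))
    (hA' : DifferentiableOn ℂ A' (Set.Icc (-c) (-κ) ×ℂ Set.Icc (-T) T))
    (hR : ∀ v ∈ Set.Icc (-T) T, ‖f (c + v * I) - A (c + v * I)‖ ≤ δ * Real.exp (-(Λ * c)))
    (hL : ∀ v ∈ Set.Icc (-T) T,
      ‖f ((-c : ℝ) + v * I) - A' ((-c : ℝ) + v * I)‖ ≤ δ * Real.exp (Λ * c))
    (hfM : ∀ w ∈ Set.Icc (-c) c ×ℂ Set.Icc (-T) T, ‖f w‖ ≤ M)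
    (hAM : ∀ w ∈ Set.Icc κ c ×ℂ Set.Icc (-T) T, ‖A w‖ ≤ M)
    (hAM' : ∀ w ∈ Set.Icc (-c) (-κ) ×ℂ Set.Icc (-T) T, ‖A' w‖ ≤ M) :
    2 * Real.pi * ‖f 0‖ ≤ (∫ v : ℝ in -T..T, (Real.exp (Λ * κ) * ‖A (κ + v * I)‖ +
        Real.exp (-(Λ * κ)) * ‖A' ((-κ : ℝ) + v * I)‖) * (6 / (κ + |v|))) +
      4 * T * δ * Real.exp (c ^ 2) / c + 8 * c * M * Real.exp (c ^ 2 - T ^ 2 + Λ * c) / T := by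
  have hc : 0 < c := hκ.trans hκc
  have hTT : -T ≤ T := by linarith
  have iT : T ∈ Set.Icc (-T) T := ⟨hTT, le_rfl⟩
  have iT' : -T ∈ Set.Icc (-T) T := ⟨le_rfl, hTT⟩
  have hδ : 0 ≤ δ := by
    have := (norm_nonneg _).trans (hL T iT)
    exact nonneg_of_mul_nonneg_left this (Real.exp_pos _)
  set g : ℂ → ℂ := fun w => f w * Complex.exp (w ^ 2 + Λ * w) with hgdef
  have hg : DifferentiableOn ℂ g (Set.Icc (-c) c ×ℂ Set.Icc (-T) T) :=
    hf.mul (by fun_prop)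
  -- The exponential factor equals 1 at the origin, so the integral recovers `f 0` itself.
  have hC := rectIntegral_div_sub (s := 0) (by simpa using hc) (by simpa using hc)
    (by simpa using hT) (by simpa using hT) hg
  have hgk : (fun w => g w / (w - 0)) = fun w => f w * kern Λ w := by
    ext w; simp [hgdef, kern, mul_div_assoc]
  rw [hgk] at hC
  have hg0 : g 0 = f 0 := by simp [hgdef]
  rw [hg0] at hC
  set B := M * (Real.exp (c ^ 2 - T ^ 2 + Λ * c) / T) with hBdef
  have hM : 0 ≤ M := (norm_nonneg _).trans (hAM _ (mem_rect (Set.right_mem_Icc.mpr hκc.le) iT))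
  have hk1 : ∀ x : ℝ, |x| ≤ c → ‖kern Λ (x + T * I)‖ ≤ Real.exp (c ^ 2 - T ^ 2 + Λ * c) / T := by
    intro x hx
    have := norm_kern_le_of_im (T := T) hΛ hT.ne' hx
    rwa [abs_of_pos hT] at this
  have hk2 : ∀ x : ℝ, |x| ≤ c →
      ‖kern Λ (x + (-T : ℝ) * I)‖ ≤ Real.exp (c ^ 2 - T ^ 2 + Λ * c) / T := by
    intro x hx
    have := norm_kern_le_of_im (T := -T) hΛ (by linarith) hx
    rwa [abs_neg, abs_of_pos hT, neg_sq] at this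
  have hH : ∀ y, y = T ∨ y = -T → ‖∫ x : ℝ in -c..c, f (x + y * I) * kern Λ (x + y * I)‖
      ≤ B * (2 * c) := by
    intro y hy
    have : B * (2 * c) = B * |c - -c| := by rw [abs_of_nonneg (by linarith)]; ring
    rw [this]
    refine intervalIntegral.norm_integral_le_of_norm_le_const fun x hx => ?_
    rw [Set.uIoc_of_le (by linarith)] at hx
    have hx' : x ∈ Set.Icc (-c) c := ⟨hx.1.le, hx.2⟩
    rw [norm_mul, hBdef]
    rcases hy with rfl | rfl
    · exact mul_le_mul (hfM _ (mem_rect hx' iT)) (hk1 x (abs_le.mpr hx')) (norm_nonneg _) hM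
    · exact mul_le_mul (hfM _ (mem_rect hx' iT')) (hk2 x (abs_le.mpr hx')) (norm_nonneg _) hM
  have hsub1 : Set.Icc κ c ×ℂ Set.Icc (-T) T ⊆ {0}ᶜ := by
    rintro w hw rfl
    have := hw.1.1; simp at this; linarith
  have hsub2 : Set.Icc (-c) (-κ) ×ℂ Set.Icc (-T) T ⊆ {0}ᶜ := by
    rintro w hw rfl
    have := hw.1.2; simp at this; linarith
  have hAk := hA.mul ((differentiableOn_kern Λ).mono hsub1)
  have hAk' := hA'.mul ((differentiableOn_kern Λ).mono hsub2)
  -- The lines of integration of `A` and `A'` are moved inwards from `±c` to `±κ`; neither move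
  -- meets the pole of the kernel at 0. This is why the two approximations need to be holomorphic
  -- only on their own side.
  have hAs := (norm_verticalIntegral_sub_le (B := B) hκc.le hT.le hAk (by
    intro x hx
    have hxc : |x| ≤ c := abs_le.mpr ⟨by linarith [hx.1], hx.2⟩
    simp only [Pi.mul_apply, norm_mul, hBdef]
    exact ⟨mul_le_mul (hAM _ (mem_rect hx iT)) (hk1 x hxc) (norm_nonneg _) hM,
      mul_le_mul (hAM _ (mem_rect hx iT')) (hk2 x hxc) (norm_nonneg _) hM⟩)).1
  have hAs' := (norm_verticalIntegral_sub_le (B := B) (by linarith) hT.le hAk' (by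
    intro x hx
    have hxc : |x| ≤ c := abs_le.mpr ⟨hx.1, by linarith [hx.2]⟩
    simp only [Pi.mul_apply, norm_mul, hBdef]
    exact ⟨mul_le_mul (hAM' _ (mem_rect hx iT)) (hk1 x hxc) (norm_nonneg _) hM,
      mul_le_mul (hAM' _ (mem_rect hx iT')) (hk2 x hxc) (norm_nonneg _) hM⟩)).2
  simp only [Pi.mul_apply] at hAs hAs'
  -- comparison of `f` with `A`, `A'` on the outer lines
  have hcmp : ∀ (x : ℝ) (G : ℂ → ℂ) (R : Set ℂ), |x| = c → ContinuousOn (fun w => G w * kern Λ w) R →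
      (∀ y ∈ Set.Icc (-T) T, (x : ℂ) + y * I ∈ R) →
      (∀ y ∈ Set.Icc (-T) T, ‖f (x + y * I) - G (x + y * I)‖ ≤ δ * Real.exp (-(Λ * x))) →
      ‖∫ y : ℝ in -T..T, f (x + y * I) * kern Λ (x + y * I)‖ ≤
        ‖∫ y : ℝ in -T..T, G (x + y * I) * kern Λ (x + y * I)‖ +
          2 * T * (δ * Real.exp (c ^ 2) / c) := by
    intro x G R hx hG hR' hb
    have hx0 : x ≠ 0 := by rintro rfl; simp at hx; linarith
    have hxm : x ∈ Set.Icc (-c) c := abs_le.mp hx.le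
    have hint : IntervalIntegrable (fun y : ℝ => f (x + y * I) * kern Λ (x + y * I))
        MeasureTheory.volume (-T) T := by
      refine intervalIntegrable_vertical (f := fun w => f w * kern Λ w)
        (R := (Set.Icc (-c) c ×ℂ Set.Icc (-T) T) \ {0}) ?_ hTT ?_
      · exact (hf.continuousOn.mono Set.sdiff_subset).mul
          ((differentiableOn_kern Λ).continuousOn.mono fun w hw => hw.2)
      · intro y hy
        refine ⟨mem_rect hxm hy, ?_⟩
        intro h
        have := congrArg Complex.re h
        simp at this
        exact hx0 this
    have hint2 := intervalIntegrable_vertical (f := fun w => G w * kern Λ w) hG hTT hR'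
    have heq : (∫ y : ℝ in -T..T, f (x + y * I) * kern Λ (x + y * I)) -
        (∫ y : ℝ in -T..T, G (x + y * I) * kern Λ (x + y * I)) =
        ∫ y : ℝ in -T..T, (f (x + y * I) - G (x + y * I)) * kern Λ (x + y * I) := by
      rw [← intervalIntegral.integral_sub hint hint2]
      congr 1; ext y; ring
    have hbd : ‖∫ y : ℝ in -T..T, (f (x + y * I) - G (x + y * I)) * kern Λ (x + y * I)‖ ≤
        (δ * Real.exp (c ^ 2) / c) * |T - -T| := by
      refine intervalIntegral.norm_integral_le_of_norm_le_const fun y hy => ?_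
      rw [Set.uIoc_of_le hTT] at hy
      rw [norm_mul]
      calc _ ≤ (δ * Real.exp (-(Λ * x))) * (Real.exp (x ^ 2 + Λ * x) / |x|) :=
            mul_le_mul (hb y ⟨hy.1.le, hy.2⟩) (norm_kern_le_of_re hx0) (norm_nonneg _)
              (by positivity)
        _ = _ := by
          rw [hx, ← sq_abs x, hx, Real.exp_add, Real.exp_neg]
          field_simp
    rw [← heq, abs_of_nonneg (by linarith)] at hbd
    have := norm_sub_norm_le (∫ y : ℝ in -T..T, f (x + y * I) * kern Λ (x + y * I))
      (∫ y : ℝ in -T..T, G (x + y * I) * kern Λ (x + y * I))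
    linarith
  have hcr := hcmp c A _ (abs_of_pos hc) hAk.continuousOn
    (fun y hy => mem_rect (Set.right_mem_Icc.mpr hκc.le) hy) hR
  have hcl := hcmp (-c) A' _ (by rw [abs_neg, abs_of_pos hc]) hAk'.continuousOn
    (fun y hy => mem_rect (Set.left_mem_Icc.mpr (by linarith)) hy) (by simpa using hL)
  -- the inner lines
  have hin : ∀ (x : ℝ) (G : ℂ → ℂ) (R : Set ℂ), |x| = κ → ContinuousOn G R → R ⊆ {0}ᶜ →
      (∀ y ∈ Set.Icc (-T) T, (x : ℂ) + y * I ∈ R) →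
      IntervalIntegrable (fun y : ℝ => Real.exp (Λ * x) * ‖G (x + y * I)‖ * (6 / (κ + |y|)))
        MeasureTheory.volume (-T) T ∧
      ‖∫ y : ℝ in -T..T, G (x + y * I) * kern Λ (x + y * I)‖ ≤
        ∫ y : ℝ in -T..T, Real.exp (Λ * x) * ‖G (x + y * I)‖ * (6 / (κ + |y|)) := by
    intro x G R hx hG hR0 hmem
    have hGn : ContinuousOn (fun y : ℝ => G (x + y * I)) (Set.Icc (-T) T) :=
      hG.comp (continuous_vertical x).continuousOn hmem
    have hi : IntervalIntegrable (fun y : ℝ => Real.exp (Λ * x) * ‖G (x + y * I)‖ * (6 / (κ + |y|)))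
        MeasureTheory.volume (-T) T := by
      apply ContinuousOn.intervalIntegrable
      rw [Set.uIcc_of_le hTT]
      refine (continuousOn_const.mul hGn.norm).mul (Continuous.continuousOn ?_)
      exact continuous_const.div (by fun_prop) (fun y => by positivity)
    refine ⟨hi, (intervalIntegral.norm_integral_le_integral_norm hTT).trans
      (intervalIntegral.integral_mono_on hTT ?_ hi fun y _ => ?_)⟩
    · refine (intervalIntegrable_vertical (f := fun w => G w * kern Λ w) (R := R) ?_ hTT hmem).norm
      exact hG.mul ((differentiableOn_kern Λ).continuousOn.mono hR0)
    · rw [norm_mul]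
      have := norm_kern_le_near (Λ := Λ) (v := y) hκ hκ1 hx
      calc _ ≤ ‖G (x + y * I)‖ * (Real.exp (Λ * x) * (6 / (κ + |y|))) := by gcongr
        _ = _ := by ring
  have hin1 := hin κ A _ (abs_of_pos hκ) hA.continuousOn hsub1
    (fun y hy => mem_rect (Set.left_mem_Icc.mpr hκc.le) hy)
  have hin2 := hin (-κ) A' _ (by rw [abs_neg, abs_of_pos hκ]) hA'.continuousOn hsub2
    (fun y hy => mem_rect (Set.right_mem_Icc.mpr (by linarith)) hy)
  have hsum : (∫ v : ℝ in -T..T, (Real.exp (Λ * κ) * ‖A (κ + v * I)‖ +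
        Real.exp (-(Λ * κ)) * ‖A' ((-κ : ℝ) + v * I)‖) * (6 / (κ + |v|))) =
      (∫ y : ℝ in -T..T, Real.exp (Λ * κ) * ‖A (κ + y * I)‖ * (6 / (κ + |y|))) +
      ∫ y : ℝ in -T..T, Real.exp (Λ * (-κ : ℝ)) * ‖A' ((-κ : ℝ) + y * I)‖ * (6 / (κ + |y|)) := by
    rw [← intervalIntegral.integral_add hin1.1 hin2.1]
    congr 1; ext y; rw [mul_neg]; ring
  have h2 := congrArg norm hC
  have h3 : ‖2 * (Real.pi : ℂ) * I * f 0‖ = 2 * Real.pi * ‖f 0‖ := by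
    simp [abs_of_pos Real.pi_pos]
  rw [h3] at h2
  rw [← h2, hsum]
  have hT1 := hH T (Or.inl rfl)
  have hT2 := hH (-T) (Or.inr rfl)
  have hB8 : 8 * c * M * Real.exp (c ^ 2 - T ^ 2 + Λ * c) / T = 8 * c * B := by
    rw [hBdef]; ring
  have hδ4 : 4 * T * δ * Real.exp (c ^ 2) / c = 4 * T * (δ * Real.exp (c ^ 2) / c) := by ring
  rw [hB8, hδ4]
  have hB0 : 0 ≤ B := by positivity
  have hfin : ‖rectIntegral (fun w => f w * kern Λ w) (-c) c (-T) T‖ ≤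
      ‖∫ x : ℝ in -c..c, f (x + (-T : ℝ) * I) * kern Λ (x + (-T : ℝ) * I)‖ +
      ‖∫ x : ℝ in -c..c, f (x + T * I) * kern Λ (x + T * I)‖ +
      ‖∫ y : ℝ in -T..T, f (c + y * I) * kern Λ (c + y * I)‖ +
      ‖∫ y : ℝ in -T..T, f ((-c : ℝ) + y * I) * kern Λ ((-c : ℝ) + y * I)‖ := by
    unfold rectIntegral
    refine (norm_sub_le _ _).trans (add_le_add ((norm_add_le _ _).trans (add_le_add
      (norm_sub_le _ _) ?_)) ?_) <;> rw [norm_mul, norm_I, one_mul]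
  -- The two horizontal sides cost `2cB` each and the two line shifts at most `2cB` each, which
  -- makes `8cB`.
  nlinarith [hin1.2, hin2.2]

/-! ### Averages over finite families -/

/-- Weighted Cauchy–Schwarz, from the discriminant of the nonnegative quadratic `μ ↦ ∫ (a - μ)² k`.
-/
theorem sq_integral_mul_le {a k : ℝ → ℝ} {T : ℝ} (hT : 0 ≤ T) (ha : ContinuousOn a (Set.Icc (-T) T))
    (hk : ContinuousOn k (Set.Icc (-T) T)) (hk0 : ∀ v, 0 ≤ k v) :
    (∫ v in -T..T, a v * k v) ^ 2 ≤ (∫ v in -T..T, k v) * ∫ v in -T..T, a v ^ 2 * k v := by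
  have hTT : -T ≤ T := by linarith
  have ii : ∀ {g : ℝ → ℝ}, ContinuousOn g (Set.Icc (-T) T) →
      IntervalIntegrable g MeasureTheory.volume (-T) T := fun h => by
    apply ContinuousOn.intervalIntegrable
    rwa [Set.uIcc_of_le hTT]
  have key : ∀ μ : ℝ, 0 ≤ (∫ v in -T..T, k v) * (μ * μ) + (-2 * ∫ v in -T..T, a v * k v) * μ
      + ∫ v in -T..T, a v ^ 2 * k v := by
    intro μ
    have h1 : 0 ≤ ∫ v in -T..T, (a v - μ) ^ 2 * k v :=
      intervalIntegral.integral_nonneg hTT fun v _ => mul_nonneg (sq_nonneg _) (hk0 v)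
    have i1 : IntervalIntegrable (fun v => a v ^ 2 * k v) MeasureTheory.volume (-T) T :=
      ii ((ha.pow 2).mul hk)
    have i2 : IntervalIntegrable (fun v => (-2 * μ) * (a v * k v)) MeasureTheory.volume (-T) T :=
      ii (continuousOn_const.mul (ha.mul hk))
    have i3 : IntervalIntegrable (fun v => μ * μ * k v) MeasureTheory.volume (-T) T :=
      ii (continuousOn_const.mul hk)
    have h2 : (∫ v in -T..T, (a v - μ) ^ 2 * k v) =
        (∫ v in -T..T, a v ^ 2 * k v) + ∫ v in -T..T, ((-2 * μ) * (a v * k v) + μ * μ * k v) := by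
      rw [← intervalIntegral.integral_add i1 (i2.add i3)]
      congr 1; ext v; ring
    rw [h2, intervalIntegral.integral_add i2 i3, intervalIntegral.integral_const_mul,
      intervalIntegral.integral_const_mul] at h1
    linarith
  have := discrim_le_zero key
  unfold discrim at this
  nlinarith

theorem sum_integral_mul_le {ι : Type*} (P : Finset ι) {a : ι → ℝ → ℝ} {k : ℝ → ℝ} {T M : ℝ}
    (hT : 0 ≤ T) (ha : ∀ i ∈ P, ContinuousOn (a i) (Set.Icc (-T) T))
    (hk : ContinuousOn k (Set.Icc (-T) T)) (hk0 : ∀ v, 0 ≤ k v)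
    (hM : ∀ v ∈ Set.Icc (-T) T, ∑ i ∈ P, a i v ≤ M) :
    ∑ i ∈ P, ∫ v in -T..T, a i v * k v ≤ M * ∫ v in -T..T, k v := by
  have hTT : -T ≤ T := by linarith
  have ii : ∀ {g : ℝ → ℝ}, ContinuousOn g (Set.Icc (-T) T) →
      IntervalIntegrable g MeasureTheory.volume (-T) T := fun h => by
    apply ContinuousOn.intervalIntegrable
    rwa [Set.uIcc_of_le hTT]
  have i1 : ∀ i ∈ P, IntervalIntegrable (fun v => a i v * k v) MeasureTheory.volume (-T) T :=
    fun i hi => ii ((ha i hi).mul hk)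
  rw [← intervalIntegral.integral_finsetSum i1, ← intervalIntegral.integral_const_mul]
  refine intervalIntegral.integral_mono_on hTT
    (ii (continuousOn_finsetSum _ fun i hi => (ha i hi).mul hk)) (ii (continuousOn_const.mul hk)) ?_
  intro v hv
  rw [← Finset.sum_mul]
  exact mul_le_mul_of_nonneg_right (hM v hv) (hk0 v)

/-- A pointwise mean square bound survives integration against the kernel at the cost of `(∫ k)²`
only; the kernels used later have `∫ k = O(log ℒ)`. -/
theorem sum_sq_integral_mul_le {ι : Type*} (P : Finset ι) {a : ι → ℝ → ℝ} {k : ℝ → ℝ} {T M : ℝ}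
    (hT : 0 ≤ T) (ha : ∀ i ∈ P, ContinuousOn (a i) (Set.Icc (-T) T))
    (hk : ContinuousOn k (Set.Icc (-T) T)) (hk0 : ∀ v, 0 ≤ k v)
    (hM : ∀ v ∈ Set.Icc (-T) T, ∑ i ∈ P, a i v ^ 2 ≤ M) :
    ∑ i ∈ P, (∫ v in -T..T, a i v * k v) ^ 2 ≤ M * (∫ v in -T..T, k v) ^ 2 := by
  have hK : 0 ≤ ∫ v in -T..T, k v :=
    intervalIntegral.integral_nonneg (by linarith) fun v _ => hk0 v
  calc _ ≤ ∑ i ∈ P, (∫ v in -T..T, k v) * ∫ v in -T..T, a i v ^ 2 * k v :=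
        Finset.sum_le_sum fun i hi => sq_integral_mul_le hT (ha i hi) hk hk0
    _ = (∫ v in -T..T, k v) * ∑ i ∈ P, ∫ v in -T..T, a i v ^ 2 * k v := by rw [Finset.mul_sum]
    _ ≤ (∫ v in -T..T, k v) * (M * ∫ v in -T..T, k v) := by
        gcongr
        exact sum_integral_mul_le P hT (fun i hi => (ha i hi).pow 2) hk hk0 hM
    _ = _ := by ring

theorem continuous_div_add_abs {κ : ℝ} (hκ : 0 < κ) (b : ℝ) :
    Continuous fun v : ℝ => b / (κ + |v|) :=
  continuous_const.div (by fun_prop) (fun v => by positivity)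

theorem integral_div_add_abs {κ T : ℝ} (hκ : 0 < κ) (hT : 0 ≤ T) (b : ℝ) :
    ∫ v in -T..T, b / (κ + |v|) = 2 * b * Real.log ((κ + T) / κ) := by
  have hc := continuous_div_add_abs hκ b
  have h0 : ∫ v in (0 : ℝ)..T, b / (κ + |v|) = b * Real.log ((κ + T) / κ) := by
    have h1 : ∫ v in (0 : ℝ)..T, b / (κ + |v|) = ∫ v in (0 : ℝ)..T, b * (κ + v)⁻¹ := by
      apply intervalIntegral.integral_congr
      intro v hv
      rw [Set.uIcc_of_le hT] at hv
      simp only [abs_of_nonneg hv.1, div_eq_mul_inv]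
    rw [h1, intervalIntegral.integral_const_mul, intervalIntegral.integral_comp_add_left
      (fun x => x⁻¹), add_zero, integral_inv_of_pos hκ (by linarith)]
  have h2 : ∫ v in -T..(0 : ℝ), b / (κ + |v|) = ∫ v in (0 : ℝ)..T, b / (κ + |v|) := by
    have := intervalIntegral.integral_comp_neg (a := 0) (b := T) (fun v : ℝ => b / (κ + |v|))
    simp only [abs_neg, neg_zero] at this
    exact this.symm
  rw [← intervalIntegral.integral_add_adjacent_intervals (b := 0)
    (hc.intervalIntegrable _ _) (hc.intervalIntegrable _ _), h2, h0]
  ring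

/-- If the mean of `‖g i w‖` is small at each point of a rectangle, then few of the `g i` exceed a
given bound in a smaller rectangle. -/
theorem card_exceed_le {ι : Type*} (P : Finset ι) {g : ι → ℂ → ℂ} {Ω : Set ℂ}
    {a b c d δ M B : ℝ} (hδ : 0 < δ) (hab : a ≤ b) (hcd : c ≤ d)
    (hΩ : ∀ s ∈ Ω, a + δ ≤ s.re ∧ s.re + δ ≤ b ∧ c + δ ≤ s.im ∧ s.im + δ ≤ d)
    (hg : ∀ i ∈ P, DifferentiableOn ℂ (g i) (Set.Icc a b ×ℂ Set.Icc c d))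
    (hM : ∀ w ∈ Set.Icc a b ×ℂ Set.Icc c d, ∑ i ∈ P, ‖g i w‖ ≤ M)
    [DecidablePred fun i => ∀ s ∈ Ω, ‖g i s‖ ≤ B] :
    ((P.filter fun i => ¬ ∀ s ∈ Ω, ‖g i s‖ ≤ B).card : ℝ) * B ≤
      δ⁻¹ * ((b - a) + (d - c)) * M := by
  have hcont : ∀ i ∈ P, ContinuousOn (fun w => ‖g i w‖) (Set.Icc a b ×ℂ Set.Icc c d) :=
    fun i hi => (hg i hi).continuousOn.norm
  have ia := Set.left_mem_Icc.mpr hab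
  have ib := Set.right_mem_Icc.mpr hab
  have ic := Set.left_mem_Icc.mpr hcd
  have id := Set.right_mem_Icc.mpr hcd
  have hM0 : 0 ≤ M :=
    (Finset.sum_nonneg fun i _ => norm_nonneg _).trans (hM _ (mem_rect ia ic))
  have hhor : ∀ y ∈ Set.Icc c d, ∑ i ∈ P, ∫ x : ℝ in a..b, ‖g i (x + y * I)‖ ≤ (b - a) * M := by
    intro y hy
    rw [← intervalIntegral.integral_finsetSum fun i hi =>
      intervalIntegrable_horizontal (hcont i hi) hab fun x hx => mem_rect hx hy]
    calc _ ≤ ∫ x : ℝ in a..b, M := by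
          refine intervalIntegral.integral_mono_on hab
            (ContinuousOn.intervalIntegrable ?_) intervalIntegrable_const
            fun x hx => hM _ (mem_rect hx hy)
          rw [Set.uIcc_of_le hab]
          exact continuousOn_finsetSum _ fun i hi => (hcont i hi).comp
            (continuous_horizontal y).continuousOn fun x hx => mem_rect hx hy
      _ = _ := by simp
  have hver : ∀ x ∈ Set.Icc a b, ∑ i ∈ P, ∫ y : ℝ in c..d, ‖g i (x + y * I)‖ ≤ (d - c) * M := by
    intro x hx
    rw [← intervalIntegral.integral_finsetSum fun i hi =>
      intervalIntegrable_vertical (hcont i hi) hcd fun y hy => mem_rect hx hy]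
    calc _ ≤ ∫ y : ℝ in c..d, M := by
          refine intervalIntegral.integral_mono_on hcd
            (ContinuousOn.intervalIntegrable ?_) intervalIntegrable_const
            fun y hy => hM _ (mem_rect hx hy)
          rw [Set.uIcc_of_le hcd]
          exact continuousOn_finsetSum _ fun i hi => (hcont i hi).comp
            (continuous_vertical x).continuousOn fun y hy => mem_rect hx hy
      _ = _ := by simp
  have hr0 : ∀ i, 0 ≤ rectNorm (g i) a b c d := fun i => by
    unfold rectNorm
    have h1 : ∀ y : ℝ, 0 ≤ ∫ x : ℝ in a..b, ‖g i (x + y * I)‖ := fun y =>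
      intervalIntegral.integral_nonneg hab fun _ _ => norm_nonneg _
    have h2 : ∀ x : ℝ, 0 ≤ ∫ y : ℝ in c..d, ‖g i (x + y * I)‖ := fun y =>
      intervalIntegral.integral_nonneg hcd fun _ _ => norm_nonneg _
    have := h1 c; have := h1 d; have := h2 a; have := h2 b
    positivity
  have htot : ∑ i ∈ P, rectNorm (g i) a b c d ≤ 2 * ((b - a) + (d - c)) * M := by
    simp only [rectNorm, Finset.sum_add_distrib]
    have := hhor c ic; have := hhor d id; have := hver a ia; have := hver b ib
    linarith
  have hpi := Real.pi_gt_three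
  calc ((P.filter fun i => ¬ ∀ s ∈ Ω, ‖g i s‖ ≤ B).card : ℝ) * B
      = ∑ i ∈ P.filter fun i => ¬ ∀ s ∈ Ω, ‖g i s‖ ≤ B, B := by simp
    _ ≤ ∑ i ∈ P.filter fun i => ¬ ∀ s ∈ Ω, ‖g i s‖ ≤ B,
          (2 * Real.pi * δ)⁻¹ * rectNorm (g i) a b c d := by
        refine Finset.sum_le_sum fun i hi => ?_
        rw [Finset.mem_filter] at hi
        obtain ⟨hiP, hi⟩ := hi
        push Not at hi
        obtain ⟨s, hs, hsB⟩ := hi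
        obtain ⟨h1, h2, h3, h4⟩ := hΩ s hs
        exact hsB.le.trans (norm_le_rectNorm hδ h1 h2 h3 h4 (hg i hiP))
    _ ≤ ∑ i ∈ P, (2 * Real.pi * δ)⁻¹ * rectNorm (g i) a b c d :=
        Finset.sum_le_sum_of_subset_of_nonneg (Finset.filter_subset _ _)
          fun i _ _ => mul_nonneg (by positivity) (hr0 i)
    _ = (2 * Real.pi * δ)⁻¹ * ∑ i ∈ P, rectNorm (g i) a b c d := by rw [Finset.mul_sum]
    _ ≤ (2 * Real.pi * δ)⁻¹ * (2 * ((b - a) + (d - c)) * M) := by gcongr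
    _ = Real.pi⁻¹ * (δ⁻¹ * ((b - a) + (d - c)) * M) := by
        field_simp
    _ ≤ 1 * (δ⁻¹ * ((b - a) + (d - c)) * M) := by
        have : 0 ≤ (b - a) + (d - c) := by linarith
        gcongr
        exact inv_le_one_of_one_le₀ (by linarith)
    _ = _ := one_mul _

/-! ### The large sieve inequality -/

/-- The trigonometric polynomial `∑ b(n) e(nx)`. -/
noncomputable def trigPoly (b : ℕ → ℂ) (N : ℕ) (x : ℝ) : ℂ :=
  ∑ n ∈ Finset.Icc 1 N, b n * Complex.exp (2 * Real.pi * n * x * I)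

theorem continuous_trigPoly (b : ℕ → ℂ) (N : ℕ) : Continuous (trigPoly b N) := by
  unfold trigPoly; fun_prop

theorem hasDerivAt_trigPoly (b : ℕ → ℂ) (N : ℕ) (x : ℝ) :
    HasDerivAt (trigPoly b N) (trigPoly (fun n => b n * (2 * Real.pi * n * I)) N x) x := by
  unfold trigPoly
  refine HasDerivAt.fun_sum fun n _ => ?_
  have h1 : HasDerivAt (fun y : ℝ => 2 * (Real.pi : ℂ) * n * y * I) (2 * Real.pi * n * I) x := by
    simpa using ((hasDerivAt_id x).ofReal_comp.const_mul (2 * (Real.pi : ℂ) * n)).mul_const I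
  refine ((h1.cexp).const_mul (b n)).congr_deriv ?_
  ring

theorem integral_exp_period {k : ℤ} (hk : k ≠ 0) :
    ∫ x in (-1 : ℝ)..2, Complex.exp (2 * Real.pi * k * x * I) = 0 := by
  have hc : (2 * Real.pi * k * I : ℂ) ≠ 0 := by
    simp [hk, Real.pi_ne_zero]
  have h1 : ∀ x : ℝ, Complex.exp (2 * Real.pi * k * x * I) =
      Complex.exp ((2 * Real.pi * k * I) * x) := fun x => by congr 1; ring
  simp only [h1]
  rw [integral_exp_mul_complex hc]
  have h2 : Complex.exp ((2 * Real.pi * k * I) * ((2 : ℝ) : ℂ)) = 1 := by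
    rw [Complex.exp_eq_one_iff]; exact ⟨2 * k, by push_cast; ring⟩
  have h3 : Complex.exp ((2 * Real.pi * k * I) * ((-1 : ℝ) : ℂ)) = 1 := by
    rw [Complex.exp_eq_one_iff]; exact ⟨-k, by push_cast; ring⟩
  rw [h2, h3]; simp

/-- Parseval over three periods instead of one: windows of half-width at most 1 about points of `[0,
1]` then stay inside `[-1, 2]`, and no argument on the circle is needed. -/
theorem integral_normSq_trigPoly (b : ℕ → ℂ) (N : ℕ) :
    ∫ x in (-1 : ℝ)..2, ‖trigPoly b N x‖ ^ 2 = 3 * ∑ n ∈ Finset.Icc 1 N, ‖b n‖ ^ 2 := by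
  have h1 : ∀ x : ℝ, ((‖trigPoly b N x‖ ^ 2 : ℝ) : ℂ) = ∑ m ∈ Finset.Icc 1 N, ∑ n ∈ Finset.Icc 1 N,
      b m * (starRingEnd ℂ) (b n) * Complex.exp (2 * Real.pi * ((m : ℤ) - n : ℤ) * x * I) := by
    intro x
    rw [Complex.ofReal_pow, ← Complex.mul_conj', trigPoly, map_sum, Finset.sum_mul_sum]
    refine Finset.sum_congr rfl fun m _ => Finset.sum_congr rfl fun n _ => ?_
    rw [map_mul, ← Complex.exp_conj]
    have : Complex.exp (2 * Real.pi * ((m : ℤ) - n : ℤ) * x * I) =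
        Complex.exp (2 * Real.pi * m * x * I) *
          Complex.exp ((starRingEnd ℂ) (2 * Real.pi * n * x * I)) := by
      rw [← Complex.exp_add]
      congr 1
      have h2 : (starRingEnd ℂ) 2 = 2 := Complex.conj_eq_iff_im.mpr (by simp)
      simp [h2]
      ring
    rw [this]; ring
  have h2 : ((∫ x in (-1 : ℝ)..2, ‖trigPoly b N x‖ ^ 2 : ℝ) : ℂ) =
      ((3 * ∑ n ∈ Finset.Icc 1 N, ‖b n‖ ^ 2 : ℝ) : ℂ) := by
    rw [← intervalIntegral.integral_ofReal]
    simp only [h1]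
    rw [intervalIntegral.integral_finsetSum fun m _ => Continuous.intervalIntegrable (by fun_prop) _ _]
    push_cast
    rw [Finset.mul_sum]
    refine Finset.sum_congr rfl fun m hm => ?_
    rw [intervalIntegral.integral_finsetSum fun n _ => Continuous.intervalIntegrable (by fun_prop) _ _]
    rw [Finset.sum_eq_single m]
    · rw [intervalIntegral.integral_const_mul]
      simp [Complex.mul_conj']
      norm_num
      ring
    · intro n _ hn
      have h3 := integral_exp_period (k := (m : ℤ) - n) (by omega)
      push_cast at h3
      rw [intervalIntegral.integral_const_mul, h3, mul_zero]
    · intro h; exact absurd hm h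
  exact_mod_cast h2

/-- The Gallagher–Sobolev inequality: `f α` differs from any `f x` in the window by at most the
integral of `‖f'‖` over the window, and the resulting bound is averaged over `x`. -/
theorem norm_le_integral_add {f f' : ℝ → ℂ} {α h : ℝ} (hh : 0 ≤ h) (hf : ∀ x, HasDerivAt f (f' x) x)
    (hf' : Continuous f') :
    2 * h * ‖f α‖ ≤ ∫ x in (α - h)..(α + h), (‖f x‖ + 2 * h * ‖f' x‖) := by
  have hfc : Continuous f := continuous_iff_continuousAt.mpr fun x => (hf x).continuousAt
  have hle : α - h ≤ α + h := by linarith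
  set J := ∫ x in (α - h)..(α + h), ‖f' x‖ with hJ
  have h1 : ∀ x ∈ Set.Icc (α - h) (α + h), ‖f α‖ ≤ ‖f x‖ + J := by
    intro x hx
    have e1 : ∫ y in x..α, f' y = f α - f x :=
      intervalIntegral.integral_eq_sub_of_hasDerivAt (fun y _ => hf y) (hf'.intervalIntegrable _ _)
    have e2 : ‖f α - f x‖ ≤ J := by
      rw [← e1]
      refine intervalIntegral.norm_integral_le_integral_norm_uIoc.trans ?_
      rw [hJ, intervalIntegral.integral_of_le hle]
      refine MeasureTheory.setIntegral_mono_set ?_ (Filter.Eventually.of_forall fun _ => norm_nonneg _) ?_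
      · exact (hf'.norm.intervalIntegrable _ _).1
      · refine LE.le.eventuallyLE ?_
        apply Set.Ioc_subset_Ioc
        · exact le_min hx.1 (by linarith)
        · exact max_le hx.2 (by linarith)
    linarith [norm_sub_norm_le (f α) (f x)]
  have h2 : ∫ x in (α - h)..(α + h), ‖f α‖ ≤ ∫ x in (α - h)..(α + h), (‖f x‖ + J) :=
    intervalIntegral.integral_mono_on hle intervalIntegrable_const
      ((hfc.norm.add continuous_const).intervalIntegrable _ _) h1
  rw [intervalIntegral.integral_const, intervalIntegral.integral_add (hfc.norm.intervalIntegrable _ _)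
    intervalIntegrable_const, intervalIntegral.integral_const] at h2
  have h3 : IntervalIntegrable (fun x => 2 * h * ‖f' x‖) MeasureTheory.volume (α - h) (α + h) :=
    (continuous_const.mul hf'.norm).intervalIntegrable _ _
  rw [intervalIntegral.integral_add (hfc.norm.intervalIntegrable _ _) h3,
    intervalIntegral.integral_const_mul]
  simp only [smul_eq_mul] at h2
  rw [← hJ]
  nlinarith

/-- Gallagher's proof: the Sobolev inequality is applied to the square of the polynomial, on windows
of half-width `1/(2R)` about the points. The spacing makes these windows disjoint, so their
integrals add up to at most one integral over `[-1, 2]`, which Parseval evaluates. The choice `K =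
2πN`, the size of differentiation, balances the two terms of `2|P P'| ≤ K|P|² + K⁻¹|P'|²`. -/
theorem large_sieve_spaced {ι : Type*} (s : Finset ι) (α : ι → ℝ) {R : ℝ} (hR : 1 ≤ R)
    (h01 : ∀ i ∈ s, α i ∈ Set.Icc (0 : ℝ) 1)
    (hsp : ∀ i ∈ s, ∀ j ∈ s, i ≠ j → 1 / R ≤ |α i - α j|) (b : ℕ → ℂ) (N : ℕ) :
    ∑ i ∈ s, ‖trigPoly b N (α i)‖ ^ 2 ≤ 40 * (R + N) * ∑ n ∈ Finset.Icc 1 N, ‖b n‖ ^ 2 := by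
  rcases Nat.eq_zero_or_pos N with rfl | hN
  · simp [trigPoly]
  have hN' : (1 : ℝ) ≤ N := by exact_mod_cast hN
  set h := 1 / (2 * R) with hh
  have hh0 : 0 < h := by positivity
  have hh1 : h ≤ 1 := by
    rw [hh, div_le_one (by positivity)]; linarith
  set b' : ℕ → ℂ := fun n => b n * (2 * Real.pi * n * I) with hb'
  set K : ℝ := 2 * Real.pi * N with hK
  have hK0 : 0 < K := by positivity
  set G : ℝ → ℝ := fun x => (R + K) * ‖trigPoly b N x‖ ^ 2 + K⁻¹ * ‖trigPoly b' N x‖ ^ 2 with hG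
  have hGc : Continuous G := by
    have := continuous_trigPoly b N
    have := continuous_trigPoly b' N
    fun_prop
  have hG0 : ∀ x, 0 ≤ G x := fun x => by positivity
  have hpt : ∀ x : ℝ, ‖trigPoly b N x‖ ^ 2 ≤ ∫ y in (x - h)..(x + h), G y := by
    intro x
    have hd : ∀ y, HasDerivAt (fun y => trigPoly b N y ^ 2)
        (2 * trigPoly b N y * trigPoly b' N y) y := fun y => by
      simpa using (hasDerivAt_trigPoly b N y).fun_pow 2
    have hcd : Continuous fun y => 2 * trigPoly b N y * trigPoly b' N y :=
      (continuous_const.mul (continuous_trigPoly b N)).mul (continuous_trigPoly b' N)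
    have := norm_le_integral_add (α := x) hh0.le hd hcd
    rw [norm_pow] at this
    have h3 : ‖trigPoly b N x‖ ^ 2 ≤ (2 * h)⁻¹ * ∫ y in (x - h)..(x + h),
        (‖trigPoly b N y ^ 2‖ + 2 * h * ‖2 * trigPoly b N y * trigPoly b' N y‖) := by
      rw [inv_mul_eq_div, le_div_iff₀ (by positivity)]; linarith
    refine h3.trans ?_
    rw [← intervalIntegral.integral_const_mul]
    refine intervalIntegral.integral_mono_on (by linarith) ?_ (hGc.intervalIntegrable _ _) ?_
    · apply Continuous.intervalIntegrable
      have := continuous_trigPoly b N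
      have := continuous_trigPoly b' N
      fun_prop
    · intro y _
      have e : (2 * h)⁻¹ = R := by rw [hh]; field_simp
      rw [mul_add, e, ← mul_assoc R, ← e, inv_mul_cancel₀ (by positivity), one_mul, e]
      simp only [hG, norm_mul, norm_pow, Complex.norm_ofNat]
      have h4 : 2 * ‖trigPoly b N y‖ * ‖trigPoly b' N y‖ ≤ K * ‖trigPoly b N y‖ ^ 2 +
          K⁻¹ * ‖trigPoly b' N y‖ ^ 2 := by
        have h5 : 0 ≤ K⁻¹ * (K * ‖trigPoly b N y‖ - ‖trigPoly b' N y‖) ^ 2 := by positivity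
        have h6 : K⁻¹ * (K * ‖trigPoly b N y‖ - ‖trigPoly b' N y‖) ^ 2 = K * ‖trigPoly b N y‖ ^ 2 +
          K⁻¹ * ‖trigPoly b' N y‖ ^ 2 - 2 * ‖trigPoly b N y‖ * ‖trigPoly b' N y‖ := by
          field_simp; ring
        linarith
      linarith
  have hunion : ∑ i ∈ s, ∫ y in (α i - h)..(α i + h), G y ≤ ∫ y in (-1 : ℝ)..2, G y := by
    have e1 : ∀ i, (∫ y in (α i - h)..(α i + h), G y) = ∫ y in Set.Ioc (α i - h) (α i + h), G y :=
      fun i => intervalIntegral.integral_of_le (by linarith)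
    simp only [e1]
    rw [← MeasureTheory.integral_biUnion_finset s (fun i _ => measurableSet_Ioc),
      intervalIntegral.integral_of_le (by norm_num)]
    · refine MeasureTheory.setIntegral_mono_set (hGc.intervalIntegrable _ _).1
        (Filter.Eventually.of_forall hG0) (LE.le.eventuallyLE ?_)
      intro x hx
      simp only [Set.mem_iUnion] at hx
      obtain ⟨i, hi, hx⟩ := hx
      have := h01 i hi
      exact ⟨by linarith [hx.1, this.1], by linarith [hx.2, this.2]⟩
    · intro i hi j hj hij
      have := hsp i hi j hj hij
      rw [Function.onFun, Set.disjoint_left]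
      intro x hx hx'
      have e2 : 1 / R = 2 * h := by rw [hh]; field_simp
      rw [e2] at this
      have : |α i - α j| < 2 * h := by
        rw [abs_lt]; constructor <;> linarith [hx.1, hx.2, hx'.1, hx'.2]
      linarith
    · intro i _
      exact (hGc.intervalIntegrable (α i - h) (α i + h)).1
  have hGint : ∫ y in (-1 : ℝ)..2, G y ≤ 40 * (R + N) * ∑ n ∈ Finset.Icc 1 N, ‖b n‖ ^ 2 := by
    rw [hG, intervalIntegral.integral_add, intervalIntegral.integral_const_mul,
      intervalIntegral.integral_const_mul, integral_normSq_trigPoly, integral_normSq_trigPoly]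
    · have h7 : ∑ n ∈ Finset.Icc 1 N, ‖b' n‖ ^ 2 ≤ K ^ 2 * ∑ n ∈ Finset.Icc 1 N, ‖b n‖ ^ 2 := by
        rw [Finset.mul_sum]
        refine Finset.sum_le_sum fun n hn => ?_
        rw [Finset.mem_Icc] at hn
        have hn' : (n : ℝ) ≤ N := by exact_mod_cast hn.2
        simp only [hb', norm_mul, Complex.norm_ofNat, Complex.norm_real, Real.norm_eq_abs,
          abs_of_pos Real.pi_pos, Complex.norm_natCast, norm_I, mul_one]
        rw [mul_pow, mul_comm, hK]
        gcongr
      have h8 : K⁻¹ * (3 * ∑ n ∈ Finset.Icc 1 N, ‖b' n‖ ^ 2) ≤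
          3 * K * ∑ n ∈ Finset.Icc 1 N, ‖b n‖ ^ 2 := by
        calc _ ≤ K⁻¹ * (3 * (K ^ 2 * ∑ n ∈ Finset.Icc 1 N, ‖b n‖ ^ 2)) := by gcongr
          _ = _ := by field_simp
      have hS : 0 ≤ ∑ n ∈ Finset.Icc 1 N, ‖b n‖ ^ 2 := by positivity
      have hpi : Real.pi < 3.15 := Real.pi_lt_d2
      have hKb : 6 * K ≤ 40 * N := by rw [hK]; nlinarith
      nlinarith
    · apply Continuous.intervalIntegrable
      have := continuous_trigPoly b N
      fun_prop
    · apply Continuous.intervalIntegrable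
      have := continuous_trigPoly b' N
      fun_prop
  exact (Finset.sum_le_sum fun i _ => hpt (α i)).trans (hunion.trans hGint)

/-- The reduced fractions `b / q` in `[0, 1)` with denominators up to `R`, as pairs `(q, b)`. -/
def farey (R : ℕ) : Finset (Σ _ : ℕ, ℕ) :=
  (Finset.Icc 1 R).sigma fun q => (Finset.range q).filter fun b => Nat.Coprime b q

/-- Distinct reduced fractions `a/q`, `a'/q'` differ by at least `1/(qq') ≥ 1/R²`. -/
theorem large_sieve_farey {R : ℕ} (hR : 1 ≤ R) (b : ℕ → ℂ) (N : ℕ) :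
    ∑ p ∈ farey R, ‖trigPoly b N ((p.2 : ℝ) / p.1)‖ ^ 2 ≤
      40 * ((R : ℝ) ^ 2 + N) * ∑ n ∈ Finset.Icc 1 N, ‖b n‖ ^ 2 := by
  have hR' : (1 : ℝ) ≤ R := by exact_mod_cast hR
  refine large_sieve_spaced (farey R) (fun p => (p.2 : ℝ) / p.1) (one_le_pow₀ hR') ?_ ?_ b N
  · rintro ⟨q, a⟩ hp
    simp only [farey, Finset.mem_sigma, Finset.mem_Icc, Finset.mem_filter, Finset.mem_range] at hp
    have hq : (0 : ℝ) < q := by exact_mod_cast hp.1.1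
    have ha : (a : ℝ) ≤ q := by exact_mod_cast hp.2.1.le
    exact ⟨by positivity, (div_le_one hq).mpr ha⟩
  · rintro ⟨q, a⟩ hp ⟨q', a'⟩ hp' hne
    simp only [farey, Finset.mem_sigma, Finset.mem_Icc, Finset.mem_filter, Finset.mem_range] at hp hp'
    have hq : (0 : ℝ) < q := by exact_mod_cast hp.1.1
    have hq' : (0 : ℝ) < q' := by exact_mod_cast hp'.1.1
    have hqR : (q : ℝ) ≤ R := by exact_mod_cast hp.1.2
    have hqR' : (q' : ℝ) ≤ R := by exact_mod_cast hp'.1.2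
    have hint : (1 : ℝ) ≤ |(a : ℝ) * q' - q * a'| := by
      have : (a : ℤ) * q' - q * a' ≠ 0 := by
        intro h0
        have h1 : a * q' = q * a' := by
          have : (a : ℤ) * q' = q * a' := by linarith
          exact_mod_cast this
        have d1 : q ∣ q' := (hp.2.2.symm).dvd_of_dvd_mul_left (Dvd.intro _ h1.symm)
        have d2 : q' ∣ q := by
          have : q' ∣ q * a' := Dvd.intro_left _ h1
          exact (hp'.2.2.symm).dvd_of_dvd_mul_right this
        have e := Nat.dvd_antisymm d1 d2
        subst e
        rw [mul_comm] at h1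
        have := Nat.eq_of_mul_eq_mul_left hp.1.1 h1
        subst this
        exact hne rfl
      have := Int.one_le_abs this
      exact_mod_cast this
    simp only
    rw [div_sub_div _ _ hq.ne' hq'.ne', abs_div, abs_of_pos (by positivity : (0 : ℝ) < q * q')]
    gcongr
    rw [sq]; gcongr

/-! ### Gauss sums: from additive to primitive multiplicative characters. -/

theorem normSq_gaussSum {q : ℕ} [NeZero q] {ψ : DirichletCharacter ℂ q} (hψ : ψ.IsPrimitive) :
    ‖gaussSum ψ ZMod.stdAddChar‖ ^ 2 = q := by
  -- Fourier inversion at `-1`: the transform of a primitive `ψ` is a multiple of `ψ⁻¹` by the Gauss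
  -- sum, and transforming twice multiplies by `q`.
  have h1 := congrFun (ZMod.dft_dft (ψ : ZMod q → ℂ)) (-1)
  have h2 : ZMod.dft (ψ : ZMod q → ℂ) =
      fun k => ψ⁻¹ (-k) * gaussSum ψ ZMod.stdAddChar := by
    ext k; exact hψ.fourierTransform_eq_inv_mul_gaussSum k
  rw [h2, ZMod.dft_apply] at h1
  have h3 := star_gaussSum_eq ψ (ZMod.stdAddChar (N := q))
  have h4 : gaussSum ψ⁻¹ (ZMod.stdAddChar (N := q))⁻¹ =
      ∑ j : ZMod q, ZMod.stdAddChar j * ψ⁻¹ (-j) := by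
    rw [gaussSum, ← Equiv.sum_comp (Equiv.neg _)]
    refine Finset.sum_congr rfl fun j _ => ?_
    simp [AddChar.inv_apply, mul_comm]
  have h5 : gaussSum ψ ZMod.stdAddChar * star (gaussSum ψ ZMod.stdAddChar) = q := by
    rw [h3, h4, Finset.mul_sum]
    simp only [neg_neg, map_one, smul_eq_mul, mul_one] at h1
    rw [← h1]
    refine Finset.sum_congr rfl fun j _ => ?_
    simp only [mul_neg, mul_one, neg_neg]
    ring
  have h6 : ((‖gaussSum ψ ZMod.stdAddChar‖ ^ 2 : ℝ) : ℂ) = (q : ℂ) := by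
    rw [← h5, Complex.star_def, Complex.mul_conj']; push_cast; rfl
  exact_mod_cast h6

theorem norm_rootNumber {q : ℕ} [NeZero q] {ψ : DirichletCharacter ℂ q} (hψ : ψ.IsPrimitive) :
    ‖rootNumber ψ‖ = 1 := by
  have hq : (0 : ℝ) < q := by exact_mod_cast Nat.pos_of_ne_zero (NeZero.ne q)
  have h1 : ‖gaussSum ψ ZMod.stdAddChar‖ = Real.sqrt q := by
    rw [← normSq_gaussSum hψ, Real.sqrt_sq (norm_nonneg _)]
  have h2 : ‖(q : ℂ) ^ (1 / 2 : ℂ)‖ = Real.sqrt q := by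
    rw [Complex.norm_natCast_cpow_of_pos (Nat.pos_of_ne_zero (NeZero.ne q)), Real.sqrt_eq_rpow]
    norm_num
  rw [rootNumber, norm_div, norm_div, norm_pow, norm_I, one_pow, div_one, h1, h2, div_self]
  positivity

open Classical in
theorem sum_normSq_character_sum {q : ℕ} [NeZero q] (g : ZMod q → ℂ) :
    ∑ ψ : DirichletCharacter ℂ q, ‖∑ b : ZMod q, ψ b * g b‖ ^ 2 =
      q.totient * ∑ b : ZMod q, if IsUnit b then ‖g b‖ ^ 2 else 0 := by
  have h1 : ∀ ψ : DirichletCharacter ℂ q, ((‖∑ b : ZMod q, ψ b * g b‖ ^ 2 : ℝ) : ℂ) =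
      ∑ b : ZMod q, ∑ a : ZMod q, g b * (starRingEnd ℂ) (g a) * (ψ⁻¹ a * ψ b) := by
    intro ψ
    rw [Complex.ofReal_pow, ← Complex.mul_conj', map_sum, Finset.sum_mul_sum]
    refine Finset.sum_congr rfl fun b _ => Finset.sum_congr rfl fun a _ => ?_
    rw [map_mul, ← MulChar.star_apply', Complex.star_def]
    ring
  have h2 : ((∑ ψ : DirichletCharacter ℂ q, ‖∑ b : ZMod q, ψ b * g b‖ ^ 2 : ℝ) : ℂ) =
      ((q.totient * ∑ b : ZMod q, if IsUnit b then ‖g b‖ ^ 2 else 0 : ℝ) : ℂ) := by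
    rw [Complex.ofReal_sum]
    simp only [h1]
    rw [Finset.sum_comm]
    push_cast
    rw [Finset.mul_sum]
    refine Finset.sum_congr rfl fun b _ => ?_
    rw [Finset.sum_comm]
    simp only [← Finset.mul_sum]
    by_cases hb : IsUnit b
    · rw [if_pos hb, Finset.sum_eq_single b]
      · have := sum_char_inv_mul_char_eq ℂ hb b
        rw [if_pos rfl] at this
        have h3 : ∀ ψ : DirichletCharacter ℂ q, ψ⁻¹ b * ψ b = ψ b⁻¹ * ψ b := fun ψ => by
          rw [MulChar.inv_apply_eq_inv']
          congr 1
          apply inv_eq_of_mul_eq_one_left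
          rw [← map_mul, ZMod.inv_mul_of_unit _ hb, map_one]
        simp only [h3]
        rw [this, Complex.mul_conj']
        push_cast
        ring
      · intro a _ hab
        by_cases ha : IsUnit a
        · have := sum_char_inv_mul_char_eq ℂ ha b
          rw [if_neg hab] at this
          have h3 : ∀ ψ : DirichletCharacter ℂ q, ψ⁻¹ a * ψ b = ψ a⁻¹ * ψ b := fun ψ => by
            rw [MulChar.inv_apply_eq_inv']
            congr 1
            apply inv_eq_of_mul_eq_one_left
            rw [← map_mul, ZMod.inv_mul_of_unit _ ha, map_one]
          simp only [h3]
          rw [this, mul_zero]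
        · simp [MulChar.map_nonunit _ ha]
      · intro h; exact absurd (Finset.mem_univ b) h
    · rw [if_neg hb]
      simp [MulChar.map_nonunit _ hb]
  exact_mod_cast h2

/-- Primitivity makes `ψ(n) τ(ψ⁻¹) = ∑ ψ⁻¹(a) e(an/q)` valid for every `n`, also for those not
coprime to `q`. -/
theorem sum_mul_gaussSum {q : ℕ} [NeZero q] {ψ : DirichletCharacter ℂ q} (hψ : ψ.IsPrimitive)
    (b : ℕ → ℂ) (N : ℕ) :
    (∑ n ∈ Finset.Icc 1 N, b n * ψ (n : ZMod q)) * gaussSum ψ⁻¹ ZMod.stdAddChar =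
      ∑ a : ZMod q, ψ⁻¹ a * trigPoly b N ((a.val : ℝ) / q) := by
  have hψ' : ψ⁻¹.IsPrimitive := by
    rw [isPrimitive_def, conductor_inv]; exact hψ
  simp only [trigPoly, Finset.mul_sum]
  rw [Finset.sum_comm, Finset.sum_mul]
  refine Finset.sum_congr rfl fun n _ => ?_
  have h1 := gaussSum_mulShift_of_isPrimitive (ZMod.stdAddChar (N := q)) hψ' (n : ZMod q)
  rw [inv_inv] at h1
  rw [mul_assoc, ← h1, gaussSum, Finset.mul_sum]
  refine Finset.sum_congr rfl fun a _ => ?_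
  have h2 : ZMod.stdAddChar (N := q) ((n : ZMod q) * a) =
      Complex.exp (2 * Real.pi * n * ((a.val : ℝ) / q : ℝ) * I) := by
    have : (n : ZMod q) * a = (((n * a.val : ℕ) : ℤ) : ZMod q) := by
      push_cast
      rw [ZMod.natCast_zmod_val]
    rw [this, ZMod.stdAddChar_coe]
    congr 1
    push_cast
    ring
  rw [AddChar.mulShift_apply, h2]
  ring

open Classical in
-- By positivity the sum may be extended to all characters, where orthogonality applies; the factor
-- `φ(q) ≤ q` it produces is cancelled by `|τ|² = q`.
theorem sum_primitive_le {q : ℕ} [NeZero q] (b : ℕ → ℂ) (N : ℕ) :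
    ∑ ψ : DirichletCharacter ℂ q with ψ.IsPrimitive,
        ‖∑ n ∈ Finset.Icc 1 N, b n * ψ (n : ZMod q)‖ ^ 2 ≤
      ∑ a ∈ (Finset.range q).filter fun a => Nat.Coprime a q,
        ‖trigPoly b N ((a : ℝ) / q)‖ ^ 2 := by
  have hq : (0 : ℝ) < q := by exact_mod_cast Nat.pos_of_ne_zero (NeZero.ne q)
  have h1 : ∀ ψ : DirichletCharacter ℂ q, ψ.IsPrimitive →
      q * ‖∑ n ∈ Finset.Icc 1 N, b n * ψ (n : ZMod q)‖ ^ 2 =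
        ‖∑ a : ZMod q, ψ⁻¹ a * trigPoly b N ((a.val : ℝ) / q)‖ ^ 2 := by
    intro ψ hψ
    have hψ' : ψ⁻¹.IsPrimitive := by
      rw [isPrimitive_def, conductor_inv]; exact hψ
    rw [← sum_mul_gaussSum hψ, norm_mul, mul_pow, normSq_gaussSum hψ', mul_comm]
  have h2 : q * ∑ ψ : DirichletCharacter ℂ q with ψ.IsPrimitive,
        ‖∑ n ∈ Finset.Icc 1 N, b n * ψ (n : ZMod q)‖ ^ 2 ≤
      ∑ ψ : DirichletCharacter ℂ q, ‖∑ a : ZMod q, ψ a * trigPoly b N ((a.val : ℝ) / q)‖ ^ 2 := by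
    rw [Finset.mul_sum]
    calc _ = ∑ ψ : DirichletCharacter ℂ q with ψ.IsPrimitive,
          ‖∑ a : ZMod q, ψ⁻¹ a * trigPoly b N ((a.val : ℝ) / q)‖ ^ 2 :=
          Finset.sum_congr rfl fun ψ hψ => h1 ψ (Finset.mem_filter.mp hψ).2
      _ ≤ ∑ ψ : DirichletCharacter ℂ q,
          ‖∑ a : ZMod q, ψ⁻¹ a * trigPoly b N ((a.val : ℝ) / q)‖ ^ 2 :=
          Finset.sum_le_sum_of_subset_of_nonneg (Finset.filter_subset _ _)
            fun _ _ _ => by positivity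
      _ = _ := Equiv.sum_comp (Equiv.inv (DirichletCharacter ℂ q))
          fun ψ => ‖∑ a : ZMod q, ψ a * trigPoly b N ((a.val : ℝ) / q)‖ ^ 2
  rw [sum_normSq_character_sum] at h2
  have h3 : (∑ a : ZMod q, if IsUnit a then ‖trigPoly b N ((a.val : ℝ) / q)‖ ^ 2 else 0) =
      ∑ a ∈ (Finset.range q).filter fun a => Nat.Coprime a q,
        ‖trigPoly b N ((a : ℝ) / q)‖ ^ 2 := by
    rw [← Finset.sum_filter]
    refine Finset.sum_bij (fun a _ => a.val) ?_ ?_ ?_ ?_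
    · intro a ha
      rw [Finset.mem_filter] at ha ⊢
      refine ⟨Finset.mem_range.mpr (ZMod.val_lt a), ?_⟩
      have := (ZMod.isUnit_iff_coprime a.val q).mp (by rw [ZMod.natCast_zmod_val]; exact ha.2)
      exact this
    · intro a _ a' _ h
      exact ZMod.val_injective q h
    · intro a ha
      rw [Finset.mem_filter, Finset.mem_range] at ha
      refine ⟨(a : ZMod q), ?_, ZMod.val_cast_of_lt ha.1⟩
      rw [Finset.mem_filter]
      exact ⟨Finset.mem_univ _, (ZMod.isUnit_iff_coprime a q).mpr ha.2⟩
    · intro a _; rfl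
  rw [h3] at h2
  have h4 : (q.totient : ℝ) ≤ q := by exact_mod_cast Nat.totient_le q
  have h5 : 0 ≤ ∑ a ∈ (Finset.range q).filter fun a => Nat.Coprime a q,
        ‖trigPoly b N ((a : ℝ) / q)‖ ^ 2 := by positivity
  exact le_of_mul_le_mul_left (h2.trans (mul_le_mul_of_nonneg_right h4 h5)) hq

/-- The large sieve inequality for a finite set of primitive characters. -/
theorem large_sieve (P : Finset (Σ q : ℕ+, DirichletCharacter ℂ (q : ℕ))) {R : ℕ} (hR : 1 ≤ R)
    (hP : ∀ x ∈ P, (x.1 : ℕ) ≤ R ∧ x.2.IsPrimitive) (b : ℕ → ℂ) (N : ℕ) :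
    ∑ x ∈ P, ‖∑ n ∈ Finset.Icc 1 N, b n * x.2 (n : ZMod (x.1 : ℕ))‖ ^ 2 ≤
      40 * ((R : ℝ) ^ 2 + N) * ∑ n ∈ Finset.Icc 1 N, ‖b n‖ ^ 2 := by
  classical
  refine le_trans ?_ (large_sieve_farey hR b N)
  set T : Finset ℕ+ := P.image Sigma.fst with hT
  have hsub : P ⊆ T.sigma fun q => Finset.univ.filter fun ψ : DirichletCharacter ℂ (q : ℕ) =>
      ψ.IsPrimitive := by
    intro x hx
    rw [Finset.mem_sigma, Finset.mem_filter]
    exact ⟨Finset.mem_image_of_mem _ hx, Finset.mem_univ _, (hP x hx).2⟩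
  refine (Finset.sum_le_sum_of_subset_of_nonneg hsub fun _ _ _ => by positivity).trans ?_
  rw [Finset.sum_sigma, farey, Finset.sum_sigma]
  refine (Finset.sum_le_sum fun q _ => sum_primitive_le b N).trans ?_
  rw [← Finset.sum_image (s := T) (g := fun q : ℕ+ => (q : ℕ)) (f := fun q : ℕ =>
    ∑ a ∈ (Finset.range q).filter fun a => Nat.Coprime a q, ‖trigPoly b N ((a : ℝ) / q)‖ ^ 2)
    (fun _ _ _ _ h => PNat.eq h)]
  refine Finset.sum_le_sum_of_subset_of_nonneg ?_ fun _ _ _ => by positivity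
  intro q hq
  obtain ⟨q', hq', rfl⟩ := Finset.mem_image.mp hq
  obtain ⟨x, hx, rfl⟩ := Finset.mem_image.mp hq'
  exact Finset.mem_Icc.mpr ⟨x.1.pos, (hP x hx).1⟩

/-! ### The coefficients `ν` and `υ` as real arithmetic functions -/

open ArithmeticFunction in
theorem abs_le_of_prime_pow {f g : ArithmeticFunction ℝ} (hf : f.IsMultiplicative)
    (hg : g.IsMultiplicative) (h : ∀ p k : ℕ, p.Prime → |f (p ^ k)| ≤ g (p ^ k)) (n : ℕ) :
    |f n| ≤ g n := by
  rcases eq_or_ne n 0 with rfl | hn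
  · simp
  rw [hf.multiplicative_factorization _ hn, hg.multiplicative_factorization _ hn, Finsupp.prod,
    Finsupp.prod, Finset.abs_prod]
  exact Finset.prod_le_prod (fun _ _ => abs_nonneg _)
    fun p hp => h p _ (Nat.prime_of_mem_primeFactors hp)

section Real

variable {D : ℕ} (χ : DirichletCharacter ℂ D)

/-- The real part of `χ`, as an arithmetic function. -/
noncomputable def chiRe : ArithmeticFunction ℝ :=
  ⟨fun n => if n = 0 then 0 else (χ (n : ZMod D)).re, by simp⟩

/-- `ν` as a real arithmetic function. -/
noncomputable def nuRe : ArithmeticFunction ℝ := (ArithmeticFunction.zeta : ArithmeticFunction ℝ) * chiRe χ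

/-- `υ` as a real arithmetic function. -/
noncomputable def upsilonRe : ArithmeticFunction ℝ :=
  (ArithmeticFunction.moebius : ArithmeticFunction ℝ) *
    ((ArithmeticFunction.moebius : ArithmeticFunction ℝ).pmul (chiRe χ))

theorem chiRe_apply {n : ℕ} (hn : n ≠ 0) : chiRe χ n = (χ (n : ZMod D)).re := by
  simp [chiRe, hn]

variable {χ} (hreal : ∀ a : ZMod D, (χ a).im = 0)
include hreal

theorem ofReal_re_chi (a : ZMod D) : (((χ a).re : ℝ) : ℂ) = χ a :=
  Complex.ext rfl (by simp [hreal a])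

theorem chiRe_mul (m n : ℕ) : chiRe χ (m * n) = chiRe χ m * chiRe χ n := by
  rcases eq_or_ne m 0 with rfl | hm
  · simp
  rcases eq_or_ne n 0 with rfl | hn
  · simp
  rw [chiRe_apply _ hm, chiRe_apply _ hn, chiRe_apply _ (mul_ne_zero hm hn)]
  push_cast
  rw [map_mul, Complex.mul_re, hreal]
  ring

omit hreal in
theorem chiRe_one : chiRe χ 1 = 1 := by
  rw [chiRe_apply _ one_ne_zero]; simp

theorem isMultiplicative_chiRe : (chiRe χ).IsMultiplicative :=
  ⟨chiRe_one, fun _ => chiRe_mul hreal _ _⟩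

theorem chi_re_eq (a : ZMod D) : (χ a).re = 0 ∨ (χ a).re = 1 ∨ (χ a).re = -1 := by
  by_cases ha : IsUnit a
  · right
    have h1 := DirichletCharacter.unit_norm_eq_one χ ha.unit
    have h2 : ‖(((χ a).re : ℝ) : ℂ)‖ = 1 := by rw [ofReal_re_chi hreal]; simpa using h1
    rw [Complex.norm_real, Real.norm_eq_abs] at h2
    exact eq_or_eq_neg_of_abs_eq h2
  · left; rw [MulChar.map_nonunit _ ha]; simp

theorem chiRe_prime_pow (p k : ℕ) : chiRe χ (p ^ k) = chiRe χ p ^ k := by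
  induction k with
  | zero => simp [chiRe_one]
  | succ k ih => rw [pow_succ, chiRe_mul hreal, ih, pow_succ]

theorem chiRe_eq (n : ℕ) : chiRe χ n = 0 ∨ chiRe χ n = 1 ∨ chiRe χ n = -1 := by
  rcases eq_or_ne n 0 with rfl | hn
  · left; simp
  · rw [chiRe_apply _ hn]; exact chi_re_eq hreal _

theorem isMultiplicative_nuRe : (nuRe χ).IsMultiplicative :=
  ArithmeticFunction.isMultiplicative_zeta.natCast.mul (isMultiplicative_chiRe hreal)

theorem isMultiplicative_upsilonRe : (upsilonRe χ).IsMultiplicative :=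
  ArithmeticFunction.isMultiplicative_moebius.intCast.mul
    (ArithmeticFunction.isMultiplicative_moebius.intCast.pmul (isMultiplicative_chiRe hreal))

omit hreal in
theorem nuRe_apply (n : ℕ) : nuRe χ n = ∑ d ∈ n.divisors, chiRe χ d := by
  rw [nuRe, ArithmeticFunction.coe_zeta_mul_apply]

theorem nu_eq (n : ℕ) : nu χ n = (nuRe χ n : ℂ) := by
  rw [nu, nuRe_apply]
  push_cast
  refine Finset.sum_congr rfl fun d hd => ?_
  rw [chiRe_apply _ (Nat.pos_of_mem_divisors hd).ne', ofReal_re_chi hreal]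

theorem upsilon_eq (n : ℕ) : upsilon χ n = (upsilonRe χ n : ℂ) := by
  rw [upsilon, upsilonRe, ArithmeticFunction.mul_apply]
  push_cast
  refine Finset.sum_congr rfl fun d hd => ?_
  have hd2 : d.2 ≠ 0 := by
    rintro h
    rw [Nat.mem_divisorsAntidiagonal, h, mul_zero] at hd
    exact hd.2 hd.1.symm
  rw [ArithmeticFunction.pmul_apply, chiRe_apply _ hd2]
  push_cast
  rw [ofReal_re_chi hreal]
  simp

theorem nuRe_prime_pow {p : ℕ} (hp : p.Prime) (k : ℕ) :
    nuRe χ (p ^ k) = ∑ i ∈ Finset.range (k + 1), chiRe χ p ^ i := by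
  rw [nuRe_apply, Nat.sum_divisors_prime_pow hp]
  exact Finset.sum_congr rfl fun i _ => chiRe_prime_pow hreal p i

omit hreal in
theorem mul_apply_prime_pow (f g : ArithmeticFunction ℝ) {p : ℕ} (hp : p.Prime) (k : ℕ) :
    (f * g) (p ^ k) = ∑ i ∈ Finset.range (k + 1), f (p ^ i) * g (p ^ (k - i)) := by
  rw [ArithmeticFunction.mul_apply,
    Nat.sum_divisorsAntidiagonal (f := fun a b => f a * g b), Nat.sum_divisors_prime_pow hp]
  refine Finset.sum_congr rfl fun i hi => ?_
  rw [Nat.pow_div (Nat.lt_succ_iff.mp (Finset.mem_range.mp hi)) hp.pos]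

theorem nuRe_prime_pow_nonneg {p : ℕ} (hp : p.Prime) (k : ℕ) : 0 ≤ nuRe χ (p ^ k) := by
  rw [nuRe_prime_pow hreal hp]
  rcases chiRe_eq hreal p with h | h | h
  · exact Finset.sum_nonneg fun i _ => by rw [h]; positivity
  · exact Finset.sum_nonneg fun i _ => by rw [h]; positivity
  · rw [h, neg_one_geom_sum]; split_ifs <;> norm_num

theorem nuRe_nonneg (n : ℕ) : 0 ≤ nuRe χ n := by
  rcases eq_or_ne n 0 with rfl | hn
  · simp
  rw [(isMultiplicative_nuRe hreal).multiplicative_factorization _ hn]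
  exact Finset.prod_nonneg fun p hp => nuRe_prime_pow_nonneg hreal (Nat.prime_of_mem_primeFactors hp) _

/-- The Euler factor of `υ` is `(1 - X)(1 - χ(p)X)`, so `υ` vanishes at `p^k` for `k ≥ 3`; the
remaining prime powers are checked for each value of `χ(p)`. -/
theorem abs_upsilonRe_le (n : ℕ) : |upsilonRe χ n| ≤ nuRe χ n := by
  refine abs_le_of_prime_pow (isMultiplicative_upsilonRe hreal) (isMultiplicative_nuRe hreal) ?_ n
  intro p k hp
  have hmu2 : ∀ j, ArithmeticFunction.moebius (p ^ (j + 2)) = 0 := fun j => by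
    rw [ArithmeticFunction.moebius_apply_prime_pow hp (by omega)]; simp
  have hmu1 : ArithmeticFunction.moebius p = -1 := ArithmeticFunction.moebius_apply_prime hp
  rw [upsilonRe, mul_apply_prime_pow _ _ hp, nuRe_prime_pow hreal hp]
  simp only [ArithmeticFunction.pmul_apply, ArithmeticFunction.intCoe_apply, chiRe_prime_pow hreal]
  match k with
  | 0 => simp
  | 1 =>
    rcases chiRe_eq hreal p with h | h | h <;> simp [Finset.sum_range_succ, hmu1, h] <;> norm_num
  | 2 =>
    have := hmu2 0
    rw [zero_add] at this
    rcases chiRe_eq hreal p with h | h | h <;> simp [Finset.sum_range_succ, hmu1, h, this]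
  | k + 3 =>
    have h0 : ∑ i ∈ Finset.range (k + 3 + 1), ((ArithmeticFunction.moebius (p ^ i) : ℤ) : ℝ) *
        (((ArithmeticFunction.moebius (p ^ (k + 3 - i)) : ℤ) : ℝ) * chiRe χ p ^ (k + 3 - i)) = 0 := by
      refine Finset.sum_eq_zero fun i hi => ?_
      rcases le_or_gt 2 i with h | h
      · obtain ⟨j, rfl⟩ := Nat.exists_eq_add_of_le' h
        rw [hmu2]; simp
      · obtain ⟨j, hj⟩ : ∃ j, k + 3 - i = j + 2 := ⟨k + 1 - i, by omega⟩
        rw [hj, hmu2]; simp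
    rw [h0, abs_zero, ← nuRe_prime_pow hreal hp]
    exact nuRe_prime_pow_nonneg hreal hp _

/-- This reduces second moments of `ν` to products of first moments, so that its sparsity under (A1)
is inherited by `ν²`. On prime powers with `χ(p) = -1` the values of `ν` are 0 or 1, hence equal to
their squares, and a single term of the convolution suffices. -/
theorem nuRe_sq_le (n : ℕ) : nuRe χ n ^ 2 ≤ (nuRe χ * nuRe χ) n := by
  have hm := isMultiplicative_nuRe hreal
  have h1 := abs_le_of_prime_pow (hm.pmul hm) (hm.mul hm) ?_ n
  · rw [ArithmeticFunction.pmul_apply, ← sq, abs_of_nonneg (sq_nonneg _)] at h1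
    exact h1
  intro p k hp
  rw [ArithmeticFunction.pmul_apply, ← sq, abs_of_nonneg (sq_nonneg _), mul_apply_prime_pow _ _ hp]
  have hnn := fun k => nuRe_prime_pow_nonneg hreal hp k
  rcases chiRe_eq hreal p with h | h | h
  · have e : ∀ k, nuRe χ (p ^ k) = 1 := fun k => by
      rw [nuRe_prime_pow hreal hp, h, Finset.sum_range_succ']; simp
    simp [e]
  · have e : ∀ k : ℕ, nuRe χ (p ^ k) = k + 1 := fun k => by
      rw [nuRe_prime_pow hreal hp, h]; simp
    simp only [e]
    calc ((k : ℝ) + 1) ^ 2 = ∑ i ∈ Finset.range (k + 1), ((k : ℝ) + 1) := by simp; ring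
      _ ≤ _ := by
        refine Finset.sum_le_sum fun i hi => ?_
        have hik : i ≤ k := Nat.lt_succ_iff.mp (Finset.mem_range.mp hi)
        rw [Nat.cast_sub hik]
        have h1 : (0 : ℝ) ≤ i := by positivity
        have h2 : (i : ℝ) ≤ k := by exact_mod_cast hik
        nlinarith
  · have e : ∀ k, nuRe χ (p ^ k) ^ 2 = nuRe χ (p ^ k) := fun k => by
      rw [nuRe_prime_pow hreal hp, h, neg_one_geom_sum]; split_ifs <;> norm_num
    rw [e, Finset.sum_range_succ']
    simp only [pow_zero, hm.map_one, one_mul, Nat.sub_zero]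
    have : 0 ≤ ∑ i ∈ Finset.range k, nuRe χ (p ^ (i + 1)) * nuRe χ (p ^ (k - (i + 1))) :=
      Finset.sum_nonneg fun i _ => mul_nonneg (hnn _) (hnn _)
    linarith

theorem abs_chiRe_le (n : ℕ) : |chiRe χ n| ≤ 1 := by
  rcases chiRe_eq hreal n with h | h | h <;> simp [h]

theorem nuRe_le_card (n : ℕ) : nuRe χ n ≤ n.divisors.card := by
  rw [nuRe_apply]
  calc _ ≤ ∑ d ∈ n.divisors, (1 : ℝ) :=
        Finset.sum_le_sum fun d _ => (le_abs_self _).trans (abs_chiRe_le hreal d)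
    _ = _ := by simp

theorem nuRe_le (n : ℕ) : nuRe χ n ≤ n :=
  (nuRe_le_card hreal n).trans (by exact_mod_cast Nat.card_divisors_le_self n)

/-- Complete multiplicativity of `χ` makes `μχ` its convolution inverse. As a consequence the
product `F G` has no terms between 2 and `D⁵`. -/
theorem nuRe_mul_upsilonRe : nuRe χ * upsilonRe χ = 1 := by
  have h1 : chiRe χ * (ArithmeticFunction.moebius : ArithmeticFunction ℝ).pmul (chiRe χ) = 1 := by
    ext n
    have h2 : (ArithmeticFunction.zeta : ArithmeticFunction ℝ) *
        (ArithmeticFunction.moebius : ArithmeticFunction ℝ) = 1 :=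
      ArithmeticFunction.coe_zeta_mul_coe_moebius
    have h3 := DFunLike.congr_fun h2 n
    rw [ArithmeticFunction.mul_apply]
    have h4 : ∑ x ∈ n.divisorsAntidiagonal, chiRe χ x.1 *
        ((ArithmeticFunction.moebius : ArithmeticFunction ℝ).pmul (chiRe χ)) x.2 = chiRe χ n *
        ((ArithmeticFunction.zeta : ArithmeticFunction ℝ) *
        (ArithmeticFunction.moebius : ArithmeticFunction ℝ)) n := by
      rw [ArithmeticFunction.mul_apply, Finset.mul_sum]
      refine Finset.sum_congr rfl fun x hx => ?_
      have hx1 : x.1 ≠ 0 := by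
        rintro h
        rw [Nat.mem_divisorsAntidiagonal, h, zero_mul] at hx
        exact hx.2 hx.1.symm
      rw [← (Nat.mem_divisorsAntidiagonal.mp hx).1, chiRe_mul hreal, ArithmeticFunction.pmul_apply,
        ArithmeticFunction.natCoe_apply, ArithmeticFunction.zeta_apply_ne hx1]
      push_cast
      ring
    rw [h4, h3]
    by_cases hn : n = 1
    · subst hn; simp [chiRe_one]
    · simp [ArithmeticFunction.one_apply_ne hn]
  rw [nuRe, upsilonRe]
  calc _ = ((ArithmeticFunction.zeta : ArithmeticFunction ℝ) *
        (ArithmeticFunction.moebius : ArithmeticFunction ℝ)) *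
        (chiRe χ * (ArithmeticFunction.moebius : ArithmeticFunction ℝ).pmul (chiRe χ)) := by ring
    _ = 1 := by rw [h1, ArithmeticFunction.coe_zeta_mul_coe_moebius, one_mul]

end Real

/-! ### Character sums and an integral representation of `L(s,ψ)` -/

theorem sum_range_shift_eq_zero {q : ℕ} [NeZero q] {ψ : DirichletCharacter ℂ q} (hψ : ψ ≠ 1) (k : ℕ) :
    ∑ i ∈ Finset.range q, ψ ((i + k : ℕ) : ZMod q) = 0 := by
  have h1 : ∑ a : ZMod q, ψ (a + k) = 0 := by
    rw [← MulChar.sum_eq_zero_of_ne_one hψ]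
    exact Equiv.sum_comp (Equiv.addRight (k : ZMod q)) ψ
  rw [← h1]
  refine Finset.sum_bij (fun i _ => (i : ZMod q)) (fun _ _ => Finset.mem_univ _) ?_ ?_ ?_
  · intro i hi j hj h
    rw [Finset.mem_range] at hi hj
    rw [← ZMod.val_cast_of_lt hi, ← ZMod.val_cast_of_lt hj, h]
  · intro a _
    exact ⟨a.val, Finset.mem_range.mpr (ZMod.val_lt a), ZMod.natCast_zmod_val a⟩
  · intro i _; push_cast; rfl

/-- Complete periods cancel and the rest is bounded trivially. This crude form is enough: it only
decides from which power of `D` onwards `ν` is known to be sparse. -/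
theorem norm_sum_range_shift_le {q : ℕ} [NeZero q] {ψ : DirichletCharacter ℂ q} (hψ : ψ ≠ 1)
    (N : ℕ) : ∀ k : ℕ, ‖∑ i ∈ Finset.range N, ψ ((i + k : ℕ) : ZMod q)‖ ≤ q := by
  induction N using Nat.strong_induction_on with
  | _ N ih =>
    intro k
    rcases le_or_gt N q with h | h
    · calc _ ≤ ∑ i ∈ Finset.range N, ‖ψ ((i + k : ℕ) : ZMod q)‖ := norm_sum_le _ _
        _ ≤ ∑ i ∈ Finset.range N, (1 : ℝ) := Finset.sum_le_sum fun i _ => norm_le_one ψ _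
        _ ≤ q := by simpa using h
    · obtain ⟨M, rfl⟩ := Nat.exists_eq_add_of_le h.le
      rw [Finset.sum_range_add, sum_range_shift_eq_zero hψ, zero_add]
      have hq := Nat.pos_of_ne_zero (NeZero.ne q)
      have := ih M (by omega) (q + k)
      refine le_trans (le_of_eq ?_) this
      congr 1
      refine Finset.sum_congr rfl fun i _ => ?_
      congr 2
      ring

theorem sum_Icc_one_eq_range {M : Type*} [AddCommMonoid M] (f : ℕ → M) (N : ℕ) :
    ∑ n ∈ Finset.Icc 1 N, f n = ∑ i ∈ Finset.range N, f (i + 1) := by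
  rw [Finset.range_eq_Ico, Finset.sum_Ico_add' f 0 N 1]
  rfl

theorem norm_sum_Icc_le {q : ℕ} [NeZero q] {ψ : DirichletCharacter ℂ q} (hψ : ψ ≠ 1) (N : ℕ) :
    ‖∑ n ∈ Finset.Icc 1 N, ψ (n : ZMod q)‖ ≤ q := by
  rw [sum_Icc_one_eq_range]
  exact norm_sum_range_shift_le hψ N 1

theorem isBigO_one_of_bounded {c : ℕ → ℂ} {B : ℝ} (h : ∀ n, ‖c n‖ ≤ B) :
    c =O[Filter.atTop] fun n : ℕ => (n : ℝ) ^ (0 : ℝ) :=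
  Asymptotics.IsBigO.of_bound B (Filter.Eventually.of_forall fun n => by simpa using h n)

theorem measurable_sum_floor (f : ℕ → ℂ) :
    Measurable fun t : ℝ => ∑ k ∈ Finset.Icc 1 ⌊t⌋₊, f k :=
  (measurable_from_nat (f := fun n : ℕ => ∑ k ∈ Finset.Icc 1 n, f k)).comp Nat.measurable_floor

/-- For `Re s > 1` this is partial summation. The right-hand side is a Mellin transform of a bounded
function supported in `t > 1`, hence holomorphic for `Re s > 0`, and the identity theorem extends
the equality. -/
theorem LFunction_eq_mul_integral {q : ℕ} [NeZero q] {ψ : DirichletCharacter ℂ q} (hψ : ψ ≠ 1)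
    {s : ℂ} (hs : 0 < s.re) : LFunction ψ s =
      s * ∫ t in Set.Ioi (1 : ℝ), (∑ k ∈ Finset.Icc 1 ⌊t⌋₊, ψ (k : ZMod q)) * (t : ℂ) ^ (-(s + 1)) := by
  set S : ℝ → ℂ := fun t => ∑ k ∈ Finset.Icc 1 ⌊t⌋₊, ψ (k : ZMod q) with hS
  have hSm : Measurable S := measurable_sum_floor _
  have hSb : ∀ t, ‖S t‖ ≤ q := fun t => norm_sum_Icc_le hψ _
  set g : ℝ → ℂ := (Set.Ioi (1 : ℝ)).indicator S with hg
  have hgm : Measurable g := hSm.indicator measurableSet_Ioi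
  have hgb : ∀ t, ‖g t‖ ≤ q := fun t =>
    (norm_indicator_le_norm_self _ _).trans (hSb t)
  have hint : ∀ z : ℂ, (∫ t in Set.Ioi (1 : ℝ), S t * (t : ℂ) ^ (-(z + 1))) = mellin g (-z) := by
    intro z
    rw [mellin, ← MeasureTheory.integral_indicator measurableSet_Ioi,
      ← MeasureTheory.integral_indicator measurableSet_Ioi]
    congr 1
    ext t
    by_cases ht : t ∈ Set.Ioi (1 : ℝ)
    · have ht' : t ∈ Set.Ioi (0 : ℝ) := Set.mem_Ioi.mpr (zero_lt_one.trans ht)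
      rw [Set.indicator_of_mem ht, Set.indicator_of_mem ht', hg, Set.indicator_of_mem ht,
        smul_eq_mul, mul_comm]
      congr 2; ring
    · rw [Set.indicator_of_notMem ht]
      by_cases ht' : t ∈ Set.Ioi (0 : ℝ)
      · rw [Set.indicator_of_mem ht', hg, Set.indicator_of_notMem ht, smul_zero]
      · rw [Set.indicator_of_notMem ht']
  have hdiff : DifferentiableOn ℂ (fun z => z * mellin g (-z)) {z | 0 < z.re} := by
    intro z hz
    have hz' : 0 < z.re := hz
    have hloc : MeasureTheory.LocallyIntegrableOn g (Set.Ioi 0) := by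
      have h1 : MeasureTheory.MemLp g ⊤ := MeasureTheory.memLp_top_of_bound
        hgm.aestronglyMeasurable q (Filter.Eventually.of_forall hgb)
      exact (h1.locallyIntegrable le_top).locallyIntegrableOn _
    have hm : DifferentiableAt ℂ (mellin g) (-z) := by
      -- The function `g` vanishes near 0, so the exponent there is arbitrary; `-z.re - 1` is just
      -- some number below the real part of `-z`.
      refine mellin_differentiableAt_of_isBigO_rpow (a := 0) (b := -z.re - 1) hloc ?_ (by simpa) ?_
        (by simp)
      · exact Asymptotics.IsBigO.of_bound q (Filter.Eventually.of_forall fun t => by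
          simpa using hgb t)
      · refine Asymptotics.IsBigO.of_bound 0 ?_
        have : Set.Ioo (0 : ℝ) 1 ∈ nhdsWithin 0 (Set.Ioi 0) := Ioo_mem_nhdsGT zero_lt_one
        filter_upwards [this] with t ht
        rw [hg, Set.indicator_of_notMem (by simpa using ht.2.le)]
        simp
    exact (differentiableAt_id.mul (hm.comp z differentiableAt_id.neg)).differentiableWithinAt
  have hopen : IsOpen {z : ℂ | 0 < z.re} := isOpen_lt continuous_const Complex.continuous_re
  have hL : DifferentiableOn ℂ (LFunction ψ) {z | 0 < z.re} :=
    (differentiable_LFunction hψ).differentiableOn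
  have hpre : IsPreconnected {z : ℂ | 0 < z.re} := (convex_halfSpace_re_gt 0).isPreconnected
  have heq : Set.EqOn (LFunction ψ) (fun z => z * mellin g (-z)) {z | 0 < z.re} := by
    refine (hL.analyticOnNhd hopen).eqOn_of_preconnected_of_eventuallyEq
      (hdiff.analyticOnNhd hopen) hpre (z₀ := 2) (by simp) ?_
    have h2 : {z : ℂ | 1 < z.re} ∈ nhds (2 : ℂ) :=
      (isOpen_lt continuous_const Complex.continuous_re).mem_nhds (by simp)
    filter_upwards [h2] with z hz
    have hz' : 1 < z.re := hz
    rw [LFunction_eq_LSeries ψ hz', ← hint,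
      LSeries_eq_mul_integral _ le_rfl (zero_lt_one.trans hz') (LSeriesSummable_of_one_lt_re ψ hz')
        (isBigO_one_of_bounded fun n => norm_sum_Icc_le hψ n)]
  rw [heq hs]
  simp only
  rw [← hint]

theorem integrableOn_rpow_mul_const {σ : ℝ} (hσ : 0 < σ) (B : ℝ) {c : ℝ} (hc : 0 < c) :
    MeasureTheory.IntegrableOn (fun t : ℝ => B * t ^ (-(σ + 1))) (Set.Ioi c) :=
  (integrableOn_Ioi_rpow_of_lt (by linarith) hc).const_mul _

theorem norm_LFunction_le {q : ℕ} [NeZero q] {ψ : DirichletCharacter ℂ q} (hψ : ψ ≠ 1)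
    {s : ℂ} (hs : 0 < s.re) : ‖LFunction ψ s‖ ≤ q * ‖s‖ / s.re := by
  rw [LFunction_eq_mul_integral hψ hs, norm_mul]
  have h1 : ‖∫ t in Set.Ioi (1 : ℝ), (∑ k ∈ Finset.Icc 1 ⌊t⌋₊, ψ (k : ZMod q)) *
      (t : ℂ) ^ (-(s + 1))‖ ≤ ∫ t in Set.Ioi (1 : ℝ), (q : ℝ) * t ^ (-(s.re + 1)) := by
    refine MeasureTheory.norm_integral_le_of_norm_le
      (integrableOn_rpow_mul_const hs _ zero_lt_one) ?_
    refine (MeasureTheory.ae_restrict_iff' measurableSet_Ioi).mpr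
      (Filter.Eventually.of_forall fun t ht => ?_)
    have ht0 : 0 < t := zero_lt_one.trans ht
    rw [norm_mul, Complex.norm_cpow_eq_rpow_re_of_pos ht0]
    simp only [neg_re, add_re, one_re]
    gcongr
    exact norm_sum_Icc_le hψ _
  rw [MeasureTheory.integral_const_mul, integral_Ioi_rpow_of_lt (by linarith) zero_lt_one] at h1
  have h2 : (q : ℝ) * (-(1 : ℝ) ^ (-(s.re + 1) + 1) / (-(s.re + 1) + 1)) = q / s.re := by
    rw [Real.one_rpow, show -(s.re + 1) + 1 = -s.re by ring, neg_div_neg_eq]; ring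
  rw [h2] at h1
  calc ‖s‖ * _ ≤ ‖s‖ * (q / s.re) := by gcongr
    _ = _ := by ring

/-- Both quantities are integrals of summatory functions against `t⁻²`. The summatory functions
agree up to `y` and differ by at most `2q` afterwards. -/
theorem norm_sum_div_sub_LFunction_one_le {q : ℕ} [NeZero q] {ψ : DirichletCharacter ℂ q}
    (hψ : ψ ≠ 1) {y : ℕ} (hy : 1 ≤ y) :
    ‖(∑ m ∈ Finset.Icc 1 y, ψ (m : ZMod q) / m) - LFunction ψ 1‖ ≤ 2 * q / y := by
  have hy0 : (0 : ℝ) < y := by exact_mod_cast hy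
  set f : ℕ → ℂ := fun n => if n ≤ y then ψ (n : ZMod q) else 0 with hf
  have hfsum : ∀ n, ∑ k ∈ Finset.Icc 1 n, f k = ∑ k ∈ Finset.Icc 1 (min n y), ψ (k : ZMod q) := by
    intro n
    rw [hf, ← Finset.sum_filter]
    refine Finset.sum_congr ?_ fun _ _ => rfl
    ext k
    simp only [Finset.mem_filter, Finset.mem_Icc]
    omega
  have hfb : ∀ n, ‖∑ k ∈ Finset.Icc 1 n, f k‖ ≤ q := fun n => by
    rw [hfsum]; exact norm_sum_Icc_le hψ _
  have hterm : ∀ n, n ∉ Finset.Icc 1 y → LSeries.term f 1 n = 0 := by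
    intro n hn
    rcases eq_or_ne n 0 with rfl | h0
    · simp
    · rw [LSeries.term_of_ne_zero h0, hf]
      have : ¬ n ≤ y := fun h => hn (Finset.mem_Icc.mpr ⟨Nat.one_le_iff_ne_zero.mpr h0, h⟩)
      simp [this]
  have hLf : LSeries f 1 = ∑ m ∈ Finset.Icc 1 y, ψ (m : ZMod q) / m := by
    rw [LSeries, tsum_eq_sum hterm]
    refine Finset.sum_congr rfl fun m hm => ?_
    rw [Finset.mem_Icc] at hm
    rw [LSeries.term_of_ne_zero (by omega), hf]
    simp [hm.2]
  have hsum : LSeriesSummable f 1 := summable_of_ne_finset_zero (s := Finset.Icc 1 y) hterm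
  have h1 := LSeries_eq_mul_integral f le_rfl (by simp) hsum (isBigO_one_of_bounded hfb)
  have h2 := LFunction_eq_mul_integral hψ (s := 1) (by simp)
  rw [hLf] at h1
  have hmeas : ∀ c : ℕ → ℂ, (∀ n, ‖∑ k ∈ Finset.Icc 1 n, c k‖ ≤ q) → MeasureTheory.IntegrableOn
      (fun t : ℝ => (∑ k ∈ Finset.Icc 1 ⌊t⌋₊, c k) * (t : ℂ) ^ (-((1 : ℂ) + 1))) (Set.Ioi 1) := by
    intro c hc
    refine MeasureTheory.Integrable.mono'
      (integrableOn_rpow_mul_const zero_lt_one (q : ℝ) zero_lt_one) ?_ ?_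
    · refine ((measurable_sum_floor c).mul ?_).aestronglyMeasurable
      exact (Complex.measurable_ofReal.pow_const _)
    · refine (MeasureTheory.ae_restrict_iff' measurableSet_Ioi).mpr
        (Filter.Eventually.of_forall fun t ht => ?_)
      have ht0 : (0 : ℝ) < t := zero_lt_one.trans ht
      rw [norm_mul, Complex.norm_cpow_eq_rpow_re_of_pos ht0]
      simp only [neg_re, add_re, one_re]
      gcongr
      exact hc _
  rw [h1, h2, one_mul, one_mul, ← MeasureTheory.integral_sub (hmeas f hfb)
    (hmeas _ fun n => norm_sum_Icc_le hψ n)]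
  set g : ℝ → ℝ := (Set.Ioi (y : ℝ)).indicator fun t => (2 * q : ℝ) * t ^ (-((1 : ℝ) + 1)) with hg
  have hgi : MeasureTheory.Integrable g := by
    rw [hg, MeasureTheory.integrable_indicator_iff measurableSet_Ioi]
    exact integrableOn_rpow_mul_const zero_lt_one _ hy0
  have h3 : ‖∫ t in Set.Ioi (1 : ℝ), ((∑ k ∈ Finset.Icc 1 ⌊t⌋₊, f k) * (t : ℂ) ^ (-((1 : ℂ) + 1)) -
      (∑ k ∈ Finset.Icc 1 ⌊t⌋₊, ψ (k : ZMod q)) * (t : ℂ) ^ (-((1 : ℂ) + 1)))‖ ≤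
      ∫ t in Set.Ioi (1 : ℝ), g t := by
    refine MeasureTheory.norm_integral_le_of_norm_le hgi.integrableOn ?_
    refine (MeasureTheory.ae_restrict_iff' measurableSet_Ioi).mpr
      (Filter.Eventually.of_forall fun t ht => ?_)
    have ht0 : (0 : ℝ) < t := zero_lt_one.trans ht
    by_cases hty : t ∈ Set.Ioi (y : ℝ)
    · rw [hg, Set.indicator_of_mem hty, ← sub_mul, norm_mul,
        Complex.norm_cpow_eq_rpow_re_of_pos ht0]
      simp only [neg_re, add_re, one_re]
      gcongr
      refine (norm_sub_le _ _).trans ?_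
      linarith [hfb ⌊t⌋₊, norm_sum_Icc_le hψ ⌊t⌋₊]
    · rw [hg, Set.indicator_of_notMem hty, hfsum, min_eq_left, sub_self, norm_zero]
      have : t ≤ y := by simpa using hty
      exact Nat.floor_le_of_le this
  refine h3.trans ?_
  have h4 : ∫ t in Set.Ioi (1 : ℝ), g t ≤ ∫ t, g t := by
    refine MeasureTheory.setIntegral_le_integral hgi (Filter.Eventually.of_forall fun t => ?_)
    rw [hg]
    refine Set.indicator_nonneg (fun t ht => ?_) t
    have : (0 : ℝ) < t := hy0.trans ht
    positivity
  refine h4.trans (le_of_eq ?_)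
  rw [hg, MeasureTheory.integral_indicator measurableSet_Ioi, MeasureTheory.integral_const_mul,
    integral_Ioi_rpow_of_lt (by norm_num) hy0]
  norm_num
  rw [Real.rpow_neg_one]
  field_simp

/-- Summation by parts with a monotone weight. -/
theorem norm_sum_antitone_mul_le {f : ℕ → ℝ} (hf : Antitone f) (hf0 : ∀ n, 0 ≤ f n) {c : ℕ → ℂ}
    {B : ℝ} (hB : ∀ n, ‖∑ i ∈ Finset.range n, c i‖ ≤ B) (n : ℕ) :
    ‖∑ i ∈ Finset.range n, f i * c i‖ ≤ B * f 0 := by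
  have hB0 : 0 ≤ B := (norm_nonneg _).trans (hB 0)
  have key : ∀ n, ‖(∑ i ∈ Finset.range (n + 1), f i * c i) -
      f n * ∑ i ∈ Finset.range (n + 1), c i‖ ≤ B * (f 0 - f n) := by
    intro n
    induction n with
    | zero => simp
    | succ n ih =>
      have e : (∑ i ∈ Finset.range (n + 1 + 1), (f i : ℂ) * c i) -
          f (n + 1) * ∑ i ∈ Finset.range (n + 1 + 1), c i =
          ((∑ i ∈ Finset.range (n + 1), (f i : ℂ) * c i) - f n * ∑ i ∈ Finset.range (n + 1), c i) +
          ((f n - f (n + 1) : ℝ) : ℂ) * ∑ i ∈ Finset.range (n + 1), c i := by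
        rw [Finset.sum_range_succ (fun i => (f i : ℂ) * c i) (n + 1), Finset.sum_range_succ c (n + 1)]
        push_cast; ring
      rw [e]
      have hmono := hf (Nat.le_succ n)
      have h2 : ‖((f n - f (n + 1) : ℝ) : ℂ) * ∑ i ∈ Finset.range (n + 1), c i‖ ≤
          (f n - f (n + 1)) * B := by
        rw [norm_mul, Complex.norm_real, Real.norm_eq_abs, abs_of_nonneg (by linarith)]
        exact mul_le_mul_of_nonneg_left (hB _) (by linarith)
      refine (norm_add_le _ _).trans ?_
      linarith
  rcases n with _ | n
  · simpa using mul_nonneg hB0 (hf0 0)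
  · have h1 := key n
    have h2 : ‖(f n : ℂ) * ∑ i ∈ Finset.range (n + 1), c i‖ ≤ f n * B := by
      rw [norm_mul, Complex.norm_real, Real.norm_eq_abs, abs_of_nonneg (hf0 n)]
      exact mul_le_mul_of_nonneg_left (hB _) (hf0 n)
    have := norm_sub_norm_le (∑ i ∈ Finset.range (n + 1), (f i : ℂ) * c i)
      (f n * ∑ i ∈ Finset.range (n + 1), c i)
    linarith

/-- The summatory function of `ν`, by the hyperbola method. -/
theorem sum_nuRe_le {D : ℕ} [NeZero D] {χ : DirichletCharacter ℂ D} (hχ : χ ≠ 1)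
    (hreal : ∀ a : ZMod D, (χ a).im = 0) {y u : ℕ} (hy : 1 ≤ y) (hyu : y ≤ u) :
    ∑ n ∈ Finset.Ioc 0 u, nuRe χ n ≤ u * (LFunction χ 1).re + 3 * D * u / y + y := by
  have hy0 : (0 : ℝ) < y := by exact_mod_cast hy
  have h1 : ∑ n ∈ Finset.Ioc 0 u, nuRe χ n = ∑ m ∈ Finset.Ioc 0 u, chiRe χ m * ((u / m : ℕ) : ℝ) := by
    rw [nuRe, mul_comm]
    exact ArithmeticFunction.sum_Ioc_mul_zeta_eq_sum (chiRe χ) u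
  rw [h1, ← Finset.sum_Ioc_consecutive _ (Nat.zero_le y) hyu]
  -- For `m ≤ y` the integer part of `u/m` is replaced by `u/m`, with error at most 1 for each `m`;
  -- the sum of `χ(m)/m` is then compared with `L(1,χ)`.
  have h2 : ∑ m ∈ Finset.Ioc 0 y, chiRe χ m * ((u / m : ℕ) : ℝ) ≤
      u * (LFunction χ 1).re + 2 * D * u / y + y := by
    have e1 : ∀ m ∈ Finset.Ioc 0 y, chiRe χ m * ((u / m : ℕ) : ℝ) ≤
        u * (χ (m : ZMod D) / m).re + 1 := by
      intro m hm
      rw [Finset.mem_Ioc] at hm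
      have hm0 : (0 : ℝ) < m := by exact_mod_cast hm.1
      have e2 : (χ (m : ZMod D) / m).re = chiRe χ m / m := by
        rw [chiRe_apply _ hm.1.ne', Complex.div_natCast_re]
      rw [e2]
      have e3 : ((u / m : ℕ) : ℝ) ≤ u / m := Nat.cast_div_le
      have e4 : (u : ℝ) / m ≤ (u / m : ℕ) + 1 := by
        rw [div_le_iff₀ hm0]
        have := Nat.lt_div_mul_add (a := u) hm.1
        have h : u ≤ (u / m + 1) * m := by linarith [Nat.lt_div_mul_add (a := u) hm.1]
        exact_mod_cast h
      have e5 := abs_le.mp (abs_chiRe_le hreal m)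
      have e6 : chiRe χ m * (((u / m : ℕ) : ℝ) - u / m) ≤ 1 := by nlinarith
      have e7 : (u : ℝ) * (chiRe χ m / m) = chiRe χ m * (u / m) := by ring
      rw [e7]; linarith
    refine (Finset.sum_le_sum e1).trans ?_
    rw [Finset.sum_add_distrib, ← Finset.mul_sum, ← Complex.re_sum]
    have e8 : (∑ m ∈ Finset.Ioc 0 y, χ (m : ZMod D) / m).re ≤ (LFunction χ 1).re + 2 * D / y := by
      have := norm_sum_div_sub_LFunction_one_le hχ hy
      have h3 := (Complex.re_le_norm _).trans this
      rw [Complex.sub_re] at h3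
      have : Finset.Ioc 0 y = Finset.Icc 1 y := rfl
      rw [this]; linarith
    have e9 : (u : ℝ) * (∑ m ∈ Finset.Ioc 0 y, χ (m : ZMod D) / m).re ≤
        u * ((LFunction χ 1).re + 2 * D / y) := by gcongr
    simp only [Finset.sum_const, Nat.card_Ioc, nsmul_eq_mul, mul_one, Nat.sub_zero]
    have e10 : (u : ℝ) * ((LFunction χ 1).re + 2 * D / y) =
        u * (LFunction χ 1).re + 2 * D * u / y := by ring
    linarith
  -- For `m > y` the integer part of `u/m` decreases with `m` and the sums of `χ` stay below `D`, so
  -- partial summation applies.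
  have h3 : ∑ m ∈ Finset.Ioc y u, chiRe χ m * ((u / m : ℕ) : ℝ) ≤ D * u / y := by
    have e0 : Finset.Ioc y u = Finset.Ico (y + 1) (u + 1) := by ext; simp
    have e1 : ∑ m ∈ Finset.Ioc y u, chiRe χ m * ((u / m : ℕ) : ℝ) =
        (∑ i ∈ Finset.range (u - y), (((u / (i + (y + 1)) : ℕ) : ℝ) : ℂ) *
          χ ((i + (y + 1) : ℕ) : ZMod D)).re := by
      rw [e0, Finset.sum_Ico_eq_sum_range, Complex.re_sum]
      refine Finset.sum_congr (by congr 1; omega) fun i _ => ?_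
      rw [Complex.re_ofReal_mul, chiRe_apply _ (by omega), add_comm (y + 1) i, mul_comm]
    rw [e1]
    refine (Complex.re_le_norm _).trans ?_
    refine (norm_sum_antitone_mul_le (f := fun i => ((u / (i + (y + 1)) : ℕ) : ℝ)) ?_ ?_
      (c := fun i => χ ((i + (y + 1) : ℕ) : ZMod D))
      (fun n => norm_sum_range_shift_le hχ n (y + 1)) (u - y)).trans ?_
    · intro i j hij
      simp only
      exact_mod_cast Nat.div_le_div_left (by omega) (by omega)
    · intro i; positivity
    · have e2 : ((u / (0 + (y + 1)) : ℕ) : ℝ) ≤ u / y := by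
        refine Nat.cast_div_le.trans ?_
        gcongr
        linarith
      calc (D : ℝ) * ((u / (0 + (y + 1)) : ℕ) : ℝ) ≤ D * (u / y) := by gcongr
        _ = _ := by ring
  have h4 : (3 : ℝ) * D * u / y = 2 * D * u / y + D * u / y := by ring
  linarith

/-! ### The size of the parameters -/

section Size

variable {D : ℕ} (hD : Real.exp (Real.exp (Real.exp (10 ^ 6))) ≤ (D : ℝ))
include hD

theorem cast_pos : (0 : ℝ) < D := (Real.exp_pos _).trans_le hD

theorem exp_exp_le_ell : Real.exp (Real.exp (10 ^ 6)) ≤ ell D := by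
  rw [ell, Real.le_log_iff_exp_le (cast_pos hD)]; exact hD

/-- The constants in the mean value estimates reach about `10^29`; this bound makes `ℒ`, and even
`log ℒ`, large enough to absorb them. -/
theorem le_log_ell : (10 : ℝ) ^ 100 ≤ Real.log (ell D) := by
  have h1 : Real.exp (10 ^ 6) ≤ Real.log (ell D) := by
    rw [Real.le_log_iff_exp_le ((Real.exp_pos _).trans_le (exp_exp_le_ell hD))]
    exact exp_exp_le_ell hD
  refine le_trans ?_ h1
  have h2 : (10 : ℝ) ^ 100 ≤ Real.exp 1 ^ 300 := by
    rw [show (300 : ℕ) = 3 * 100 from rfl, pow_mul]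
    gcongr
    calc (10 : ℝ) ≤ 2.7 ^ 3 := by norm_num
      _ ≤ Real.exp 1 ^ 3 := by gcongr; linarith [Real.exp_one_gt_d9]
  have h3 : Real.exp 1 ^ 300 = Real.exp 300 := by
    rw [← Real.exp_nat_mul]; norm_num
  rw [h3] at h2
  exact h2.trans (Real.exp_le_exp.mpr (by norm_num))

theorem ell_pos : 0 < ell D := (Real.exp_pos _).trans_le (exp_exp_le_ell hD)

theorem log_ell_le : Real.log (ell D) ≤ ell D := Real.log_le_self (ell_pos hD).le

theorem le_ell : (10 : ℝ) ^ 100 ≤ ell D := (le_log_ell hD).trans (log_ell_le hD)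

theorem exp_ell : Real.exp (ell D) = D := Real.exp_log (cast_pos hD)

omit hD in
theorem pow_twenty_le_exp {x : ℝ} (hx : 10 ^ 100 ≤ x) : x ^ 20 ≤ Real.exp (x / 100) := by
  have hx0 : 0 < x := lt_of_lt_of_le (by norm_num) hx
  have h1 := Real.pow_div_factorial_le_exp (x := x / 100) (by positivity) 21
  refine le_trans ?_ h1
  rw [div_pow, div_div, le_div_iff₀ (by positivity), pow_succ x 20]
  refine mul_le_mul_of_nonneg_left ?_ (by positivity)
  refine le_trans ?_ hx
  norm_num [Nat.factorial]

theorem ell_pow_le : ell D ^ 20 ≤ Real.exp (ell D / 100) := pow_twenty_le_exp (le_ell hD)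

theorem log_ell_pow_le : Real.log (ell D) ^ 20 ≤ ell D ^ (1 / 100 : ℝ) := by
  have := pow_twenty_le_exp (le_log_ell hD)
  rwa [Real.rpow_def_of_pos (ell_pos hD), mul_one_div]

end Size

/-! ### Sums of `ν` under assumption (A1) -/

section Sums

theorem sum_mul_antidiagonal_le {F : ℕ → ℕ → ℝ} (hF : ∀ a b, 0 ≤ F a b) (s : Finset ℕ)
    (B : Finset (ℕ × ℕ)) (hB : ∀ n ∈ s, ∀ p ∈ n.divisorsAntidiagonal, p ∈ B) :
    ∑ n ∈ s, ∑ p ∈ n.divisorsAntidiagonal, F p.1 p.2 ≤ ∑ p ∈ B, F p.1 p.2 := by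
  rw [← Finset.sum_biUnion]
  · refine Finset.sum_le_sum_of_subset_of_nonneg ?_ fun p _ _ => hF p.1 p.2
    intro p hp
    obtain ⟨n, hn, hp⟩ := Finset.mem_biUnion.mp hp
    exact hB n hn p hp
  · intro m _ n _ hmn
    rw [Function.onFun, Finset.disjoint_left]
    intro p hp hp'
    rw [Nat.mem_divisorsAntidiagonal] at hp hp'
    exact hmn (hp.1.symm.trans hp'.1)

theorem mul_apply_div (f g : ArithmeticFunction ℝ) (n : ℕ) :
    (f * g) n / n = ∑ p ∈ n.divisorsAntidiagonal, (f p.1 / p.1) * (g p.2 / p.2) := by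
  rw [ArithmeticFunction.mul_apply, Finset.sum_div]
  refine Finset.sum_congr rfl fun p hp => ?_
  rw [← (Nat.mem_divisorsAntidiagonal.mp hp).1]
  push_cast
  rw [mul_div_mul_comm]

theorem sum_mul_div_le {f g : ArithmeticFunction ℝ} (hf : ∀ n, 0 ≤ f n) (hg : ∀ n, 0 ≤ g n) (x : ℕ) :
    ∑ n ∈ Finset.Ioc 0 x, (f * g) n / n ≤
      (∑ a ∈ Finset.Ioc 0 x, f a / a) * ∑ b ∈ Finset.Ioc 0 x, g b / b := by
  rw [Finset.sum_mul_sum, ← Finset.sum_product']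
  simp only [mul_apply_div]
  refine sum_mul_antidiagonal_le (F := fun a b => (f a / a) * (g b / b))
    (fun a b => mul_nonneg (div_nonneg (hf a) (by positivity)) (div_nonneg (hg b) (by positivity)))
    _ _ ?_
  intro n hn p hp
  rw [Finset.mem_Ioc] at hn
  have h1 := Nat.fst_mem_divisors_of_mem_antidiagonal hp
  have h2 := Nat.snd_mem_divisors_of_mem_antidiagonal hp
  simp only [Finset.mem_product, Finset.mem_Ioc]
  exact ⟨⟨Nat.pos_of_mem_divisors h1, (Nat.divisor_le h1).trans hn.2⟩,
    Nat.pos_of_mem_divisors h2, (Nat.divisor_le h2).trans hn.2⟩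

/-- If `ab > z²` then `a > z` or `b > z`. -/
theorem sum_mul_self_div_tail_le {f : ArithmeticFunction ℝ} (hf : ∀ n, 0 ≤ f n) {z w x : ℕ}
    (hz : z * z ≤ w) :
    ∑ n ∈ Finset.Ioc w x, (f * f) n / n ≤
      2 * (∑ a ∈ Finset.Ioc z x, f a / a) * ∑ b ∈ Finset.Ioc 0 x, f b / b := by
  have hnn : ∀ n, 0 ≤ f n / n := fun n => div_nonneg (hf n) (by positivity)
  simp only [mul_apply_div]
  refine (sum_mul_antidiagonal_le (F := fun a b => (f a / a) * (f b / b))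
    (fun a b => mul_nonneg (hnn a) (hnn b)) _
    ((Finset.Ioc z x ×ˢ Finset.Ioc 0 x) ∪ (Finset.Ioc 0 x ×ˢ Finset.Ioc z x)) ?_).trans ?_
  · intro n hn p hp
    rw [Finset.mem_Ioc] at hn
    have h1 := Nat.fst_mem_divisors_of_mem_antidiagonal hp
    have h2 := Nat.snd_mem_divisors_of_mem_antidiagonal hp
    have h3 := (Nat.mem_divisorsAntidiagonal.mp hp).1
    have h4 := Nat.pos_of_mem_divisors h1
    have h5 := Nat.pos_of_mem_divisors h2
    have h6 := (Nat.divisor_le h1).trans hn.2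
    have h7 := (Nat.divisor_le h2).trans hn.2
    simp only [Finset.mem_union, Finset.mem_product, Finset.mem_Ioc]
    by_cases h : z < p.1
    · exact Or.inl ⟨⟨h, h6⟩, h5, h7⟩
    · refine Or.inr ⟨⟨h4, h6⟩, ?_, h7⟩
      by_contra h8
      push Not at h h8
      have : p.1 * p.2 ≤ z * z := Nat.mul_le_mul h h8
      omega
  · have h1 := Finset.sum_union_inter (s₁ := Finset.Ioc z x ×ˢ Finset.Ioc 0 x)
      (s₂ := Finset.Ioc 0 x ×ˢ Finset.Ioc z x) (f := fun p : ℕ × ℕ => (f p.1 / p.1) * (f p.2 / p.2))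
    have h2 : 0 ≤ ∑ p ∈ (Finset.Ioc z x ×ˢ Finset.Ioc 0 x) ∩ (Finset.Ioc 0 x ×ˢ Finset.Ioc z x),
        (f p.1 / p.1) * (f p.2 / p.2) := Finset.sum_nonneg fun p _ => mul_nonneg (hnn _) (hnn _)
    rw [Finset.sum_product' (f := fun a b => (f a / a) * (f b / b)), ← Finset.sum_mul_sum,
      Finset.sum_product' (f := fun a b => (f a / a) * (f b / b)), ← Finset.sum_mul_sum] at h1
    linarith

theorem sum_inv_le {x : ℕ} {y : ℝ} (hx : (x : ℝ) ≤ Real.exp y) (hy : 0 ≤ y) :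
    ∑ n ∈ Finset.Ioc 0 x, (1 : ℝ) / n ≤ 1 + y := by
  have h1 := harmonic_le_one_add_log x
  rw [harmonic_eq_sum_Icc] at h1
  push_cast at h1
  have h2 : Real.log x ≤ y := by
    rcases Nat.eq_zero_or_pos x with rfl | h
    · simpa using hy
    · rw [Real.log_le_iff_le_exp (by exact_mod_cast h)]; exact hx
  simp only [one_div]
  exact h1.trans (by linarith)

variable {D : ℕ} (hD : Real.exp (Real.exp (Real.exp (10 ^ 6))) ≤ (D : ℝ)) {χ : DirichletCharacter ℂ D}
  (hreal : ∀ a : ZMod D, (χ a).im = 0)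
include hD hreal

theorem sum_nuRe_div_le_of_le {x : ℕ} (hx : (x : ℝ) ≤ Real.exp (5 * ell D)) :
    ∑ n ∈ Finset.Ioc 0 x, nuRe χ n / n ≤ 36 * ell D ^ 2 := by
  have hL := le_ell hD
  have h0 : 0 ≤ ∑ n ∈ Finset.Ioc 0 x, (1 : ℝ) / n := Finset.sum_nonneg fun _ _ => by positivity
  have h1 := sum_inv_le hx (by nlinarith [ell_pos hD])
  have hz : ∀ n : ℕ, (0 : ℝ) ≤ (ArithmeticFunction.zeta : ArithmeticFunction ℝ) n := fun n => by
    rw [ArithmeticFunction.natCoe_apply]; positivity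
  have h2 := sum_mul_div_le hz hz x
  have h3 : ∑ n ∈ Finset.Ioc 0 x, (ArithmeticFunction.zeta : ArithmeticFunction ℝ) n / n =
      ∑ n ∈ Finset.Ioc 0 x, (1 : ℝ) / n := by
    refine Finset.sum_congr rfl fun n hn => ?_
    rw [ArithmeticFunction.natCoe_apply,
      ArithmeticFunction.zeta_apply_ne (Finset.mem_Ioc.mp hn).1.ne', Nat.cast_one]
  rw [h3] at h2
  have h4 : ∀ n : ℕ, nuRe χ n ≤ ((ArithmeticFunction.zeta : ArithmeticFunction ℝ) *
      (ArithmeticFunction.zeta : ArithmeticFunction ℝ)) n := by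
    intro n
    rw [nuRe_apply, ArithmeticFunction.coe_zeta_mul_apply]
    refine Finset.sum_le_sum fun d hd => (le_abs_self _).trans ?_
    rw [ArithmeticFunction.natCoe_apply,
      ArithmeticFunction.zeta_apply_ne (Nat.pos_of_mem_divisors hd).ne', Nat.cast_one]
    exact abs_chiRe_le hreal d
  calc _ ≤ ∑ n ∈ Finset.Ioc 0 x, ((ArithmeticFunction.zeta : ArithmeticFunction ℝ) *
      (ArithmeticFunction.zeta : ArithmeticFunction ℝ)) n / n := by
        gcongr with n; exact h4 n
    _ ≤ _ := h2
    _ ≤ (1 + 5 * ell D) * (1 + 5 * ell D) := by gcongr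
    _ ≤ 36 * ell D ^ 2 := by nlinarith

theorem sum_nuRe_sq_div_le_of_le {x : ℕ} (hx : (x : ℝ) ≤ Real.exp (5 * ell D)) :
    ∑ n ∈ Finset.Ioc 0 x, nuRe χ n ^ 2 / n ≤ 1296 * ell D ^ 4 := by
  have h1 := sum_nuRe_div_le_of_le hD hreal hx
  have h0 : 0 ≤ ∑ n ∈ Finset.Ioc 0 x, nuRe χ n / n :=
    Finset.sum_nonneg fun n _ => div_nonneg (nuRe_nonneg hreal n) (by positivity)
  calc _ ≤ ∑ n ∈ Finset.Ioc 0 x, (nuRe χ * nuRe χ) n / n := by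
        gcongr with n; exact nuRe_sq_le hreal n
    _ ≤ _ := sum_mul_div_le (nuRe_nonneg hreal) (nuRe_nonneg hreal) x
    _ ≤ (36 * ell D ^ 2) * (36 * ell D ^ 2) := by gcongr
    _ = _ := by ring

variable [NeZero D] (hχ : χ ≠ 1) (hA1 : A1 χ)
include hχ hA1

/-- The bound for `L(1,χ)` in assumption (A1). -/
theorem sum_nuRe_le_of_A1 {u : ℕ} (hu : Real.exp (9 / 8 * ell D) ≤ u) :
    ∑ n ∈ Finset.Ioc 0 u, nuRe χ n ≤ 2 * ((ell D ^ 17)⁻¹ * (Real.log (ell D))⁻¹) * u := by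
  have hL := le_ell hD
  have hL0 := ell_pos hD
  have hl := le_log_ell hD
  have hl0 : 0 < Real.log (ell D) := lt_of_lt_of_le (by norm_num) hl
  have hD0 := cast_pos hD
  have hu0 : (0 : ℝ) < u := (Real.exp_pos _).trans_le hu
  have hDu : (D : ℝ) ≤ u * Real.exp (-(ell D / 8)) := by
    calc (D : ℝ) = Real.exp (9 / 8 * ell D) * Real.exp (-(ell D / 8)) := by
          rw [← Real.exp_add, ← exp_ell hD]; congr 1; ring
      _ ≤ _ := by gcongr
  have hD1 : (1 : ℝ) ≤ D := by rw [← exp_ell hD]; exact Real.one_le_exp hL0.le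
  have hDu' : (D : ℝ) ≤ u := hDu.trans (by
    have : Real.exp (-(ell D / 8)) ≤ 1 := Real.exp_le_one_iff.mpr (by linarith)
    nlinarith)
  -- The cut `y ≈ √(uD)` balances the errors `Du/y` and `y` of the hyperbola method. For `u ≥
  -- D^{9/8}` both are at most about `u D^{-1/16}`, negligible against the term with `L(1,χ)`.
  set r := Real.sqrt (u * D) with hr
  have hrr : r * r = u * D := Real.mul_self_sqrt (by positivity)
  have hr1 : 1 ≤ r := by rw [hr, Real.one_le_sqrt]; nlinarith
  have hru : r ≤ u * Real.exp (-(ell D / 16)) := by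
    rw [hr]
    apply Real.sqrt_le_iff.mpr
    refine ⟨by positivity, ?_⟩
    rw [mul_pow, ← Real.exp_nat_mul, sq]
    have : ((2 : ℕ) : ℝ) * -(ell D / 16) = -(ell D / 8) := by push_cast; ring
    rw [this, mul_assoc]
    gcongr
  set y := ⌊r⌋₊ with hy
  have hy1 : 1 ≤ y := Nat.le_floor (by simpa using hr1)
  have hyr : (y : ℝ) ≤ r := Nat.floor_le (by linarith)
  have hyr2 : r ≤ 2 * y := by
    have h1 := Nat.lt_floor_add_one r
    have h2 : (1 : ℝ) ≤ y := by exact_mod_cast hy1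
    linarith
  have hyu : y ≤ u := by
    have : (y : ℝ) ≤ u := by nlinarith
    exact_mod_cast this
  have h1 := sum_nuRe_le hχ hreal hy1 hyu
  have hy0 : (0 : ℝ) < y := by exact_mod_cast hy1
  have h2 : 3 * D * u / y ≤ 6 * r := by
    rw [div_le_iff₀ hy0]; nlinarith
  set η := (ell D ^ 17)⁻¹ * (Real.log (ell D))⁻¹ with hη
  have h3 : (LFunction χ 1).re ≤ η := le_of_lt hA1
  have h4 : 7 * Real.exp (-(ell D / 16)) ≤ η := by
    rw [hη, ← mul_inv, Real.exp_neg, ← div_eq_mul_inv, div_le_iff₀ (Real.exp_pos _),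
      inv_mul_eq_div, le_div_iff₀ (by positivity)]
    calc 7 * (ell D ^ 17 * Real.log (ell D)) ≤ ell D * (ell D ^ 17 * ell D) := by
          gcongr
          · linarith
          · exact log_ell_le hD
      _ = ell D ^ 19 := by ring
      _ ≤ ell D ^ 20 := pow_le_pow_right₀ (by linarith) (by norm_num)
      _ ≤ Real.exp (ell D / 100) := ell_pow_le hD
      _ ≤ _ := Real.exp_le_exp.mpr (by linarith)
  nlinarith

/-- Each dyadic block contributes at most four times the quantity in (A1), and `O(ℒ²)` blocks reach
`exp(2ℒ²) = Q²`. -/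
theorem sum_nuRe_div_tail_le {z x : ℕ} (hz : Real.exp (9 / 8 * ell D) ≤ z)
    (hx : (x : ℝ) ≤ Real.exp (2 * ell D ^ 2)) :
    ∑ n ∈ Finset.Ioc z x, nuRe χ n / n ≤
      20 * ell D ^ 2 * ((ell D ^ 17)⁻¹ * (Real.log (ell D))⁻¹) := by
  have hL := le_ell hD
  have hL0 := ell_pos hD
  have hl := le_log_ell hD
  have hl0 : 0 < Real.log (ell D) := lt_of_lt_of_le (by norm_num) hl
  set η := (ell D ^ 17)⁻¹ * (Real.log (ell D))⁻¹ with hη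
  have hη0 : 0 ≤ η := by positivity
  have hz0 : (0 : ℝ) < z := (Real.exp_pos _).trans_le hz
  have hnn : ∀ n : ℕ, 0 ≤ nuRe χ n / n := fun n => div_nonneg (nuRe_nonneg hreal n) (by positivity)
  have key : ∀ k : ℕ, ∑ n ∈ Finset.Ioc z (2 ^ k * z), nuRe χ n / n ≤ 4 * η * k := by
    intro k
    induction k with
    | zero => simp
    | succ k ih =>
      have hle1 : z ≤ 2 ^ k * z := Nat.le_mul_of_pos_left z (by positivity)
      have hle2 : 2 ^ k * z ≤ 2 ^ (k + 1) * z := Nat.mul_le_mul_right _ (Nat.pow_le_pow_right (by norm_num) (by omega))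
      rw [← Finset.sum_Ioc_consecutive _ hle1 hle2]
      have hw0 : (0 : ℝ) < (2 ^ k * z : ℕ) := by push_cast; positivity
      have h1 : ∑ n ∈ Finset.Ioc (2 ^ k * z) (2 ^ (k + 1) * z), nuRe χ n / n ≤ 4 * η := by
        calc _ ≤ ∑ n ∈ Finset.Ioc (2 ^ k * z) (2 ^ (k + 1) * z), nuRe χ n / (2 ^ k * z : ℕ) := by
              refine Finset.sum_le_sum fun n hn => ?_
              have hn' : ((2 ^ k * z : ℕ) : ℝ) ≤ n := by exact_mod_cast (Finset.mem_Ioc.mp hn).1.le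
              exact div_le_div_of_nonneg_left (nuRe_nonneg hreal n) hw0 hn'
          _ = (∑ n ∈ Finset.Ioc (2 ^ k * z) (2 ^ (k + 1) * z), nuRe χ n) / (2 ^ k * z : ℕ) := by
              rw [Finset.sum_div]
          _ ≤ (∑ n ∈ Finset.Ioc 0 (2 ^ (k + 1) * z), nuRe χ n) / (2 ^ k * z : ℕ) := by
              exact div_le_div_of_nonneg_right (Finset.sum_le_sum_of_subset_of_nonneg
                (Finset.Ioc_subset_Ioc_left (Nat.zero_le _)) fun n _ _ => nuRe_nonneg hreal n) hw0.le
          _ ≤ (2 * η * (2 ^ (k + 1) * z : ℕ)) / (2 ^ k * z : ℕ) := by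
              gcongr
              refine sum_nuRe_le_of_A1 hD hreal hχ hA1 (hz.trans ?_)
              exact_mod_cast hle1.trans hle2
          _ = 4 * η := by
              push_cast; field_simp; ring
      push_cast
      linarith
  -- Enough doublings, because `3 log 2 > 2`.
  set k := ⌈3 * ell D ^ 2⌉₊ with hk
  have hk1 : 3 * ell D ^ 2 ≤ k := Nat.le_ceil _
  have hk2 : (k : ℝ) ≤ 5 * ell D ^ 2 := by
    have := Nat.ceil_lt_add_one (a := 3 * ell D ^ 2) (by positivity)
    nlinarith
  have hxk : x ≤ 2 ^ k * z := by
    have h1 : (x : ℝ) ≤ 2 ^ k * z := by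
      have hz1 : (1 : ℝ) ≤ z := by
        have : 0 < z := by exact_mod_cast hz0
        exact_mod_cast this
      have h2 : Real.exp (2 * ell D ^ 2) ≤ 2 ^ k := by
        rw [← Real.exp_log (show (0 : ℝ) < 2 ^ k by positivity), Real.log_pow]
        apply Real.exp_le_exp.mpr
        have := Real.log_two_gt_d9
        nlinarith
      calc (x : ℝ) ≤ 2 ^ k := hx.trans h2
        _ ≤ 2 ^ k * z := le_mul_of_one_le_right (by positivity) hz1
    exact_mod_cast h1
  calc _ ≤ ∑ n ∈ Finset.Ioc z (2 ^ k * z), nuRe χ n / n :=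
        Finset.sum_le_sum_of_subset_of_nonneg (Finset.Ioc_subset_Ioc_right hxk) fun n _ _ => hnn n
    _ ≤ 4 * η * k := key k
    _ ≤ 4 * η * (5 * ell D ^ 2) := by gcongr
    _ = _ := by ring

theorem sum_nuRe_div_le {x : ℕ} (hx : (x : ℝ) ≤ Real.exp (2 * ell D ^ 2)) :
    ∑ n ∈ Finset.Ioc 0 x, nuRe χ n / n ≤ 37 * ell D ^ 2 := by
  have hL := le_ell hD
  have hL0 := ell_pos hD
  have hl := le_log_ell hD
  have hnn : ∀ n : ℕ, 0 ≤ nuRe χ n / n := fun n => div_nonneg (nuRe_nonneg hreal n) (by positivity)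
  set z := ⌈Real.exp (9 / 8 * ell D)⌉₊ with hz
  have hz1 : Real.exp (9 / 8 * ell D) ≤ z := Nat.le_ceil _
  have hz2 : (z : ℝ) ≤ Real.exp (5 * ell D) := by
    have h1 := Nat.ceil_lt_add_one (Real.exp_pos (9 / 8 * ell D)).le
    have h2 : 1 ≤ Real.exp (9 / 8 * ell D) := Real.one_le_exp (by positivity)
    have h3 : Real.exp 1 * Real.exp (9 / 8 * ell D) ≤ Real.exp (5 * ell D) := by
      rw [← Real.exp_add]; apply Real.exp_le_exp.mpr; linarith
    have := Real.exp_one_gt_d9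
    nlinarith
  have h1 := sum_nuRe_div_le_of_le hD hreal hz2
  have h2 := sum_nuRe_div_tail_le hD hreal hχ hA1 hz1 hx
  have h3 : 20 * ell D ^ 2 * ((ell D ^ 17)⁻¹ * (Real.log (ell D))⁻¹) ≤ ell D ^ 2 := by
    have a1 : (ell D ^ 17)⁻¹ ≤ 1 := inv_le_one_of_one_le₀ (one_le_pow₀ (by linarith))
    have a2 : (Real.log (ell D))⁻¹ ≤ 1 / 20 := by
      rw [inv_le_comm₀ (by linarith) (by norm_num)]; linarith
    have a3 : (ell D ^ 17)⁻¹ * (Real.log (ell D))⁻¹ ≤ 1 * (1 / 20) :=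
      mul_le_mul a1 a2 (inv_nonneg.mpr (by linarith)) zero_le_one
    nlinarith
  calc _ ≤ ∑ n ∈ Finset.Ioc 0 z ∪ Finset.Ioc z x, nuRe χ n / n := by
        refine Finset.sum_le_sum_of_subset_of_nonneg ?_ fun n _ _ => hnn n
        intro n
        simp only [Finset.mem_union, Finset.mem_Ioc]
        omega
    _ = ∑ n ∈ Finset.Ioc 0 z, nuRe χ n / n + ∑ n ∈ Finset.Ioc z x, nuRe χ n / n := by
        refine Finset.sum_union (Finset.disjoint_left.mpr fun n => ?_)
        simp only [Finset.mem_Ioc]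
        omega
    _ ≤ _ := by linarith

/-- In `ν * ν` one factor must exceed `D^{9/8}`, because `D^{9/4}` lies below `D^{23/10}` with room
for rounding. That factor contributes `ℒ² · ℒ⁻¹⁷/log ℒ` and the free one `ℒ²`, which explains the
exponent 13. -/
theorem sum_nuRe_sq_div_tail_le {w x : ℕ} (hw : Real.exp (23 / 10 * ell D) ≤ w)
    (hx : (x : ℝ) ≤ Real.exp (2 * ell D ^ 2)) :
    ∑ n ∈ Finset.Ioc w x, nuRe χ n ^ 2 / n ≤ 1480 * (ell D ^ 13)⁻¹ * (Real.log (ell D))⁻¹ := by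
  have hL := le_ell hD
  have hL0 := ell_pos hD
  have hl := le_log_ell hD
  have hl0 : 0 < Real.log (ell D) := lt_of_lt_of_le (by norm_num) hl
  set z := ⌈Real.exp (9 / 8 * ell D)⌉₊ with hz
  have hz1 : Real.exp (9 / 8 * ell D) ≤ z := Nat.le_ceil _
  have hz2 : (z : ℝ) ≤ 2 * Real.exp (9 / 8 * ell D) := by
    have h1 := Nat.ceil_lt_add_one (Real.exp_pos (9 / 8 * ell D)).le
    have h2 : 1 ≤ Real.exp (9 / 8 * ell D) := Real.one_le_exp (by positivity)
    linarith
  have hzw : z * z ≤ w := by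
    have h1 : (z : ℝ) * z ≤ w := by
      calc (z : ℝ) * z ≤ (2 * Real.exp (9 / 8 * ell D)) * (2 * Real.exp (9 / 8 * ell D)) := by gcongr
        _ = 4 * Real.exp (9 / 4 * ell D) := by
          rw [show 9 / 4 * ell D = 9 / 8 * ell D + 9 / 8 * ell D by ring, Real.exp_add]; ring
        _ ≤ Real.exp 2 * Real.exp (9 / 4 * ell D) := by
          gcongr
          rw [show (2 : ℝ) = 1 + 1 by norm_num, Real.exp_add]
          nlinarith [Real.exp_one_gt_d9]
        _ ≤ Real.exp (23 / 10 * ell D) := by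
          rw [← Real.exp_add]; apply Real.exp_le_exp.mpr; linarith
        _ ≤ w := hw
    exact_mod_cast h1
  have h1 := sum_nuRe_div_tail_le hD hreal hχ hA1 hz1 hx
  have h2 := sum_nuRe_div_le hD hreal hχ hA1 hx
  have h3 := sum_mul_self_div_tail_le (nuRe_nonneg hreal) hzw (x := x)
  have h4 : 0 ≤ ∑ n ∈ Finset.Ioc 0 x, nuRe χ n / n :=
    Finset.sum_nonneg fun n _ => div_nonneg (nuRe_nonneg hreal n) (by positivity)
  calc _ ≤ ∑ n ∈ Finset.Ioc w x, (nuRe χ * nuRe χ) n / n := by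
        gcongr with n; exact nuRe_sq_le hreal n
    _ ≤ _ := h3
    _ ≤ 2 * (20 * ell D ^ 2 * ((ell D ^ 17)⁻¹ * (Real.log (ell D))⁻¹)) * (37 * ell D ^ 2) := by
        gcongr
    _ = _ := by field_simp; ring

end Sums

/-! ### The logarithmic derivative of the Gamma function -/

/-- Grönwall's inequality along the segment; zeros of `f` need not be excluded. -/
theorem norm_le_exp_mul_norm {f : ℂ → ℂ} {z w : ℂ} {C : ℝ}
    (hf : ∀ u ∈ segment ℝ z w, DifferentiableAt ℂ f u)
    (hC : ∀ u ∈ segment ℝ z w, ‖deriv f u‖ ≤ C * ‖f u‖) :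
    ‖f w‖ ≤ Real.exp (C * ‖w - z‖) * ‖f z‖ := by
  have hmem : ∀ t ∈ Set.Icc (0 : ℝ) 1, z + t * (w - z) ∈ segment ℝ z w := by
    intro t ht
    rw [segment_eq_image']
    exact ⟨t, ht, by simp⟩
  have hd : ∀ t ∈ Set.Icc (0 : ℝ) 1,
      HasDerivAt (fun t : ℝ => f (z + t * (w - z))) (deriv f (z + t * (w - z)) * (w - z)) t := by
    intro t ht
    have h1 : HasDerivAt (fun t : ℝ => z + t * (w - z)) (w - z) t := by
      simpa using ((hasDerivAt_id t).ofReal_comp.mul_const (w - z)).const_add z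
    exact (hf _ (hmem t ht)).hasDerivAt.comp t h1
  have := norm_le_gronwallBound_of_norm_deriv_right_le (δ := ‖f z‖) (K := C * ‖w - z‖) (ε := 0)
    (fun t ht => (hd t ht).continuousAt.continuousWithinAt)
    (fun t ht => (hd t ⟨ht.1, ht.2.le⟩).hasDerivWithinAt) (by simp)
    (fun t ht => by
      rw [norm_mul, add_zero]
      have := hC _ (hmem t ⟨ht.1, ht.2.le⟩)
      nlinarith [norm_nonneg (w - z)]) 1 ⟨zero_le_one, le_rfl⟩
  rw [gronwallBound_ε0] at this
  simpa [mul_comm] using this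

/-- An inequality `‖f'‖ ≤ K‖f‖` passes to pointwise limits without any convergence of the
derivatives: on a ball of radius `ε` Grönwall turns it into a Lipschitz bound at `z` in terms of `‖f
z‖`, which survives the limit, and then `ε → 0`. -/
theorem norm_deriv_le_of_tendsto {f : ℕ → ℂ → ℂ} {g : ℂ → ℂ} {z : ℂ} {r K : ℝ} (hr : 0 < r)
    (hK : 0 ≤ K) (hf : ∀ᶠ n in Filter.atTop, ∀ u ∈ Metric.ball z r, DifferentiableAt ℂ (f n) u ∧
      ‖deriv (f n) u‖ ≤ K * ‖f n u‖)
    (hlim : ∀ u, Filter.Tendsto (fun n => f n u) Filter.atTop (nhds (g u)))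
    (hg : DifferentiableAt ℂ g z) : ‖deriv g z‖ ≤ K * ‖g z‖ := by
  have key : ∀ ε : ℝ, 0 < ε → ε < r → ‖deriv g z‖ ≤ K * (Real.exp (K * ε) * ‖g z‖) := by
    intro ε hε hεr
    refine hg.hasDerivAt.le_of_lip' (by positivity) ?_
    filter_upwards [Metric.ball_mem_nhds z hε] with w hw
    have hlim1 : Filter.Tendsto (fun n => ‖f n w - f n z‖) Filter.atTop (nhds ‖g w - g z‖) :=
      ((hlim w).sub (hlim z)).norm
    have hlim2 : Filter.Tendsto (fun n => K * (Real.exp (K * ε) * ‖f n z‖) * ‖w - z‖) Filter.atTop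
        (nhds (K * (Real.exp (K * ε) * ‖g z‖) * ‖w - z‖)) :=
      (((hlim z).norm.const_mul _).const_mul _).mul_const _
    refine le_of_tendsto_of_tendsto hlim1 hlim2 ?_
    filter_upwards [hf] with n hn
    have hsub : Metric.ball z ε ⊆ Metric.ball z r := Metric.ball_subset_ball hεr.le
    refine Convex.norm_image_sub_le_of_norm_deriv_le (s := Metric.ball z ε)
      (fun u hu => (hn u (hsub hu)).1) ?_ (convex_ball z ε) (Metric.mem_ball_self hε) hw
    intro u hu
    refine (hn u (hsub hu)).2.trans (mul_le_mul_of_nonneg_left ?_ hK)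
    have hseg : segment ℝ z u ⊆ Metric.ball z r :=
      ((convex_ball z ε).segment_subset (Metric.mem_ball_self hε) hu).trans hsub
    refine (norm_le_exp_mul_norm (C := K) (fun v hv => (hn v (hseg hv)).1)
      (fun v hv => (hn v (hseg hv)).2)).trans ?_
    gcongr
    rw [← dist_eq_norm]
    exact (Metric.mem_ball.mp hu).le
  have hlim3 : Filter.Tendsto (fun ε : ℝ => K * (Real.exp (K * ε) * ‖g z‖)) (nhdsWithin 0 (Set.Ioi 0))
      (nhds (K * (Real.exp (K * 0) * ‖g z‖))) := by
    apply Filter.Tendsto.mono_left _ nhdsWithin_le_nhds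
    apply Continuous.tendsto
    fun_prop
  have := ge_of_tendsto hlim3 (by
    filter_upwards [Ioo_mem_nhdsGT hr] with ε hε using key ε hε.1 hε.2)
  simpa using this

theorem sum_div_mul_le_harmonic (m n : ℕ) :
    ∑ j ∈ Finset.range n, (m : ℝ) / (((j : ℝ) + 1) * (m + j + 1)) ≤ 1 + Real.log m := by
  refine le_trans ?_ (harmonic_le_one_add_log m)
  have h : ∀ k : ℕ, ((harmonic k : ℚ) : ℝ) = ∑ j ∈ Finset.range k, ((j : ℝ) + 1)⁻¹ := by
    intro k; simp [harmonic]
  rw [h]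
  have h1 : ∑ j ∈ Finset.range n, (m : ℝ) / (((j : ℝ) + 1) * (m + j + 1)) =
      ∑ j ∈ Finset.range n, ((j : ℝ) + 1)⁻¹ - ∑ j ∈ Finset.range n, (((m + j : ℕ) : ℝ) + 1)⁻¹ := by
    rw [← Finset.sum_sub_distrib]
    refine Finset.sum_congr rfl fun j _ => ?_
    push_cast
    field_simp
    ring
  have h2 := Finset.sum_range_add_sub_sum_range (fun j : ℕ => ((j : ℝ) + 1)⁻¹) m n
  have h3 : ∑ j ∈ Finset.range n, ((j : ℝ) + 1)⁻¹ ≤ ∑ j ∈ Finset.range (m + n), ((j : ℝ) + 1)⁻¹ :=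
    Finset.sum_le_sum_of_subset_of_nonneg (Finset.range_mono (by omega))
      fun _ _ _ => by positivity
  linarith

/-- The left side is the logarithmic derivative of Euler's finite product for `Γ`. Comparing `1/(z +
j)` with `1/(j + 1)`, with `|z + j|` of order at least `|Im z| + j + 1`, leaves a telescoping sum of
size `log |Im z|`; the harmonic sum cancels `log n` up to a constant. The bound is uniform in `n`.
-/
theorem norm_log_sub_sum_inv_le {z : ℂ} (hre : |z.re| ≤ 11) (him : 20 ≤ |z.im|) {n : ℕ}
    (hn : n ≠ 0) :
    ‖(Real.log n : ℂ) - ∑ j ∈ Finset.range (n + 1), (z + j)⁻¹‖ ≤ 10 * Real.log (|z.im| + 1) := by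
  set t := |z.im| with ht
  set m := ⌈t⌉₊ with hm
  have htm : t ≤ m := Nat.le_ceil t
  have hmt : (m : ℝ) ≤ t + 1 := (Nat.ceil_lt_add_one (by linarith)).le
  have hne : ∀ j : ℕ, z + j ≠ 0 := by
    intro j h
    have := congrArg Complex.im h
    simp at this
    rw [ht, this] at him
    norm_num at him
  have h1 : ‖∑ j ∈ Finset.range (n + 1), ((z + j)⁻¹ - ((j : ℂ) + 1)⁻¹)‖ ≤ 6 * (1 + Real.log m) := by
    calc _ ≤ ∑ j ∈ Finset.range (n + 1), 6 * ((m : ℝ) / (((j : ℝ) + 1) * (m + j + 1))) := by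
          refine norm_sum_le_of_le _ fun j _ => ?_
          have hj : (j : ℂ) + 1 ≠ 0 := by exact_mod_cast Nat.succ_ne_zero j
          rw [inv_sub_inv (hne j) hj, norm_div, norm_mul]
          have e1 : ‖(j : ℂ) + 1 - (z + j)‖ ≤ 2 * t := by
            rw [show (j : ℂ) + 1 - (z + j) = 1 - z by ring]
            refine (norm_sub_le _ _).trans ?_
            have := Complex.norm_le_abs_re_add_abs_im z
            rw [norm_one]; linarith
          have e2 : ‖(j : ℂ) + 1‖ = j + 1 := by
            rw [show (j : ℂ) + 1 = ((j + 1 : ℝ) : ℂ) by push_cast; rfl, norm_real]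
            exact abs_of_nonneg (by positivity)
          have e3 : (t + j + 1) / 3 ≤ ‖z + j‖ := by
            have a1 : t ≤ ‖z + j‖ := by simpa [ht] using Complex.abs_im_le_norm (z + j)
            have a2 : (j : ℝ) - 11 ≤ ‖z + j‖ := by
              refine le_trans ?_ (Complex.re_le_norm (z + j))
              simp only [add_re, natCast_re]
              linarith [neg_abs_le z.re]
            linarith
          have hj0 : (0 : ℝ) ≤ j := by positivity
          rw [e2]
          have ht0 : 0 < t := by linarith
          calc _ ≤ 2 * t / ((t + j + 1) / 3 * (j + 1)) := by gcongr
            _ = 6 * (1 / ((j + 1) * (1 + (j + 1) / t))) := by field_simp; ring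
            _ ≤ 6 * (1 / ((j + 1) * (1 + (j + 1) / m))) := by gcongr
            _ = _ := by
              have : (0 : ℝ) < m := by linarith
              field_simp; ring
      _ ≤ _ := by
          rw [← Finset.mul_sum]
          gcongr
          exact sum_div_mul_le_harmonic m (n + 1)
  have hH : ∑ j ∈ Finset.range (n + 1), ((j : ℂ) + 1)⁻¹ = (((harmonic (n + 1) : ℚ) : ℝ) : ℂ) := by
    simp [harmonic]
  have hn0 : (1 : ℝ) ≤ n := by exact_mod_cast Nat.one_le_iff_ne_zero.mpr hn
  have h2 : ‖(Real.log n : ℂ) - ∑ j ∈ Finset.range (n + 1), ((j : ℂ) + 1)⁻¹‖ ≤ 2 := by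
    rw [hH, ← ofReal_sub, norm_real, Real.norm_eq_abs, abs_le]
    have a1 := harmonic_le_one_add_log (n + 1)
    have a2 := log_add_one_le_harmonic (n + 1)
    have a3 : Real.log n ≤ Real.log ((n + 1 + 1 : ℕ) : ℝ) :=
      Real.log_le_log (by linarith) (by push_cast; linarith)
    have a4 : Real.log ((n + 1 : ℕ) : ℝ) ≤ 1 + Real.log n := by
      calc Real.log ((n + 1 : ℕ) : ℝ) ≤ Real.log (2 * n) :=
            Real.log_le_log (by positivity) (by push_cast; linarith)
        _ = Real.log 2 + Real.log n := Real.log_mul (by norm_num) (by positivity)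
        _ ≤ _ := by linarith [Real.log_two_lt_d9]
    constructor <;> linarith
  have h3 : (Real.log n : ℂ) - ∑ j ∈ Finset.range (n + 1), (z + j)⁻¹ =
      ((Real.log n : ℂ) - ∑ j ∈ Finset.range (n + 1), ((j : ℂ) + 1)⁻¹) -
        ∑ j ∈ Finset.range (n + 1), ((z + j)⁻¹ - ((j : ℂ) + 1)⁻¹) := by
    rw [Finset.sum_sub_distrib]; ring
  rw [h3]
  refine (norm_sub_le _ _).trans ?_
  have h4 : Real.log m ≤ Real.log (t + 1) := Real.log_le_log (by linarith) hmt
  have h5 : 2 ≤ Real.log (t + 1) := by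
    rw [Real.le_log_iff_exp_le (by linarith)]
    have : Real.exp 2 = Real.exp 1 ^ 2 := by rw [← Real.exp_nat_mul]; norm_num
    rw [this]
    nlinarith [Real.exp_one_lt_d9, Real.exp_pos 1]
  linarith

theorem deriv_GammaSeq {z : ℂ} (hz : z.im ≠ 0) {n : ℕ} (hn : n ≠ 0) :
    DifferentiableAt ℂ (fun s => GammaSeq s n) z ∧ deriv (fun s => GammaSeq s n) z =
      ((Real.log n : ℂ) - ∑ j ∈ Finset.range (n + 1), (z + j)⁻¹) * GammaSeq z n := by
  have hne : ∀ j : ℕ, z + j ≠ 0 := by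
    intro j h
    have := congrArg Complex.im h
    simp at this
    exact hz this
  have hn' : (n : ℂ) ≠ 0 := by exact_mod_cast hn
  have d1 : DifferentiableAt ℂ (fun s : ℂ => (n : ℂ) ^ s * (n.factorial : ℂ)) z :=
    (differentiableAt_id.const_cpow (Or.inl hn')).mul_const _
  have d2 : DifferentiableAt ℂ (fun s : ℂ => ∏ j ∈ Finset.range (n + 1), (s + (j : ℂ))) z := by
    fun_prop
  have n1 : (n : ℂ) ^ z * (n.factorial : ℂ) ≠ 0 :=
    mul_ne_zero (by simp [cpow_eq_zero_iff, hn']) (by exact_mod_cast n.factorial_ne_zero)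
  have n2 : ∏ j ∈ Finset.range (n + 1), (z + (j : ℂ)) ≠ 0 :=
    Finset.prod_ne_zero_iff.mpr fun j _ => hne j
  have hd : DifferentiableAt ℂ (fun s => GammaSeq s n) z := d1.div d2 n2
  refine ⟨hd, ?_⟩
  have hl : logDeriv (fun s => GammaSeq s n) z =
      (Real.log n : ℂ) - ∑ j ∈ Finset.range (n + 1), (z + j)⁻¹ := by
    unfold GammaSeq
    rw [logDeriv_div z n1 n2 d1 d2, logDeriv_prod (fun j _ => hne j) (fun j _ => by fun_prop)]
    congr 1
    · have : HasDerivAt (fun s : ℂ => (n : ℂ) ^ s) ((n : ℂ) ^ z * Complex.log n) z := by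
        simpa using (hasDerivAt_id z).const_cpow (c := (n : ℂ)) (Or.inl hn')
      rw [logDeriv_apply, (this.mul_const _).deriv, ← natCast_log]
      have n3 : (n : ℂ) ^ z ≠ 0 := left_ne_zero_of_mul n1
      have n4 : (n.factorial : ℂ) ≠ 0 := right_ne_zero_of_mul n1
      field_simp
    · refine Finset.sum_congr rfl fun j _ => ?_
      rw [logDeriv_apply]
      simp
  have hg : GammaSeq z n ≠ 0 := div_ne_zero n1 n2
  rw [← hl, logDeriv_apply, div_mul_cancel₀ _ hg]

theorem norm_deriv_Gamma_le {z : ℂ} (hre : |z.re| ≤ 10) (him : 21 ≤ |z.im|) :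
    ‖deriv Gamma z‖ ≤ 10 * Real.log (|z.im| + 2) * ‖Gamma z‖ := by
  have hz : z.im ≠ 0 := by rintro h; rw [h] at him; norm_num at him
  refine norm_deriv_le_of_tendsto (f := fun n s => GammaSeq s n) (r := 1) one_pos ?_ ?_
    GammaSeq_tendsto_Gamma ?_
  · exact mul_nonneg (by norm_num) (Real.log_nonneg (by linarith))
  · filter_upwards [Filter.eventually_ne_atTop 0] with n hn u hu
    have h1 : ‖u - z‖ < 1 := by rw [← dist_eq_norm]; exact hu
    have h2 := (abs_re_le_norm (u - z)).trans h1.le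
    have h3 := (abs_im_le_norm (u - z)).trans h1.le
    rw [sub_re] at h2
    rw [sub_im] at h3
    have h4 : |u.re| ≤ 11 := by
      have := abs_add_le (u.re - z.re) z.re
      rw [sub_add_cancel] at this; linarith
    have h5 : |u.im| ≤ |z.im| + 1 := by
      have := abs_add_le (u.im - z.im) z.im
      rw [sub_add_cancel] at this; linarith
    have h6 : 20 ≤ |u.im| := by
      have := abs_sub_abs_le_abs_sub z.im u.im
      rw [abs_sub_comm] at this; linarith
    have h7 : u.im ≠ 0 := by rintro h; rw [h] at h6; norm_num at h6
    obtain ⟨a, b⟩ := deriv_GammaSeq h7 hn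
    refine ⟨a, ?_⟩
    rw [b, norm_mul]
    gcongr
    refine (norm_log_sub_sum_inv_le h4 h6 hn).trans ?_
    have := Real.log_le_log (by linarith : 0 < |u.im| + 1) (by linarith : |u.im| + 1 ≤ |z.im| + 2)
    linarith
  · refine differentiableAt_Gamma z fun m h => hz ?_
    rw [h]; simp

/-! ### The Gamma factors -/

theorem gammaReal_ne_zero {s : ℂ} (hs : s.im ≠ 0) : Gammaℝ s ≠ 0 := by
  intro h
  obtain ⟨n, hn⟩ := Gammaℝ_eq_zero_iff.mp h
  apply hs
  rw [hn]
  simp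

theorem differentiableAt_gammaReal {s : ℂ} (hs : s.im ≠ 0) : DifferentiableAt ℂ Gammaℝ s := by
  have h := (differentiable_Gammaℝ_inv s).inv (inv_ne_zero (gammaReal_ne_zero hs))
  have e : (fun s => (Gammaℝ s)⁻¹)⁻¹ = Gammaℝ := by funext s; simp
  rwa [e] at h

theorem gammaReal_conj (s : ℂ) : Gammaℝ (starRingEnd ℂ s) = starRingEnd ℂ (Gammaℝ s) := by
  rw [Gammaℝ_def, Gammaℝ_def, map_mul, ← Gamma_conj]
  have hpi : (Real.pi : ℂ).arg ≠ Real.pi := by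
    rw [arg_ofReal_of_nonneg Real.pi_nonneg]; exact Real.pi_ne_zero.symm
  have h2 : (starRingEnd ℂ) 2 = 2 := by simpa using Complex.conj_ofReal 2
  congr 1
  · have := Complex.cpow_conj (Real.pi : ℂ) (-s / 2) hpi
    rw [conj_ofReal] at this
    rw [← this]
    simp [h2]
  · simp [h2]

theorem norm_logDeriv_gammaReal_le {s : ℂ} (hre : |s.re| ≤ 20) (him : 42 ≤ |s.im|) :
    ‖logDeriv Gammaℝ s‖ ≤ 1 + 5 * Real.log (|s.im| / 2 + 2) := by
  have hz : (s / 2).im ≠ 0 := by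
    intro h
    have : s.im = 0 := by simpa using h
    rw [this] at him; norm_num at him
  have hd : DifferentiableAt ℂ Gamma (s / 2) := differentiableAt_Gamma _ fun m h => hz (by rw [h]; simp)
  have hg0 : Gamma (s / 2) ≠ 0 := Gamma_ne_zero fun m h => hz (by rw [h]; simp)
  have hfun : Gammaℝ = fun s : ℂ => (Real.pi : ℂ) ^ (-s / 2) * Gamma (s / 2) := by
    funext s; exact Gammaℝ_def s
  have hpi : (Real.pi : ℂ) ≠ 0 := by exact_mod_cast Real.pi_ne_zero
  have hp : HasDerivAt (fun s : ℂ => (Real.pi : ℂ) ^ (-s / 2))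
      ((Real.pi : ℂ) ^ (-s / 2) * Complex.log Real.pi * (-1 / 2)) s := by
    have h1 : HasDerivAt (fun s : ℂ => -s / 2) (-1 / 2) s := ((hasDerivAt_id s).neg.div_const 2)
    exact h1.const_cpow (Or.inl hpi)
  have hp0 : (Real.pi : ℂ) ^ (-s / 2) ≠ 0 := by simp [cpow_eq_zero_iff, hpi]
  have hG : HasDerivAt (fun s : ℂ => Gamma (s / 2)) (deriv Gamma (s / 2) * (1 / 2)) s := by
    have h1 : HasDerivAt (fun s : ℂ => s / 2) (1 / 2) s := (hasDerivAt_id s).div_const 2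
    exact hd.hasDerivAt.comp s h1
  rw [hfun, logDeriv_mul s hp0 hg0 hp.differentiableAt hG.differentiableAt, logDeriv_apply,
    logDeriv_apply, hp.deriv, hG.deriv]
  refine (norm_add_le _ _).trans (add_le_add ?_ ?_)
  · rw [mul_assoc, mul_div_cancel_left₀ _ hp0, norm_mul, ← ofReal_log Real.pi_nonneg, norm_real,
      Real.norm_of_nonneg (Real.log_nonneg (by linarith [Real.pi_gt_three]))]
    have : Real.log Real.pi ≤ 2 := by
      rw [Real.log_le_iff_le_exp Real.pi_pos]
      have : Real.exp 2 = Real.exp 1 ^ 2 := by rw [← Real.exp_nat_mul]; norm_num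
      rw [this]
      nlinarith [Real.exp_one_gt_d9, Real.pi_lt_four]
    norm_num
    linarith
  · rw [norm_div, div_le_iff₀ (norm_pos_iff.mpr hg0), norm_mul]
    have e : (s / 2).im = s.im / 2 := by simp
    have e' : (s / 2).re = s.re / 2 := by simp
    have h := norm_deriv_Gamma_le (z := s / 2) (by rw [e', abs_div, abs_two]; linarith)
      (by rw [e, abs_div, abs_two]; linarith)
    rw [e, abs_div, abs_two] at h
    have : ‖(1 / 2 : ℂ)‖ = 1 / 2 := by norm_num
    rw [this]
    linarith

section GammaFactor

variable {k : ℕ} (ψ : DirichletCharacter ℂ k)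

theorem gammaFactor_ne_zero {s : ℂ} (hs : s.im ≠ 0) : gammaFactor ψ s ≠ 0 := by
  unfold gammaFactor
  split_ifs
  · exact gammaReal_ne_zero hs
  · exact gammaReal_ne_zero (by simpa using hs)

theorem differentiableAt_gammaFactor {s : ℂ} (hs : s.im ≠ 0) :
    DifferentiableAt ℂ (gammaFactor ψ) s := by
  unfold gammaFactor
  split_ifs
  · exact differentiableAt_gammaReal hs
  · exact DifferentiableAt.comp (g := Gammaℝ) (f := fun s => s + 1) s
      (differentiableAt_gammaReal (by simpa using hs)) (by fun_prop)

theorem gammaFactor_conj (s : ℂ) :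
    gammaFactor ψ (starRingEnd ℂ s) = starRingEnd ℂ (gammaFactor ψ s) := by
  unfold gammaFactor
  split_ifs
  · exact gammaReal_conj s
  · rw [← gammaReal_conj]; simp

theorem norm_logDeriv_gammaFactor_le {s : ℂ} (hre : |s.re| ≤ 19) (him : 42 ≤ |s.im|) :
    ‖logDeriv (gammaFactor ψ) s‖ ≤ 1 + 5 * Real.log (|s.im| / 2 + 2) := by
  have hs : s.im ≠ 0 := by rintro h; rw [h] at him; norm_num at him
  by_cases h : ψ.Even
  · rw [show gammaFactor ψ = Gammaℝ from funext fun s => h.gammaFactor_def s]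
    exact norm_logDeriv_gammaReal_le (by linarith) him
  · have e : gammaFactor ψ = Gammaℝ ∘ (fun s => s + 1) := by
      funext s; simp [gammaFactor, h]
    rw [e, logDeriv_comp (differentiableAt_gammaReal (by simpa using hs)) (by fun_prop)]
    have hre' : |(s + 1).re| ≤ 20 := by
      rw [add_re, one_re]
      have := abs_add_le s.re 1
      rw [abs_one] at this
      linarith
    have := norm_logDeriv_gammaReal_le hre' (by simpa using him)
    simpa using this

variable [NeZero k]

theorem Delta_ne_zero (hψ : ψ.IsPrimitive) {s : ℂ} (hs : s.im ≠ 0) : Delta ψ s ≠ 0 := by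
  unfold Delta
  refine div_ne_zero (mul_ne_zero (mul_ne_zero ?_ ?_) (gammaFactor_ne_zero ψ (by simpa using hs)))
    (gammaFactor_ne_zero ψ hs)
  · rw [← norm_pos_iff, norm_rootNumber hψ]; norm_num
  · simp [cpow_eq_zero_iff, NeZero.ne k]

/-- On the critical line `1 - s` is the conjugate of `s`, so the two gamma factors have equal
modulus. -/
theorem norm_Delta_half (hψ : ψ.IsPrimitive) {t : ℝ} (ht : t ≠ 0) :
    ‖Delta ψ (1 / 2 + t * I)‖ = 1 := by
  have h1 : (1 : ℂ) - (1 / 2 + t * I) = starRingEnd ℂ (1 / 2 + t * I) := by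
    apply Complex.ext <;> simp; norm_num
  have h2 : gammaFactor ψ (1 / 2 + t * I) ≠ 0 := gammaFactor_ne_zero ψ (by simpa using ht)
  unfold Delta
  rw [h1, gammaFactor_conj, norm_div, norm_mul, norm_mul, norm_rootNumber hψ, RCLike.norm_conj,
    one_mul, mul_div_assoc, div_self (norm_ne_zero_iff.mpr h2), mul_one,
    norm_natCast_cpow_of_pos (Nat.pos_of_ne_zero (NeZero.ne k))]
  simp

theorem differentiableAt_Delta {s : ℂ} (hs : s.im ≠ 0) : DifferentiableAt ℂ (Delta ψ) s := by
  have hk : (k : ℂ) ≠ 0 := by exact_mod_cast NeZero.ne k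
  unfold Delta
  have h1 : DifferentiableAt ℂ (fun s => gammaFactor ψ (1 - s)) s :=
    DifferentiableAt.comp s (differentiableAt_gammaFactor ψ (s := 1 - s) (by simpa using hs))
      (by fun_prop)
  have h2 : DifferentiableAt ℂ (fun s : ℂ => (k : ℂ) ^ (1 / 2 - s)) s :=
    DifferentiableAt.const_cpow (by fun_prop) (Or.inl hk)
  exact ((h2.const_mul _).mul h1).div (differentiableAt_gammaFactor ψ hs) (gammaFactor_ne_zero ψ hs)

/-- The power `k^{1/2-s}` contributes exactly `-log k`; the two gamma factors contribute only the
logarithm of the height. -/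
theorem norm_logDeriv_Delta_add_log_le (hψ : ψ.IsPrimitive) {s : ℂ} (hre : |s.re| ≤ 18)
    (him : 42 ≤ |s.im|) :
    ‖logDeriv (Delta ψ) s + Real.log k‖ ≤ 2 + 10 * Real.log (|s.im| / 2 + 2) := by
  have hs : s.im ≠ 0 := by rintro h; rw [h] at him; norm_num at him
  have hk : (k : ℂ) ≠ 0 := by exact_mod_cast NeZero.ne k
  have hk' : (k : ℂ) ^ (1 / 2 - s) ≠ 0 := by simp [cpow_eq_zero_iff, NeZero.ne k]
  have hr : rootNumber ψ ≠ 0 := by rw [← norm_pos_iff, norm_rootNumber hψ]; norm_num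
  have hs' : (1 - s).im ≠ 0 := by simpa using hs
  have d1 : DifferentiableAt ℂ (fun s => gammaFactor ψ (1 - s)) s :=
    DifferentiableAt.comp s (differentiableAt_gammaFactor ψ (s := 1 - s) hs') (by fun_prop)
  have hp : HasDerivAt (fun s : ℂ => (k : ℂ) ^ (1 / 2 - s))
      ((k : ℂ) ^ (1 / 2 - s) * Complex.log k * (-1)) s := by
    have h1 : HasDerivAt (fun s : ℂ => 1 / 2 - s) (-1) s := (hasDerivAt_id s).const_sub (1 / 2)
    exact h1.const_cpow (Or.inl hk)
  have d2 : DifferentiableAt ℂ (fun s : ℂ => rootNumber ψ * (k : ℂ) ^ (1 / 2 - s)) s :=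
    hp.differentiableAt.const_mul _
  have e : logDeriv (Delta ψ) s =
      -Real.log k - logDeriv (gammaFactor ψ) (1 - s) - logDeriv (gammaFactor ψ) s := by
    unfold Delta
    rw [logDeriv_div (f := fun s => rootNumber ψ * (k : ℂ) ^ (1 / 2 - s) * gammaFactor ψ (1 - s))
        (g := gammaFactor ψ) s (mul_ne_zero (mul_ne_zero hr hk') (gammaFactor_ne_zero ψ hs'))
      (gammaFactor_ne_zero ψ hs) (d2.mul d1) (differentiableAt_gammaFactor ψ hs),
      logDeriv_mul (f := fun s : ℂ => rootNumber ψ * (k : ℂ) ^ (1 / 2 - s))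
        (g := fun s => gammaFactor ψ (1 - s)) s (mul_ne_zero hr hk') (gammaFactor_ne_zero ψ hs')
        d2 d1,
      show (fun s => gammaFactor ψ (1 - s)) = gammaFactor ψ ∘ (fun s => 1 - s) from rfl,
      logDeriv_comp (differentiableAt_gammaFactor ψ hs') (by fun_prop)]
    have : logDeriv (fun z : ℂ => rootNumber ψ * (k : ℂ) ^ (1 / 2 - z)) s = -Real.log k := by
      rw [logDeriv_apply, (hp.const_mul _).deriv, natCast_log, div_eq_iff (mul_ne_zero hr hk')]
      ring
    rw [this]
    simp
    ring
  rw [e]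
  have e2 : -(Real.log k : ℂ) - logDeriv (gammaFactor ψ) (1 - s) - logDeriv (gammaFactor ψ) s +
      Real.log k = -(logDeriv (gammaFactor ψ) (1 - s) + logDeriv (gammaFactor ψ) s) := by ring
  rw [e2, norm_neg]
  have hre1 : |(1 - s).re| ≤ 19 := by
    rw [sub_re, one_re]
    have := abs_sub 1 s.re
    rw [abs_one] at this
    linarith
  have b1 := norm_logDeriv_gammaFactor_le ψ hre1 (by simpa using him)
  have b2 := norm_logDeriv_gammaFactor_le ψ (s := s) (by linarith) him
  have e3 : |(1 - s).im| = |s.im| := by simp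
  rw [e3] at b1
  refine (norm_add_le _ _).trans ?_
  linarith

end GammaFactor

/-! ### The twisted character -/

section Twist

variable {D q : ℕ} (χ : DirichletCharacter ℂ D) (ψ : DirichletCharacter ℂ q)

theorem twist_apply (n : ℕ) : twist χ ψ (n : ZMod (Nat.lcm q D)) = ψ (n : ZMod q) * χ (n : ZMod D) := by
  by_cases h : Nat.Coprime n (Nat.lcm q D)
  · have hi : IsCoprime (n : ℤ) (Nat.lcm q D : ℕ) := Nat.isCoprime_iff_coprime.mpr h
    have h1 := changeLevel_eq_cast_of_dvd' ψ (Nat.dvd_lcm_left q D) hi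
    have h2 := changeLevel_eq_cast_of_dvd' χ (Nat.dvd_lcm_right q D) hi
    simp only [Int.cast_natCast] at h1 h2
    rw [twist, DirichletCharacter.mul, MulChar.mul_apply, h1, h2]
  · have hu : ¬ IsUnit (n : ZMod (Nat.lcm q D)) := by rwa [ZMod.isUnit_iff_coprime]
    rw [MulChar.map_nonunit _ hu]
    by_cases hq : Nat.Coprime n q
    · have hDn : ¬ Nat.Coprime n D := fun hd => h (Nat.Coprime.coprime_dvd_right
        (Nat.lcm_dvd_mul q D) (Nat.Coprime.mul_right hq hd))
      rw [MulChar.map_nonunit χ (by rwa [ZMod.isUnit_iff_coprime]), mul_zero]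
    · rw [MulChar.map_nonunit ψ (by rwa [ZMod.isUnit_iff_coprime]), zero_mul]

variable {χ ψ}

theorem inv_eq_self_of_real [NeZero D] (hreal : ∀ a : ZMod D, (χ a).im = 0) : χ⁻¹ = χ := by
  rw [← MulChar.star_eq_inv]
  ext a
  rw [MulChar.star_apply, ← ofReal_re_chi hreal]
  exact conj_ofReal _

theorem twist_inv [NeZero D] (hreal : ∀ a : ZMod D, (χ a).im = 0) :
    twist χ ψ⁻¹ = (twist χ ψ)⁻¹ := by
  rw [twist, twist, DirichletCharacter.mul, DirichletCharacter.mul, mul_inv, map_inv]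
  congr 1
  rw [← map_inv, inv_eq_self_of_real hreal]

theorem isPrimitive_inv (h : ψ.IsPrimitive) : ψ⁻¹.IsPrimitive := by
  rw [isPrimitive_def, conductor_inv]; exact h

theorem inv_mem_PsiMod [NeZero D] (hreal : ∀ a : ZMod D, (χ a).im = 0) (h : ψ ∈ PsiMod χ q) :
    ψ⁻¹ ∈ PsiMod χ q :=
  ⟨isPrimitive_inv h.1, by rw [twist_inv hreal]; exact isPrimitive_inv h.2⟩

theorem ne_one_of_isPrimitive [NeZero q] (h : ψ.IsPrimitive) (hq : q ≠ 1) : ψ ≠ 1 := by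
  rintro rfl
  rw [isPrimitive_def, conductor_one] at h
  exact hq h.symm

theorem natCast_cpow_conj (n : ℕ) (s : ℂ) :
    (n : ℂ) ^ (starRingEnd ℂ s) = starRingEnd ℂ ((n : ℂ) ^ s) := by
  rw [Complex.cpow_conj _ _ (by rw [natCast_arg]; exact Real.pi_ne_zero.symm), conj_natCast]

theorem inv_apply_eq_conj [NeZero q] (a : ZMod q) : ψ⁻¹ a = starRingEnd ℂ (ψ a) := by
  rw [← MulChar.star_eq_inv, MulChar.star_apply]; rfl

theorem LFunction_conj [NeZero q] (hψ : ψ ≠ 1) (s : ℂ) :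
    LFunction ψ⁻¹ (starRingEnd ℂ s) = starRingEnd ℂ (LFunction ψ s) := by
  have hψ' : ψ⁻¹ ≠ 1 := by simpa using hψ
  have h1 : Differentiable ℂ (starRingEnd ℂ ∘ LFunction ψ⁻¹ ∘ starRingEnd ℂ) := by
    intro z
    have := (differentiable_LFunction hψ' (starRingEnd ℂ z)).conj_conj
    rwa [conj_conj] at this
  have h2 := differentiable_LFunction hψ
  have h3 : starRingEnd ℂ ∘ LFunction ψ⁻¹ ∘ starRingEnd ℂ = LFunction ψ := by
    refine AnalyticOnNhd.eq_of_eventuallyEq (z₀ := 2)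
      (analyticOnNhd_univ_iff_differentiable.mpr h1)
      (analyticOnNhd_univ_iff_differentiable.mpr h2) ?_
    have ho : IsOpen {z : ℂ | 1 < z.re} := isOpen_lt continuous_const continuous_re
    filter_upwards [ho.mem_nhds (show (1 : ℝ) < (2 : ℂ).re by simp)] with z hz
    have hz' : 1 < (starRingEnd ℂ z).re := by simpa using hz
    simp only [Function.comp_apply]
    rw [LFunction_eq_LSeries _ hz, LFunction_eq_LSeries _ hz', LSeries, LSeries, conj_tsum]
    refine tsum_congr fun n => ?_
    rw [LSeries.term_def, LSeries.term_def]
    split_ifs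
    · simp
    · rw [map_div₀, natCast_cpow_conj, conj_conj, inv_apply_eq_conj, conj_conj]
  have := congrFun h3 s
  simp only [Function.comp_apply] at this
  rw [← this, conj_conj]

end Twist

/-! ### The product `L(s,ψ) L(s,ψχ)` -/

section LL

variable {D q : ℕ} [NeZero D] [NeZero q] {χ : DirichletCharacter ℂ D} {ψ : DirichletCharacter ℂ q}

theorem hasSum_LL {s : ℂ} (hs : 1 < s.re) :
    HasSum (fun n : ℕ => nu χ n * ψ (n : ZMod q) / (n : ℂ) ^ s) (LL χ ψ s) := by
  have h1 := (LSeriesSummable_of_one_lt_re ψ hs).hasSum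
  have h2 := (LSeriesSummable_of_one_lt_re (twist χ ψ) hs).hasSum
  have h3 : LSeriesHasSum _ s (_ * _) := LSeriesHasSum.convolution h1 h2
  rw [LL, LFunction_eq_LSeries _ hs, LFunction_eq_LSeries _ hs]
  have h4 : HasSum (LSeries.term (LSeries.convolution (fun n => ψ (n : ZMod q))
      fun n => twist χ ψ (n : ZMod (Nat.lcm q D))) s)
      (LSeries (fun n => ψ (n : ZMod q)) s * LSeries (fun n => twist χ ψ (n : ZMod (Nat.lcm q D))) s) := h3
  convert h4 using 1
  funext n
  rw [LSeries.term_def]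
  split_ifs with hn
  · simp [hn, nu]
  · congr 1
    rw [LSeries.convolution_def, nu, Finset.sum_mul]
    beta_reduce
    rw [Nat.sum_divisorsAntidiagonal' (f := fun a b : ℕ =>
      ψ (a : ZMod q) * twist χ ψ (b : ZMod (Nat.lcm q D)))]
    refine Finset.sum_congr rfl fun d hd => ?_
    have hd' := (Nat.mem_divisors.mp hd).1
    have h : ψ (n : ZMod q) = ψ ((n / d : ℕ) : ZMod q) * ψ (d : ZMod q) := by
      rw [← map_mul, ← Nat.cast_mul, Nat.div_mul_cancel hd']
    rw [twist_apply, h]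
    ring

theorem LL_eq_Delta1_mul (hreal : ∀ a : ZMod D, (χ a).im = 0) (hψ : ψ ∈ PsiMod χ q) {s : ℂ}
    (hs : s.im ≠ 0) : LL χ ψ s = Delta1 χ ψ s * LL χ ψ⁻¹ (1 - s) := by
  rw [LL, LFunction_eq_Delta_mul hψ.1 hs, LFunction_eq_Delta_mul hψ.2 hs, Delta1, LL,
    twist_inv hreal]
  ring

theorem twist_ne_one (hq : q ≠ 1) (hψ : ψ ∈ PsiMod χ q) : twist χ ψ ≠ 1 :=
  ne_one_of_isPrimitive hψ.2 fun h => hq (Nat.dvd_one.mp (h ▸ Nat.dvd_lcm_left q D))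

theorem differentiable_LL (hq : q ≠ 1) (hψ : ψ ∈ PsiMod χ q) : Differentiable ℂ (LL χ ψ) :=
  (differentiable_LFunction (ne_one_of_isPrimitive hψ.1 hq)).mul
    (differentiable_LFunction (twist_ne_one hq hψ))

theorem LL_conj (hreal : ∀ a : ZMod D, (χ a).im = 0) (hq : q ≠ 1) (hψ : ψ ∈ PsiMod χ q) (s : ℂ) :
    LL χ ψ⁻¹ (starRingEnd ℂ s) = starRingEnd ℂ (LL χ ψ s) := by
  rw [LL, LL, twist_inv hreal, LFunction_conj (ne_one_of_isPrimitive hψ.1 hq),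
    LFunction_conj (twist_ne_one hq hψ), map_mul]

theorem norm_LL_le (hq : q ≠ 1) (hψ : ψ ∈ PsiMod χ q) {s : ℂ} (hs : 0 < s.re) :
    ‖LL χ ψ s‖ ≤ q ^ 2 * D * (‖s‖ / s.re) ^ 2 := by
  have h1 := norm_LFunction_le (ne_one_of_isPrimitive hψ.1 hq) hs
  have h2 := norm_LFunction_le (twist_ne_one hq hψ) hs
  have h3 : ((Nat.lcm q D : ℕ) : ℝ) ≤ q * D := by
    exact_mod_cast Nat.lcm_le_mul (NeZero.pos q) (NeZero.pos D)
  rw [LL, norm_mul]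
  calc _ ≤ (q * ‖s‖ / s.re) * ((Nat.lcm q D : ℕ) * ‖s‖ / s.re) := by gcongr
    _ ≤ (q * ‖s‖ / s.re) * ((q * D) * ‖s‖ / s.re) := by gcongr
    _ = _ := by ring

/-! ### The factor `Δ₁` near the point `s₀` -/

theorem Delta1_ne_zero (hψ : ψ ∈ PsiMod χ q) {s : ℂ} (hs : s.im ≠ 0) : Delta1 χ ψ s ≠ 0 :=
  mul_ne_zero (Delta_ne_zero _ hψ.1 hs) (Delta_ne_zero _ hψ.2 hs)

theorem differentiableAt_Delta1 {s : ℂ} (hs : s.im ≠ 0) : DifferentiableAt ℂ (Delta1 χ ψ) s :=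
  (differentiableAt_Delta _ hs).mul (differentiableAt_Delta _ hs)

theorem norm_Delta1_half (hψ : ψ ∈ PsiMod χ q) {t : ℝ} (ht : t ≠ 0) :
    ‖Delta1 χ ψ (1 / 2 + t * I)‖ = 1 := by
  rw [Delta1, norm_mul, norm_Delta_half _ hψ.1 ht, norm_Delta_half _ hψ.2 ht, one_mul]

variable (hD : Real.exp (Real.exp (Real.exp (10 ^ 6))) ≤ (D : ℝ)) (hq : q ∈ calQ D)
  (hψ : ψ ∈ PsiMod χ q)

omit [NeZero D] in
include hq in
theorem sq_ell_lt_log : ell D ^ 2 < Real.log q ∧ Real.log q < ell D ^ 2 + 1 := by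
  have hq0 : (0 : ℝ) < q := by exact_mod_cast NeZero.pos q
  constructor
  · rw [Real.lt_log_iff_exp_lt hq0]; exact hq.1
  · have h1 : Real.log q < Real.log (2 * Q D) := Real.log_lt_log hq0 hq.2.1
    rw [Q, Real.log_mul (by norm_num) (Real.exp_pos _).ne', Real.log_exp] at h1
    linarith [Real.log_two_lt_d9]

include hD

omit [NeZero D] in
theorem million_le_cast : (1000000 : ℝ) ≤ D := by
  rw [← exp_ell hD]
  have h1 := le_ell hD
  have h2 := Real.add_one_le_exp (ell D)
  linarith

include hq hψ

/-- Since `Q < q < 2Q` and `q ≤ [q,D] ≤ qD`, the logarithms of both conductors equal `ℒ² = log Q` up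
to `O(ℒ)`, and so does the contribution of the gamma factors at height about `D`, of size `O(ℒ)`,
fit in the error. -/
theorem norm_logDeriv_Delta1_add_le {s : ℂ} (hre : |s.re| ≤ 18) (h1 : D / 2 ≤ s.im)
    (h2 : s.im ≤ 2 * D) : ‖logDeriv (Delta1 χ ψ) s + 2 * (ell D : ℂ) ^ 2‖ ≤ 30 * ell D := by
  have hL := le_ell hD
  have hD2 := million_le_cast hD
  have him : |s.im| = s.im := abs_of_nonneg (by linarith)
  have hs : s.im ≠ 0 := by intro h; rw [h] at h1; linarith
  have h3 : 42 ≤ |s.im| := by rw [him]; linarith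
  have a1 := norm_logDeriv_Delta_add_log_le ψ hψ.1 hre h3
  have a2 := norm_logDeriv_Delta_add_log_le (twist χ ψ) hψ.2 hre h3
  have hlog : Real.log (|s.im| / 2 + 2) ≤ ell D + 1 := by
    rw [him]
    calc Real.log (s.im / 2 + 2) ≤ Real.log (2 * D) :=
          Real.log_le_log (by linarith) (by linarith)
      _ = Real.log 2 + ell D := by rw [Real.log_mul (by norm_num) (by linarith)]; rfl
      _ ≤ _ := by linarith [Real.log_two_lt_d9]
  obtain ⟨b1, b2⟩ := sq_ell_lt_log hq
  have hl1 : (q : ℝ) ≤ Nat.lcm q D := by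
    exact_mod_cast Nat.le_of_dvd (NeZero.pos _) (Nat.dvd_lcm_left q D)
  have hl2 : ((Nat.lcm q D : ℕ) : ℝ) ≤ q * D := by
    exact_mod_cast Nat.lcm_le_mul (NeZero.pos q) (NeZero.pos D)
  have hq0 : (0 : ℝ) < q := by exact_mod_cast NeZero.pos q
  have c1 : Real.log q ≤ Real.log (Nat.lcm q D) := Real.log_le_log hq0 hl1
  have c2 : Real.log (Nat.lcm q D) ≤ Real.log q + ell D := by
    rw [ell, ← Real.log_mul hq0.ne' (by linarith)]
    exact Real.log_le_log (by linarith) hl2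
  have e : logDeriv (Delta1 χ ψ) s = logDeriv (Delta ψ) s + logDeriv (Delta (twist χ ψ)) s := by
    unfold Delta1
    exact logDeriv_mul s (Delta_ne_zero _ hψ.1 hs) (Delta_ne_zero _ hψ.2 hs)
      (differentiableAt_Delta _ hs) (differentiableAt_Delta _ hs)
  have e2 : logDeriv (Delta1 χ ψ) s + 2 * (ell D : ℂ) ^ 2 =
      (logDeriv (Delta ψ) s + Real.log q) +
      (logDeriv (Delta (twist χ ψ)) s + Real.log (Nat.lcm q D)) +
      ((2 * ell D ^ 2 - Real.log q - Real.log (Nat.lcm q D) : ℝ) : ℂ) := by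
    rw [e]; push_cast; ring
  rw [e2]
  refine (norm_add₃_le).trans ?_
  have a3 : ‖((2 * ell D ^ 2 - Real.log q - Real.log (Nat.lcm q D) : ℝ) : ℂ)‖ ≤ ell D + 2 := by
    rw [norm_real, Real.norm_eq_abs, abs_le]
    constructor <;> linarith
  linarith

/-- Multiplication by `exp(2ℒ²u)` removes the main term of the logarithmic derivative, so Grönwall's
inequality from the critical line, where `|Δ₁| = 1`, costs only `30|x|ℒ` in the exponent. In short,
`|Δ₁| ≈ Q^{-2x}`. -/
theorem norm_Delta1_le {x t : ℝ} (hx : |x| ≤ 17) (h1 : D / 2 ≤ t) (h2 : t ≤ 2 * D) :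
    ‖Delta1 χ ψ (1 / 2 + x + t * I)‖ ≤ Real.exp (-(2 * x * ell D ^ 2) + 30 * |x| * ell D) := by
  have hD2 := million_le_cast hD
  have ht : t ≠ 0 := by rintro rfl; linarith
  set c : ℂ := 2 * (ell D : ℂ) ^ 2 with hc
  set z : ℂ := 1 / 2 + t * I with hz
  set w : ℂ := 1 / 2 + x + t * I with hw
  have hexp : ∀ u : ℂ, HasDerivAt (fun u => Complex.exp (c * u)) (Complex.exp (c * u) * c) u := by
    intro u
    simpa using ((hasDerivAt_id u).const_mul c).cexp
  have hseg : ∀ u ∈ segment ℝ z w, |u.re| ≤ 18 ∧ u.im = t := by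
    intro u hu
    rw [segment_eq_image'] at hu
    obtain ⟨θ, hθ, rfl⟩ := hu
    have e : z + θ • (w - z) = ((1 / 2 + θ * x : ℝ) : ℂ) + t * I := by
      rw [hz, hw, real_smul]; push_cast; ring
    simp only [e]
    constructor
    · have : |θ * x| ≤ 17 := by
        rw [abs_mul, abs_of_nonneg hθ.1]
        nlinarith [hθ.1, hθ.2, abs_nonneg x]
      rw [abs_le] at this
      simp only [add_re, ofReal_re, mul_re, I_re, mul_zero, ofReal_im, I_im, mul_one, sub_self,
        add_zero, abs_le]
      constructor <;> linarith [this.1, this.2]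
    · simp
  have key := norm_le_exp_mul_norm (f := fun u => Complex.exp (c * u) * Delta1 χ ψ u) (z := z)
    (w := w) (C := 30 * ell D)
    (fun u hu => (hexp u).differentiableAt.mul
      (differentiableAt_Delta1 (by rw [(hseg u hu).2]; exact ht)))
    (fun u hu => by
      obtain ⟨hu1, hu2⟩ := hseg u hu
      have hu0 : u.im ≠ 0 := by rw [hu2]; exact ht
      have hne := Delta1_ne_zero hψ hu0
      have hd : deriv (fun u => Complex.exp (c * u) * Delta1 χ ψ u) u =
          (logDeriv (Delta1 χ ψ) u + c) * (Complex.exp (c * u) * Delta1 χ ψ u) := by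
        have h := (hexp u).mul (differentiableAt_Delta1 (χ := χ) (ψ := ψ) hu0).hasDerivAt
        refine h.deriv.trans ?_
        rw [logDeriv_apply]
        field_simp
        ring
      rw [hd, norm_mul]
      gcongr
      exact norm_logDeriv_Delta1_add_le hD hq hψ hu1 (by rw [hu2]; exact h1) (by rw [hu2]; exact h2))
  have hwz : w - z = x := by rw [hw, hz]; ring
  rw [norm_mul, norm_mul, norm_Delta1_half hψ ht, hwz, norm_real, Real.norm_eq_abs, mul_one,
    norm_exp, norm_exp, ← Real.exp_add] at key
  have r1 : (c * w).re = 2 * ell D ^ 2 * (1 / 2 + x) := by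
    have : c * w = ((2 * ell D ^ 2 * (1 / 2 + x) : ℝ) : ℂ) + ((2 * ell D ^ 2 * t : ℝ) : ℂ) * I := by
      rw [hc, hw]; push_cast; ring
    rw [this, add_re, ofReal_re, re_ofReal_mul, I_re, mul_zero, add_zero]
  have r2 : (c * z).re = 2 * ell D ^ 2 * (1 / 2) := by
    have : c * z = ((2 * ell D ^ 2 * (1 / 2) : ℝ) : ℂ) + ((2 * ell D ^ 2 * t : ℝ) : ℂ) * I := by
      rw [hc, hz]; push_cast; ring
    rw [this, add_re, ofReal_re, re_ofReal_mul, I_re, mul_zero, add_zero]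
  rw [r1, r2] at key
  have hpos := Real.exp_pos (2 * ell D ^ 2 * (1 / 2 + x))
  rw [← le_div_iff₀' hpos, ← Real.exp_sub] at key
  refine key.trans (le_of_eq ?_)
  congr 1
  ring

end LL

/-! ### Dirichlet polynomials -/

/-- The Dirichlet polynomial `∑_{w < n ≤ x} a(n) ψ(n) n^{-s}`. -/
noncomputable def dpoly (a : ℕ → ℂ) {q : ℕ} (ψ : DirichletCharacter ℂ q) (w x : ℕ) (s : ℂ) : ℂ :=
  ∑ n ∈ Finset.Ioc w x, a n * ψ (n : ZMod q) / (n : ℂ) ^ s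

section DPoly

variable {a : ℕ → ℂ} {q : ℕ} {ψ : DirichletCharacter ℂ q} {w x : ℕ}

theorem differentiable_dpoly : Differentiable ℂ (dpoly a ψ w x) := by
  intro s
  unfold dpoly
  refine DifferentiableAt.fun_sum fun n hn => ?_
  have hn0 : (n : ℂ) ≠ 0 := by
    have := (Finset.mem_Ioc.mp hn).1
    exact_mod_cast (by omega : n ≠ 0)
  have h : DifferentiableAt ℂ (fun s : ℂ => (n : ℂ) ^ s) s :=
    differentiableAt_id.const_cpow (Or.inl hn0)
  exact (differentiableAt_const _).div h (by simp [cpow_eq_zero_iff, hn0])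

theorem dpoly_add {u : ℕ} (hu : w ≤ u) (hx : u ≤ x) (s : ℂ) :
    dpoly a ψ w u s + dpoly a ψ u x s = dpoly a ψ w x s :=
  Finset.sum_Ioc_consecutive _ hu hx

theorem norm_dpoly_term {n : ℕ} (hn : n ≠ 0) (s : ℂ) :
    ‖a n * ψ (n : ZMod q) / (n : ℂ) ^ s‖ ≤ ‖a n‖ * (n : ℝ) ^ (-s.re) := by
  have hn' : (0 : ℝ) < n := by exact_mod_cast Nat.pos_of_ne_zero hn
  rw [norm_div, norm_mul, norm_natCast_cpow_of_pos (Nat.pos_of_ne_zero hn), Real.rpow_neg hn'.le,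
    ← div_eq_mul_inv]
  gcongr
  exact mul_le_of_le_one_right (norm_nonneg _) (ψ.norm_le_one _)

theorem norm_dpoly_le (ha : ∀ n, ‖a n‖ ≤ n) {s : ℂ} {c : ℝ} (hc : 0 ≤ c) (hs : -c ≤ s.re) :
    ‖dpoly a ψ w x s‖ ≤ (x : ℝ) ^ (c + 2) := by
  rcases Nat.eq_zero_or_pos x with rfl | hx
  · simp [dpoly]; positivity
  have hx1 : (1 : ℝ) ≤ x := by exact_mod_cast hx
  calc ‖dpoly a ψ w x s‖ ≤ ∑ n ∈ Finset.Ioc w x, (x : ℝ) * (x : ℝ) ^ c := by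
        refine norm_sum_le_of_le _ fun n hn => ?_
        obtain ⟨h1, h2⟩ := Finset.mem_Ioc.mp hn
        have hn0 : n ≠ 0 := by omega
        have hn1 : (1 : ℝ) ≤ n := by exact_mod_cast Nat.one_le_iff_ne_zero.mpr hn0
        have hnx : (n : ℝ) ≤ x := by exact_mod_cast h2
        refine (norm_dpoly_term hn0 s).trans ?_
        gcongr
        · exact (ha n).trans hnx
        · calc (n : ℝ) ^ (-s.re) ≤ (n : ℝ) ^ c := Real.rpow_le_rpow_of_exponent_le hn1 (by linarith)
            _ ≤ _ := Real.rpow_le_rpow (by linarith) hnx hc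
    _ ≤ (x : ℝ) * (x * (x : ℝ) ^ c) := by
        rw [Finset.sum_const, nsmul_eq_mul]
        gcongr
        simp
    _ = _ := by
        rw [Real.rpow_add (by linarith), Real.rpow_two]; ring

theorem dpoly_inv [NeZero q] (ha : ∀ n, starRingEnd ℂ (a n) = a n) (s : ℂ) :
    dpoly a ψ⁻¹ w x s = starRingEnd ℂ (dpoly a ψ w x (starRingEnd ℂ s)) := by
  unfold dpoly
  rw [map_sum]
  refine Finset.sum_congr rfl fun n _ => ?_
  rw [map_div₀, map_mul, ha, natCast_cpow_conj, conj_conj, inv_apply_eq_conj]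

end DPoly

section Products

variable {D : ℕ} {χ : DirichletCharacter ℂ D} {q : ℕ} {ψ : DirichletCharacter ℂ q}

theorem F_eq_dpoly (s : ℂ) : F χ ψ s = dpoly (nu χ) ψ 0 (D ^ 5) s := rfl

theorem G_eq_dpoly (s : ℂ) : G χ ψ s = dpoly (upsilon χ) ψ 0 (D ^ 5) s := rfl

variable (hreal : ∀ a : ZMod D, (χ a).im = 0)
include hreal

theorem norm_nu_le (n : ℕ) : ‖nu χ n‖ ≤ nuRe χ n := by
  rw [nu_eq hreal, norm_real, Real.norm_of_nonneg (nuRe_nonneg hreal n)]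

theorem norm_upsilon_le (n : ℕ) : ‖upsilon χ n‖ ≤ nuRe χ n := by
  rw [upsilon_eq hreal, norm_real]
  exact abs_upsilonRe_le hreal n

theorem dpoly_mul_dpoly_sub_one {N : ℕ} (hN : 1 ≤ N) (s : ℂ) :
    dpoly (nu χ) ψ 0 N s * dpoly (upsilon χ) ψ 0 N s - 1 =
      ∑ p ∈ (Finset.Ioc 0 N ×ˢ Finset.Ioc 0 N).filter (fun p => N < p.1 * p.2),
        nu χ p.1 * upsilon χ p.2 * ψ ((p.1 * p.2 : ℕ) : ZMod q) / ((p.1 * p.2 : ℕ) : ℂ) ^ s := by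
  set t : ℕ × ℕ → ℂ := fun p =>
    nu χ p.1 * upsilon χ p.2 * ψ ((p.1 * p.2 : ℕ) : ZMod q) / ((p.1 * p.2 : ℕ) : ℂ) ^ s with ht
  have h1 : dpoly (nu χ) ψ 0 N s * dpoly (upsilon χ) ψ 0 N s =
      ∑ p ∈ Finset.Ioc 0 N ×ˢ Finset.Ioc 0 N, t p := by
    unfold dpoly
    rw [Finset.sum_mul_sum, ← Finset.sum_product']
    refine Finset.sum_congr rfl fun p hp => ?_
    rw [ht]
    simp only
    rw [Nat.cast_mul, Nat.cast_mul, map_mul, natCast_mul_natCast_cpow]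
    ring
  -- The pairs with product at most `N` make up complete divisor sums, that is, the coefficients of
  -- `ν * υ = 1`; only `n = 1` survives.
  have h2 : ∑ p ∈ (Finset.Ioc 0 N ×ˢ Finset.Ioc 0 N).filter (fun p => ¬ N < p.1 * p.2), t p = 1 := by
    have h3 : ∀ n ∈ Finset.Ioc 0 N, ∑ p ∈ n.divisorsAntidiagonal, t p =
        if n = 1 then 1 else 0 := by
      intro n hn
      have e1 : ∑ p ∈ n.divisorsAntidiagonal, t p =
          ((nuRe χ * upsilonRe χ) n : ℝ) * (ψ (n : ZMod q) / (n : ℂ) ^ s) := by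
        rw [ArithmeticFunction.mul_apply, ofReal_sum, Finset.sum_mul]
        refine Finset.sum_congr rfl fun p hp => ?_
        rw [ht]
        simp only
        rw [(Nat.mem_divisorsAntidiagonal.mp hp).1, nu_eq hreal, upsilon_eq hreal]
        push_cast
        ring
      rw [e1, nuRe_mul_upsilonRe hreal, ArithmeticFunction.one_apply]
      split_ifs with h
      · simp [h]
      · simp
    calc _ = ∑ n ∈ Finset.Ioc 0 N, ∑ p ∈ n.divisorsAntidiagonal, t p := by
          rw [Finset.sum_sigma']
          refine Finset.sum_bij' (fun p _ => ⟨p.1 * p.2, p⟩) (fun x _ => x.2) ?_ ?_ ?_ ?_ ?_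
          · intro p hp
            simp only [Finset.mem_filter, Finset.mem_product, Finset.mem_Ioc] at hp
            simp only [Finset.mem_sigma, Finset.mem_Ioc, Nat.mem_divisorsAntidiagonal, true_and]
            have := Nat.mul_pos hp.1.1.1 hp.1.2.1
            exact ⟨⟨this, by omega⟩, this.ne'⟩
          · rintro ⟨n, p⟩ hp
            simp only [Finset.mem_sigma, Finset.mem_Ioc, Nat.mem_divisorsAntidiagonal] at hp
            obtain ⟨⟨hn1, hn2⟩, hp1, hp2⟩ := hp
            simp only [Finset.mem_filter, Finset.mem_product, Finset.mem_Ioc]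
            have a1 : 0 < p.1 := Nat.pos_of_ne_zero (by rintro h; rw [h] at hp1; omega)
            have a2 : 0 < p.2 := Nat.pos_of_ne_zero (by rintro h; rw [h] at hp1; omega)
            have a3 : p.1 ≤ p.1 * p.2 := Nat.le_mul_of_pos_right _ a2
            have a4 : p.2 ≤ p.1 * p.2 := Nat.le_mul_of_pos_left _ a1
            omega
          · intro p _; rfl
          · rintro ⟨n, p⟩ hp
            simp only [Finset.mem_sigma, Nat.mem_divisorsAntidiagonal] at hp
            simp only [Sigma.mk.injEq, heq_eq_eq, and_true]
            exact hp.2.1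
          · intro p _; rfl
      _ = ∑ n ∈ Finset.Ioc 0 N, if n = 1 then 1 else 0 := Finset.sum_congr rfl h3
      _ = 1 := by
          rw [Finset.sum_ite_eq', if_pos (Finset.mem_Ioc.mpr ⟨one_pos, hN⟩)]
  rw [h1, ← Finset.sum_filter_add_sum_filter_not _ (fun p => N < p.1 * p.2), h2]
  ring

theorem norm_dpoly_mul_dpoly_sub_one_le {N : ℕ} (hN : 1 ≤ N) {s : ℂ} {B : ℝ}
    (hB : ∀ m : ℕ, N < m → m ≤ N ^ 2 → (m : ℝ) ^ (-s.re) ≤ B) (hB0 : 0 ≤ B) :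
    ‖dpoly (nu χ) ψ 0 N s * dpoly (upsilon χ) ψ 0 N s - 1‖ ≤ (N : ℝ) ^ 4 * B := by
  rw [dpoly_mul_dpoly_sub_one hreal hN]
  calc _ ≤ ∑ p ∈ (Finset.Ioc 0 N ×ˢ Finset.Ioc 0 N).filter (fun p => N < p.1 * p.2),
        (N : ℝ) * N * B := by
        refine norm_sum_le_of_le _ fun p hp => ?_
        simp only [Finset.mem_filter, Finset.mem_product, Finset.mem_Ioc] at hp
        have hm0 : p.1 * p.2 ≠ 0 := by omega
        have hm := norm_dpoly_term (a := fun _ => nu χ p.1 * upsilon χ p.2) (ψ := ψ) hm0 s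
        refine hm.trans ?_
        have e1 : ‖nu χ p.1‖ ≤ N := ((norm_nu_le hreal _).trans (nuRe_le hreal _)).trans
          (by exact_mod_cast hp.1.1.2)
        have e2 : ‖upsilon χ p.2‖ ≤ N := ((norm_upsilon_le hreal _).trans (nuRe_le hreal _)).trans
          (by exact_mod_cast hp.1.2.2)
        have e3 := hB (p.1 * p.2) hp.2 (by
          rw [sq]; exact Nat.mul_le_mul hp.1.1.2 hp.1.2.2)
        rw [norm_mul]
        gcongr
    _ ≤ ((N : ℝ) * N) * (N * N * B) := by
        rw [Finset.sum_const, nsmul_eq_mul]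
        have : ((Finset.Ioc 0 N ×ˢ Finset.Ioc 0 N).filter (fun p => N < p.1 * p.2)).card ≤ N * N :=
          (Finset.card_filter_le _ _).trans (by simp)
        have h : ((((Finset.Ioc 0 N ×ˢ Finset.Ioc 0 N).filter (fun p => N < p.1 * p.2)).card : ℕ) : ℝ)
            ≤ N * N := by exact_mod_cast this
        gcongr
    _ = _ := by ring

theorem norm_dpoly_mul_dpoly_sub_one_le_of_nonneg {N : ℕ} (hN : 1 ≤ N) {s : ℂ} (hs : 0 ≤ s.re) :
    ‖dpoly (nu χ) ψ 0 N s * dpoly (upsilon χ) ψ 0 N s - 1‖ ≤ (N : ℝ) ^ 4 * (N : ℝ) ^ (-s.re) := by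
  refine norm_dpoly_mul_dpoly_sub_one_le hreal hN (fun m hm _ => ?_) (by positivity)
  have : (1 : ℝ) ≤ N := by exact_mod_cast hN
  exact Real.rpow_le_rpow_of_nonpos (by linarith) (by exact_mod_cast hm.le) (by linarith)

theorem norm_dpoly_mul_dpoly_sub_one_le_of_nonpos {N : ℕ} (hN : 1 ≤ N) {s : ℂ} (hs : s.re ≤ 0) :
    ‖dpoly (nu χ) ψ 0 N s * dpoly (upsilon χ) ψ 0 N s - 1‖ ≤
      (N : ℝ) ^ 4 * ((N : ℝ) ^ 2) ^ (-s.re) := by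
  refine norm_dpoly_mul_dpoly_sub_one_le hreal hN (fun m _ hm => ?_) (by positivity)
  exact Real.rpow_le_rpow (by positivity) (by exact_mod_cast hm) (by linarith)

end Products

/-! ### Mean values over the family -/

section MeanValue

variable {D : ℕ} {χ : DirichletCharacter ℂ D}
  {P : Finset (Σ q : ℕ+, DirichletCharacter ℂ (q : ℕ))} (hP : ∀ y ∈ P, y ∈ Psi χ)
include hP

theorem sum_normSq_character_sum_le (b : ℕ → ℂ) {N : ℕ} (hN : (N : ℝ) ≤ Q D ^ 2) :
    ∑ y ∈ P, ‖∑ n ∈ Finset.Icc 1 N, b n * y.2 (n : ZMod (y.1 : ℕ))‖ ^ 2 ≤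
      200 * Q D ^ 2 * ∑ n ∈ Finset.Icc 1 N, ‖b n‖ ^ 2 := by
  have hQ : 1 ≤ Q D := Real.one_le_exp (sq_nonneg _)
  set R := ⌊2 * Q D⌋₊ with hR
  have hR1 : 1 ≤ R := Nat.le_floor (by push_cast; linarith)
  have hR2 : (R : ℝ) ≤ 2 * Q D := Nat.floor_le (by linarith)
  refine (large_sieve P hR1 (fun y hy => ⟨?_, (hP y hy).2.1⟩) b N).trans ?_
  · exact Nat.le_floor (hP y hy).1.2.1.le
  -- All moduli are below `2Q`, so `R² + N ≤ 5Q²`, and `40 · 5 = 200`.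
  · have : (R : ℝ) ^ 2 ≤ 4 * Q D ^ 2 := by
      have h0 : (0 : ℝ) ≤ R := by positivity
      nlinarith
    refine mul_le_mul_of_nonneg_right (by linarith) (Finset.sum_nonneg fun _ _ => by positivity)

/-- The large sieve applied to the one-term sequence `b(1) = 1` counts the characters. -/
theorem card_le_mul_sq : (P.card : ℝ) ≤ 200 * Q D ^ 2 := by
  have hQ : 1 ≤ Q D := Real.one_le_exp (sq_nonneg _)
  have h := sum_normSq_character_sum_le hP (fun _ => 1) (N := 1) (by push_cast; nlinarith)
  simpa using h

theorem sum_normSq_dpoly_le {a : ℕ → ℂ} (ha : ∀ n, ‖a n‖ ≤ nuRe χ n) {w x : ℕ}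
    (hx : (x : ℝ) ≤ Q D ^ 2) {s : ℂ} {C : ℝ}
    (hC : ∀ n ∈ Finset.Ioc w x, (n : ℝ) ^ (1 - 2 * s.re) ≤ C) :
    ∑ y ∈ P, ‖dpoly a y.2 w x s‖ ^ 2 ≤
      200 * Q D ^ 2 * (C * ∑ n ∈ Finset.Ioc w x, nuRe χ n ^ 2 / n) := by
  have h := sum_normSq_character_sum_le hP
    (fun n => if w < n then a n / (n : ℂ) ^ s else 0) (N := x) hx
  have e1 : ∀ g : ℕ → ℂ, ∑ n ∈ Finset.Icc 1 x, (if w < n then g n else 0) =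
      ∑ n ∈ Finset.Ioc w x, g n := by
    intro g
    rw [← Finset.sum_filter]
    congr 1
    ext n
    simp only [Finset.mem_filter, Finset.mem_Icc, Finset.mem_Ioc]
    omega
  have e2 : ∀ g : ℕ → ℝ, ∑ n ∈ Finset.Icc 1 x, (if w < n then g n else 0) =
      ∑ n ∈ Finset.Ioc w x, g n := by
    intro g
    rw [← Finset.sum_filter]
    congr 1
    ext n
    simp only [Finset.mem_filter, Finset.mem_Icc, Finset.mem_Ioc]
    omega
  have e3 : ∀ y : Σ q : ℕ+, DirichletCharacter ℂ (q : ℕ), ∑ n ∈ Finset.Icc 1 x,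
      (if w < n then a n / (n : ℂ) ^ s else 0) * y.2 (n : ZMod (y.1 : ℕ)) = dpoly a y.2 w x s := by
    intro y
    simp_rw [ite_mul, zero_mul]
    rw [e1, dpoly]
    exact Finset.sum_congr rfl fun n _ => by ring
  simp_rw [e3] at h
  refine h.trans ?_
  gcongr
  calc ∑ n ∈ Finset.Icc 1 x, ‖if w < n then a n / (n : ℂ) ^ s else 0‖ ^ 2 =
        ∑ n ∈ Finset.Icc 1 x, (if w < n then ‖a n / (n : ℂ) ^ s‖ ^ 2 else 0) := by
        refine Finset.sum_congr rfl fun n _ => ?_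
        split_ifs <;> simp
    _ = ∑ n ∈ Finset.Ioc w x, ‖a n / (n : ℂ) ^ s‖ ^ 2 := e2 _
    _ ≤ ∑ n ∈ Finset.Ioc w x, C * (nuRe χ n ^ 2 / n) := by
        refine Finset.sum_le_sum fun n hn => ?_
        have hn0 : 0 < n := by have := (Finset.mem_Ioc.mp hn).1; omega
        have hn' : (0 : ℝ) < n := by exact_mod_cast hn0
        have hp : ((n : ℝ) ^ s.re) ^ 2 = n * ((n : ℝ) ^ (1 - 2 * s.re))⁻¹ := by
          rw [← Real.rpow_natCast, ← Real.rpow_mul hn'.le, ← Real.rpow_neg hn'.le]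
          nth_rewrite 2 [← Real.rpow_one (n : ℝ)]
          rw [← Real.rpow_add hn']
          congr 1
          push_cast
          ring
        rw [norm_div, norm_natCast_cpow_of_pos hn0, div_pow, hp, div_mul_eq_div_div,
          div_inv_eq_mul, mul_comm]
        refine mul_le_mul (hC n hn) ?_ (by positivity) ((by positivity : (0 : ℝ) ≤ _).trans (hC n hn))
        gcongr
        exact ha n
    _ = _ := by rw [Finset.mul_sum]

variable (hD : Real.exp (Real.exp (Real.exp (10 ^ 6))) ≤ (D : ℝ))
  (hreal : ∀ a : ZMod D, (χ a).im = 0)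
include hD hreal

omit hP hreal in
-- For `n ≤ D⁵`, moving a distance `4/ℒ` to the left of the critical line costs at most the constant
-- `e^{40}`, so the logarithmically weighted sums still control the mean squares there.
theorem rpow_le_of_le_exp {σ : ℝ} (hσ : 1 / 2 - 4 / ell D ≤ σ) {n x : ℕ} (hn : 0 < n) (hnx : n ≤ x)
    (hx : (x : ℝ) ≤ Real.exp (5 * ell D)) : (n : ℝ) ^ (1 - 2 * σ) ≤ 10 ^ 18 := by
  have hL := ell_pos hD
  have hn1 : (1 : ℝ) ≤ n := by exact_mod_cast hn
  have hnx' : (n : ℝ) ≤ Real.exp (5 * ell D) := le_trans (by exact_mod_cast hnx) hx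
  calc (n : ℝ) ^ (1 - 2 * σ) ≤ (n : ℝ) ^ (8 / ell D) :=
        Real.rpow_le_rpow_of_exponent_le hn1 (by
          have : 8 / ell D = 2 * (4 / ell D) := by ring
          linarith)
    _ ≤ (Real.exp (5 * ell D)) ^ (8 / ell D) := Real.rpow_le_rpow (by linarith) hnx' (by positivity)
    _ = Real.exp 1 ^ 40 := by
        rw [← Real.exp_mul, ← Real.exp_nat_mul]
        congr 1
        field_simp
        norm_num
    _ ≤ 2.72 ^ 40 := by gcongr; linarith [Real.exp_one_lt_d9]
    _ ≤ 10 ^ 18 := by norm_num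

theorem sum_normSq_dpoly_le_of_le {a : ℕ → ℂ} (ha : ∀ n, ‖a n‖ ≤ nuRe χ n) {s : ℂ}
    (hs : 1 / 2 - 4 / ell D ≤ s.re) {x : ℕ} (hx : (x : ℝ) ≤ Real.exp (5 * ell D)) :
    ∑ y ∈ P, ‖dpoly a y.2 0 x s‖ ^ 2 ≤ 10 ^ 26 * ell D ^ 4 * Q D ^ 2 := by
  have hL := le_ell hD
  have hxQ : (x : ℝ) ≤ Q D ^ 2 := by
    refine hx.trans ?_
    rw [Q, ← Real.exp_nat_mul]
    apply Real.exp_le_exp.mpr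
    push_cast
    nlinarith
  refine (sum_normSq_dpoly_le hP ha hxQ fun n hn => rpow_le_of_le_exp hD hs
    (Finset.mem_Ioc.mp hn).1 (Finset.mem_Ioc.mp hn).2 hx).trans ?_
  have := sum_nuRe_sq_div_le_of_le hD hreal hx
  calc _ ≤ 200 * Q D ^ 2 * (10 ^ 18 * (1296 * ell D ^ 4)) := by gcongr
    _ = 200 * 10 ^ 18 * 1296 * (ell D ^ 4 * Q D ^ 2) := by ring
    _ ≤ 10 ^ 26 * (ell D ^ 4 * Q D ^ 2) := by gcongr; norm_num
    _ = _ := by ring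

theorem sum_normSq_dpoly_tail_le [NeZero D] (hχ : χ ≠ 1) (hA1 : A1 χ) {a : ℕ → ℂ}
    (ha : ∀ n, ‖a n‖ ≤ nuRe χ n) {s : ℂ} (hs : 1 / 2 - 4 / ell D ≤ s.re) {w x : ℕ}
    (hw : Real.exp (23 / 10 * ell D) ≤ w) (hx : (x : ℝ) ≤ Real.exp (5 * ell D)) :
    ∑ y ∈ P, ‖dpoly a y.2 w x s‖ ^ 2 ≤ 10 ^ 26 * (ell D ^ 13)⁻¹ * Q D ^ 2 := by
  have hL := le_ell hD
  have hl := le_log_ell hD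
  have hxQ' : (x : ℝ) ≤ Real.exp (2 * ell D ^ 2) :=
    hx.trans (Real.exp_le_exp.mpr (by nlinarith))
  have hxQ : (x : ℝ) ≤ Q D ^ 2 := by
    rw [Q, ← Real.exp_nat_mul]; exact_mod_cast hxQ'
  refine (sum_normSq_dpoly_le hP ha hxQ fun n hn => rpow_le_of_le_exp hD hs
    (Nat.zero_lt_of_lt (Finset.mem_Ioc.mp hn).1) (Finset.mem_Ioc.mp hn).2 hx).trans ?_
  have := sum_nuRe_sq_div_tail_le hD hreal hχ hA1 hw hxQ'
  have hl1 : (Real.log (ell D))⁻¹ ≤ 1 := inv_le_one_of_one_le₀ (by linarith)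
  have h13 : 0 ≤ (ell D ^ 13)⁻¹ := by positivity
  calc _ ≤ 200 * Q D ^ 2 * (10 ^ 18 * (1480 * (ell D ^ 13)⁻¹ * (Real.log (ell D))⁻¹)) := by gcongr
    _ ≤ 200 * Q D ^ 2 * (10 ^ 18 * (1480 * (ell D ^ 13)⁻¹ * 1)) := by gcongr
    _ = 200 * 10 ^ 18 * 1480 * ((ell D ^ 13)⁻¹ * Q D ^ 2) := by ring
    _ ≤ 10 ^ 26 * ((ell D ^ 13)⁻¹ * Q D ^ 2) := by gcongr; norm_num
    _ = _ := by ring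

end MeanValue

/-! ### The characters for which (I1) fails -/

section Exceptional

variable {D : ℕ} (hD : Real.exp (Real.exp (Real.exp (10 ^ 6))) ≤ (D : ℝ)) {χ : DirichletCharacter ℂ D}
  {P : Finset (Σ q : ℕ+, DirichletCharacter ℂ (q : ℕ))} (hP : ∀ y ∈ P, y ∈ Psi χ)
  (hreal : ∀ a : ZMod D, (χ a).im = 0)

include hD in
theorem sqrt_alpha : Real.sqrt (alpha D) = 1 / ell D := by
  rw [alpha, ← inv_pow, Real.sqrt_sq (inv_nonneg.mpr (ell_pos hD).le), one_div]

include hD in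
theorem mem_Omega1_rect {s : ℂ} (hs : s ∈ Omega1 D) :
    (1 / 2 - 3 / ell D) + 1 / ell D ≤ s.re ∧ s.re + 1 / ell D ≤ 3 / 2 + 1 / ell D ∧
      ((D : ℝ) - 1 - 20 * ell D - 1 / ell D) + 1 / ell D ≤ s.im ∧
      s.im + 1 / ell D ≤ D + 1 + 20 * ell D + 1 / ell D := by
  obtain ⟨h1, h2, h3⟩ := hs
  rw [sqrt_alpha hD] at h1
  have e1 : (s - s0 D).re = s.re - 1 / 2 := by simp [s0]
  have e2 : (s - s0 D).im = s.im - D := by simp [s0]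
  rw [e1] at h1 h2
  rw [e2, abs_lt] at h3
  have : 3 / ell D = 1 / ell D + 2 * (1 / ell D) := by ring
  refine ⟨?_, ?_, ?_, ?_⟩ <;> linarith

include hD in
theorem rect_perimeter_le :
    ((3 / 2 + 1 / ell D) - (1 / 2 - 3 / ell D)) +
      (((D : ℝ) + 1 + 20 * ell D + 1 / ell D) - (D - 1 - 20 * ell D - 1 / ell D)) ≤ 50 * ell D := by
  have hL := le_ell hD
  have : 1 / ell D ≤ 1 := by rw [div_le_one (ell_pos hD)]; linarith
  have e : 3 / ell D = 3 * (1 / ell D) := by ring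
  linarith

include hD hP hreal

open Classical in
-- The mean square is `O(ℒ⁴)`; Cauchy's formula at distance `1/ℒ` over a perimeter `O(ℒ)` costs
-- `ℒ²`; the squared threshold is `ℒ⁶ log² ℒ / 16`. The exceptional proportion is thus `O(1/log²
-- ℒ)`.
theorem card_dpoly_exceed_le {a : ℕ → ℂ} (ha : ∀ n, ‖a n‖ ≤ nuRe χ n) :
    ((P.filter fun y => ¬ ∀ s ∈ Omega1 D, ‖dpoly a y.2 0 (D ^ 5) s‖ ≤
      ell D ^ 3 * Real.log (ell D) / 4).card : ℝ) ≤ Q D ^ 2 / 2000 := by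
  have hL := le_ell hD
  have hL0 := ell_pos hD
  have hl := le_log_ell hD
  have hl0 : 0 < Real.log (ell D) := lt_of_lt_of_le (by norm_num) hl
  set B := ell D ^ 3 * Real.log (ell D) / 4 with hB
  have hB0 : 0 < B := by positivity
  have hx : ((D ^ 5 : ℕ) : ℝ) ≤ Real.exp (5 * ell D) := by
    have := Real.exp_nat_mul (ell D) 5
    rw [exp_ell hD] at this
    push_cast at this ⊢
    exact this.ge
  have h := card_exceed_le P (g := fun y s => dpoly a y.2 0 (D ^ 5) s ^ 2) (Ω := Omega1 D)
    (δ := 1 / ell D) (B := B ^ 2) (M := 10 ^ 26 * ell D ^ 4 * Q D ^ 2) (by positivity)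
    (a := 1 / 2 - 3 / ell D) (b := 3 / 2 + 1 / ell D)
    (c := (D : ℝ) - 1 - 20 * ell D - 1 / ell D) (d := D + 1 + 20 * ell D + 1 / ell D)
    (by
      have : 0 ≤ 1 / ell D := by positivity
      have : 0 ≤ 3 / ell D := by positivity
      linarith)
    (by
      have : 0 ≤ 1 / ell D := by positivity
      linarith)
    (fun s hs => mem_Omega1_rect hD hs)
    (fun y _ => (differentiable_dpoly.pow 2).differentiableOn)
    (fun w hw => by
      simp only [norm_pow]
      refine sum_normSq_dpoly_le_of_le hP hD hreal ha ?_ hx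
      have h1 := (mem_reProdIm.mp hw).1.1
      have : 4 / ell D = 3 / ell D + 1 / ell D := by ring
      have : 0 ≤ 1 / ell D := by positivity
      linarith)
  have e : (P.filter fun y => ¬ ∀ s ∈ Omega1 D, ‖dpoly a y.2 0 (D ^ 5) s ^ 2‖ ≤ B ^ 2) =
      P.filter fun y => ¬ ∀ s ∈ Omega1 D, ‖dpoly a y.2 0 (D ^ 5) s‖ ≤ B := by
    refine Finset.filter_congr fun y _ => ?_
    simp only [norm_pow]
    simp_rw [pow_le_pow_iff_left₀ (norm_nonneg _) hB0.le two_ne_zero]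
  rw [e] at h
  have h2 := rect_perimeter_le hD
  set K := ((P.filter fun y => ¬ ∀ s ∈ Omega1 D, ‖dpoly a y.2 0 (D ^ 5) s‖ ≤ B).card : ℝ) with hK
  have h3 : K * B ^ 2 ≤ (1 / ell D)⁻¹ * (50 * ell D) * (10 ^ 26 * ell D ^ 4 * Q D ^ 2) :=
    h.trans (by gcongr)
  have h4 : K * (Real.log (ell D)) ^ 2 ≤ 800 * 10 ^ 26 * Q D ^ 2 := by
    have e1 : K * B ^ 2 = (K * (Real.log (ell D)) ^ 2) * (ell D ^ 6 / 16) := by rw [hB]; ring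
    have e2 : (1 / ell D)⁻¹ * (50 * ell D) * (10 ^ 26 * ell D ^ 4 * Q D ^ 2) =
        (800 * 10 ^ 26 * Q D ^ 2) * (ell D ^ 6 / 16) := by
      rw [one_div, inv_inv]; ring
    rw [e1, e2] at h3
    exact le_of_mul_le_mul_right h3 (by positivity)
  have hK0 : 0 ≤ K := by positivity
  have h5 : (10 : ℝ) ^ 100 * 1 ≤ Real.log (ell D) ^ 2 := by nlinarith
  have h6 : K * (10 ^ 100 * 1) ≤ K * Real.log (ell D) ^ 2 := by gcongr
  have h7 : 0 ≤ Q D ^ 2 := by positivity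
  linarith

open Classical in
theorem card_not_I1_le :
    ((P.filter fun y => ¬ I1 χ y.2).card : ℝ) ≤ Q D ^ 2 / 1000 := by
  have h1 := card_dpoly_exceed_le hD hP hreal (norm_nu_le hreal)
  have h2 := card_dpoly_exceed_le hD hP hreal (norm_upsilon_le hreal)
  have hl : 0 < Real.log (ell D) := lt_of_lt_of_le (by norm_num) (le_log_ell hD)
  have hL0 := ell_pos hD
  have hsub : (P.filter fun y => ¬ I1 χ y.2) ⊆
      (P.filter fun y => ¬ ∀ s ∈ Omega1 D, ‖dpoly (nu χ) y.2 0 (D ^ 5) s‖ ≤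
        ell D ^ 3 * Real.log (ell D) / 4) ∪
      (P.filter fun y => ¬ ∀ s ∈ Omega1 D, ‖dpoly (upsilon χ) y.2 0 (D ^ 5) s‖ ≤
        ell D ^ 3 * Real.log (ell D) / 4) := by
    intro y hy
    rw [← Finset.filter_or, Finset.mem_filter]
    obtain ⟨hy1, hy2⟩ := Finset.mem_filter.mp hy
    refine ⟨hy1, ?_⟩
    by_contra hcon
    push Not at hcon
    refine hy2 ⟨ell D ^ 3 * Real.log (ell D) / 2, half_lt_self (by positivity), fun s hs => ?_⟩
    have a1 := hcon.1 s hs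
    have a2 := hcon.2 s hs
    beta_reduce
    rw [F_eq_dpoly, G_eq_dpoly]
    linarith
  have h3 := (Finset.card_le_card hsub).trans (Finset.card_union_le _ _)
  have h4 := (Nat.cast_le (α := ℝ)).mpr h3
  push_cast at h4
  linarith

end Exceptional

/-! ### The characters for which (I2) fails -/

section SecondInequality

variable {D : ℕ} (hD : Real.exp (Real.exp (Real.exp (10 ^ 6))) ≤ (D : ℝ)) {χ : DirichletCharacter ℂ D}

include hD in
theorem cast_pow_five_eq_exp : ((D ^ 5 : ℕ) : ℝ) = Real.exp (5 * ell D) := by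
  have := Real.exp_nat_mul (ell D) 5
  rw [exp_ell hD] at this
  push_cast at this ⊢
  exact this.symm

/-- The part of `F G` in which at least one of the two variables exceeds `w`. -/
noncomputable def tailProduct (χ : DirichletCharacter ℂ D) {q : ℕ} (ψ : DirichletCharacter ℂ q)
    (w : ℕ) (s : ℂ) : ℂ :=
  dpoly (nu χ) ψ w (D ^ 5) s * dpoly (upsilon χ) ψ 0 (D ^ 5) s +
    dpoly (nu χ) ψ 0 w s * dpoly (upsilon χ) ψ w (D ^ 5) s

variable {q : ℕ} {ψ : DirichletCharacter ℂ q}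

theorem differentiable_tailProduct {w : ℕ} : Differentiable ℂ (tailProduct χ ψ w) :=
  (differentiable_dpoly.mul differentiable_dpoly).add
    (differentiable_dpoly.mul differentiable_dpoly)

theorem F_mul_G_sub_tailProduct {w : ℕ} (hw : w ≤ D ^ 5) (s : ℂ) :
    F χ ψ s * G χ ψ s - tailProduct χ ψ w s =
      dpoly (nu χ) ψ 0 w s * dpoly (upsilon χ) ψ 0 w s := by
  rw [F_eq_dpoly, G_eq_dpoly, tailProduct, ← dpoly_add (Nat.zero_le w) hw,
    ← dpoly_add (Nat.zero_le w) hw]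
  ring

include hD

theorem log_one_add_sq_le : Real.log ((1 / ell D + ell D) / (1 / ell D)) ≤ 3 * Real.log (ell D) := by
  have hL := le_ell hD
  have hL0 := ell_pos hD
  rw [← Real.log_rpow hL0]
  apply Real.log_le_log (by positivity)
  have : (1 / ell D + ell D) / (1 / ell D) = 1 + ell D ^ 2 := by field_simp
  rw [this, show (3 : ℝ) = (3 : ℕ) by norm_num, Real.rpow_natCast]
  nlinarith

variable (hreal : ∀ a : ZMod D, (χ a).im = 0)
include hreal

/-- All terms of `FG - 1` have `n > D⁵`. Once the tail product is removed, the terms of `FG` have `n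
≤ w² ≤ D^{24/5}`. A kernel `exp(Λz)` with `exp Λ` strictly between these two lengths damps `FG - 1`
far to the right and `FG - 1` minus the tail far to the left; only the tail near the imaginary axis
remains. -/
theorem norm_F_mul_G_sub_one_le {w : ℕ} (hw1 : 1 ≤ w)
    (hw : (w : ℝ) ≤ Real.exp (24 / 10 * ell D)) {s : ℂ}
    (hs1 : 0 ≤ s.re) (hs2 : s.re ≤ 2) :
    ‖F χ ψ s * G χ ψ s - 1‖ ≤ (∫ v : ℝ in -ell D..ell D,
      ‖tailProduct χ ψ w (s + (((-(1 / ell D) : ℝ) : ℂ) + v * I))‖ * (6 / (1 / ell D + |v|))) +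
        2 * Real.exp (-ell D) := by
  set L := ell D with hLdef
  have hL := le_ell hD
  rw [← hLdef] at hL
  have hL0 : 0 < L := lt_of_lt_of_le (by norm_num) hL
  have hLL : 10 ^ 100 * L ≤ L ^ 2 := by nlinarith
  have hN := cast_pow_five_eq_exp hD
  rw [← hLdef] at hN
  have hD1 : 1 ≤ D := by
    have := cast_pos hD
    exact_mod_cast this
  have hN1 : 1 ≤ D ^ 5 := Nat.one_le_pow _ _ hD1
  have hwN : w ≤ D ^ 5 := by
    have : (w : ℝ) ≤ ((D ^ 5 : ℕ) : ℝ) := by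
      rw [hN]; exact hw.trans (Real.exp_le_exp.mpr (by linarith))
    exact_mod_cast this
  have hwN' : (w : ℝ) ≤ Real.exp (5 * L) := hN ▸ (by exact_mod_cast hwN)
  have hna : ∀ n, ‖nu χ n‖ ≤ n := fun n => (norm_nu_le hreal n).trans (nuRe_le hreal n)
  have hua : ∀ n, ‖upsilon χ n‖ ≤ n := fun n => (norm_upsilon_le hreal n).trans (nuRe_le hreal n)
  have hpoly : ∀ (a : ℕ → ℂ), (∀ n, ‖a n‖ ≤ n) → ∀ (u x : ℕ) (z : ℂ), (x : ℝ) ≤ Real.exp (5 * L) →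
      -400 ≤ z.re → ‖dpoly a ψ u x z‖ ≤ Real.exp (2010 * L) := by
    intro a ha u x z hx hz
    refine (norm_dpoly_le ha (by norm_num : (0 : ℝ) ≤ 400) hz).trans ?_
    calc (x : ℝ) ^ ((400 : ℝ) + 2) ≤ (Real.exp (5 * L)) ^ ((400 : ℝ) + 2) := by gcongr
      _ = _ := by rw [← Real.exp_mul]; congr 1; ring
  have hbig : 2 * Real.exp (4020 * L) ≤ Real.exp (4021 * L) := by
    rw [show 4021 * L = L + 4020 * L by ring, Real.exp_add]
    gcongr
    linarith [Real.add_one_le_exp L]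
  have hsum : Real.exp (2010 * L) * Real.exp (2010 * L) = Real.exp (4020 * L) := by
    rw [← Real.exp_add]; congr 1; ring
  have hre : ∀ z : ℂ, (s + z).re = s.re + z.re := fun z => add_re _ _
  -- The value `Λ = 49/10 · ℒ` lies between `24/5 · ℒ` and `5ℒ`. The gap `ℒ/10` on each side,
  -- multiplied by `c = 400`, outweighs the trivial factors `N⁴ = e^{20ℒ}` and `w⁴`, and the height
  -- `T = ℒ` makes the Gaussian kill the horizontal sides.
  have hker := norm_le_of_kern (f := fun z => F χ ψ (s + z) * G χ ψ (s + z) - 1) (A := fun _ => 0)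
    (A' := fun z => tailProduct χ ψ w (s + z)) (κ := 1 / L) (c := 400) (T := L)
    (Λ := 49 / 10 * L) (δ := Real.exp (-(20 * L))) (M := Real.exp (4021 * L))
    (by positivity) (by rw [div_le_one hL0]; linarith) (by
      have : 1 / L ≤ 1 := by rw [div_le_one hL0]; linarith
      linarith) hL0 (by positivity)
    (by
      have : Differentiable ℂ fun z => F χ ψ (s + z) * G χ ψ (s + z) - 1 :=
        (((differentiable_dpoly (a := nu χ)).comp (differentiable_id.const_add s)).mul
          ((differentiable_dpoly (a := upsilon χ)).comp (differentiable_id.const_add s))).sub_const 1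
      exact this.differentiableOn)
    (differentiable_const _).differentiableOn
    (differentiable_tailProduct.comp (differentiable_id.const_add s)).differentiableOn
    (by
      intro v _
      rw [sub_zero, F_eq_dpoly, G_eq_dpoly]
      have hr : (s + (((400 : ℝ) : ℂ) + v * I)).re = s.re + 400 := by simp
      refine (norm_dpoly_mul_dpoly_sub_one_le_of_nonneg hreal hN1 (by rw [hr]; linarith)).trans ?_
      rw [hN, hr, ← Real.exp_nat_mul, ← Real.exp_mul, ← Real.exp_add, ← Real.exp_add]
      apply Real.exp_le_exp.mpr
      push_cast
      nlinarith)
    (by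
      intro v _
      have hr : (s + (((-400 : ℝ) : ℂ) + v * I)).re = s.re - 400 := by simp; ring
      have e : F χ ψ (s + (((-400 : ℝ) : ℂ) + v * I)) * G χ ψ (s + (((-400 : ℝ) : ℂ) + v * I)) - 1 -
          tailProduct χ ψ w (s + (((-400 : ℝ) : ℂ) + v * I)) =
          dpoly (nu χ) ψ 0 w (s + (((-400 : ℝ) : ℂ) + v * I)) *
            dpoly (upsilon χ) ψ 0 w (s + (((-400 : ℝ) : ℂ) + v * I)) - 1 := by
        rw [← F_mul_G_sub_tailProduct hwN]; ring
      rw [e]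
      refine (norm_dpoly_mul_dpoly_sub_one_le_of_nonpos hreal hw1 (by rw [hr]; linarith)).trans ?_
      rw [hr]
      calc (w : ℝ) ^ 4 * ((w : ℝ) ^ 2) ^ (-(s.re - 400)) ≤
            (Real.exp (24 / 10 * L)) ^ 4 * ((Real.exp (24 / 10 * L)) ^ 2) ^ (-(s.re - 400)) := by
            gcongr
            linarith
        _ = Real.exp (48 / 5 * L + 48 / 10 * L * (400 - s.re)) := by
            rw [← Real.exp_nat_mul, ← Real.exp_nat_mul, ← Real.exp_mul, ← Real.exp_add]
            congr 1
            push_cast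
            ring
        _ ≤ _ := by
            rw [← Real.exp_add]
            apply Real.exp_le_exp.mpr
            nlinarith)
    (by
      intro z hz
      have hz1 := (mem_reProdIm.mp hz).1.1
      have hr : -400 ≤ (s + z).re := by rw [hre]; linarith
      have b1 := hpoly _ hna 0 (D ^ 5) (s + z) hN.le hr
      have b2 := hpoly _ hua 0 (D ^ 5) (s + z) hN.le hr
      have b3 : 1 ≤ Real.exp (4020 * L) := Real.one_le_exp (by positivity)
      refine (norm_sub_le _ _).trans ?_
      rw [norm_mul, norm_one, F_eq_dpoly, G_eq_dpoly]
      have := mul_le_mul b1 b2 (norm_nonneg _) (Real.exp_pos _).le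
      linarith)
    (fun z _ => by simp only [norm_zero]; positivity)
    (by
      intro z hz
      have hz1 := (mem_reProdIm.mp hz).1.1
      have hr : -400 ≤ (s + z).re := by rw [hre]; linarith
      have b1 := hpoly _ hna w (D ^ 5) (s + z) hN.le hr
      have b2 := hpoly _ hua 0 (D ^ 5) (s + z) hN.le hr
      have b3 := hpoly _ hna 0 w (s + z) hwN' hr
      have b4 := hpoly _ hua w (D ^ 5) (s + z) hN.le hr
      refine (norm_add_le _ _).trans ?_
      rw [norm_mul, norm_mul]
      have := mul_le_mul b1 b2 (norm_nonneg _) (Real.exp_pos _).le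
      have := mul_le_mul b3 b4 (norm_nonneg _) (Real.exp_pos _).le
      linarith)
  have t1 : 4 * L * Real.exp (-(20 * L)) * Real.exp ((400 : ℝ) ^ 2) / 400 ≤ Real.exp (-L) := by
    have h1 : L ≤ Real.exp L := by linarith [Real.add_one_le_exp L]
    calc 4 * L * Real.exp (-(20 * L)) * Real.exp ((400 : ℝ) ^ 2) / 400 =
          L / 100 * (Real.exp (-(20 * L)) * Real.exp ((400 : ℝ) ^ 2)) := by ring
      _ ≤ Real.exp L * (Real.exp (-(20 * L)) * Real.exp ((400 : ℝ) ^ 2)) := by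
          gcongr; linarith
      _ ≤ _ := by
          rw [← Real.exp_add, ← Real.exp_add]
          apply Real.exp_le_exp.mpr
          linarith
  have t2 : 8 * 400 * Real.exp (4021 * L) * Real.exp ((400 : ℝ) ^ 2 - L ^ 2 + 49 / 10 * L * 400) / L ≤
      Real.exp (-L) := by
    rw [div_le_iff₀ hL0]
    calc 8 * 400 * Real.exp (4021 * L) * Real.exp ((400 : ℝ) ^ 2 - L ^ 2 + 49 / 10 * L * 400) =
          3200 * Real.exp (4021 * L + ((400 : ℝ) ^ 2 - L ^ 2 + 49 / 10 * L * 400)) := by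
          rw [Real.exp_add (4021 * L)]; ring
      _ ≤ L * Real.exp (-L) := by
          gcongr
          · linarith
          · linarith
      _ = _ := mul_comm _ _
  have hpi : 1 ≤ 2 * Real.pi := by linarith [Real.pi_gt_three]
  have h0 : ‖F χ ψ s * G χ ψ s - 1‖ ≤ 2 * Real.pi * ‖F χ ψ (s + 0) * G χ ψ (s + 0) - 1‖ := by
    rw [add_zero]
    exact le_mul_of_one_le_left (norm_nonneg _) hpi
  have h1 : (∫ v : ℝ in -L..L, (Real.exp (49 / 10 * L * (1 / L)) * ‖(0 : ℂ)‖ +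
      Real.exp (-(49 / 10 * L * (1 / L))) *
        ‖tailProduct χ ψ w (s + (((-(1 / L) : ℝ) : ℂ) + v * I))‖) * (6 / (1 / L + |v|))) ≤
      ∫ v : ℝ in -L..L, ‖tailProduct χ ψ w (s + (((-(1 / L) : ℝ) : ℂ) + v * I))‖ *
        (6 / (1 / L + |v|)) := by
    have hc1 : Continuous fun v : ℝ => ‖tailProduct χ ψ w (s + (((-(1 / L) : ℝ) : ℂ) + v * I))‖ :=
      (differentiable_tailProduct.continuous.comp (by fun_prop)).norm
    have hc2 := continuous_div_add_abs (κ := 1 / L) (by positivity) 6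
    refine intervalIntegral.integral_mono_on (by linarith)
      (Continuous.intervalIntegrable (by fun_prop) _ _) (Continuous.intervalIntegrable (by fun_prop) _ _)
      fun v _ => ?_
    have : Real.exp (-(49 / 10 * L * (1 / L))) ≤ 1 := Real.exp_le_one_iff.mpr (by
      have : 0 ≤ 49 / 10 * L * (1 / L) := by positivity
      linarith)
    rw [norm_zero, mul_zero, zero_add]
    have hn := norm_nonneg (tailProduct χ ψ w (s + (((-(1 / L) : ℝ) : ℂ) + v * I)))
    gcongr
    nlinarith
  linarith

variable {P : Finset (Σ q : ℕ+, DirichletCharacter ℂ (q : ℕ))} (hP : ∀ y ∈ P, y ∈ Psi χ)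
  [NeZero D] (hχ : χ ≠ 1) (hA1 : A1 χ)
include hP hχ hA1

theorem sum_norm_tailProduct_le {w : ℕ} (hw0 : Real.exp (23 / 10 * ell D) ≤ w)
    (hw : (w : ℝ) ≤ Real.exp (24 / 10 * ell D)) {s : ℂ} (hs : 1 / 2 - 4 / ell D ≤ s.re) :
    ∑ y ∈ P, ‖tailProduct χ y.2 w s‖ ≤ 2 * 10 ^ 26 * (ell D ^ 4)⁻¹ * Q D ^ 2 := by
  have hL := le_ell hD
  have hL0 := ell_pos hD
  have hN := (cast_pow_five_eq_exp hD).le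
  have hw5 : (w : ℝ) ≤ Real.exp (5 * ell D) := hw.trans (Real.exp_le_exp.mpr (by linarith))
  have b1 := sum_normSq_dpoly_tail_le hP hD hreal hχ hA1 (norm_nu_le hreal) hs hw0 hN
  have b2 := sum_normSq_dpoly_tail_le hP hD hreal hχ hA1 (norm_upsilon_le hreal) hs hw0 hN
  have b3 := sum_normSq_dpoly_le_of_le hP hD hreal (norm_nu_le hreal) hs hw5
  have b4 := sum_normSq_dpoly_le_of_le hP hD hreal (norm_upsilon_le hreal) hs hN
  -- The weight in `2xy ≤ l x² + y²/l` for a tail of mean square `ℒ⁻¹³` against a factor of mean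
  -- square `ℒ⁴`; the balance would be `ℒ^{17/2}`, and an integral exponent is sufficient.
  set l := ell D ^ 8 with hl
  have hl0 : 0 < l := by positivity
  have key : ∀ x y : ℝ, x * y ≤ (l * x ^ 2 + l⁻¹ * y ^ 2) / 2 := by
    intro x y
    have h1 : l * x ^ 2 + l⁻¹ * y ^ 2 - 2 * (x * y) = l⁻¹ * (l * x - y) ^ 2 := by
      field_simp; ring
    have h2 : 0 ≤ l⁻¹ * (l * x - y) ^ 2 := by positivity
    linarith
  have h1 : ∑ y ∈ P, ‖tailProduct χ y.2 w s‖ ≤ ∑ y ∈ P,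
      ((l / 2 * ‖dpoly (nu χ) y.2 w (D ^ 5) s‖ ^ 2 + l / 2 * ‖dpoly (upsilon χ) y.2 w (D ^ 5) s‖ ^ 2) +
      (l⁻¹ / 2 * ‖dpoly (nu χ) y.2 0 w s‖ ^ 2 + l⁻¹ / 2 * ‖dpoly (upsilon χ) y.2 0 (D ^ 5) s‖ ^ 2)) := by
    refine Finset.sum_le_sum fun y _ => ?_
    refine (norm_add_le _ _).trans ?_
    rw [norm_mul, norm_mul]
    have k1 := key ‖dpoly (nu χ) y.2 w (D ^ 5) s‖ ‖dpoly (upsilon χ) y.2 0 (D ^ 5) s‖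
    have k2 := key ‖dpoly (upsilon χ) y.2 w (D ^ 5) s‖ ‖dpoly (nu χ) y.2 0 w s‖
    linarith
  refine h1.trans ?_
  rw [Finset.sum_add_distrib, Finset.sum_add_distrib, Finset.sum_add_distrib, ← Finset.mul_sum,
    ← Finset.mul_sum, ← Finset.mul_sum, ← Finset.mul_sum]
  have c1 : l / 2 * (10 ^ 26 * (ell D ^ 13)⁻¹ * Q D ^ 2) ≤ 10 ^ 26 * (ell D ^ 4)⁻¹ * Q D ^ 2 / 2 := by
    have : l * (ell D ^ 13)⁻¹ ≤ (ell D ^ 4)⁻¹ := by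
      rw [hl, ← div_eq_mul_inv, div_le_iff₀ (by positivity)]
      have : (ell D ^ 4)⁻¹ * ell D ^ 13 = ell D ^ 9 := by field_simp
      rw [this]
      exact pow_le_pow_right₀ (by linarith) (by norm_num)
    calc _ = l * (ell D ^ 13)⁻¹ * (10 ^ 26 * Q D ^ 2 / 2) := by ring
      _ ≤ (ell D ^ 4)⁻¹ * (10 ^ 26 * Q D ^ 2 / 2) := by gcongr
      _ = _ := by ring
  have c2 : l⁻¹ / 2 * (10 ^ 26 * ell D ^ 4 * Q D ^ 2) = 10 ^ 26 * (ell D ^ 4)⁻¹ * Q D ^ 2 / 2 := by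
    rw [hl]; field_simp
  have d1 := mul_le_mul_of_nonneg_left b1 (by positivity : 0 ≤ l / 2)
  have d2 := mul_le_mul_of_nonneg_left b2 (by positivity : 0 ≤ l / 2)
  have d3 := mul_le_mul_of_nonneg_left b3 (by positivity : 0 ≤ l⁻¹ / 2)
  have d4 := mul_le_mul_of_nonneg_left b4 (by positivity : 0 ≤ l⁻¹ / 2)
  linarith

theorem sum_norm_F_mul_G_sub_one_le {s : ℂ} (hs1 : 1 / 2 - 3 / ell D ≤ s.re) (hs2 : s.re ≤ 2) :
    ∑ y ∈ P, ‖F χ y.2 s * G χ y.2 s - 1‖ ≤ 10 ^ 29 * (ell D ^ 3)⁻¹ * Q D ^ 2 := by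
  have hL := le_ell hD
  have hL0 := ell_pos hD
  have hll := log_ell_le hD
  have h0 : 3 / ell D ≤ 1 / 2 := by rw [div_le_iff₀ hL0]; linarith
  -- The cut `D^{12/5}` is beyond `D^{23/10}`, where `ν` is sparse, while its square stays below
  -- `D⁵`.
  set w := ⌊Real.exp (24 / 10 * ell D)⌋₊ with hw
  have hw2 : (w : ℝ) ≤ Real.exp (24 / 10 * ell D) := Nat.floor_le (Real.exp_pos _).le
  have hw1 : Real.exp (23 / 10 * ell D) ≤ w := by
    have h1 := Nat.lt_floor_add_one (Real.exp (24 / 10 * ell D))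
    have h2 : Real.exp (24 / 10 * ell D) = Real.exp (1 / 10 * ell D) * Real.exp (23 / 10 * ell D) := by
      rw [← Real.exp_add]; congr 1; ring
    have h3 : 2 ≤ Real.exp (1 / 10 * ell D) := by
      linarith [Real.add_one_le_exp (1 / 10 * ell D)]
    have h4 : 1 ≤ Real.exp (23 / 10 * ell D) := Real.one_le_exp (by positivity)
    rw [← hw] at h1
    nlinarith
  have hw3 : 1 ≤ w := by
    have : (0 : ℝ) < w := (Real.exp_pos _).trans_le hw1
    exact_mod_cast this
  have h1 : ∑ y ∈ P, ‖F χ y.2 s * G χ y.2 s - 1‖ ≤ ∑ y ∈ P, ((∫ v : ℝ in -ell D..ell D,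
      ‖tailProduct χ y.2 w (s + (((-(1 / ell D) : ℝ) : ℂ) + v * I))‖ * (6 / (1 / ell D + |v|))) +
        2 * Real.exp (-ell D)) :=
    Finset.sum_le_sum fun y _ => norm_F_mul_G_sub_one_le hD hreal hw3 hw2 (by linarith) hs2
  have h2 := sum_integral_mul_le P (T := ell D)
    (a := fun y v => ‖tailProduct χ y.2 w (s + (((-(1 / ell D) : ℝ) : ℂ) + (v : ℂ) * I))‖)
    (k := fun v => 6 / (1 / ell D + |v|)) (M := 2 * 10 ^ 26 * (ell D ^ 4)⁻¹ * Q D ^ 2) hL0.le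
    (fun y _ => ((differentiable_tailProduct.continuous.comp (by fun_prop)).norm).continuousOn)
    (continuous_div_add_abs (by positivity) 6).continuousOn (fun v => by positivity)
    (fun v _ => sum_norm_tailProduct_le hD hreal hP hχ hA1 hw1 hw2 (by
      have : (s + (((-(1 / ell D) : ℝ) : ℂ) + (v : ℂ) * I)).re = s.re - 1 / ell D := by simp; ring
      rw [this]
      have : 4 / ell D = 3 / ell D + 1 / ell D := by ring
      linarith))
  rw [integral_div_add_abs (by positivity) hL0.le] at h2
  have h3 := log_one_add_sq_le hD
  have h4 := card_le_mul_sq hP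
  rw [Finset.sum_add_distrib, Finset.sum_const, nsmul_eq_mul] at h1
  have h5 : Real.exp (-ell D) ≤ (ell D ^ 3)⁻¹ := by
    rw [Real.exp_neg]
    apply inv_anti₀ (by positivity)
    calc ell D ^ 3 ≤ ell D ^ 20 := pow_le_pow_right₀ (by linarith) (by norm_num)
      _ ≤ Real.exp (ell D / 100) := ell_pow_le hD
      _ ≤ _ := Real.exp_le_exp.mpr (by linarith)
  have h6 : 2 * 10 ^ 26 * (ell D ^ 4)⁻¹ * Q D ^ 2 *
      (2 * 6 * Real.log ((1 / ell D + ell D) / (1 / ell D))) ≤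
      72 * 10 ^ 26 * (ell D ^ 3)⁻¹ * Q D ^ 2 := by
    calc _ ≤ 2 * 10 ^ 26 * (ell D ^ 4)⁻¹ * Q D ^ 2 * (2 * 6 * (3 * ell D)) := by
          gcongr; linarith
      _ = _ := by field_simp; ring
  have h7 : (P.card : ℝ) * (2 * Real.exp (-ell D)) ≤ 200 * Q D ^ 2 * (2 * (ell D ^ 3)⁻¹) := by
    gcongr
  have h8 : 0 ≤ (ell D ^ 3)⁻¹ * Q D ^ 2 := by positivity
  linarith

open Classical in
-- The mean `O(ℒ⁻³)` survives the loss `O(ℒ²)` of Cauchy's formula on the rectangle around `Ω₁`.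
theorem card_not_I2_le : ((P.filter fun y => ¬ I2 χ y.2).card : ℝ) ≤ Q D ^ 2 / 1000 := by
  have hL := le_ell hD
  have hL0 := ell_pos hD
  have h := card_exceed_le P (g := fun y s => F χ y.2 s * G χ y.2 s - 1) (Ω := Omega1 D)
    (δ := 1 / ell D) (B := 1 / 4) (M := 10 ^ 29 * (ell D ^ 3)⁻¹ * Q D ^ 2) (by positivity)
    (a := 1 / 2 - 3 / ell D) (b := 3 / 2 + 1 / ell D)
    (c := (D : ℝ) - 1 - 20 * ell D - 1 / ell D) (d := D + 1 + 20 * ell D + 1 / ell D)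
    (by
      have : 0 ≤ 1 / ell D := by positivity
      have : 0 ≤ 3 / ell D := by positivity
      linarith)
    (by
      have : 0 ≤ 1 / ell D := by positivity
      linarith)
    (fun s hs => mem_Omega1_rect hD hs)
    (fun y _ => ((differentiable_dpoly.mul differentiable_dpoly).sub_const 1).differentiableOn)
    (fun w hw => by
      obtain ⟨h1, h2⟩ := (mem_reProdIm.mp hw).1
      refine sum_norm_F_mul_G_sub_one_le hD hreal hP hχ hA1 h1 ?_
      have : 1 / ell D ≤ 1 / 2 := by rw [div_le_div_iff₀ hL0 two_pos]; linarith
      linarith)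
  have hsub : (P.filter fun y => ¬ I2 χ y.2) ⊆
      P.filter fun y => ¬ ∀ s ∈ Omega1 D, ‖F χ y.2 s * G χ y.2 s - 1‖ ≤ 1 / 4 := by
    refine Finset.monotone_filter_right _ fun y _ hy hcon => hy ⟨1 / 4, by norm_num, hcon⟩
  have h1 : ((P.filter fun y => ¬ I2 χ y.2).card : ℝ) ≤ _ :=
    (Nat.cast_le (α := ℝ)).mpr (Finset.card_le_card hsub)
  have h2 := rect_perimeter_le hD
  have h3 := h.trans (mul_le_mul_of_nonneg_right
    (mul_le_mul_of_nonneg_left h2 (by positivity : 0 ≤ (1 / ell D)⁻¹))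
    (by positivity : 0 ≤ 10 ^ 29 * (ell D ^ 3)⁻¹ * Q D ^ 2))
  have h4 : (1 / ell D)⁻¹ * (50 * ell D) * (10 ^ 29 * (ell D ^ 3)⁻¹ * Q D ^ 2) =
      50 * 10 ^ 29 * ((ell D)⁻¹ * Q D ^ 2) := by
    field_simp
  rw [h4] at h3
  have h5 : (ell D)⁻¹ ≤ (10 ^ 100)⁻¹ := inv_anti₀ (by norm_num) hL
  have h6 : (ell D)⁻¹ * Q D ^ 2 ≤ (10 ^ 100)⁻¹ * Q D ^ 2 := by gcongr
  have h7 : 0 ≤ Q D ^ 2 := by positivity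
  linarith

end SecondInequality

/-! ### The approximate functional equation -/

section ApproximateFunctionalEquation

variable {D : ℕ} [NeZero D] {χ : DirichletCharacter ℂ D} {q : ℕ} [NeZero q]
  {ψ : DirichletCharacter ℂ q}

/-- The difference between `L(s,ψ) L(s,ψχ)` and its approximation of length `w`. -/
noncomputable def approxError (χ : DirichletCharacter ℂ D) (ψ : DirichletCharacter ℂ q) (w : ℕ)
    (s : ℂ) : ℂ :=
  LL χ ψ s - dpoly (nu χ) ψ 0 w s - Delta1 χ ψ s * dpoly (nu χ) ψ⁻¹ 0 w (1 - s)

theorem LL_sub_calF (s : ℂ) : LL χ ψ s - calF χ ψ s = approxError χ ψ (D ^ 5) s := by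
  rw [calF, F_eq_dpoly, F_eq_dpoly, approxError]; ring

theorem approxError_eq_add {w x : ℕ} (hwx : w ≤ x) (s : ℂ) :
    approxError χ ψ w s = approxError χ ψ x s +
      (dpoly (nu χ) ψ w x s + Delta1 χ ψ s * dpoly (nu χ) ψ⁻¹ w x (1 - s)) := by
  rw [approxError, approxError, ← dpoly_add (Nat.zero_le w) hwx, ← dpoly_add (Nat.zero_le w) hwx]
  ring

theorem differentiableAt_approxError (hq : q ≠ 1) (hψ : ψ ∈ PsiMod χ q) {w : ℕ} {s : ℂ}
    (hs : s.im ≠ 0) : DifferentiableAt ℂ (approxError χ ψ w) s := by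
  have h1 : DifferentiableAt ℂ (fun s => dpoly (nu χ) ψ⁻¹ 0 w (1 - s)) s :=
    DifferentiableAt.comp (g := dpoly (nu χ) ψ⁻¹ 0 w) (f := fun s => 1 - s) s
      (differentiable_dpoly _) (by fun_prop)
  exact ((differentiable_LL hq hψ s).sub (differentiable_dpoly s)).sub
    ((differentiableAt_Delta1 hs).mul h1)

theorem norm_LL_sub_dpoly_le (hreal : ∀ a : ZMod D, (χ a).im = 0) {x : ℕ} (hx : 1 ≤ x) {s : ℂ}
    (hs : 3 ≤ s.re) : ‖LL χ ψ s - dpoly (nu χ) ψ 0 x s‖ ≤ 2 * (x : ℝ) ^ (-(s.re - 3)) := by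
  have h1 := hasSum_LL (χ := χ) (ψ := ψ) (by linarith : 1 < s.re)
  have h2 : HasSum (fun n : ℕ => if n ∈ Finset.Ioc 0 x then
      nu χ n * ψ (n : ZMod q) / (n : ℂ) ^ s else 0) (dpoly (nu χ) ψ 0 x s) := by
    have := hasSum_sum_of_ne_finset_zero (L := SummationFilter.unconditional ℕ) (f := fun n : ℕ => if n ∈ Finset.Ioc 0 x then
      nu χ n * ψ (n : ZMod q) / (n : ℂ) ^ s else 0) (s := Finset.Ioc 0 x)
      (fun n hn => by simp only [if_neg hn])
    convert this using 1
    refine Finset.sum_congr rfl fun n hn => ?_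
    rw [if_pos hn]
  have hx1 : (1 : ℝ) ≤ x := by exact_mod_cast hx
  have h3 := (hasSum_zeta_two.mul_left ((x : ℝ) ^ (-(s.re - 3))))
  refine ((h1.sub h2).norm_le_of_bounded h3 fun n => ?_).trans ?_
  · split_ifs with hn
    · rw [sub_self, norm_zero]; positivity
    · rcases Nat.eq_zero_or_pos n with rfl | hn0
      · simp [nu]
      · have hxn : x < n := by
          rw [Finset.mem_Ioc] at hn; omega
        have hn' : (0 : ℝ) < n := by exact_mod_cast hn0
        rw [sub_zero]
        refine (norm_dpoly_term hn0.ne' s).trans ?_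
        calc ‖nu χ n‖ * (n : ℝ) ^ (-s.re) ≤ n * (n : ℝ) ^ (-s.re) := by
              gcongr
              exact (norm_nu_le hreal n).trans (nuRe_le hreal n)
          _ = (n : ℝ) ^ (-(s.re - 3)) * (1 / (n : ℝ) ^ 2) := by
              rw [show -s.re = -(s.re - 3) - (3 : ℕ) by push_cast; ring, Real.rpow_sub_natCast hn'.ne']
              field_simp
          _ ≤ (x : ℝ) ^ (-(s.re - 3)) * (1 / (n : ℝ) ^ 2) := by
              gcongr ?_ * _
              exact Real.rpow_le_rpow_of_nonpos (by linarith) (by exact_mod_cast hxn.le) (by linarith)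
  · rw [mul_comm]
    gcongr
    nlinarith [Real.pi_lt_d2, Real.pi_pos]

variable (hD : Real.exp (Real.exp (Real.exp (10 ^ 6))) ≤ (D : ℝ)) (hq : q ∈ calQ D)
  (hψ : ψ ∈ PsiMod χ q)

include hD in
omit [NeZero D] in
theorem im_mem_of_abs_le {t : ℝ} (ht : |t - D| ≤ 2 + 10 * ell D + ell D ^ 2) :
    (D : ℝ) / 2 ≤ t ∧ t ≤ 2 * D := by
  have hL := le_ell hD
  have h1 : 2 + 10 * ell D + ell D ^ 2 ≤ ell D ^ 20 / 2 := by
    have e1 : ell D ^ 20 = ell D ^ 3 * ell D ^ 17 := by ring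
    have e2 : 1 ≤ ell D ^ 17 := one_le_pow₀ (by linarith)
    have e3 : ell D ^ 3 = ell D * ell D ^ 2 := by ring
    have e4 : ell D ^ 3 ≤ ell D ^ 20 := by rw [e1]; exact le_mul_of_one_le_right (by positivity) e2
    nlinarith
  have h2 : ell D ^ 20 ≤ D := by
    rw [← exp_ell hD]
    exact (ell_pow_le hD).trans (Real.exp_le_exp.mpr (by linarith))
  rw [abs_le] at ht
  have := cast_pos hD
  constructor <;> linarith [ht.1, ht.2]

include hq in
omit [NeZero D] [NeZero q] in
theorem ne_one_of_mem_calQ : q ≠ 1 := by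
  rintro rfl
  have h1 := hq.1
  have h2 : 1 ≤ Q D := Real.one_le_exp (sq_nonneg _)
  push_cast at h1
  linarith

include hD hq hψ

theorem norm_Delta1_le' {z : ℂ} (hz : |z.re - 1 / 2| ≤ 17)
    (hz' : |z.im - D| ≤ 2 + 10 * ell D + ell D ^ 2) :
    ‖Delta1 χ ψ z‖ ≤ Real.exp (-(2 * (z.re - 1 / 2) * ell D ^ 2) + 30 * |z.re - 1 / 2| * ell D) := by
  obtain ⟨h1, h2⟩ := im_mem_of_abs_le hD hz'
  have := norm_Delta1_le hD hq hψ hz h1 h2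
  have e : (1 / 2 : ℂ) + ((z.re - 1 / 2 : ℝ) : ℂ) + (z.im : ℂ) * I = z := by
    apply Complex.ext <;> simp
  rwa [e] at this

theorem norm_LL_le_of_half_le {z : ℂ} (hz : 1 / 2 ≤ z.re) (hz1 : z.re ≤ 14) (hz' : |z.im| ≤ 2 * D) :
    ‖LL χ ψ z‖ ≤ Real.exp (3 * ell D ^ 2) := by
  have hL := le_ell hD
  have hD6 := million_le_cast hD
  refine (norm_LL_le (ne_one_of_mem_calQ hq) hψ (by linarith : 0 < z.re)).trans ?_
  have h1 : ‖z‖ ≤ 3 * D := by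
    refine (norm_le_abs_re_add_abs_im z).trans ?_
    rw [abs_of_nonneg (by linarith : 0 ≤ z.re)]
    linarith
  have h2 : ‖z‖ / z.re ≤ 6 * D := by
    rw [div_le_iff₀ (by linarith)]
    nlinarith
  have h3 : (q : ℝ) ≤ 2 * Q D := hq.2.1.le
  calc (q : ℝ) ^ 2 * D * (‖z‖ / z.re) ^ 2 ≤ (2 * Q D) ^ 2 * D * (6 * D) ^ 2 := by gcongr
    _ = 144 * (Real.exp (ell D ^ 2) * Real.exp (ell D ^ 2) *
        (Real.exp (ell D) * Real.exp (ell D) * Real.exp (ell D))) := by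
        rw [Q, exp_ell hD]; ring
    _ ≤ Real.exp (ell D) * (Real.exp (ell D ^ 2) * Real.exp (ell D ^ 2) *
        (Real.exp (ell D) * Real.exp (ell D) * Real.exp (ell D))) := by
        gcongr
        rw [exp_ell hD]; linarith
    _ ≤ _ := by
        simp only [← Real.exp_add]
        apply Real.exp_le_exp.mpr
        nlinarith

variable (hreal : ∀ a : ZMod D, (χ a).im = 0)
include hreal

/-- To the left of the critical line the functional equation reflects the bound. Any fixed power of
`Q` is acceptable, as it only has to be beaten by the Gaussian on the horizontal sides. -/
theorem norm_LL_le_of_near {z : ℂ} (hz0 : -12 ≤ z.re) (hz1 : z.re ≤ 14)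
    (hz' : |z.im - D| ≤ 2 + 10 * ell D + ell D ^ 2) :
    ‖LL χ ψ z‖ ≤ Real.exp (30 * ell D ^ 2) := by
  have hL := le_ell hD
  obtain ⟨h1, h2⟩ := im_mem_of_abs_le hD hz'
  have hD6 := million_le_cast hD
  have him : |z.im| ≤ 2 * D := by rw [abs_of_nonneg (by linarith)]; exact h2
  rcases le_total (1 / 2) z.re with h | h
  · refine (norm_LL_le_of_half_le hD hq hψ h hz1 him).trans (Real.exp_le_exp.mpr ?_)
    nlinarith
  · have hΔ := norm_Delta1_le' hD hq hψ (z := z) (by rw [abs_le]; constructor <;> linarith) hz'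
    have hLL := norm_LL_le_of_half_le hD hq (inv_mem_PsiMod hreal hψ) (z := 1 - z)
      (by rw [sub_re, one_re]; linarith) (by rw [sub_re, one_re]; linarith) (by simpa using him)
    rw [LL_eq_Delta1_mul hreal hψ (by intro h0; rw [h0] at h1; linarith), norm_mul]
    refine (mul_le_mul hΔ hLL (norm_nonneg _) (Real.exp_pos _).le).trans ?_
    rw [← Real.exp_add]
    apply Real.exp_le_exp.mpr
    rw [abs_of_nonpos (by linarith)]
    nlinarith

set_option maxHeartbeats 4000000 in
-- The approximate functional equation. Far to the right the error differs from the polynomial over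
-- `w < n ≤ x` by the tail of the Dirichlet series beyond `x` and by the dual sum, which `|Δ₁| ≈
-- Q^{-2 Re}` makes small; far to the left the functional equation exchanges the two roles. The
-- kernel with `Λ = ℒ² = log Q` suppresses both remainders because `w` is below `Q` and `x` is above
-- it. What is left are polynomials in the sparse range, taken on lines at distance `α` from `s`,
-- where `exp(±Λα)` is bounded.
theorem norm_approxError_le {w x : ℕ} (hw : (w : ℝ) ≤ Real.exp (1 / 2 * ell D ^ 2))
    (hx0 : Real.exp (7 / 5 * ell D ^ 2) ≤ x) (hx : (x : ℝ) ≤ Real.exp (3 / 2 * ell D ^ 2)) {s : ℂ}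
    (hs1 : -1 / 100 ≤ s.re - 1 / 2) (hs2 : s.re - 1 / 2 ≤ 1)
    (hs3 : |s.im - D| ≤ 2 + 10 * ell D) :
    ‖approxError χ ψ w s‖ ≤ (∫ v : ℝ in -(ell D ^ 2)..ell D ^ 2,
      (3 * ‖dpoly (nu χ) ψ w x (s + ((alpha D : ℂ) + v * I))‖ +
        ‖Delta1 χ ψ (s + (((-alpha D : ℝ) : ℂ) + v * I)) *
          dpoly (nu χ) ψ⁻¹ w x (1 - (s + (((-alpha D : ℝ) : ℂ) + v * I)))‖) *
        (6 / (alpha D + |v|))) + 2 * Real.exp (-ell D) := by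
  have hα : alpha D = (ell D ^ 2)⁻¹ := rfl
  have hq1 := ne_one_of_mem_calQ hq
  set L := ell D with hLdef
  have hL := le_ell hD
  rw [← hLdef] at hL
  have hL0 : 0 < L := lt_of_lt_of_le (by norm_num) hL
  have hLL : 10 ^ 100 * L ≤ L ^ 2 := by nlinarith
  have hα0 : 0 < alpha D := by rw [hα]; positivity
  have hα1 : alpha D ≤ 1 := by
    rw [hα]; apply inv_le_one_of_one_le₀; nlinarith
  have hx0' : (0 : ℝ) < x := (Real.exp_pos _).trans_le hx0
  have hx1 : 1 ≤ x := by exact_mod_cast hx0'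
  have hwx : w ≤ x := by
    have : (w : ℝ) ≤ x := hw.trans ((Real.exp_le_exp.mpr (by nlinarith)).trans hx0)
    exact_mod_cast this
  have hna : ∀ n, ‖nu χ n‖ ≤ n := fun n => (norm_nu_le hreal n).trans (nuRe_le hreal n)
  have hnear : ∀ z : ℂ, |z.im| ≤ L ^ 2 → |(s + z).im - D| ≤ 2 + 10 * L + L ^ 2 := by
    intro z hz
    have e : (s + z).im - D = (s.im - D) + z.im := by rw [add_im]; ring
    rw [e]
    exact (abs_add_le _ _).trans (by linarith)
  have hne : ∀ z : ℂ, |z.im| ≤ L ^ 2 → (s + z).im ≠ 0 := by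
    intro z hz h0
    have h1 := (im_mem_of_abs_le hD (hnear z hz)).1
    have := million_le_cast hD
    rw [h0] at h1; linarith
  have himrect : ∀ {a b : ℝ} {z : ℂ}, z ∈ Set.Icc a b ×ℂ Set.Icc (-(L ^ 2)) (L ^ 2) →
      |z.im| ≤ L ^ 2 := fun hz => abs_le.mpr (mem_reProdIm.mp hz).2
  have hpow : ∀ (m : ℕ) (b c : ℝ), (m : ℝ) ≤ Real.exp (b * L ^ 2) → 0 ≤ c →
      (m : ℝ) ^ (c + 2) ≤ Real.exp (b * (c + 2) * L ^ 2) := by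
    intro m b c hm hc
    calc (m : ℝ) ^ (c + 2) ≤ (Real.exp (b * L ^ 2)) ^ (c + 2) := by gcongr
      _ = _ := by rw [← Real.exp_mul]; congr 1; ring
  have hp1 : ∀ (φ : DirichletCharacter ℂ q) (z : ℂ), -(25 / 2) ≤ z.re →
      ‖dpoly (nu χ) φ 0 w z‖ ≤ Real.exp (1 / 2 * (25 / 2 + 2) * L ^ 2) := fun φ z hz =>
    (norm_dpoly_le hna (by norm_num) hz).trans (hpow _ _ _ hw (by norm_num))
  have hp2 : ∀ (φ : DirichletCharacter ℂ q) (z : ℂ), -(25 / 2) ≤ z.re →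
      ‖dpoly (nu χ) φ w x z‖ ≤ Real.exp (3 / 2 * (25 / 2 + 2) * L ^ 2) := fun φ z hz =>
    (norm_dpoly_le hna (by norm_num) hz).trans (hpow _ _ _ hx (by norm_num))
  have htail : ∀ (φ : DirichletCharacter ℂ q) (z : ℂ), 3 ≤ z.re →
      ‖LL χ φ z - dpoly (nu χ) φ 0 x z‖ ≤ 2 * Real.exp (-(7 / 5 * (z.re - 3) * L ^ 2)) := by
    intro φ z hz
    refine (norm_LL_sub_dpoly_le hreal hx1 hz).trans ?_
    gcongr
    calc (x : ℝ) ^ (-(z.re - 3)) ≤ (Real.exp (7 / 5 * L ^ 2)) ^ (-(z.re - 3)) :=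
          Real.rpow_le_rpow_of_nonpos (Real.exp_pos _) hx0 (by linarith)
      _ = _ := by rw [← Real.exp_mul]; congr 1; ring
  have h35 : 3 * Real.exp (50 * L ^ 2) ≤ Real.exp (100 * L ^ 2) := by
    rw [show 100 * L ^ 2 = 50 * L ^ 2 + 50 * L ^ 2 by ring, Real.exp_add]
    gcongr
    have := Real.add_one_le_exp (50 * L ^ 2)
    nlinarith
  have hΔ0 : ∀ z : ℂ, -12 ≤ z.re → z.re ≤ 12 → |z.im| ≤ L ^ 2 →
      ‖Delta1 χ ψ (s + z)‖ ≤ Real.exp (27 * L ^ 2) := by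
    intro z h1 h2 h3
    have hx : |(s + z).re - 1 / 2| ≤ 13 := by
      rw [add_re, abs_le]; constructor <;> linarith
    refine (norm_Delta1_le' hD hq hψ (by linarith) (hnear z h3)).trans (Real.exp_le_exp.mpr ?_)
    have h4 := (abs_le.mp hx).1
    nlinarith [abs_nonneg ((s + z).re - 1 / 2)]
  have hre1 : ∀ z : ℂ, (1 - (s + z)).re = 1 - s.re - z.re := by
    intro z; rw [sub_re, add_re, one_re]; ring
  have hdiffinv : ∀ z : ℂ, DifferentiableAt ℂ (fun z => dpoly (nu χ) ψ⁻¹ w x (1 - (s + z))) z :=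
    fun z => DifferentiableAt.comp (g := dpoly (nu χ) ψ⁻¹ w x) (f := fun z => 1 - (s + z)) z
      (differentiable_dpoly _) (by fun_prop)
  have hdiffΔ : ∀ z : ℂ, |z.im| ≤ L ^ 2 → DifferentiableAt ℂ (fun z => Delta1 χ ψ (s + z)) z :=
    fun z hz => DifferentiableAt.comp (g := Delta1 χ ψ) (f := fun z => s + z) z
      (differentiableAt_Delta1 (hne z hz)) (by fun_prop)
  -- Exponents in units of `ℒ²`. At `+12` the remainder must be below `-13`: the tail beyond `x ≥
  -- Q^{7/5}` gives about `-7/5 · 9.5`, and the dual sum about `-24 + 7.25`. At `-12` it must be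
  -- below `11`: the reflected tail gives about `24 - 13.3`, and the short sum `7.25`. The height
  -- `ℒ²` yields the factor `exp(-ℒ⁴)` on the horizontal sides.
  have hker := norm_le_of_kern (f := fun z => approxError χ ψ w (s + z))
    (A := fun z => dpoly (nu χ) ψ w x (s + z))
    (A' := fun z => Delta1 χ ψ (s + z) * dpoly (nu χ) ψ⁻¹ w x (1 - (s + z)))
    (κ := alpha D) (c := 12) (T := L ^ 2)
    (Λ := L ^ 2) (δ := Real.exp (-(L ^ 2))) (M := Real.exp (100 * L ^ 2))
    hα0 hα1 (by linarith) (by positivity) (by positivity)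
    (fun z hz => (DifferentiableAt.comp (g := approxError χ ψ w) (f := fun z => s + z) z
      (differentiableAt_approxError hq1 hψ (hne z (himrect hz))) (by fun_prop)).differentiableWithinAt)
    (differentiable_dpoly.comp (differentiable_id.const_add s)).differentiableOn
    (fun z hz => ((hdiffΔ z (himrect hz)).mul (hdiffinv z)).differentiableWithinAt)
    (by
      intro v hv
      have hv' : |(((12 : ℝ) : ℂ) + v * I).im| ≤ L ^ 2 := by simpa using abs_le.mpr hv
      set z : ℂ := ((12 : ℝ) : ℂ) + v * I with hz
      have hzr : z.re = 12 := by simp [hz]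
      have e : approxError χ ψ w (s + z) - dpoly (nu χ) ψ w x (s + z) =
          (LL χ ψ (s + z) - dpoly (nu χ) ψ 0 x (s + z)) -
            Delta1 χ ψ (s + z) * dpoly (nu χ) ψ⁻¹ 0 w (1 - (s + z)) := by
        rw [approxError, ← dpoly_add (Nat.zero_le w) hwx]; ring
      rw [e]
      have hsz : (s + z).re = s.re + 12 := by rw [add_re, hzr]
      have b1 := htail ψ (s + z) (by rw [hsz]; linarith)
      have b2 := norm_Delta1_le' hD hq hψ (z := s + z)
        (by rw [hsz, abs_le]; constructor <;> linarith) (hnear z hv')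
      have b3 := hp1 ψ⁻¹ (1 - (s + z)) (by rw [hre1, hzr]; linarith)
      refine (norm_sub_le _ _).trans ?_
      rw [norm_mul]
      have b4 := mul_le_mul b2 b3 (norm_nonneg _) (Real.exp_pos _).le
      rw [← Real.exp_add, hsz, abs_of_nonneg (by linarith)] at b4
      rw [hsz] at b1
      have c1 : Real.exp (-(7 / 5 * (s.re + 12 - 3) * L ^ 2)) ≤ Real.exp (-2) * Real.exp (-(13 * L ^ 2)) := by
        rw [← Real.exp_add]; apply Real.exp_le_exp.mpr; nlinarith
      have c2 := b4.trans (show _ ≤ Real.exp (-2) * Real.exp (-(13 * L ^ 2)) by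
        rw [← Real.exp_add]; apply Real.exp_le_exp.mpr
        rw [← hLdef]
        nlinarith)
      have c3 : Real.exp (-2) ≤ 1 / 3 := by
        rw [Real.exp_neg, inv_le_comm₀ (Real.exp_pos _) (by norm_num)]
        norm_num
        linarith [Real.add_one_le_exp 2]
      have c4 : Real.exp (-(L ^ 2)) * Real.exp (-(L ^ 2 * 12)) = Real.exp (-(13 * L ^ 2)) := by
        rw [← Real.exp_add]; congr 1; ring
      rw [c4]
      nlinarith [Real.exp_pos (-(13 * L ^ 2))])
    (by
      intro v hv
      have hv' : |(((-12 : ℝ) : ℂ) + v * I).im| ≤ L ^ 2 := by simpa using abs_le.mpr hv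
      set z : ℂ := ((-12 : ℝ) : ℂ) + v * I with hz
      have hzr : z.re = -12 := by simp [hz]
      have e : approxError χ ψ w (s + z) - Delta1 χ ψ (s + z) * dpoly (nu χ) ψ⁻¹ w x (1 - (s + z)) =
          Delta1 χ ψ (s + z) * (LL χ ψ⁻¹ (1 - (s + z)) - dpoly (nu χ) ψ⁻¹ 0 x (1 - (s + z))) -
            dpoly (nu χ) ψ 0 w (s + z) := by
        rw [approxError, ← dpoly_add (ψ := ψ⁻¹) (Nat.zero_le w) hwx,
          LL_eq_Delta1_mul hreal hψ (hne z hv')]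
        ring
      rw [e]
      have hsz : (s + z).re = s.re - 12 := by rw [add_re, hzr]; ring
      have hsz' : (1 - (s + z)).re = 13 - s.re := by rw [hre1, hzr]; ring
      have b1 := htail ψ⁻¹ (1 - (s + z)) (by rw [hsz']; linarith)
      have b2 := norm_Delta1_le' hD hq hψ (z := s + z)
        (by rw [hsz, abs_le]; constructor <;> linarith) (hnear z hv')
      have b3 := hp1 ψ (s + z) (by rw [hsz]; linarith)
      refine (norm_sub_le _ _).trans ?_
      rw [norm_mul]
      have b4 := mul_le_mul b2 b1 (norm_nonneg _) (Real.exp_pos _).le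
      rw [hsz, hsz', abs_of_nonpos (by linarith), mul_left_comm, ← Real.exp_add] at b4
      have c0 : Real.exp (-2) * Real.exp (11 * L ^ 2) = Real.exp (11 * L ^ 2 - 2) := by
        rw [← Real.exp_add]; congr 1; ring
      have c1 := b3.trans (show _ ≤ Real.exp (-2) * Real.exp (11 * L ^ 2) by
        rw [c0]; apply Real.exp_le_exp.mpr; nlinarith)
      have c2 := b4.trans (show _ ≤ 2 * (Real.exp (-2) * Real.exp (11 * L ^ 2)) by
        rw [c0]
        gcongr
        rw [← hLdef]
        nlinarith)
      have c3 : Real.exp (-2) ≤ 1 / 3 := by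
        rw [Real.exp_neg, inv_le_comm₀ (Real.exp_pos _) (by norm_num)]
        norm_num
        linarith [Real.add_one_le_exp 2]
      have c4 : Real.exp (-(L ^ 2)) * Real.exp (L ^ 2 * 12) = Real.exp (11 * L ^ 2) := by
        rw [← Real.exp_add]; congr 1; ring
      rw [c4]
      nlinarith [Real.exp_pos (11 * L ^ 2)])
    (by
      intro z hz
      obtain ⟨hz1, hz2⟩ := (mem_reProdIm.mp hz).1
      have hz3 := himrect hz
      have b1 := norm_LL_le_of_near hD hq hψ hreal (z := s + z) (by rw [add_re]; linarith)
        (by rw [add_re]; linarith) (hnear z hz3)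
      have b2 := hp1 ψ (s + z) (by rw [add_re]; linarith)
      have b3 := hp1 ψ⁻¹ (1 - (s + z)) (by rw [hre1]; linarith)
      have b4 := mul_le_mul (hΔ0 z hz1 hz2 hz3) b3 (norm_nonneg _) (Real.exp_pos _).le
      rw [← Real.exp_add, ← norm_mul] at b4
      have c1 := b1.trans (Real.exp_le_exp.mpr (by rw [← hLdef]; nlinarith : _ ≤ 50 * L ^ 2))
      have c2 := b2.trans (Real.exp_le_exp.mpr (by nlinarith : _ ≤ 50 * L ^ 2))
      have c3 := b4.trans (Real.exp_le_exp.mpr (by nlinarith : _ ≤ 50 * L ^ 2))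
      refine (norm_sub_le _ _).trans ?_
      have := norm_sub_le (LL χ ψ (s + z)) (dpoly (nu χ) ψ 0 w (s + z))
      linarith)
    (by
      intro z hz
      obtain ⟨hz1, hz2⟩ := (mem_reProdIm.mp hz).1
      have b2 := hp2 ψ (s + z) (by rw [add_re]; linarith)
      exact b2.trans (Real.exp_le_exp.mpr (by nlinarith)))
    (by
      intro z hz
      obtain ⟨hz1, hz2⟩ := (mem_reProdIm.mp hz).1
      have b3 := hp2 ψ⁻¹ (1 - (s + z)) (by rw [hre1]; linarith)
      have b4 := mul_le_mul (hΔ0 z hz1 (by linarith) (himrect hz)) b3 (norm_nonneg _)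
        (Real.exp_pos _).le
      rw [← Real.exp_add, ← norm_mul] at b4
      exact b4.trans (Real.exp_le_exp.mpr (by nlinarith)))
  have t1 : 4 * L ^ 2 * Real.exp (-(L ^ 2)) * Real.exp ((12 : ℝ) ^ 2) / 12 ≤ Real.exp (-L) := by
    have h1 : L ≤ Real.exp L := by linarith [Real.add_one_le_exp L]
    calc 4 * L ^ 2 * Real.exp (-(L ^ 2)) * Real.exp ((12 : ℝ) ^ 2) / 12 =
          (L * L / 3) * (Real.exp (-(L ^ 2)) * Real.exp ((12 : ℝ) ^ 2)) := by ring
      _ ≤ (Real.exp L * Real.exp L) * (Real.exp (-(L ^ 2)) * Real.exp ((12 : ℝ) ^ 2)) := by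
          gcongr
          have := mul_le_mul h1 h1 hL0.le (Real.exp_pos _).le
          nlinarith
      _ ≤ _ := by
          rw [← Real.exp_add, ← Real.exp_add, ← Real.exp_add]
          apply Real.exp_le_exp.mpr
          nlinarith
  have t2 : 8 * 12 * Real.exp (100 * L ^ 2) * Real.exp ((12 : ℝ) ^ 2 - (L ^ 2) ^ 2 + L ^ 2 * 12) / L ^ 2 ≤
      Real.exp (-L) := by
    rw [div_le_iff₀ (by positivity)]
    calc 8 * 12 * Real.exp (100 * L ^ 2) * Real.exp ((12 : ℝ) ^ 2 - (L ^ 2) ^ 2 + L ^ 2 * 12) =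
          96 * Real.exp (100 * L ^ 2 + ((12 : ℝ) ^ 2 - (L ^ 2) ^ 2 + L ^ 2 * 12)) := by
          rw [Real.exp_add (100 * L ^ 2)]; ring
      _ ≤ L ^ 2 * Real.exp (-L) := by
          gcongr
          · nlinarith
          · nlinarith
      _ = _ := mul_comm _ _
  have hpi : 1 ≤ 2 * Real.pi := by linarith [Real.pi_gt_three]
  have h0 : ‖approxError χ ψ w s‖ ≤ 2 * Real.pi * ‖approxError χ ψ w (s + 0)‖ := by
    rw [add_zero]
    exact le_mul_of_one_le_left (norm_nonneg _) hpi
  have hΛκ : L ^ 2 * alpha D = 1 := by rw [hα]; field_simp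
  rw [hΛκ] at hker
  have hcA : Continuous fun v : ℝ => dpoly (nu χ) ψ w x (s + ((alpha D : ℂ) + v * I)) :=
    differentiable_dpoly.continuous.comp (by fun_prop)
  have hcA' : ContinuousOn (fun v : ℝ => Delta1 χ ψ (s + (((-alpha D : ℝ) : ℂ) + v * I)) *
      dpoly (nu χ) ψ⁻¹ w x (1 - (s + (((-alpha D : ℝ) : ℂ) + v * I)))) (Set.uIcc (-(L ^ 2)) (L ^ 2)) := by
    intro v hv
    rw [Set.uIcc_of_le (by nlinarith)] at hv
    have hz : |((((-alpha D : ℝ) : ℂ) + v * I)).im| ≤ L ^ 2 := by simpa using abs_le.mpr hv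
    have hd := ((hdiffΔ _ hz).mul (hdiffinv _)).continuousAt
    exact (ContinuousAt.comp (f := fun v : ℝ => (((-alpha D : ℝ) : ℂ) + v * I)) hd
      (by fun_prop)).continuousWithinAt
  have hck := (continuous_div_add_abs hα0 6).continuousOn (s := Set.uIcc (-(L ^ 2)) (L ^ 2))
  have h1 : (∫ v : ℝ in -(L ^ 2)..L ^ 2,
      (Real.exp 1 * ‖dpoly (nu χ) ψ w x (s + ((alpha D : ℂ) + v * I))‖ +
      Real.exp (-1) * ‖Delta1 χ ψ (s + (((-alpha D : ℝ) : ℂ) + v * I)) *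
        dpoly (nu χ) ψ⁻¹ w x (1 - (s + (((-alpha D : ℝ) : ℂ) + v * I)))‖) * (6 / (alpha D + |v|))) ≤
      ∫ v : ℝ in -(L ^ 2)..L ^ 2, (3 * ‖dpoly (nu χ) ψ w x (s + ((alpha D : ℂ) + v * I))‖ +
        ‖Delta1 χ ψ (s + (((-alpha D : ℝ) : ℂ) + v * I)) *
          dpoly (nu χ) ψ⁻¹ w x (1 - (s + (((-alpha D : ℝ) : ℂ) + v * I)))‖) *
        (6 / (alpha D + |v|)) := by
    refine intervalIntegral.integral_mono_on (by nlinarith)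
      (ContinuousOn.intervalIntegrable
        (((hcA.norm.continuousOn.const_mul _).add (hcA'.norm.const_mul _)).mul hck))
      (ContinuousOn.intervalIntegrable
        (((hcA.norm.continuousOn.const_mul _).add hcA'.norm).mul hck)) fun v _ => ?_
    have e1 : Real.exp 1 ≤ 3 := by linarith [Real.exp_one_lt_d9]
    have e2 : Real.exp (-1) ≤ 1 := Real.exp_le_one_iff.mpr (by norm_num)
    gcongr
    exact mul_le_of_le_one_left (norm_nonneg _) e2
  linarith

end ApproximateFunctionalEquation

/-! ### The characters for which (I3) fails -/

theorem sq_le_of_le_add {a b c d n : ℝ} (hn : 0 ≤ n) (h : n ≤ a + 2 * d + b + c) :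
    n ^ 2 ≤ 4 * a ^ 2 + 4 * b ^ 2 + 4 * c ^ 2 + 16 * d ^ 2 := by
  have h5 : n ^ 2 ≤ (a + 2 * d + b + c) ^ 2 := by gcongr
  nlinarith [sq_nonneg (a - b), sq_nonneg (a - c), sq_nonneg (b - c), sq_nonneg (a - 2 * d),
    sq_nonneg (b - 2 * d), sq_nonneg (c - 2 * d)]

theorem sq_three_mul_add_le (a b : ℝ) : (3 * a + b) ^ 2 ≤ 18 * a ^ 2 + 2 * b ^ 2 := by
  nlinarith [sq_nonneg (3 * a - b)]

section ThirdInequality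

variable {D : ℕ} (hD : Real.exp (Real.exp (Real.exp (10 ^ 6))) ≤ (D : ℝ))
include hD

theorem exp_add_le_mul_rpow {c b : ℝ} (hb : b ≤ 13) :
    Real.exp (c * Real.log (ell D) + b) ≤ 10 ^ 6 * ell D ^ c := by
  rw [Real.exp_add, Real.rpow_def_of_pos (ell_pos hD), mul_comm, mul_comm c]
  gcongr
  calc Real.exp b ≤ Real.exp 13 := Real.exp_le_exp.mpr hb
    _ = Real.exp 1 ^ 13 := by rw [← Real.exp_nat_mul]; norm_num
    _ ≤ 2.72 ^ 13 := by gcongr; linarith [Real.exp_one_lt_d9]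
    _ ≤ 10 ^ 6 := by norm_num

theorem alpha_mul_sq : alpha D * ell D ^ 2 = 1 := by
  have := ell_pos hD
  rw [alpha]; field_simp

theorem alpha_pos : 0 < alpha D := by
  have := ell_pos hD
  rw [alpha]; positivity

/-- On the lines used for (I3) the distance to the critical line is `O(α log ℒ)`. -/
theorem neg_mul_sq_le {σ : ℝ} (hσ : -(1 / 10 * alpha D * Real.log (ell D) + 3 * alpha D) ≤ σ) :
    -σ * ell D ^ 2 ≤ 1 / 10 * Real.log (ell D) + 3 := by
  have h1 := alpha_mul_sq hD
  have h2 : 0 ≤ ell D ^ 2 := sq_nonneg _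
  have h3 := mul_le_mul_of_nonneg_right (neg_le.mp hσ) h2
  calc -σ * ell D ^ 2 ≤ (1 / 10 * alpha D * Real.log (ell D) + 3 * alpha D) * ell D ^ 2 := h3
    _ = (1 / 10 * Real.log (ell D) + 3) * (alpha D * ell D ^ 2) := by ring
    _ = _ := by rw [h1, mul_one]

omit hD in
theorem log_mem_of_le {n : ℕ} (hn : 0 < n) (hn2 : (n : ℝ) ≤ Real.exp (3 / 2 * ell D ^ 2)) :
    0 ≤ Real.log n ∧ Real.log n ≤ 3 / 2 * ell D ^ 2 :=
  ⟨Real.log_nonneg (by exact_mod_cast hn),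
    (Real.log_le_iff_le_exp (by exact_mod_cast hn)).mpr hn2⟩

/-- At distance `α log ℒ / 10` to the left, `n ≤ Q^{3/2}` gives `n^{-2σ} ≤ Q^{3|σ|}`, about
`ℒ^{3/10}`; this is what fixes the width of `Ω₂`. -/
theorem rpow_neg_two_mul_le {σ : ℝ}
    (hσ : -(1 / 10 * alpha D * Real.log (ell D) + 3 * alpha D) ≤ σ) {n : ℕ} (hn : 0 < n)
    (hn2 : (n : ℝ) ≤ Real.exp (3 / 2 * ell D ^ 2)) :
    (n : ℝ) ^ (-(2 * σ)) ≤ 10 ^ 6 * ell D ^ (3 / 10 : ℝ) := by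
  obtain ⟨h1, h2⟩ := log_mem_of_le hn hn2
  have h3 := neg_mul_sq_le hD hσ
  have hl := le_log_ell hD
  rw [Real.rpow_def_of_pos (by exact_mod_cast hn)]
  refine le_trans (Real.exp_le_exp.mpr ?_) (exp_add_le_mul_rpow hD (c := 3 / 10) (b := 9) (by norm_num))
  rcases le_total 0 σ with h | h
  · have : Real.log n * -(2 * σ) ≤ 0 := by nlinarith
    linarith
  · have : Real.log n * -(2 * σ) ≤ 3 / 2 * ell D ^ 2 * -(2 * σ) :=
      mul_le_mul_of_nonneg_right h2 (by linarith)
    linarith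

/-- The `O(ℒ)` error in the logarithmic derivative of `Δ₁` contributes only a constant factor here,
because `|σ|` is `O(log ℒ / ℒ²)` on the left side. -/
theorem neg_mul_ell_le {σ : ℝ} (hσ : -(1 / 10 * alpha D * Real.log (ell D) + 3 * alpha D) ≤ σ) :
    60 * (-σ) * ell D ≤ 1 := by
  have hL := le_ell hD
  have hL0 := ell_pos hD
  have h3 := neg_mul_sq_le hD hσ
  have hl := le_log_ell hD
  have h4 := Real.log_le_sub_one_of_pos (x := Real.sqrt (ell D)) (by positivity)
  rw [Real.log_sqrt hL0.le] at h4
  have h5 := Real.mul_self_sqrt hL0.le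
  have h6 : (10 : ℝ) ^ 50 ≤ Real.sqrt (ell D) := by
    apply Real.le_sqrt_of_sq_le
    rw [← pow_mul]; exact hL
  have h7 : 60 * (-σ * ell D ^ 2) ≤ ell D := by
    have : 60 * (1 / 10 * Real.log (ell D) + 3) ≤ ell D := by nlinarith
    linarith
  have h8 : 60 * (-σ) * ell D * ell D ≤ 1 * ell D := by linarith [h7]
  exact le_of_mul_le_mul_right h8 hL0

/-- Here `|Δ₁|² ≈ Q^{-4σ}`. For `σ < 0` the worst case is `n = 1` and gives `ℒ^{4/10}`; for `σ > 0`
the factor `n^{2σ} ≤ Q^{3σ}` is outweighed by `Q^{-4σ}`. -/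
theorem dual_factor_le {σ : ℝ}
    (hσ : -(1 / 10 * alpha D * Real.log (ell D) + 3 * alpha D) ≤ σ) {n : ℕ} (hn : 0 < n)
    (hn2 : (n : ℝ) ≤ Real.exp (3 / 2 * ell D ^ 2)) :
    Real.exp (-(2 * σ * ell D ^ 2) + 30 * |σ| * ell D) ^ 2 * (n : ℝ) ^ (2 * σ) ≤
      10 ^ 6 * ell D ^ (4 / 10 : ℝ) := by
  obtain ⟨h1, h2⟩ := log_mem_of_le hn hn2
  have h3 := neg_mul_sq_le hD hσ
  have h4 := neg_mul_ell_le hD hσ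
  have hl := le_log_ell hD
  have hL := le_ell hD
  rw [Real.rpow_def_of_pos (by exact_mod_cast hn), ← Real.exp_nat_mul, ← Real.exp_add]
  refine le_trans (Real.exp_le_exp.mpr ?_)
    (exp_add_le_mul_rpow hD (c := 4 / 10) (b := 13) le_rfl)
  push_cast
  rcases le_total 0 σ with h | h
  · rw [abs_of_nonneg h]
    have e1 : Real.log n * (2 * σ) ≤ 3 / 2 * ell D ^ 2 * (2 * σ) :=
      mul_le_mul_of_nonneg_right h2 (by linarith)
    have e2 : 0 ≤ σ * (ell D * (ell D - 60)) :=
      mul_nonneg h (mul_nonneg (by linarith) (by linarith))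
    nlinarith
  · rw [abs_of_nonpos h]
    have e1 : Real.log n * (2 * σ) ≤ 0 := mul_nonpos_of_nonneg_of_nonpos h1 (by linarith)
    linarith

/-- For `n ≥ Q^{1/2}` and `σ < 0` the factor `n^{2σ}` saves `ℒ^{1/10}`. The saving later pays for
the `log² ℒ` produced by the smoothing kernel. -/
theorem dual_factor_le_of_le {σ : ℝ}
    (hσ : -(1 / 10 * alpha D * Real.log (ell D) + 3 * alpha D) ≤ σ) {n : ℕ}
    (hn : Real.exp (1 / 2 * ell D ^ 2) ≤ n) (hn2 : (n : ℝ) ≤ Real.exp (3 / 2 * ell D ^ 2)) :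
    Real.exp (-(2 * σ * ell D ^ 2) + 30 * |σ| * ell D) ^ 2 * (n : ℝ) ^ (2 * σ) ≤
      10 ^ 6 * ell D ^ (3 / 10 : ℝ) := by
  have hn0 : (0 : ℝ) < n := (Real.exp_pos _).trans_le hn
  have h1 : 1 / 2 * ell D ^ 2 ≤ Real.log n := (Real.le_log_iff_exp_le hn0).mpr hn
  have h2 := (log_mem_of_le (by exact_mod_cast hn0) hn2).2
  have h3 := neg_mul_sq_le hD hσ
  have h4 := neg_mul_ell_le hD hσ
  have hl := le_log_ell hD
  have hL := le_ell hD
  rw [Real.rpow_def_of_pos hn0, ← Real.exp_nat_mul, ← Real.exp_add]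
  refine le_trans (Real.exp_le_exp.mpr ?_)
    (exp_add_le_mul_rpow hD (c := 3 / 10) (b := 13) le_rfl)
  push_cast
  rcases le_total 0 σ with h | h
  · rw [abs_of_nonneg h]
    have e1 : Real.log n * (2 * σ) ≤ 3 / 2 * ell D ^ 2 * (2 * σ) :=
      mul_le_mul_of_nonneg_right h2 (by linarith)
    have e2 : 0 ≤ σ * (ell D * (ell D - 60)) :=
      mul_nonneg h (mul_nonneg (by linarith) (by linarith))
    nlinarith
  · rw [abs_of_nonpos h]
    have e1 : Real.log n * (2 * σ) ≤ 1 / 2 * ell D ^ 2 * (2 * σ) :=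
      mul_le_mul_of_nonpos_right h1 (by linarith)
    linarith

variable [NeZero D] {χ : DirichletCharacter ℂ D} (hreal : ∀ a : ZMod D, (χ a).im = 0)
  {P : Finset (Σ q : ℕ+, DirichletCharacter ℂ (q : ℕ))} (hP : ∀ y ∈ P, y ∈ Psi χ)
include hreal hP

omit hD [NeZero D] in
theorem sum_normSq_nu_tail_le {w x : ℕ} (hx : (x : ℝ) ≤ Q D ^ 2) {s : ℂ} {C S : ℝ}
    (hC : ∀ n ∈ Finset.Ioc w x, (n : ℝ) ^ (1 - 2 * s.re) ≤ C) (hC0 : 0 ≤ C)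
    (hS : ∑ n ∈ Finset.Ioc w x, nuRe χ n ^ 2 / n ≤ S) :
    ∑ y ∈ P, ‖dpoly (nu χ) y.2 w x s‖ ^ 2 ≤ 200 * Q D ^ 2 * (C * S) :=
  (sum_normSq_dpoly_le hP (norm_nu_le hreal) hx hC).trans (by gcongr)

/-- Because `ν` is real, the dual polynomial is the conjugate of the direct one at the reflected
point, and the bound for `Δ₁` is uniform in `ψ`; the large sieve then applies as in the direct case.
-/
theorem sum_normSq_dual_le {w x : ℕ} (hx : (x : ℝ) ≤ Q D ^ 2) {s : ℂ} {C S : ℝ}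
    (hs : |s.re - 1 / 2| ≤ 17) (hs' : |s.im - D| ≤ 2 + 10 * ell D + ell D ^ 2)
    (hC : ∀ n ∈ Finset.Ioc w x, Real.exp (-(2 * (s.re - 1 / 2) * ell D ^ 2) +
      30 * |s.re - 1 / 2| * ell D) ^ 2 * (n : ℝ) ^ (2 * (s.re - 1 / 2)) ≤ C) (hC0 : 0 ≤ C)
    (hS : ∑ n ∈ Finset.Ioc w x, nuRe χ n ^ 2 / n ≤ S) :
    ∑ y ∈ P, ‖Delta1 χ y.2 s * dpoly (nu χ) y.2⁻¹ w x (1 - s)‖ ^ 2 ≤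
      200 * Q D ^ 2 * (C * S) := by
  set E := Real.exp (-(2 * (s.re - 1 / 2) * ell D ^ 2) + 30 * |s.re - 1 / 2| * ell D) with hE
  have hE0 : 0 < E := Real.exp_pos _
  have hre : (starRingEnd ℂ (1 - s)).re = 1 / 2 - (s.re - 1 / 2) := by simp; ring
  have h1 := sum_normSq_nu_tail_le hreal hP hx (s := starRingEnd ℂ (1 - s)) (C := C / E ^ 2)
    (w := w) (fun n hn => by
      rw [hre, le_div_iff₀ (by positivity), mul_comm,
        show 1 - 2 * (1 / 2 - (s.re - 1 / 2)) = 2 * (s.re - 1 / 2) by ring]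
      exact hC n hn) (by positivity) hS
  calc _ ≤ ∑ y ∈ P, E ^ 2 * ‖dpoly (nu χ) y.2 w x (starRingEnd ℂ (1 - s))‖ ^ 2 := by
        refine Finset.sum_le_sum fun y hy => ?_
        have hconj : ∀ n, starRingEnd ℂ (nu χ n) = nu χ n := fun n => by
          rw [nu_eq hreal, conj_ofReal]
        rw [norm_mul, dpoly_inv hconj, RCLike.norm_conj, mul_pow]
        gcongr
        exact norm_Delta1_le' hD (hP y hy).1 (hP y hy).2 hs hs'
    _ ≤ E ^ 2 * (200 * Q D ^ 2 * (C / E ^ 2 * S)) := by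
        rw [← Finset.mul_sum]; gcongr
    _ = _ := by field_simp

variable (hχ : χ ≠ 1) (hA1 : A1 χ)
include hχ hA1

set_option maxHeartbeats 1600000 in
-- The approximation of length `D⁵` differs from that of length `w ≈ Q^{1/2}` by a direct and a dual
-- polynomial over `D⁵ < n ≤ w`, estimated at the point itself. Beyond `w` the smoothed formula is
-- used. Every polynomial involved lives where `∑ ν(n)²/n` is `O(ℒ⁻¹³/log ℒ)`, and the largest
-- weight is `ℒ^{4/10}`.
theorem sum_normSq_LL_sub_calF_le {s : ℂ}
    (hs1 : -(1 / 10 * alpha D * Real.log (ell D) + alpha D) ≤ s.re - 1 / 2)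
    (hs2 : s.re - 1 / 2 ≤ 1) (hs3 : |s.im - D| ≤ 2 + 10 * ell D) :
    ∑ y ∈ P, ‖LL χ y.2 s - calF χ y.2 s‖ ^ 2 ≤
      10 ^ 19 * Q D ^ 2 * (ell D ^ (4 / 10 : ℝ) * ((ell D ^ 13)⁻¹ * (Real.log (ell D))⁻¹)) := by
  have hα0 := alpha_pos hD
  have hαL := alpha_mul_sq hD
  set L := ell D with hLdef
  set l := Real.log L with hl_def
  have hL := le_ell hD
  rw [← hLdef] at hL
  have hl := le_log_ell hD
  rw [← hLdef, ← hl_def] at hl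
  have hL0 : 0 < L := lt_of_lt_of_le (by norm_num) hL
  have hl0 : 0 < l := lt_of_lt_of_le (by norm_num) hl
  have hlL : l ≤ L := log_ell_le hD
  have hLL : 10 ^ 100 * L ≤ L ^ 2 := by nlinarith
  have hα1 : alpha D ≤ 1 := by
    rw [alpha]; apply inv_le_one_of_one_le₀; rw [← hLdef]; nlinarith
  set w := ⌊Real.exp (1 / 2 * L ^ 2)⌋₊ with hw
  set x := ⌊Real.exp (3 / 2 * L ^ 2)⌋₊ with hx
  have hw2 : (w : ℝ) ≤ Real.exp (1 / 2 * L ^ 2) := Nat.floor_le (Real.exp_pos _).le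
  have hw1 := Nat.lt_floor_add_one (Real.exp (1 / 2 * L ^ 2))
  rw [← hw] at hw1
  have hx2 : (x : ℝ) ≤ Real.exp (3 / 2 * L ^ 2) := Nat.floor_le (Real.exp_pos _).le
  have hfloor : ∀ a b : ℝ, 1 ≤ b → 0 ≤ a → Real.exp a ≤ (⌊Real.exp (a + b)⌋₊ : ℝ) := by
    intro a b hb ha
    have h1 := Nat.lt_floor_add_one (Real.exp (a + b))
    have h2 : 2 * Real.exp a ≤ Real.exp (a + b) := by
      rw [Real.exp_add, mul_comm]
      gcongr
      linarith [Real.add_one_le_exp b]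
    have h3 := Real.one_le_exp ha
    linarith
  have hx1 : Real.exp (7 / 5 * L ^ 2) ≤ x := by
    have := hfloor (7 / 5 * L ^ 2) (1 / 10 * L ^ 2) (by nlinarith) (by positivity)
    rwa [show 7 / 5 * L ^ 2 + 1 / 10 * L ^ 2 = 3 / 2 * L ^ 2 by ring] at this
  have hwN : Real.exp (23 / 10 * L) ≤ w := by
    have := hfloor (23 / 10 * L) (1 / 2 * L ^ 2 - 23 / 10 * L) (by nlinarith) (by positivity)
    rwa [show 23 / 10 * L + (1 / 2 * L ^ 2 - 23 / 10 * L) = 1 / 2 * L ^ 2 by ring] at this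
  have hN := cast_pow_five_eq_exp hD
  rw [← hLdef] at hN
  have hNw : D ^ 5 ≤ w := by
    have := hfloor (5 * L) (1 / 2 * L ^ 2 - 5 * L) (by nlinarith) (by positivity)
    rw [show 5 * L + (1 / 2 * L ^ 2 - 5 * L) = 1 / 2 * L ^ 2 by ring, ← hN] at this
    exact_mod_cast this
  have hN23 : Real.exp (23 / 10 * L) ≤ (D ^ 5 : ℕ) := by
    rw [hN]; exact Real.exp_le_exp.mpr (by linarith)
  have hQ2 : Q D ^ 2 = Real.exp (2 * L ^ 2) := by
    rw [Q, ← Real.exp_nat_mul]; norm_num; rfl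
  have hxQ : (x : ℝ) ≤ Q D ^ 2 := by
    rw [hQ2]; exact hx2.trans (Real.exp_le_exp.mpr (by nlinarith))
  have hwQ : (w : ℝ) ≤ Q D ^ 2 := by
    rw [hQ2]; exact hw2.trans (Real.exp_le_exp.mpr (by nlinarith))
  have hw32 : (w : ℝ) ≤ Real.exp (3 / 2 * L ^ 2) := hw2.trans (Real.exp_le_exp.mpr (by nlinarith))
  have hS1 := sum_nuRe_sq_div_tail_le hD hreal hχ hA1 hwN (x := x) (by rw [← hLdef, ← hQ2]; exact hxQ)
  have hS2 := sum_nuRe_sq_div_tail_le hD hreal hχ hA1 hN23 (x := w) (by rw [← hLdef, ← hQ2]; exact hwQ)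
  rw [← hLdef, ← hl_def] at hS1 hS2
  set V := (L ^ 13)⁻¹ * l⁻¹ with hV
  have hV0 : 0 < V := by positivity
  have e480 : 1480 * (L ^ 13)⁻¹ * l⁻¹ = 1480 * V := by rw [hV]; ring
  rw [e480] at hS1 hS2
  set u3 := L ^ (3 / 10 : ℝ) with hu3
  set u4 := L ^ (4 / 10 : ℝ) with hu4
  have hu30 : 0 < u3 := by positivity
  have hu40 : 0 < u4 := by positivity
  -- The gap between the exponents `3/10` and `4/10` absorbs the squared logarithm of the kernel
  -- integral.
  have hu34 : u3 * l ^ 2 ≤ u4 := by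
    have h1 : l ^ 2 ≤ L ^ (1 / 10 : ℝ) := by
      calc l ^ 2 ≤ l ^ 20 := pow_le_pow_right₀ (by linarith) (by norm_num)
        _ ≤ L ^ (1 / 100 : ℝ) := log_ell_pow_le hD
        _ ≤ _ := Real.rpow_le_rpow_of_exponent_le (by linarith) (by norm_num)
    calc u3 * l ^ 2 ≤ u3 * L ^ (1 / 10 : ℝ) := by gcongr
      _ = u4 := by rw [hu3, hu4, ← Real.rpow_add hL0]; norm_num
  have hu34' : u3 ≤ u4 := Real.rpow_le_rpow_of_exponent_le (by linarith) (by norm_num)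
  have hu41 : 1 ≤ u4 := Real.one_le_rpow (by linarith) (by norm_num)
  set θ := 1 / 10 * alpha D * l with hθ
  have hθα : θ + 3 * alpha D ≤ 1 / 100 := by
    have e : (θ + 3 * alpha D) * L ^ 2 = 1 / 10 * l + 3 := by
      have : (θ + 3 * alpha D) * L ^ 2 = (1 / 10 * l + 3) * (alpha D * L ^ 2) := by rw [hθ]; ring
      rw [this, hαL, mul_one]
    have h2 : 0 < L ^ 2 := by positivity
    by_contra hcon
    push Not at hcon
    have := mul_lt_mul_of_pos_right hcon h2
    linarith
  -- mean squares of the two direct terms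
  have hB1 := sum_normSq_nu_tail_le hreal hP hwQ (s := s) (w := D ^ 5) (C := 10 ^ 6 * u3)
    (fun n hn => by
      obtain ⟨h1, h2⟩ := Finset.mem_Ioc.mp hn
      have := rpow_neg_two_mul_le hD (σ := s.re - 1 / 2) (by linarith) (n := n) (by omega)
        (le_trans (by exact_mod_cast h2) hw32)
      rwa [show -(2 * (s.re - 1 / 2)) = 1 - 2 * s.re by ring] at this) (by positivity) hS2
  have hnear : ∀ v : ℝ, |v| ≤ L ^ 2 → |s.im + v - D| ≤ 2 + 10 * L + L ^ 2 := by
    intro v hv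
    have e : s.im + v - D = (s.im - D) + v := by ring
    rw [e]
    exact (abs_add_le _ _).trans (by linarith)
  have hB2 := sum_normSq_dual_le hD hreal hP hwQ (s := s) (w := D ^ 5) (C := 10 ^ 6 * u4)
    (by rw [abs_le]; constructor <;> linarith)
    (hs3.trans (by rw [← hLdef]; nlinarith))
    (fun n hn => by
      obtain ⟨h1, h2⟩ := Finset.mem_Ioc.mp hn
      exact dual_factor_le hD (σ := s.re - 1 / 2) (by linarith) (n := n) (by omega)
        (le_trans (by exact_mod_cast h2) hw32)) (by positivity) hS2
  -- mean square of the integrands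
  set κ := alpha D with hκ
  have hJ := sum_sq_integral_mul_le P (T := L ^ 2)
    (a := fun y v => 3 * ‖dpoly (nu χ) y.2 w x (s + ((κ : ℂ) + (v : ℂ) * I))‖ +
        ‖Delta1 χ y.2 (s + (((-κ : ℝ) : ℂ) + (v : ℂ) * I)) *
          dpoly (nu χ) y.2⁻¹ w x (1 - (s + (((-κ : ℝ) : ℂ) + (v : ℂ) * I)))‖)
    (k := fun v => 6 / (κ + |v|)) (M := 20 * (200 * Q D ^ 2 * (10 ^ 6 * u3 * (1480 * V))))
    (by positivity)
    (fun y hy => by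
      have hc1 : Continuous fun v : ℝ => dpoly (nu χ) y.2 w x (s + ((κ : ℂ) + v * I)) :=
        differentiable_dpoly.continuous.comp (by fun_prop)
      have hc2 : Continuous fun v : ℝ =>
          dpoly (nu χ) y.2⁻¹ w x (1 - (s + (((-κ : ℝ) : ℂ) + v * I))) :=
        differentiable_dpoly.continuous.comp (by fun_prop)
      have hc3 : ContinuousOn (fun v : ℝ => Delta1 χ y.2 (s + (((-κ : ℝ) : ℂ) + v * I)))
          (Set.Icc (-(L ^ 2)) (L ^ 2)) := by
        intro v hv
        have h1 := (im_mem_of_abs_le hD (hnear v (abs_le.mpr hv))).1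
        have h2 := million_le_cast hD
        have him : (s + (((-κ : ℝ) : ℂ) + v * I)).im ≠ 0 := by
          have : (s + (((-κ : ℝ) : ℂ) + v * I)).im = s.im + v := by simp
          rw [this]
          linarith
        exact (ContinuousAt.comp (f := fun v : ℝ => s + (((-κ : ℝ) : ℂ) + v * I))
          (differentiableAt_Delta1 him).continuousAt (by fun_prop)).continuousWithinAt
      exact (hc1.norm.continuousOn.const_mul _).add (hc3.mul hc2.continuousOn).norm)
    (continuous_div_add_abs hα0 6).continuousOn (fun v => by positivity)
    (fun v hv => by
      have hz1 : (s + ((κ : ℂ) + v * I)).re = s.re + κ := by simp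
      have hz2 : (s + (((-κ : ℝ) : ℂ) + v * I)).re = s.re - κ := by simp; ring
      have hz3 : (s + (((-κ : ℝ) : ℂ) + v * I)).im = s.im + v := by simp
      have hA := sum_normSq_nu_tail_le hreal hP hxQ (s := s + ((κ : ℂ) + v * I)) (w := w)
        (C := 10 ^ 6 * u3)
        (fun n hn => by
          obtain ⟨h1, h2⟩ := Finset.mem_Ioc.mp hn
          have := rpow_neg_two_mul_le hD (σ := s.re + κ - 1 / 2) (by linarith) (n := n) (by omega)
            (le_trans (by exact_mod_cast h2) hx2)
          rw [hz1]
          rwa [show -(2 * (s.re + κ - 1 / 2)) = 1 - 2 * (s.re + κ) by ring] at this)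
        (by positivity) hS1
      have hA' := sum_normSq_dual_le hD hreal hP hxQ (s := s + (((-κ : ℝ) : ℂ) + v * I)) (w := w)
        (C := 10 ^ 6 * u3)
        (by rw [hz2, abs_le]; constructor <;> linarith)
        (by rw [hz3]; exact hnear v (abs_le.mpr hv))
        (fun n hn => by
          obtain ⟨h1, h2⟩ := Finset.mem_Ioc.mp hn
          rw [hz2]
          refine dual_factor_le_of_le hD (σ := s.re - κ - 1 / 2) (by linarith) (n := n) ?_
            (le_trans (by exact_mod_cast h2) hx2)
          refine hw1.le.trans ?_
          exact_mod_cast h1)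
        (by positivity) hS1
      calc _ ≤ ∑ y ∈ P, (18 * ‖dpoly (nu χ) y.2 w x (s + ((κ : ℂ) + v * I))‖ ^ 2 +
            2 * ‖Delta1 χ y.2 (s + (((-κ : ℝ) : ℂ) + v * I)) *
              dpoly (nu χ) y.2⁻¹ w x (1 - (s + (((-κ : ℝ) : ℂ) + v * I)))‖ ^ 2) := by
            exact Finset.sum_le_sum fun y _ => sq_three_mul_add_le _ _
        _ ≤ _ := by
            rw [Finset.sum_add_distrib, ← Finset.mul_sum, ← Finset.mul_sum]
            linarith)
  rw [integral_div_add_abs hα0 (by positivity)] at hJ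
  have hlog : Real.log ((κ + L ^ 2) / κ) ≤ 5 * l := by
    rw [hl_def, ← Real.log_rpow hL0]
    apply Real.log_le_log (by positivity)
    have : (κ + L ^ 2) / κ = 1 + L ^ 4 := by
      rw [hκ, alpha, ← hLdef]; field_simp
    rw [this, show (5 : ℝ) = (5 : ℕ) by norm_num, Real.rpow_natCast]
    have : 1 ≤ L ^ 4 := one_le_pow₀ (by linarith)
    nlinarith
  have hlog0 : 0 ≤ Real.log ((κ + L ^ 2) / κ) := Real.log_nonneg (by
    rw [le_div_iff₀ hα0]; nlinarith)
  -- assembling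
  have hpt : ∀ y ∈ P, ‖LL χ y.2 s - calF χ y.2 s‖ ^ 2 ≤
      4 * (∫ v : ℝ in -(L ^ 2)..L ^ 2,
        (3 * ‖dpoly (nu χ) y.2 w x (s + ((κ : ℂ) + v * I))‖ +
        ‖Delta1 χ y.2 (s + (((-κ : ℝ) : ℂ) + v * I)) *
          dpoly (nu χ) y.2⁻¹ w x (1 - (s + (((-κ : ℝ) : ℂ) + v * I)))‖) * (6 / (κ + |v|))) ^ 2 +
      4 * ‖dpoly (nu χ) y.2 (D ^ 5) w s‖ ^ 2 +
      4 * ‖Delta1 χ y.2 s * dpoly (nu χ) y.2⁻¹ (D ^ 5) w (1 - s)‖ ^ 2 +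
      16 * Real.exp (-L) ^ 2 := by
    intro y hy
    have h1 := norm_approxError_le hD (hP y hy).1 (hP y hy).2 hreal hw2 hx1 hx2 (s := s)
      (by linarith) hs2 hs3
    rw [← hLdef, ← hκ] at h1
    have h2 : ‖LL χ y.2 s - calF χ y.2 s‖ ≤ ‖approxError χ y.2 w s‖ +
        ‖dpoly (nu χ) y.2 (D ^ 5) w s‖ +
        ‖Delta1 χ y.2 s * dpoly (nu χ) y.2⁻¹ (D ^ 5) w (1 - s)‖ := by
      rw [LL_sub_calF, approxError_eq_add hNw]
      refine (norm_add_le _ _).trans ?_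
      have := norm_add_le (dpoly (nu χ) y.2 (D ^ 5) w s)
        (Delta1 χ y.2 s * dpoly (nu χ) y.2⁻¹ (D ^ 5) w (1 - s))
      linarith
    have h3 := h2.trans (add_le_add_left (add_le_add_left h1 _) _)
    exact sq_le_of_le_add (norm_nonneg _) h3
  refine (Finset.sum_le_sum hpt).trans ?_
  rw [Finset.sum_add_distrib, Finset.sum_add_distrib, Finset.sum_add_distrib, ← Finset.mul_sum,
    ← Finset.mul_sum, ← Finset.mul_sum, Finset.sum_const, nsmul_eq_mul]
  have hcard := card_le_mul_sq hP
  have hQ0 : 0 < Q D ^ 2 := pow_pos (Real.exp_pos _) 2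
  have k1 : 20 * (200 * Q D ^ 2 * (10 ^ 6 * u3 * (1480 * V))) *
      (2 * 6 * Real.log ((κ + L ^ 2) / κ)) ^ 2 ≤
      3 * 10 ^ 16 * (Q D ^ 2 * (u4 * V)) := by
    calc _ ≤ 20 * (200 * Q D ^ 2 * (10 ^ 6 * u3 * (1480 * V))) * (2 * 6 * (5 * l)) ^ 2 := by
          gcongr
      _ = 20 * 200 * 10 ^ 6 * 1480 * 3600 * (Q D ^ 2 * (u3 * l ^ 2 * V)) := by ring
      _ ≤ 3 * 10 ^ 16 * (Q D ^ 2 * (u4 * V)) := 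
          mul_le_mul (by norm_num) (by gcongr) (by positivity) (by norm_num)
  have k2 : 200 * Q D ^ 2 * (10 ^ 6 * u3 * (1480 * V)) ≤ 3 * 10 ^ 11 * (Q D ^ 2 * (u4 * V)) := by
    calc _ = 200 * 10 ^ 6 * 1480 * (Q D ^ 2 * (u3 * V)) := by ring
      _ ≤ 3 * 10 ^ 11 * (Q D ^ 2 * (u4 * V)) := 
          mul_le_mul (by norm_num) (by gcongr) (by positivity) (by norm_num)
  have k3 : 200 * Q D ^ 2 * (10 ^ 6 * u4 * (1480 * V)) ≤ 3 * 10 ^ 11 * (Q D ^ 2 * (u4 * V)) := by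
    calc _ = 200 * 10 ^ 6 * 1480 * (Q D ^ 2 * (u4 * V)) := by ring
      _ ≤ 3 * 10 ^ 11 * (Q D ^ 2 * (u4 * V)) := 
          mul_le_mul (by norm_num) (by gcongr) (by positivity) (by norm_num)
  have k4 : (P.card : ℝ) * (16 * Real.exp (-L) ^ 2) ≤ 3200 * (Q D ^ 2 * (u4 * V)) := by
    have h1 : Real.exp (-L) ^ 2 ≤ u4 * V := by
      have h2 : Real.exp (-L) ^ 2 ≤ V := by
        rw [← Real.exp_nat_mul, hV, ← mul_inv]
        push_cast
        rw [show (2 : ℝ) * -L = -(2 * L) by ring, Real.exp_neg]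
        apply inv_anti₀ (by positivity)
        calc L ^ 13 * l ≤ L ^ 13 * L := by gcongr
          _ = L ^ 14 := by ring
          _ ≤ L ^ 20 := pow_le_pow_right₀ (by linarith) (by norm_num)
          _ ≤ Real.exp (L / 100) := ell_pow_le hD
          _ ≤ _ := Real.exp_le_exp.mpr (by linarith)
      nlinarith
    calc _ ≤ 200 * Q D ^ 2 * (16 * (u4 * V)) := by gcongr
      _ = _ := by ring
  have k5 : 0 < Q D ^ 2 * (u4 * V) := by positivity
  linarith

omit hD [NeZero D] hreal hP hχ hA1 in
theorem mem_Omega2_rect {s : ℂ} (hs : s ∈ Omega2 D) :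
    (1 / 2 - 1 / 10 * alpha D * Real.log (ell D) - alpha D) + alpha D ≤ s.re ∧
      s.re + alpha D ≤ 1 + alpha D ∧
      ((D : ℝ) - 1 - 10 * ell D - alpha D) + alpha D ≤ s.im ∧
      s.im + alpha D ≤ D + 1 + 10 * ell D + alpha D := by
  obtain ⟨h1, h2, h3⟩ := hs
  have e1 : (s - s0 D).re = s.re - 1 / 2 := by simp [s0]
  have e2 : (s - s0 D).im = s.im - D := by simp [s0]
  rw [e1] at h1 h2
  rw [e2, abs_lt] at h3
  refine ⟨?_, ?_, ?_, ?_⟩ <;> linarith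

open Classical in
-- Cauchy's formula at distance `α = ℒ⁻²` over a perimeter `O(ℒ)` costs `ℒ³`. Since `3 + 4/10 - 13 =
-- -48/5`, the powers of `ℒ` match the squared threshold `ℒ^{-48/5}` exactly, and the exceptional
-- proportion is `O(1/log ℒ)`: the factor `(log log D)⁻¹` of (A1) is what decides.
theorem card_not_I3_le : ((P.filter fun y => ¬ I3 χ y.2).card : ℝ) ≤ Q D ^ 2 / 1000 := by
  have hα0 := alpha_pos hD
  have hαL := alpha_mul_sq hD
  have hL := le_ell hD
  have hL0 := ell_pos hD
  have hl := le_log_ell hD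
  have hlL := log_ell_le hD
  have hl0 : 0 < Real.log (ell D) := lt_of_lt_of_le (by norm_num) hl
  set θ := 1 / 10 * alpha D * Real.log (ell D) with hθ
  have hθ0 : 0 ≤ θ := by positivity
  have hα1 : alpha D ≤ 1 / 10 := by
    rw [alpha, inv_le_comm₀ (by positivity) (by norm_num)]; nlinarith
  have hθα : θ ≤ 1 := by
    have h1 : alpha D * Real.log (ell D) ≤ alpha D * ell D ^ 2 := by
      gcongr; nlinarith
    rw [hαL] at h1
    rw [hθ]; linarith
  have hD6 := million_le_cast hD
  set B := ell D ^ (-(24 / 5) : ℝ) / 2 with hB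
  have hB0 : 0 < B := by positivity
  set V := (ell D ^ 13)⁻¹ * (Real.log (ell D))⁻¹ with hV
  set u4 := ell D ^ (4 / 10 : ℝ) with hu4
  have hu40 : 0 < u4 := by positivity
  have h := card_exceed_le P (g := fun y s => (LL χ y.2 s - calF χ y.2 s) ^ 2) (Ω := Omega2 D)
    (δ := alpha D) (B := B ^ 2) (M := 10 ^ 19 * Q D ^ 2 * (u4 * V)) hα0
    (a := 1 / 2 - θ - alpha D) (b := 1 + alpha D)
    (c := (D : ℝ) - 1 - 10 * ell D - alpha D) (d := D + 1 + 10 * ell D + alpha D)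
    (by linarith) (by linarith)
    (fun s hs => mem_Omega2_rect hs)
    (fun y hy s hs => by
      have h1 := (mem_reProdIm.mp hs).2
      have h2 := (im_mem_of_abs_le hD (t := s.im)
        (by rw [abs_le]; constructor <;> nlinarith [h1.1, h1.2])).1
      have him : s.im ≠ 0 := by
        intro h0; rw [h0] at h2; linarith
      have hd := differentiableAt_approxError (ne_one_of_mem_calQ (hP y hy).1) (hP y hy).2 (w := D ^ 5)
        him
      have e : (fun s => (LL χ y.2 s - calF χ y.2 s) ^ 2) =
          fun s => approxError χ y.2 (D ^ 5) s ^ 2 := by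
        funext s; rw [LL_sub_calF]
      rw [e]
      exact (hd.pow 2).differentiableWithinAt)
    (fun s hs => by
      simp only [norm_pow]
      obtain ⟨h1, h2⟩ := mem_reProdIm.mp hs
      refine sum_normSq_LL_sub_calF_le hD hreal hP hχ hA1 (by linarith [h1.1]) (by linarith [h1.2]) ?_
      rw [abs_le]; constructor <;> linarith [h2.1, h2.2])
  have e : (P.filter fun y => ¬ ∀ s ∈ Omega2 D, ‖(LL χ y.2 s - calF χ y.2 s) ^ 2‖ ≤ B ^ 2) =
      P.filter fun y => ¬ ∀ s ∈ Omega2 D, ‖LL χ y.2 s - calF χ y.2 s‖ ≤ B := by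
    refine Finset.filter_congr fun y _ => ?_
    simp only [norm_pow]
    simp_rw [pow_le_pow_iff_left₀ (norm_nonneg _) hB0.le two_ne_zero]
  rw [e] at h
  have hsub : (P.filter fun y => ¬ I3 χ y.2) ⊆
      P.filter fun y => ¬ ∀ s ∈ Omega2 D, ‖LL χ y.2 s - calF χ y.2 s‖ ≤ B :=
    Finset.monotone_filter_right _ fun y _ hy hcon => hy ⟨B, half_lt_self (by positivity), hcon⟩
  have hK := (Nat.cast_le (α := ℝ)).mpr (Finset.card_le_card hsub)
  set K := ((P.filter fun y => ¬ ∀ s ∈ Omega2 D, ‖LL χ y.2 s - calF χ y.2 s‖ ≤ B).card : ℝ) with hKdef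
  have hB2 : B ^ 2 = u4 * (ell D ^ 10)⁻¹ / 4 := by
    have : (ell D ^ (-(24 / 5) : ℝ)) ^ 2 = u4 * (ell D ^ 10)⁻¹ := by
      rw [hu4, ← Real.rpow_natCast, ← Real.rpow_mul hL0.le, ← Real.rpow_natCast (ell D) 10,
        ← Real.rpow_neg hL0.le, ← Real.rpow_add hL0]
      norm_num
    rw [hB, div_pow, this]; norm_num
  have hper : (1 + alpha D - (1 / 2 - θ - alpha D)) +
      ((D + 1 + 10 * ell D + alpha D) - ((D : ℝ) - 1 - 10 * ell D - alpha D)) ≤ 50 * ell D := by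
    linarith
  have hαinv : (alpha D)⁻¹ = ell D ^ 2 := by rw [alpha, inv_inv]
  have h3 : K * B ^ 2 ≤ ell D ^ 2 * (50 * ell D) * (10 ^ 19 * Q D ^ 2 * (u4 * V)) := by
    rw [hαinv] at h
    exact h.trans (by gcongr)
  have h4 : K ≤ 200 * 10 ^ 19 * (Q D ^ 2 * (Real.log (ell D))⁻¹) := by
    have e1 : ell D ^ 2 * (50 * ell D) * (10 ^ 19 * Q D ^ 2 * (u4 * V)) =
        (200 * 10 ^ 19 * (Q D ^ 2 * (Real.log (ell D))⁻¹)) * B ^ 2 := by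
      rw [hB2, hV]; field_simp; ring
    rw [e1] at h3
    exact le_of_mul_le_mul_right h3 (by positivity)
  have h5 : (Real.log (ell D))⁻¹ ≤ (10 ^ 100)⁻¹ := inv_anti₀ (by norm_num) hl
  have h6 : Q D ^ 2 * (Real.log (ell D))⁻¹ ≤ Q D ^ 2 * (10 ^ 100)⁻¹ := by gcongr
  have h7 : 0 ≤ Q D ^ 2 := by positivity
  linarith

end ThirdInequality

/-! ### The number of characters in the family -/

section FactorsThrough

theorem FactorsThrough.mul_inv {n d : ℕ} {ψ η : DirichletCharacter ℂ n} (h : ψ.FactorsThrough d)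
    (h' : η.FactorsThrough d) : (ψ * η⁻¹).FactorsThrough d := by
  obtain ⟨hd, a, rfl⟩ := h
  obtain ⟨_, b, rfl⟩ := h'
  exact ⟨hd, a * b⁻¹, by rw [map_mul, map_inv]⟩

variable {n : ℕ} [NeZero n]

theorem exists_prime_factorsThrough {ψ : DirichletCharacter ℂ n} (h : ¬ ψ.IsPrimitive) :
    ∃ p ∈ n.primeFactors, ψ.FactorsThrough (n / p) := by
  obtain ⟨k, hk⟩ := ψ.conductor_dvd_level
  have hn : n ≠ 0 := NeZero.ne n
  have hk1 : k ≠ 1 := by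
    rintro rfl
    exact h (by rw [isPrimitive_def]; omega)
  obtain ⟨p, hp, hpk⟩ := Nat.exists_prime_and_dvd hk1
  have hpn : p ∣ n := hk ▸ hpk.mul_left _
  refine ⟨p, Nat.mem_primeFactors.mpr ⟨hp, hpn, hn⟩, ?_⟩
  refine (mem_conductorSet_iff_conductor_dvd _ (Nat.div_dvd_of_dvd hpn)).mpr ?_
  obtain ⟨j, rfl⟩ := hpk
  have : n / p = ψ.conductor * j := by
    apply Nat.div_eq_of_eq_mul_left hp.pos
    rw [mul_assoc, mul_comm j p]; exact hk
  exact this ▸ Dvd.intro _ rfl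

/-- A set of characters whose quotients all have modulus `d` has at most `φ(d)` elements. -/
theorem ncard_le_totient {d : ℕ} (hd : d ∣ n) (T : Set (DirichletCharacter ℂ n))
    (h : ∀ a ∈ T, ∀ b ∈ T, (a * b⁻¹).FactorsThrough d) : T.ncard ≤ d.totient := by
  have : NeZero d := ⟨fun h0 => NeZero.ne n (Nat.eq_zero_of_zero_dvd (h0 ▸ hd))⟩
  rcases T.eq_empty_or_nonempty with rfl | ⟨b, hb⟩
  · simp
  have hsub : T ⊆ (fun a => changeLevel hd a * b) '' Set.univ := by
    intro a ha
    obtain ⟨_, c, hc⟩ := h a ha b hb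
    exact ⟨c, trivial, by dsimp only; rw [← hc]; simp⟩
  calc T.ncard ≤ ((fun a => changeLevel hd a * b) '' Set.univ).ncard :=
        Set.ncard_le_ncard hsub (Set.toFinite _)
    _ ≤ (Set.univ : Set (DirichletCharacter ℂ d)).ncard := Set.ncard_image_le (Set.toFinite _)
    _ = d.totient := by
      rw [Set.ncard_univ, card_eq_totient_of_hasEnoughRootsOfUnity]

end FactorsThrough

section Count

variable {D : ℕ} [NeZero D] {χ : DirichletCharacter ℂ D}

/-- If `q` divided `[q,D]/p`, then `ψ` and hence `χ` would factor through `[q,D]/p`. Primitivity of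
`χ` would force `D`, and so `[q,D]`, to divide `[q,D]/p`, which is absurd. In particular `p` divides
`q`. -/
theorem exists_prime_twist_factorsThrough (hprim : χ.IsPrimitive) {q : ℕ} [NeZero q]
    {ψ : DirichletCharacter ℂ q} (h : ¬ (twist χ ψ).IsPrimitive) :
    ∃ p ∈ q.primeFactors, ¬ q ∣ Nat.lcm q D / p ∧
      (twist χ ψ).FactorsThrough (Nat.lcm q D / p) := by
  obtain ⟨p, hp, hf⟩ := exists_prime_factorsThrough h
  have hpp := Nat.prime_of_mem_primeFactors hp
  have hpm := Nat.dvd_of_mem_primeFactors hp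
  have hm0 : Nat.lcm q D ≠ 0 := NeZero.ne _
  have hnd : ¬ q ∣ Nat.lcm q D / p := by
    intro hq
    have h1 : (changeLevel (Nat.dvd_lcm_left q D) ψ).FactorsThrough (Nat.lcm q D / p) :=
      FactorsThrough.mono _ (changeLevel_factorsThrough ψ _) hq (Nat.div_dvd_of_dvd hpm)
    have h2 := FactorsThrough.mul_inv hf h1
    have h3 : twist χ ψ * (changeLevel (Nat.dvd_lcm_left q D) ψ)⁻¹ =
        changeLevel (Nat.dvd_lcm_right q D) χ := by
      rw [twist, DirichletCharacter.mul]
      exact mul_inv_cancel_comm _ _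
    rw [h3] at h2
    have h4 := conductor_dvd_of_mem_conductorSet _ h2
    rw [conductor_changeLevel, (isPrimitive_def χ).mp hprim] at h4
    have h5 := Nat.le_of_dvd (Nat.div_pos (Nat.le_of_dvd (Nat.pos_of_ne_zero hm0) hpm) hpp.pos)
      (Nat.lcm_dvd hq h4)
    exact absurd h5 (not_le.mpr (Nat.div_lt_self (Nat.pos_of_ne_zero hm0) hpp.one_lt))
  refine ⟨p, ?_, hnd, hf⟩
  rw [Nat.mem_primeFactors]
  refine ⟨hpp, ?_, NeZero.ne q⟩
  by_contra hpq
  apply hnd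
  have hc : Nat.Coprime q p := ((Nat.Prime.coprime_iff_not_dvd hpp).mpr hpq).symm
  refine hc.dvd_of_dvd_mul_right ?_
  rw [Nat.div_mul_cancel hpm]
  exact Nat.dvd_lcm_left q D

/-- In the quotient of two such twists `χ` cancels, so the conductor of `a b⁻¹` divides both `q` and
`[q,D]/p`. It must divide `q/p`, since otherwise `q` itself would divide `[q,D]/p`. The count
therefore reduces to quotients of modulus `q/p`. -/
theorem ncard_twist_factorsThrough_le {q : ℕ} [NeZero q] {p : ℕ} (hp : p ∈ q.primeFactors)
    (hnd : ¬ q ∣ Nat.lcm q D / p) :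
    {ψ : DirichletCharacter ℂ q | (twist χ ψ).FactorsThrough (Nat.lcm q D / p)}.ncard ≤
      (q / p).totient := by
  have hpp := Nat.prime_of_mem_primeFactors hp
  have hpq := Nat.dvd_of_mem_primeFactors hp
  refine ncard_le_totient (Nat.div_dvd_of_dvd hpq) _ fun a ha b hb => ?_
  have h1 := FactorsThrough.mul_inv ha hb
  have h2 : twist χ a * (twist χ b)⁻¹ = changeLevel (Nat.dvd_lcm_left q D) (a * b⁻¹) := by
    rw [twist, twist, DirichletCharacter.mul, DirichletCharacter.mul, map_mul, map_inv, mul_inv]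
    rw [mul_mul_mul_comm, mul_inv_cancel, mul_one]
  rw [h2] at h1
  have h4 := conductor_dvd_of_mem_conductorSet _ h1
  rw [conductor_changeLevel] at h4
  refine (mem_conductorSet_iff_conductor_dvd _ (Nat.div_dvd_of_dvd hpq)).mpr ?_
  have hq0 : q ≠ 0 := NeZero.ne q
  obtain ⟨k, hk⟩ := (a * b⁻¹).conductor_dvd_level
  obtain ⟨j, hj⟩ := hpq
  have hpk : p ∣ k := by
    by_contra hpk
    apply hnd
    have hc : Nat.Coprime p k := (Nat.Prime.coprime_iff_not_dvd hpp).mpr hpk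
    have hpm : p ∣ Nat.lcm q D := (Nat.dvd_of_mem_primeFactors hp).trans (Nat.dvd_lcm_left q D)
    refine (Nat.dvd_div_iff_mul_dvd hpm).mpr ?_
    have h5 : Nat.lcm ((a * b⁻¹).conductor * p) ((a * b⁻¹).conductor * k) ∣ Nat.lcm q D := by
      refine Nat.lcm_dvd ?_ (hk ▸ Nat.dvd_lcm_left q D)
      rw [mul_comm]
      exact (Nat.dvd_div_iff_mul_dvd hpm).mp h4
    rw [Nat.lcm_mul_left, hc.lcm_eq_mul] at h5
    have h6 : p * q = (a * b⁻¹).conductor * (p * k) := 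
      (congrArg (p * ·) hk).trans (by ring)
    rwa [h6]
  obtain ⟨i, rfl⟩ := hpk
  refine ⟨i, Nat.div_eq_of_eq_mul_left hpp.pos ?_⟩
  rw [mul_assoc, mul_comm i p]; exact hk

/-- A character outside `Ψ_q` fails for a prime `p ∣ q`: either it, or its twist, drops to the
modulus divided by `p`. Each alternative accounts for at most `φ(q/p)` characters, hence the factor
2. -/
theorem totient_le_ncard_add (hprim : χ.IsPrimitive) (q : ℕ) [NeZero q] :
    q.totient ≤ (PsiMod χ q).ncard + 2 * ∑ p ∈ q.primeFactors, (q / p).totient := by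
  classical
  set A : ℕ → Set (DirichletCharacter ℂ q) := fun p => {ψ | ψ.FactorsThrough (q / p)} with hA
  set B : ℕ → Set (DirichletCharacter ℂ q) := fun p =>
    {ψ | ¬ q ∣ Nat.lcm q D / p ∧ (twist χ ψ).FactorsThrough (Nat.lcm q D / p)} with hB
  have hsub : (Set.univ : Set (DirichletCharacter ℂ q)) ⊆
      PsiMod χ q ∪ ⋃ p ∈ q.primeFactors, (A p ∪ B p) := by
    intro ψ _
    by_cases h1 : ψ.IsPrimitive
    · by_cases h2 : (twist χ ψ).IsPrimitive
      · exact Or.inl ⟨h1, h2⟩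
      · obtain ⟨p, hp, h3⟩ := exists_prime_twist_factorsThrough hprim h2
        exact Or.inr (Set.mem_biUnion hp (Or.inr h3))
    · obtain ⟨p, hp, h3⟩ := exists_prime_factorsThrough h1
      exact Or.inr (Set.mem_biUnion hp (Or.inl h3))
  have hcard : q.totient = (Set.univ : Set (DirichletCharacter ℂ q)).ncard := by
    rw [Set.ncard_univ, card_eq_totient_of_hasEnoughRootsOfUnity]
  rw [hcard]
  refine (Set.ncard_le_ncard hsub (Set.toFinite _)).trans ((Set.ncard_union_le _ _).trans ?_)
  gcongr
  refine (Finset.set_ncard_biUnion_le _ _).trans ?_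
  rw [Finset.mul_sum]
  refine Finset.sum_le_sum fun p hp => (Set.ncard_union_le _ _).trans ?_
  have hA1 : (A p).ncard ≤ (q / p).totient :=
    ncard_le_totient (Nat.div_dvd_of_dvd (Nat.dvd_of_mem_primeFactors hp)) _
      fun a ha b hb => FactorsThrough.mul_inv ha hb
  have hB1 : (B p).ncard ≤ (q / p).totient := by
    by_cases h : q ∣ Nat.lcm q D / p
    · have : B p = ∅ := by ext; simp [hB, h]
      simp [this]
    · exact (Set.ncard_le_ncard (fun ψ hψ => hψ.2) (Set.toFinite _)).trans
        (ncard_twist_factorsThrough_le hp h)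
  omega

/-- The union bound for the integers coprime to `q`. -/
theorem sub_sum_le_totient (q : ℕ) (hq : q ≠ 0) :
    (q : ℝ) * (1 - ∑ p ∈ q.primeFactors, (1 : ℝ) / p) ≤ q.totient := by
  have h1 : Finset.range q ⊆ (Finset.range q).filter (q.Coprime ·) ∪
      q.primeFactors.biUnion fun p => (Finset.range q).filter (p ∣ ·) := by
    intro a ha
    by_cases h : q.Coprime a
    · exact Finset.mem_union_left _ (Finset.mem_filter.mpr ⟨ha, h⟩)
    · obtain ⟨p, hp, hpq, hpa⟩ := Nat.Prime.not_coprime_iff_dvd.mp h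
      refine Finset.mem_union_right _ (Finset.mem_biUnion.mpr ⟨p, ?_, Finset.mem_filter.mpr ⟨ha, hpa⟩⟩)
      exact Nat.mem_primeFactors.mpr ⟨hp, hpq, hq⟩
  have h2 := (Finset.card_le_card h1).trans (Finset.card_union_le _ _)
  have h3 : (q.primeFactors.biUnion fun p => (Finset.range q).filter (p ∣ ·)).card ≤
      ∑ p ∈ q.primeFactors, q / p := by
    refine Finset.card_biUnion_le.trans (Finset.sum_le_sum fun p hp => ?_)
    have hpq := Nat.dvd_of_mem_primeFactors hp
    have hpp := Nat.prime_of_mem_primeFactors hp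
    have : (Finset.range q).filter (p ∣ ·) ⊆ (Finset.range (q / p)).image (· * p) := by
      intro a ha
      obtain ⟨ha1, j, rfl⟩ := Finset.mem_filter.mp ha
      refine Finset.mem_image.mpr ⟨j, ?_, mul_comm _ _⟩
      rw [Finset.mem_range] at ha1 ⊢
      exact (Nat.lt_div_iff_mul_lt' hpq j).mpr ha1
    simpa using (Finset.card_le_card this).trans Finset.card_image_le
  rw [Finset.card_range] at h2
  have h4 : (q : ℝ) ≤ q.totient + ∑ p ∈ q.primeFactors, (q : ℝ) / p := by
    have h5 : q ≤ q.totient + ∑ p ∈ q.primeFactors, q / p := by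
      refine h2.trans (add_le_add (le_of_eq rfl) h3)
    have h6 : (q : ℝ) ≤ (q.totient : ℝ) + ∑ p ∈ q.primeFactors, ((q / p : ℕ) : ℝ) := by
      exact_mod_cast h5
    refine h6.trans (add_le_add_right (Finset.sum_le_sum fun p _ => Nat.cast_div_le) _)
  rw [mul_sub, Finset.mul_sum, mul_one]
  simp only [mul_one_div]
  linarith

theorem sub_sum_le_ncard_PsiMod (hprim : χ.IsPrimitive) (q : ℕ) [NeZero q] :
    (q : ℝ) * (1 - 3 * ∑ p ∈ q.primeFactors, (1 : ℝ) / p) ≤ (PsiMod χ q).ncard := by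
  have h1 := sub_sum_le_totient q (NeZero.ne q)
  have h2 : (q.totient : ℝ) ≤
      (PsiMod χ q).ncard + 2 * ∑ p ∈ q.primeFactors, ((q / p).totient : ℝ) := by
    exact_mod_cast totient_le_ncard_add hprim q
  have h3 : ∑ p ∈ q.primeFactors, ((q / p).totient : ℝ) ≤
      q * ∑ p ∈ q.primeFactors, (1 : ℝ) / p := by
    rw [Finset.mul_sum]
    refine Finset.sum_le_sum fun p _ => ?_
    rw [mul_one_div]
    exact (Nat.cast_le.mpr (Nat.totient_le _)).trans Nat.cast_div_le
  linarith

/-! ### Averaging over an arithmetic progression -/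

/-- If some `6k + 1` is divisible by `m`, then `m` is coprime to 6 and the admissible `k` form a
single class mod `m`; otherwise there is nothing to count. -/
theorem card_filter_dvd_le (a b m : ℕ) (hab : a ≤ b) (hm0 : m ≠ 0) :
    (((Finset.Ioc a b).filter fun k => m ∣ 6 * k + 1).card : ℝ) ≤ ((b : ℝ) - a) / m + 1 := by
  have hab' : (a : ℝ) ≤ b := by exact_mod_cast hab
  have hmp : (0 : ℝ) < m := by positivity
  rcases ((Finset.Ioc a b).filter fun k => m ∣ 6 * k + 1).eq_empty_or_nonempty with h | ⟨v, hv⟩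
  · rw [h]
    have : 0 ≤ ((b : ℝ) - a) / m := div_nonneg (by linarith) hmp.le
    simp; linarith
  have hv1 := (Finset.mem_filter.mp hv).2
  have hm : Nat.Coprime 6 m := by
    refine Nat.Coprime.coprime_dvd_right hv1 ?_
    exact (Nat.coprime_mul_left_add_right 6 1 v).mpr (by norm_num)
  have hsub : ((Finset.Ioc a b).filter fun k => m ∣ 6 * k + 1) ⊆
      (Finset.Ioc a b).filter (· ≡ v [MOD m]) := by
    intro k hk
    obtain ⟨hk1, hk2⟩ := Finset.mem_filter.mp hk
    refine Finset.mem_filter.mpr ⟨hk1, ?_⟩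
    have h1 : 6 * k + 1 ≡ 6 * v + 1 [MOD m] :=
      ((Nat.modEq_zero_iff_dvd).mpr hk2).trans ((Nat.modEq_zero_iff_dvd).mpr hv1).symm
    exact Nat.ModEq.cancel_left_of_coprime hm.symm (Nat.ModEq.add_right_cancel' 1 h1)
  refine (Nat.cast_le.mpr (Finset.card_le_card hsub)).trans ?_
  have h := Nat.Ioc_filter_modEq_card a b (Nat.pos_of_ne_zero hm0) v
  have h' : ((((Finset.Ioc a b).filter (· ≡ v [MOD m])).card : ℤ) : ℚ) ≤
      ((b : ℚ) - a) / m + 1 := by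
    rw [h, Int.cast_max]
    have hmq : (0 : ℚ) < m := by positivity
    have habq : (a : ℚ) ≤ b := by exact_mod_cast hab
    apply max_le
    · push_cast
      have e1 := Int.floor_le (((b : ℚ) - v) / m)
      have e2 := Int.lt_floor_add_one (((a : ℚ) - v) / m)
      have e3 : ((b : ℚ) - a) / m = ((b : ℚ) - v) / m - ((a : ℚ) - v) / m := by ring
      linarith
    · have : 0 ≤ ((b : ℚ) - a) / m := div_nonneg (by linarith) hmq.le
      push_cast; linarith
  have h2 : (((((Finset.Ioc a b).filter (· ≡ v [MOD m])).card : ℤ) : ℚ) : ℝ) ≤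
      ((((b : ℚ) - a) / m + 1 : ℚ) : ℝ) := by exact_mod_cast h'
  push_cast at h2
  exact h2

/-- Comparison with the telescoping series of `1/(4j(j+1))`, whose sum from `j = 2` is `1/8`. -/
theorem sum_inv_odd_sq_le (N : ℕ) : ∑ j ∈ Finset.Ico 2 N, (1 : ℝ) / ((2 * j + 1 : ℕ) : ℝ) ^ 2 ≤ 1 / 8 := by
  have h : ∀ n : ℕ, ∑ j ∈ Finset.Ico 2 (n + 2), (1 : ℝ) / ((2 * j + 1 : ℕ) : ℝ) ^ 2 ≤
      1 / 8 - 1 / (4 * (n + 2)) := by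
    intro n
    induction n with
    | zero => norm_num
    | succ n ih =>
      rw [show n + 1 + 2 = n + 2 + 1 by ring, Finset.sum_Ico_succ_top (by omega)]
      have h1 : (1 : ℝ) / ((2 * (n + 2) + 1 : ℕ) : ℝ) ^ 2 ≤
          1 / (4 * (n + 2)) - 1 / (4 * (n + 3)) := by
        have h2 : (1 : ℝ) / (4 * (n + 2)) - 1 / (4 * (n + 3)) = 1 / (4 * ((n + 2) * (n + 3))) := by
          field_simp; ring
        rw [h2]
        apply one_div_le_one_div_of_le (by positivity)
        push_cast
        nlinarith
      push_cast at ih h1 ⊢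
      rw [show (n : ℝ) + 1 + 2 = n + 3 by ring]
      linarith
  rcases le_or_gt N 2 with hN | hN
  · rw [Finset.Ico_eq_empty (by omega)]; norm_num
  · obtain ⟨n, rfl⟩ := Nat.exists_eq_add_of_le' hN.le
    refine (h n).trans ?_
    have : (0 : ℝ) ≤ 1 / (4 * (n + 2)) := by positivity
    linarith

theorem sum_inv_odd_le (N : ℕ) :
    ∑ j ∈ Finset.Ico 2 N, (1 : ℝ) / ((2 * j + 1 : ℕ) : ℝ) ≤ 1 + Real.log N := by
  have h := harmonic_le_one_add_log N
  refine le_trans ?_ h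
  rw [harmonic_eq_sum_Icc]
  push_cast
  refine (Finset.sum_le_sum (g := fun j : ℕ => ((j : ℝ))⁻¹) fun j hj => ?_).trans
    (Finset.sum_le_sum_of_subset_of_nonneg ?_ fun j _ _ => by positivity)
  · rw [one_div]
    have : (0 : ℝ) < j := by have := (Finset.mem_Ico.mp hj).1; positivity
    apply inv_anti₀ this; linarith
  · intro j hj
    have := Finset.mem_Ico.mp hj
    exact Finset.mem_Icc.mpr ⟨by omega, by omega⟩

/-- On average over `q ≡ 1 (mod 6)` the integer `q` is square-free and `∑_{p ∣ q} 1/p` is small. -/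
theorem sum_weight_ge {a b K N : ℕ} (hab : a ≤ b) :
    ((b : ℝ) - a) / 2 - K - 3 * (1 + Real.log N) ≤ ∑ k ∈ Finset.Ioc a b,
      (1 - ∑ j ∈ Finset.Ico 2 K, (if (2 * j + 1) ^ 2 ∣ 6 * k + 1 then (1 : ℝ) else 0) -
        3 * ∑ j ∈ Finset.Ico 2 N,
          (if 2 * j + 1 ∣ 6 * k + 1 then (1 : ℝ) / ((2 * j + 1 : ℕ) : ℝ) else 0)) := by
  rw [Finset.sum_sub_distrib, Finset.sum_sub_distrib, ← Finset.mul_sum, Finset.sum_comm,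
    Finset.sum_comm (t := Finset.Ico 2 N)]
  have hab' : (a : ℝ) ≤ b := by exact_mod_cast hab
  have h0 : ∑ k ∈ Finset.Ioc a b, (1 : ℝ) = b - a := by
    rw [Finset.sum_const, Nat.card_Ioc, nsmul_eq_mul, mul_one, Nat.cast_sub hab]
  have h1 : ∑ j ∈ Finset.Ico 2 K, ∑ k ∈ Finset.Ioc a b,
      (if (2 * j + 1) ^ 2 ∣ 6 * k + 1 then (1 : ℝ) else 0) ≤ ((b : ℝ) - a) * (1 / 8) + K := by
    calc _ ≤ ∑ j ∈ Finset.Ico 2 K, (((b : ℝ) - a) * (1 / ((2 * j + 1 : ℕ) : ℝ) ^ 2) + 1) := by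
          refine Finset.sum_le_sum fun j _ => ?_
          rw [← Finset.sum_filter, Finset.sum_const, nsmul_eq_mul, mul_one]
          refine (card_filter_dvd_le a b ((2 * j + 1) ^ 2) hab (by positivity)).trans ?_
          rw [Nat.cast_pow, mul_one_div]
      _ ≤ _ := by
          rw [Finset.sum_add_distrib, ← Finset.mul_sum, Finset.sum_const, nsmul_eq_mul, mul_one,
            Nat.card_Ico]
          refine add_le_add (mul_le_mul_of_nonneg_left (sum_inv_odd_sq_le K) (by linarith)) ?_
          exact_mod_cast Nat.sub_le K 2
  have h2 : ∑ j ∈ Finset.Ico 2 N, ∑ k ∈ Finset.Ioc a b,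
      (if 2 * j + 1 ∣ 6 * k + 1 then (1 : ℝ) / ((2 * j + 1 : ℕ) : ℝ) else 0) ≤
      ((b : ℝ) - a) * (1 / 8) + (1 + Real.log N) := by
    calc _ ≤ ∑ j ∈ Finset.Ico 2 N, (((b : ℝ) - a) * (1 / ((2 * j + 1 : ℕ) : ℝ) ^ 2) +
          1 / ((2 * j + 1 : ℕ) : ℝ)) := by
          refine Finset.sum_le_sum fun j _ => ?_
          rw [← Finset.sum_filter, Finset.sum_const, nsmul_eq_mul]
          have hj : (0 : ℝ) < ((2 * j + 1 : ℕ) : ℝ) := by positivity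
          calc _ ≤ (((b : ℝ) - a) / ((2 * j + 1 : ℕ) : ℝ) + 1) * (1 / ((2 * j + 1 : ℕ) : ℝ)) :=
                mul_le_mul_of_nonneg_right
                  (card_filter_dvd_le a b (2 * j + 1) hab (by positivity)) (by positivity)
            _ = _ := by field_simp
      _ ≤ _ := by
          rw [Finset.sum_add_distrib, ← Finset.mul_sum]
          exact add_le_add (mul_le_mul_of_nonneg_left (sum_inv_odd_sq_le N) (by linarith))
            (sum_inv_odd_le N)
  linarith

/-- Prime factors of `6k + 1` are odd and at least 5, so sums over all odd integers from 5 on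
dominate the sums over primes. If `6k + 1` is not squarefree, one square divisor already makes the
weight nonpositive; `K` is large enough to detect it. -/
theorem weight_le {k K N : ℕ} (hK : 6 * k + 1 < (2 * K + 1) ^ 2) (hN : 6 * k + 1 < 2 * N + 1) :
    1 - ∑ j ∈ Finset.Ico 2 K, (if (2 * j + 1) ^ 2 ∣ 6 * k + 1 then (1 : ℝ) else 0) -
        3 * ∑ j ∈ Finset.Ico 2 N,
          (if 2 * j + 1 ∣ 6 * k + 1 then (1 : ℝ) / ((2 * j + 1 : ℕ) : ℝ) else 0) ≤
      if Squarefree (6 * k + 1) then 1 - 3 * ∑ p ∈ (6 * k + 1).primeFactors, (1 : ℝ) / p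
        else 0 := by
  have hodd : ∀ p : ℕ, p.Prime → p ∣ 6 * k + 1 → ∃ j, 2 ≤ j ∧ p = 2 * j + 1 := by
    intro p hp hpk
    have h2 : p ≠ 2 := by rintro rfl; omega
    have h3 : p ≠ 3 := by rintro rfl; omega
    obtain ⟨j, hj⟩ := hp.odd_of_ne_two h2
    refine ⟨j, ?_, hj⟩
    have := hp.two_le
    omega
  have hn1 : 0 ≤ ∑ j ∈ Finset.Ico 2 K, (if (2 * j + 1) ^ 2 ∣ 6 * k + 1 then (1 : ℝ) else 0) :=
    Finset.sum_nonneg fun j _ => by split_ifs <;> norm_num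
  have hn2 : 0 ≤ ∑ j ∈ Finset.Ico 2 N,
      (if 2 * j + 1 ∣ 6 * k + 1 then (1 : ℝ) / ((2 * j + 1 : ℕ) : ℝ) else 0) :=
    Finset.sum_nonneg fun j _ => by split_ifs <;> positivity
  split_ifs with hsq
  · have h1 : ∑ p ∈ (6 * k + 1).primeFactors, (1 : ℝ) / p ≤ ∑ j ∈ Finset.Ico 2 N,
        (if 2 * j + 1 ∣ 6 * k + 1 then (1 : ℝ) / ((2 * j + 1 : ℕ) : ℝ) else 0) := by
      rw [← Finset.sum_filter, ← Finset.sum_image (f := fun d : ℕ => (1 : ℝ) / d)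
        (g := fun j => 2 * j + 1) (fun x _ y _ h => by simpa using h)]
      refine Finset.sum_le_sum_of_subset_of_nonneg ?_ fun _ _ _ => by positivity
      intro p hp
      have hpp := Nat.prime_of_mem_primeFactors hp
      have hpd := Nat.dvd_of_mem_primeFactors hp
      obtain ⟨j, hj2, rfl⟩ := hodd p hpp hpd
      have := Nat.le_of_dvd (by omega) hpd
      exact Finset.mem_image.mpr ⟨j, Finset.mem_filter.mpr
        ⟨Finset.mem_Ico.mpr ⟨hj2, by omega⟩, hpd⟩, rfl⟩
    linarith
  · rw [Nat.squarefree_iff_prime_squarefree] at hsq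
    push Not at hsq
    obtain ⟨p, hp, hpd⟩ := hsq
    obtain ⟨j, hj2, rfl⟩ := hodd p hp ((Dvd.intro _ rfl).trans hpd)
    have hpd' : (2 * j + 1) ^ 2 ∣ 6 * k + 1 := by rwa [sq]
    have hjK : j < K := by
      by_contra h
      have h1 := Nat.le_of_dvd (by omega) hpd'
      have h2 : (2 * K + 1) ^ 2 ≤ (2 * j + 1) ^ 2 := Nat.pow_le_pow_left (by omega) 2
      omega
    have h1 := Finset.single_le_sum (s := Finset.Ico 2 K)
      (f := fun j => if (2 * j + 1) ^ 2 ∣ 6 * k + 1 then (1 : ℝ) else 0)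
      (fun j _ => by split_ifs <;> norm_num) (Finset.mem_Ico.mpr ⟨hj2, hjK⟩)
    simp only [if_pos hpd'] at h1
    linarith

theorem finite_Psi (χ : DirichletCharacter ℂ D) : (Psi χ).Finite := by
  have h : Psi χ ⊆ ⋃ q ∈ {q : ℕ+ | (q : ℕ) ∈ calQ D}, Sigma.mk q '' Set.univ := by
    rintro ⟨q, ψ⟩ hx
    exact Set.mem_biUnion (show q ∈ {q : ℕ+ | (q : ℕ) ∈ calQ D} from hx.1) ⟨ψ, trivial, rfl⟩
  refine Set.Finite.subset (Set.Finite.biUnion ?_ fun q _ => Set.toFinite _) h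
  refine Set.Finite.of_injOn (f := fun q : ℕ+ => (q : ℕ)) (t := Set.Iic ⌊2 * Q D⌋₊) ?_
    (fun _ _ _ _ h => PNat.coe_injective h) (Set.finite_Iic _)
  intro q hq
  exact Nat.le_floor hq.2.1.le

/-- The moduli `q = 6k + 1` between `Q` and `2Q` number about `Q/6`. The mean weight is at least
about `1 - 1/8 - 3/8 = 1/2` and each unit of weight is worth at least `Q` characters, so the total
is about `Q²/12`; the errors are absorbed by passing to `Q²/20`. -/
theorem card_Psi_ge (hD : Real.exp (Real.exp (Real.exp (10 ^ 6))) ≤ (D : ℝ))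
    (hprim : χ.IsPrimitive) : Q D ^ 2 / 20 ≤ (Psi χ).ncard := by
  classical
  have hL := le_ell hD
  have hL0 := ell_pos hD
  set R := Real.exp (ell D ^ 2 / 2) with hR
  have hRQ : Q D = R ^ 2 := by rw [Q, hR, ← Real.exp_nat_mul]; congr 1; push_cast; ring
  have hRL : ell D ^ 2 ≤ R / 10 ^ 6 := by
    have h1 : ell D ^ 20 ≤ R := (ell_pow_le hD).trans (Real.exp_le_exp.mpr (by nlinarith))
    have h2 : (10 : ℝ) ^ 6 ≤ ell D ^ 18 := by
      calc (10 : ℝ) ^ 6 ≤ 10 ^ 100 := by norm_num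
        _ ≤ ell D ^ 1 := by simpa using hL
        _ ≤ ell D ^ 18 := pow_le_pow_right₀ (by linarith) (by norm_num)
    rw [le_div_iff₀ (by positivity)]
    calc _ ≤ ell D ^ 2 * ell D ^ 18 := by gcongr
      _ = ell D ^ 20 := by ring
      _ ≤ R := h1
  have hL2 : (10 : ℝ) ^ 100 ≤ ell D ^ 2 := by nlinarith
  have hR0 : (10 : ℝ) ^ 106 ≤ R := by
    have : (10 : ℝ) ^ 106 = 10 ^ 100 * 10 ^ 6 := by norm_num
    rw [this]; linarith
  have hQR : (10 : ℝ) ^ 100 * R ≤ Q D := by rw [hRQ]; nlinarith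
  set a := ⌊Q D / 6⌋₊ with ha
  -- Subtracting 1 keeps `6k + 1` strictly below `2Q`. Below, `K ≥ √Q` and `N ≥ Q` ensure that `(2K
  -- + 1)²` and `2N + 1` exceed every modulus.
  set b := ⌊Q D / 3⌋₊ - 1 with hb
  set K := ⌈R⌉₊ with hK
  set N := ⌈Q D⌉₊ with hN
  have hQ0 : 0 < Q D := Real.exp_pos _
  have ha1 := Nat.floor_le (show 0 ≤ Q D / 6 by positivity)
  have ha2 := Nat.lt_floor_add_one (Q D / 6)
  have hb1 := Nat.floor_le (show 0 ≤ Q D / 3 by positivity)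
  have hb2 := Nat.lt_floor_add_one (Q D / 3)
  have hb3 : (b : ℝ) = ⌊Q D / 3⌋₊ - 1 := by
    rw [hb, Nat.cast_sub, Nat.cast_one]
    apply Nat.le_floor
    push_cast; linarith
  have hK1 := Nat.le_ceil R
  have hK2 := Nat.ceil_lt_add_one (show 0 ≤ R by positivity)
  have hN1 := Nat.le_ceil (Q D)
  have hN2 := Nat.ceil_lt_add_one hQ0.le
  have hab : a ≤ b := by
    have : (a : ℝ) ≤ b := by linarith
    exact_mod_cast this
  have hlog : Real.log N ≤ ell D ^ 2 + 1 := by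
    have h1 : (N : ℝ) ≤ Real.exp (ell D ^ 2 + 1) := by
      rw [Real.exp_add]
      have := Real.add_one_le_exp 1
      have : Q D = Real.exp (ell D ^ 2) := rfl
      nlinarith
    exact (Real.log_le_iff_le_exp (by linarith)).mpr h1
  have hsum := sum_weight_ge (K := K) (N := N) hab
  set T := (Finset.Ioc a b).filter fun k => Squarefree (6 * k + 1) with hT
  have hbd : ∀ k ∈ Finset.Ioc a b, Q D < ((6 * k + 1 : ℕ) : ℝ) ∧ ((6 * k + 1 : ℕ) : ℝ) < 2 * Q D := by
    intro k hk
    obtain ⟨h1, h2⟩ := Finset.mem_Ioc.mp hk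
    have h1' : (a : ℝ) + 1 ≤ k := by exact_mod_cast h1
    have h2' : (k : ℝ) ≤ b := by exact_mod_cast h2
    push_cast
    constructor <;> linarith
  have hterm : ∀ k ∈ Finset.Ioc a b, Q D * (1 - ∑ j ∈ Finset.Ico 2 K,
        (if (2 * j + 1) ^ 2 ∣ 6 * k + 1 then (1 : ℝ) else 0) -
        3 * ∑ j ∈ Finset.Ico 2 N,
          (if 2 * j + 1 ∣ 6 * k + 1 then (1 : ℝ) / ((2 * j + 1 : ℕ) : ℝ) else 0)) ≤
      if Squarefree (6 * k + 1) then ((PsiMod χ (6 * k + 1)).ncard : ℝ) else 0 := by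
    intro k hk
    have hq := hbd k hk
    have h1 := weight_le (k := k) (K := K) (N := N) (by
      have : ((6 * k + 1 : ℕ) : ℝ) < (2 * K + 1) ^ 2 := by
        have h1 : R ^ 2 ≤ (K : ℝ) ^ 2 := pow_le_pow_left₀ (Real.exp_pos _).le hK1 2
        have h2 : ((2 : ℝ) * K + 1) ^ 2 = 4 * (K : ℝ) ^ 2 + 4 * K + 1 := by ring
        rw [h2]
        linarith [hq.2]
      exact_mod_cast this) (by
      have : ((6 * k + 1 : ℕ) : ℝ) < 2 * N + 1 := by linarith
      exact_mod_cast this)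
    refine (mul_le_mul_of_nonneg_left h1 hQ0.le).trans ?_
    split_ifs with hsq
    · have h2 := sub_sum_le_ncard_PsiMod hprim (6 * k + 1)
      rcases le_total 0 (1 - 3 * ∑ p ∈ (6 * k + 1).primeFactors, (1 : ℝ) / p) with h3 | h3
      · exact (mul_le_mul_of_nonneg_right hq.1.le h3).trans h2
      · exact (mul_nonpos_of_nonneg_of_nonpos hQ0.le h3).trans (Nat.cast_nonneg _)
    · simp
  have hsum2 := (mul_le_mul_of_nonneg_left hsum hQ0.le).trans
    ((Finset.mul_sum _ _ _).trans_le (Finset.sum_le_sum hterm))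
  rw [← Finset.sum_filter] at hsum2
  have hcard : ∑ k ∈ T, ((PsiMod χ (6 * k + 1)).ncard : ℝ) ≤ (Psi χ).ncard := by
    set W : Finset (Σ q : ℕ+, DirichletCharacter ℂ (q : ℕ)) :=
      (T.image fun k => Nat.succPNat (6 * k)).sigma
        fun q => (Set.toFinite (PsiMod χ (q : ℕ))).toFinset with hW
    have h1 : (W : Set _) ⊆ Psi χ := by
      rintro ⟨q, ψ⟩ hx
      obtain ⟨h1, h2⟩ := Finset.mem_sigma.mp hx
      obtain ⟨k, hk, rfl⟩ := Finset.mem_image.mp h1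
      obtain ⟨hk1, hk2⟩ := Finset.mem_filter.mp hk
      refine ⟨⟨(hbd k hk1).1, (hbd k hk1).2, ?_, hk2⟩, (Set.Finite.mem_toFinset _).mp h2⟩
      exact (Nat.coprime_mul_left_add_right 6 1 k).mpr (by norm_num)
    have h2 : W.card = ∑ k ∈ T, (PsiMod χ (6 * k + 1)).ncard := by
      rw [hW, Finset.card_sigma, Finset.sum_image]
      · refine Finset.sum_congr rfl fun k _ => ?_
        rw [Set.ncard_eq_toFinset_card]
        rfl
      · intro x _ y _ h
        have := congrArg (fun q : ℕ+ => (q : ℕ)) h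
        simpa using this
    have h3 := Set.ncard_le_ncard h1 (finite_Psi χ)
    rw [Set.ncard_coe_finset, h2] at h3
    exact_mod_cast h3
  refine le_trans ?_ (hsum2.trans hcard)
  have hfin : Q D / 20 ≤ ((b : ℝ) - a) / 2 - K - 3 * (1 + Real.log N) := by linarith
  calc Q D ^ 2 / 20 = Q D * (Q D / 20) := by ring
    _ ≤ _ := mul_le_mul_of_nonneg_left hfin hQ0.le

end Count

/-! ### Sign changes -/

/-- Where `ω = kπ`, the function `Z` has the sign `(-1)^k`, so there is a zero between consecutive
such points. Choosing it with `ω` in the half-open interval from `kπ` to `(k+1)π` makes the zeros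
for different `k` distinct. The loss of 2 comes from rounding at both ends. -/
theorem exists_zeros {a b : ℝ} {Z ω : ℝ → ℝ} (hab : a ≤ b) (hZ : ContinuousOn Z (Set.Icc a b))
    (hω : ContinuousOn ω (Set.Icc a b)) (hmono : StrictMonoOn ω (Set.Icc a b))
    (hclose : ∀ t ∈ Set.Icc a b, |Z t - 2 * Real.cos (ω t)| < 2) :
    ∃ T : Finset ℝ, (∀ t ∈ T, t ∈ Set.Icc a b ∧ Z t = 0) ∧
      (ω b - ω a) / Real.pi - 2 ≤ T.card := by
  have hpi := Real.pi_pos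
  set k0 : ℤ := ⌈ω a / Real.pi⌉ with hk0
  set k1 : ℤ := ⌊ω b / Real.pi⌋ with hk1
  have ha : a ∈ Set.Icc a b := ⟨le_rfl, hab⟩
  have hb : b ∈ Set.Icc a b := ⟨hab, le_rfl⟩
  have hex : ∀ k : ℤ, ∃ t, k0 ≤ k → k ≤ k1 → t ∈ Set.Icc a b ∧ ω t = k * Real.pi := by
    intro k
    by_cases h : k0 ≤ k ∧ k ≤ k1
    · have h1 : ω a ≤ k * Real.pi := by
        have : ω a / Real.pi ≤ k := Int.ceil_le.mp h.1
        rwa [div_le_iff₀ hpi] at this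
      have h2 : k * Real.pi ≤ ω b := by
        have : (k : ℝ) ≤ ω b / Real.pi := Int.le_floor.mp h.2
        rwa [le_div_iff₀ hpi] at this
      obtain ⟨t, ht, ht'⟩ := intermediate_value_Icc hab hω ⟨h1, h2⟩
      exact ⟨t, fun _ _ => ⟨ht, ht'⟩⟩
    · exact ⟨0, fun h1 h2 => absurd ⟨h1, h2⟩ h⟩
  choose τ hτ using hex
  have hsign : ∀ k : ℤ, k0 ≤ k → k ≤ k1 → 0 < (-1 : ℝ) ^ k * Z (τ k) := by
    intro k h1 h2
    obtain ⟨h3, h4⟩ := hτ k h1 h2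
    have h5 := abs_lt.mp (hclose _ h3)
    rw [h4, Real.cos_int_mul_pi] at h5
    rcases Int.even_or_odd k with hk | hk
    · rw [hk.neg_one_zpow] at h5 ⊢; linarith
    · rw [hk.neg_one_zpow] at h5 ⊢; linarith
  have hex2 : ∀ k : ℤ, ∃ z, k0 ≤ k → k + 1 ≤ k1 →
      z ∈ Set.Icc a b ∧ Z z = 0 ∧ k * Real.pi ≤ ω z ∧ ω z < (k + 1) * Real.pi := by
    intro k
    by_cases h : k0 ≤ k ∧ k + 1 ≤ k1
    · obtain ⟨h1, h2⟩ := hτ k h.1 (by omega)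
      obtain ⟨h3, h4⟩ := hτ (k + 1) (by omega) h.2
      have h5 : τ k < τ (k + 1) := by
        rw [← hmono.lt_iff_lt h1 h3, h2, h4]; push_cast; linarith
      have hsub : Set.Icc (τ k) (τ (k + 1)) ⊆ Set.Icc a b := Set.Icc_subset_Icc h1.1 h3.2
      have e1 := hsign k h.1 (by omega)
      have e2 := hsign (k + 1) (by omega) h.2
      rw [zpow_add_one₀ (by norm_num)] at e2
      have hz : ∃ z ∈ Set.Icc (τ k) (τ (k + 1)), (-1 : ℝ) ^ k * Z z = 0 := by
        have hc : ContinuousOn (fun t => (-1 : ℝ) ^ k * Z t) (Set.Icc (τ k) (τ (k + 1))) :=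
          continuousOn_const.mul (hZ.mono hsub)
        exact intermediate_value_Icc' h5.le hc ⟨by linarith, by linarith⟩
      obtain ⟨z, hz1, hz2⟩ := hz
      have hz0 : Z z = 0 := (mul_eq_zero.mp hz2).resolve_left (zpow_ne_zero _ (by norm_num))
      have hne : z ≠ τ (k + 1) := by
        rintro rfl
        rw [hz0] at e2; simp at e2
      refine ⟨z, fun _ _ => ⟨hsub hz1, hz0, ?_, ?_⟩⟩
      · rw [← h2]; exact hmono.monotoneOn h1 (hsub hz1) hz1.1
      · have := hmono (hsub hz1) h3 (lt_of_le_of_ne hz1.2 hne)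
        rw [h4] at this; push_cast at this; exact this
    · exact ⟨0, fun h1 h2 => absurd ⟨h1, h2⟩ h⟩
  choose z hz using hex2
  refine ⟨(Finset.Ico k0 k1).image z, ?_, ?_⟩
  · intro t ht
    obtain ⟨k, hk, rfl⟩ := Finset.mem_image.mp ht
    obtain ⟨h1, h2⟩ := Finset.mem_Ico.mp hk
    obtain ⟨e1, e2, _⟩ := hz k h1 (by omega)
    exact ⟨e1, e2⟩
  · rw [Finset.card_image_of_injOn, Int.card_Ico]
    · have h1 : (k1 - k0 : ℝ) ≤ ((k1 - k0).toNat : ℝ) := by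
        have := Int.self_le_toNat (k1 - k0)
        exact_mod_cast this
      have h2 := Int.ceil_lt_add_one (ω a / Real.pi)
      have h3 := Int.lt_floor_add_one (ω b / Real.pi)
      rw [sub_div]
      linarith
    · intro k hk k' hk' h
      obtain ⟨h1, h2⟩ := Finset.mem_Ico.mp hk
      obtain ⟨h1', h2'⟩ := Finset.mem_Ico.mp hk'
      obtain ⟨_, _, e1, e2⟩ := hz k h1 (by omega)
      obtain ⟨_, _, e1', e2'⟩ := hz k' h1' (by omega)
      rw [h] at e1 e2
      have l1 : (k : ℝ) < k' + 1 := lt_of_mul_lt_mul_right (e1.trans_lt e2') hpi.le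
      have l2 : (k' : ℝ) < k + 1 := lt_of_mul_lt_mul_right (e1'.trans_lt e2) hpi.le
      have l1' : k < k' + 1 := by exact_mod_cast l1
      have l2' : k' < k + 1 := by exact_mod_cast l2
      omega

/-- A unimodular solution of `h' = 2iwh` is `e^{2iω}` with `ω' = w`. -/
theorem exists_phase {a b : ℝ} (hab : a ≤ b) {h : ℝ → ℂ} {w : ℝ → ℝ}
    (hw : ContinuousOn w (Set.Icc a b))
    (hd : ∀ t ∈ Set.Icc a b, HasDerivAt h (2 * I * w t * h t) t) (hn : ‖h a‖ = 1) :
    ∃ ω : ℝ → ℝ, (∀ t ∈ Set.Icc a b, HasDerivAt ω (w t) t) ∧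
      ∀ t ∈ Set.Icc a b, h t = exp (2 * I * ω t) := by
  -- The constant extension beyond the endpoints makes the integrand continuous everywhere, so that
  -- the primitive has two-sided derivatives at `a` and `b` too.
  set W : ℝ → ℝ := Set.IccExtend hab (Set.domRestrict (Set.Icc a b) w) with hW
  have hWc : Continuous W := (continuousOn_iff_continuous_domRestrict.mp hw).Icc_extend'
  have hWw : ∀ t ∈ Set.Icc a b, W t = w t := fun t ht => by
    rw [hW, Set.IccExtend_of_mem _ _ ht]; rfl
  set ω : ℝ → ℝ := fun t => arg (h a) / 2 + ∫ u in a..t, W u with hω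
  have hωd : ∀ t, HasDerivAt ω (W t) t := fun t =>
    (intervalIntegral.integral_hasDerivAt_right (hWc.intervalIntegrable _ _)
      (hWc.stronglyMeasurableAtFilter _ _) hWc.continuousAt).const_add _
  have hωd' : ∀ t ∈ Set.Icc a b, HasDerivAt ω (w t) t := fun t ht => hWw t ht ▸ hωd t
  refine ⟨ω, hωd', ?_⟩
  set g : ℝ → ℂ := fun t => h t * exp (-(2 * I * ω t)) with hg
  have hgd : ∀ t ∈ Set.Icc a b, HasDerivAt g 0 t := by
    intro t ht
    have h1 := (hωd' t ht).ofReal_comp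
    have h2 := (hd t ht).mul ((h1.const_mul (2 * I)).neg.cexp)
    convert! h2 using 1
    ring
  have hconst : ∀ t ∈ Set.Icc a b, g t = g a :=
    constant_of_has_deriv_right_zero (fun t ht => (hgd t ht).continuousAt.continuousWithinAt)
      fun t ht => (hgd t (Set.Ico_subset_Icc_self ht)).hasDerivWithinAt
  have hga : g a = 1 := by
    have h1 : ω a = arg (h a) / 2 := by simp [hω]
    have h2 := norm_mul_exp_arg_mul_I (h a)
    rw [hn, ofReal_one, one_mul] at h2
    have h3 : 2 * I * ((arg (h a) / 2 : ℝ) : ℂ) = arg (h a) * I := by push_cast; ring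
    rw [hg]
    dsimp only
    rw [h1, h3, exp_neg, h2, mul_inv_cancel₀]
    exact norm_ne_zero_iff.mp (by rw [hn]; norm_num)
  intro t ht
  have h1 := hconst t ht
  rw [hga, hg] at h1
  dsimp only at h1
  rw [exp_neg, ← div_eq_mul_inv, div_eq_one_iff_eq (exp_ne_zero _)] at h1
  exact h1

/-! ### The logarithmic derivative -/

/-- A function whose values on a disc have bounded ratios has bounded logarithmic derivative. -/
theorem norm_logDeriv_le_of_ball {f : ℂ → ℂ} {c : ℂ} {R A : ℝ} (hR : 0 < R) (hA : 0 < A)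
    (hf : DifferentiableOn ℂ f (Metric.ball c R)) (hf0 : ∀ z ∈ Metric.ball c R, f z ≠ 0)
    (hb : ∀ z ∈ Metric.ball c R, ‖f z‖ ≤ Real.exp A * ‖f c‖) :
    ‖logDeriv f c‖ ≤ 4 * A / R := by
  have hc : c ∈ Metric.ball c R := Metric.mem_ball_self hR
  have hlog : DifferentiableOn ℂ (logDeriv f) (Metric.ball c R) :=
    (hf.deriv Metric.isOpen_ball).div hf hf0
  -- A primitive of the logarithmic derivative, normalised by `g c = 0`, is a branch of
  -- `log(f/f(c))`; the hypothesis bounds its real part by `A`.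
  obtain ⟨g, hgc, hg⟩ := (hlog.isExactOn_ball).with_val_at c 0
  have hconst : ∀ z ∈ Metric.ball c R, f z = f c * exp (g z) := by
    set k : ℂ → ℂ := fun z => f z * exp (-g z) with hk
    have hkd : ∀ z ∈ Metric.ball c R, HasDerivAt k 0 z := by
      intro z hz
      have h1 := (hf.differentiableAt (Metric.isOpen_ball.mem_nhds hz)).hasDerivAt
      have h2 := h1.mul ((hg z hz).neg.cexp)
      convert! h2 using 1
      rw [logDeriv_apply]
      have := hf0 z hz
      field_simp
      ring
    intro z hz
    have h1 := (convex_ball c R).is_const_of_fderivWithin_eq_zero (𝕜 := ℂ) (f := k)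
      (fun z hz => (hkd z hz).differentiableAt.differentiableWithinAt) (fun z hz => by
        rw [fderivWithin_of_isOpen Metric.isOpen_ball hz]
        ext; simp [(hkd z hz).hasFDerivAt.fderiv]) hz hc
    rw [hk] at h1
    dsimp only at h1
    rw [hgc, neg_zero, exp_zero, mul_one, exp_neg] at h1
    rw [← h1, mul_assoc, inv_mul_cancel₀ (exp_ne_zero _), mul_one]
  have hfc := hf0 c hc
  have hre : ∀ z ∈ Metric.ball c R, (g z).re ≤ A := by
    intro z hz
    have h1 := hb z hz
    rw [hconst z hz, norm_mul, norm_exp, mul_comm] at h1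
    exact Real.exp_le_exp.mp (le_of_mul_le_mul_right h1 (norm_pos_iff.mpr hfc))
  have hmem : ∀ z ∈ Metric.ball (0 : ℂ) R, c + z ∈ Metric.ball c R := by
    intro z hz; simpa [dist_eq_norm] using hz
  have hgd : DifferentiableOn ℂ (fun z => g (c + z)) (Metric.ball 0 R) := fun z hz =>
    (((hg _ (hmem z hz)).differentiableAt).comp z
      (differentiableAt_id.const_add c)).differentiableWithinAt
  have hbound : ∀ z ∈ Metric.sphere (0 : ℂ) (R / 2), ‖g (c + z)‖ ≤ 2 * A := by
    intro z hz
    have hz' : ‖z‖ = R / 2 := by simpa using hz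
    -- On the circle of radius `R/2` the Borel–Carathéodory bound equals `2A`; Cauchy's estimate
    -- then gives `2A/(R/2) = 4A/R`.
    have h1 := borelCaratheodory_zero hA hgd (fun z hz => hre _ (hmem z hz)) hR
      (z := z) (by rw [mem_ball_zero_iff, hz']; linarith) (by simpa using hgc)
    rw [hz'] at h1
    refine h1.trans (le_of_eq ?_)
    field_simp
    ring
  have hsub : Metric.closedBall (0 : ℂ) (R / 2) ⊆ Metric.ball 0 R :=
    Metric.closedBall_subset_ball (by linarith)
  have h2 := norm_deriv_le_of_forall_mem_sphere_norm_le (by linarith : 0 < R / 2)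
    ((hgd.mono hsub).diffContOnCl_ball le_rfl) hbound
  have h3 : HasDerivAt (fun z => g (c + z)) (logDeriv f c) 0 := by
    have := (hg c hc)
    rw [← add_zero c] at this
    simpa using this.comp_const_add c 0
  rw [h3.deriv] at h2
  refine h2.trans (le_of_eq ?_)
  field_simp
  ring

/-! ### Zeros on the critical line -/

/-- To be read with `A = F`, `B = Δ₁` and `X = L(s,ψ)L(s,ψχ)` on the critical line. The phase is
chosen so that `B conj A = A exp(-2iω)`: the factor `exp(iω)/A` makes `A + B conj A` into a cosine
and, by the functional equation for `X`, makes `X` real. -/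
theorem phase_identities {X A B : ℂ} {ω : ℝ} (hA : A ≠ 0) (hB : B ≠ 0)
    (hX : X = B * starRingEnd ℂ X) (h : A / (B * starRingEnd ℂ A) = exp (2 * I * ω)) :
    starRingEnd ℂ (X * exp (I * ω) / A) = X * exp (I * ω) / A ∧
      (A + B * starRingEnd ℂ A) * exp (I * ω) / A = 2 * Real.cos ω := by
  have hA' : starRingEnd ℂ A ≠ 0 := (map_ne_zero _).mpr hA
  have he := exp_ne_zero (I * (ω : ℂ))
  have hconj : starRingEnd ℂ (exp (I * ω)) = (exp (I * ω))⁻¹ := by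
    rw [← exp_conj, ← exp_neg, map_mul, conj_I, conj_ofReal, neg_mul]
  have h2 : exp (2 * I * (ω : ℂ)) = exp (I * ω) ^ 2 := by
    rw [← exp_nat_mul]; congr 1; push_cast; ring
  rw [h2, div_eq_iff (mul_ne_zero hB hA')] at h
  constructor
  · rw [map_div₀, map_mul, hconj, div_eq_div_iff hA' hA]
    generalize starRingEnd ℂ A = A' at *
    generalize starRingEnd ℂ X = X' at *
    rw [h, hX]
    field_simp
  · have hcos : (2 : ℂ) * Real.cos ω = exp (I * ω) + (exp (I * ω))⁻¹ := by
      rw [ofReal_cos, Complex.two_cos, ← exp_neg]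
      congr 2 <;> ring
    rw [hcos, div_eq_iff hA]
    have : B * starRingEnd ℂ A = A * ((exp (I * ω))⁻¹ * (exp (I * ω))⁻¹) := by
      nth_rewrite 2 [h]
      field_simp
    rw [this]
    field_simp

section Zeros

variable {D : ℕ} [NeZero D] {χ : DirichletCharacter ℂ D} {q : ℕ} [NeZero q]
  {ψ : DirichletCharacter ℂ q}

theorem differentiable_F : Differentiable ℂ (F χ ψ) := differentiable_dpoly

theorem F_inv_one_sub (hreal : ∀ a : ZMod D, (χ a).im = 0) (t : ℝ) :
    F χ ψ⁻¹ (1 - (1 / 2 + t * I)) = starRingEnd ℂ (F χ ψ (1 / 2 + t * I)) := by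
  rw [F_eq_dpoly, dpoly_inv (fun n => by rw [nu_eq hreal, conj_ofReal]), F_eq_dpoly]
  congr 2
  apply Complex.ext <;> simp; norm_num

theorem LL_eq_Delta1_mul_conj (hreal : ∀ a : ZMod D, (χ a).im = 0) (hq : q ≠ 1)
    (hψ : ψ ∈ PsiMod χ q) {t : ℝ} (ht : t ≠ 0) :
    LL χ ψ (1 / 2 + t * I) =
      Delta1 χ ψ (1 / 2 + t * I) * starRingEnd ℂ (LL χ ψ (1 / 2 + t * I)) := by
  rw [← LL_conj hreal hq hψ]
  have h : starRingEnd ℂ (1 / 2 + t * I : ℂ) = 1 - (1 / 2 + t * I) := by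
    apply Complex.ext <;> simp; norm_num
  rw [h]
  exact LL_eq_Delta1_mul hreal hψ (by simpa using ht)

/-- The logarithmic derivative of `Δ₁` is real on the critical line. -/
theorem logDeriv_Delta1_im (hψ : ψ ∈ PsiMod χ q) {t : ℝ} (ht : t ≠ 0) :
    (logDeriv (Delta1 χ ψ) (1 / 2 + t * I)).im = 0 := by
  have him : (1 / 2 + t * I : ℂ).im ≠ 0 := by simpa using ht
  have hline : HasDerivAt (fun u : ℝ => (1 / 2 + u * I : ℂ)) I t := by
    simpa using ((hasDerivAt_id t).ofReal_comp.mul_const I).const_add (1 / 2 : ℂ)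
  have hB := (differentiableAt_Delta1 (χ := χ) (ψ := ψ) him).hasDerivAt.comp t hline
  have h1 := hB.mul hB.star
  have h2 : (fun u : ℝ => Delta1 χ ψ (1 / 2 + u * I) * starRingEnd ℂ (Delta1 χ ψ (1 / 2 + u * I)))
      =ᶠ[nhds t] fun _ => 1 := by
    filter_upwards [isOpen_ne.mem_nhds ht] with u hu
    rw [mul_conj, normSq_eq_norm_sq, norm_Delta1_half hψ hu]; simp
  have h3 := (hasDerivAt_const t (1 : ℂ)).congr_of_eventuallyEq h2
  have h4 := h3.unique h1
  have h5 : Delta1 χ ψ (1 / 2 + t * I) ≠ 0 := Delta1_ne_zero hψ him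
  have h6 := h2.self_of_nhds
  dsimp only at h6
  set B := Delta1 χ ψ (1 / 2 + t * I) with hBdef
  set l := logDeriv (Delta1 χ ψ) (1 / 2 + t * I) with hl
  have h7 : deriv (Delta1 χ ψ) (1 / 2 + t * I) = l * B := by
    rw [hl, logDeriv_apply, div_mul_cancel₀ _ h5]
  simp only [Function.comp_apply, ← hBdef, h7, Complex.star_def, map_mul, conj_I] at h4
  have h8 : (0 : ℂ) = (l - starRingEnd ℂ l) * I * (B * starRingEnd ℂ B) := by
    rw [h4]; ring
  rw [h6, mul_one] at h8
  have h9 : l - starRingEnd ℂ l = 0 := (mul_eq_zero.mp h8.symm).resolve_right I_ne_zero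
  exact conj_eq_iff_im.mp (sub_eq_zero.mp h9).symm

/-- Along the line `F` contributes `i F'/F` to the logarithmic derivative, its conjugate in the
denominator contributes `i conj(F'/F)`, and `Δ₁` contributes `-i Δ₁'/Δ₁` with `Δ₁'/Δ₁` real. The sum
is purely imaginary, as a real phase requires. -/
theorem hasDerivAt_phase (hψ : ψ ∈ PsiMod χ q) {t : ℝ} (ht : t ≠ 0)
    (hF : F χ ψ (1 / 2 + t * I) ≠ 0) :
    HasDerivAt (fun u : ℝ => F χ ψ (1 / 2 + u * I) /
      (Delta1 χ ψ (1 / 2 + u * I) * starRingEnd ℂ (F χ ψ (1 / 2 + u * I))))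
      (2 * I * ((logDeriv (F χ ψ) (1 / 2 + t * I)).re -
        (logDeriv (Delta1 χ ψ) (1 / 2 + t * I)).re / 2 : ℝ) * (F χ ψ (1 / 2 + t * I) /
      (Delta1 χ ψ (1 / 2 + t * I) * starRingEnd ℂ (F χ ψ (1 / 2 + t * I))))) t := by
  have him : (1 / 2 + t * I : ℂ).im ≠ 0 := by simpa using ht
  have hline : HasDerivAt (fun u : ℝ => (1 / 2 + u * I : ℂ)) I t := by
    simpa using ((hasDerivAt_id t).ofReal_comp.mul_const I).const_add (1 / 2 : ℂ)
  have hB := (differentiableAt_Delta1 (χ := χ) (ψ := ψ) him).hasDerivAt.comp t hline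
  have hA := (differentiable_F (χ := χ) (ψ := ψ) _).hasDerivAt.comp t hline
  have h5 : Delta1 χ ψ (1 / 2 + t * I) ≠ 0 := Delta1_ne_zero hψ him
  have hF' : starRingEnd ℂ (F χ ψ (1 / 2 + t * I)) ≠ 0 := (map_ne_zero _).mpr hF
  have h1 := hA.div (hB.mul hA.star) (mul_ne_zero h5 hF')
  refine h1.congr_deriv ?_
  set A := F χ ψ (1 / 2 + t * I) with hAdef
  set B := Delta1 χ ψ (1 / 2 + t * I) with hBdef
  have him0 := logDeriv_Delta1_im hψ ht
  set l := logDeriv (Delta1 χ ψ) (1 / 2 + t * I) with hl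
  set m := logDeriv (F χ ψ) (1 / 2 + t * I) with hm
  have h7 : deriv (Delta1 χ ψ) (1 / 2 + t * I) = l * B := by
    rw [hl, logDeriv_apply, div_mul_cancel₀ _ h5]
  have h8 : deriv (F χ ψ) (1 / 2 + t * I) = m * A := by
    rw [hm, logDeriv_apply, div_mul_cancel₀ _ hF]
  have h9 : ((m.re - l.re / 2 : ℝ) : ℂ) = (m + starRingEnd ℂ m) / 2 - l / 2 := by
    rw [add_conj]
    have : ((l.re : ℝ) : ℂ) = l := Complex.ext rfl (by simp [him0])
    push_cast
    rw [this]
    ring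
  rw [h9]
  simp only [Pi.mul_apply, Function.comp_apply, ← hBdef, ← hAdef, h7, h8, Complex.star_def, map_mul, conj_I]
  field_simp
  ring

variable (hD : Real.exp (Real.exp (Real.exp (10 ^ 6))) ≤ (D : ℝ))
include hD

/-- The lower bound comes from the upper bound for `G`, because `FG` stays within `1/2` of 1. -/
theorem F_bounds (h1 : I1 χ ψ) (h2 : I2 χ ψ) {s : ℂ} (hs : s ∈ Omega1 D) :
    ‖F χ ψ s‖ ≤ ell D ^ 3 * Real.log (ell D) ∧
      1 / (2 * (ell D ^ 3 * Real.log (ell D))) ≤ ‖F χ ψ s‖ := by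
  have hL0 := ell_pos hD
  have hl0 : 0 < Real.log (ell D) := lt_of_lt_of_le (by norm_num) (le_log_ell hD)
  obtain ⟨M, hM, h1⟩ := h1
  obtain ⟨N, hN, h2⟩ := h2
  have e1 := h1 s hs
  have e2 := h2 s hs
  dsimp only at e1 e2
  have hF := norm_nonneg (F χ ψ s)
  have hG := norm_nonneg (G χ ψ s)
  refine ⟨by linarith, ?_⟩
  have e3 : 1 / 2 ≤ ‖F χ ψ s‖ * ‖G χ ψ s‖ := by
    rw [← norm_mul]
    have := norm_sub_norm_le (1 : ℂ) (1 - F χ ψ s * G χ ψ s)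
    rw [sub_sub_cancel, norm_one, norm_sub_rev] at this
    linarith
  rw [div_le_iff₀ (by positivity)]
  have e4 : ‖F χ ψ s‖ * ‖G χ ψ s‖ ≤ ‖F χ ψ s‖ * (ell D ^ 3 * Real.log (ell D)) :=
    mul_le_mul_of_nonneg_left (by linarith) hF
  linarith

/-- Discs of radius `1/ℒ` about points of the critical line lie in `Ω₁`, which extends `2/ℒ` to the
left. There the ratios of values of `|F|` are at most `ℒ⁹`, so `A = 9 log ℒ` and `4A/R = 36 ℒ log
ℒ`. -/
theorem norm_logDeriv_F_le (h1 : I1 χ ψ) (h2 : I2 χ ψ) {t : ℝ} (ht : |t - D| < 1) :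
    ‖logDeriv (F χ ψ) (1 / 2 + t * I)‖ ≤ 36 * (ell D * Real.log (ell D)) := by
  have hL := le_ell hD
  have hL0 := ell_pos hD
  have hl0 : 0 < Real.log (ell D) := lt_of_lt_of_le (by norm_num) (le_log_ell hD)
  have hlL := log_ell_le hD
  have hR : 0 < 1 / ell D := by positivity
  have hR1 : 1 / ell D ≤ 1 / 2 := one_div_le_one_div_of_le (by norm_num) (by linarith)
  have hmem : ∀ z ∈ Metric.ball (1 / 2 + t * I : ℂ) (1 / ell D), z ∈ Omega1 D := by
    intro z hz
    rw [Metric.mem_ball, dist_eq_norm] at hz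
    have e1 := (abs_re_le_norm (z - (1 / 2 + t * I))).trans_lt hz
    have e2 := (abs_im_le_norm (z - (1 / 2 + t * I))).trans_lt hz
    simp at e1 e2
    rw [abs_lt] at e1 e2 ht
    refine ⟨?_, ?_, ?_⟩
    · rw [sqrt_alpha hD]
      simp [s0]
      rw [one_div] at hR hR1
      linarith
    · simp [s0]; rw [one_div] at hR1; linarith
    · simp [s0]
      rw [one_div] at hR1
      rw [abs_lt]; constructor <;> linarith
  have hA : 0 < 9 * Real.log (ell D) := by positivity
  have hlow : 0 < 1 / (2 * (ell D ^ 3 * Real.log (ell D))) := by positivity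
  have hexp : Real.exp (9 * Real.log (ell D)) = ell D ^ 9 := by
    rw [mul_comm, Real.exp_mul, Real.exp_log hL0]
    exact_mod_cast Real.rpow_natCast _ 9
  have key := norm_logDeriv_le_of_ball hR hA
    ((differentiable_F (χ := χ) (ψ := ψ)).differentiableOn) (fun z hz => by
      have := (F_bounds hD h1 h2 (hmem z hz)).2
      exact norm_pos_iff.mp (hlow.trans_le this)) (fun z hz => by
      have e1 := (F_bounds hD h1 h2 (hmem z hz)).1
      have e2 := (F_bounds hD h1 h2 (hmem _ (Metric.mem_ball_self hR))).2
      rw [hexp]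
      refine e1.trans (le_trans ?_ (mul_le_mul_of_nonneg_left e2 (by positivity)))
      rw [mul_one_div, le_div_iff₀ (by positivity)]
      have e3 : Real.log (ell D) ≤ ell D := by linarith
      calc ell D ^ 3 * Real.log (ell D) * (2 * (ell D ^ 3 * Real.log (ell D))) ≤
            ell D ^ 3 * ell D * (ell D * (ell D ^ 3 * ell D)) := by
              have : (2 : ℝ) ≤ ell D := by linarith
              gcongr
        _ = ell D ^ 9 := by ring)
  refine key.trans (le_of_eq ?_)
  field_simp
  ring

/-- For `ψ ∈ Ψ*` there are many zeros on the critical line. -/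
theorem exists_critical_zeros (hreal : ∀ a : ZMod D, (χ a).im = 0) (hq : q ∈ calQ D)
    (hψ : ψ ∈ PsiMod χ q) (h1 : I1 χ ψ) (h2 : I2 χ ψ) (h3 : I3 χ ψ) :
    ∃ T : Finset ℝ, (∀ t ∈ T, |t - D| < 1 ∧ LL χ ψ (1 / 2 + t * I) = 0) ∧
      3 / 5 * ell D ^ 2 ≤ T.card := by
  have hL := le_ell hD
  have hL0 := ell_pos hD
  have hl := le_log_ell hD
  have hl0 : 0 < Real.log (ell D) := lt_of_lt_of_le (by norm_num) hl
  have hq1 : q ≠ 1 := ne_one_of_mem_calQ hq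
  set a : ℝ := D - 99 / 100 with ha
  set b : ℝ := D + 99 / 100 with hb
  have hab : a < b := by linarith
  have hD1 := million_le_cast hD
  have hnear : ∀ t ∈ Set.Icc a b, |t - D| < 1 := fun t ht => by
    rw [abs_lt]; constructor <;> linarith [ht.1, ht.2]
  have ht0 : ∀ t ∈ Set.Icc a b, t ≠ 0 := fun t ht h => by linarith [ht.1]
  have hsub : ∀ t : ℝ, (1 / 2 + t * I : ℂ) - s0 D = ((t - D : ℝ) : ℂ) * I := fun t => by
    rw [s0]; push_cast; ring
  have hO1 : ∀ t ∈ Set.Icc a b, (1 / 2 + t * I : ℂ) ∈ Omega1 D := fun t ht => by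
    have := hnear t ht
    have hs : 0 < 1 / ell D := by positivity
    simp only [Omega1, Set.mem_ofPred_eq, hsub, sqrt_alpha hD]
    simp only [mul_I_re, mul_I_im, ofReal_re, ofReal_im]
    exact ⟨by linarith, by norm_num, by linarith⟩
  have hO2 : ∀ t ∈ Set.Icc a b, (1 / 2 + t * I : ℂ) ∈ Omega2 D := fun t ht => by
    have := hnear t ht
    have hα := alpha_pos hD
    have hs : 0 < 1 / 10 * alpha D * Real.log (ell D) := by positivity
    simp only [Omega2, Set.mem_ofPred_eq, hsub]
    simp only [mul_I_re, mul_I_im, ofReal_re, ofReal_im]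
    exact ⟨by linarith, by norm_num, by linarith⟩
  have hlow : 0 < 1 / (2 * (ell D ^ 3 * Real.log (ell D))) := by positivity
  have hFlow := fun t ht => (F_bounds hD h1 h2 (hO1 t ht)).2
  have hF0 : ∀ t ∈ Set.Icc a b, F χ ψ (1 / 2 + t * I) ≠ 0 := fun t ht =>
    norm_pos_iff.mp (hlow.trans_le (hFlow t ht))
  have hB0 : ∀ t ∈ Set.Icc a b, Delta1 χ ψ (1 / 2 + t * I) ≠ 0 := fun t ht =>
    Delta1_ne_zero hψ (by simpa using ht0 t ht)
  have hlinec : Continuous fun t : ℝ => (1 / 2 + t * I : ℂ) := by fun_prop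
  set w : ℝ → ℝ := fun t => (logDeriv (F χ ψ) (1 / 2 + t * I)).re -
        (logDeriv (Delta1 χ ψ) (1 / 2 + t * I)).re / 2 with hw
  have hwc : ContinuousOn w (Set.Icc a b) := by
    intro t ht
    have e1 : ContinuousAt (logDeriv (F χ ψ)) (1 / 2 + t * I) := by
      have hA : AnalyticAt ℂ (F χ ψ) (1 / 2 + t * I) :=
        (differentiable_F (χ := χ) (ψ := ψ)).analyticAt _
      exact (hA.deriv.div hA (hF0 t ht)).continuousAt
    have e2 : ContinuousAt (logDeriv (Delta1 χ ψ)) (1 / 2 + t * I) := by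
      have hA : AnalyticAt ℂ (Delta1 χ ψ) (1 / 2 + t * I) := by
        refine DifferentiableOn.analyticAt (s := {z : ℂ | z.im ≠ 0})
          (fun z hz => (differentiableAt_Delta1 hz).differentiableWithinAt)
          (IsOpen.mem_nhds (isOpen_ne_fun continuous_im continuous_const) ?_)
        simpa using ht0 t ht
      exact (hA.deriv.div hA (hB0 t ht)).continuousAt
    have e1' := continuous_re.continuousAt.comp (e1.comp (f := fun t : ℝ => (1 / 2 + t * I : ℂ))
      (hlinec.continuousAt (x := t)))
    have e2' := continuous_re.continuousAt.comp (e2.comp (f := fun t : ℝ => (1 / 2 + t * I : ℂ))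
      (hlinec.continuousAt (x := t)))
    exact (e1'.sub (e2'.div_const 2)).continuousWithinAt
  -- The main term `ℒ²` is half of `-Δ₁'/Δ₁`; the contributions `O(ℒ log ℒ)` from `F` and `O(ℒ)`
  -- from the gamma factors and conductors are negligible.
  have hwlow : ∀ t ∈ Set.Icc a b, 99 / 100 * ell D ^ 2 ≤ w t := by
    intro t ht
    have e1 := (abs_re_le_norm _).trans (norm_logDeriv_F_le hD h1 h2 (hnear t ht))
    obtain ⟨i1, i2⟩ := im_mem_of_abs_le hD (t := t) (by
      have := hnear t ht
      have : 0 ≤ ell D ^ 2 := by positivity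
      linarith)
    have e2 := (abs_re_le_norm _).trans (norm_logDeriv_Delta1_add_le hD hq hψ
      (s := 1 / 2 + t * I) (by simp; norm_num) (by simpa using i1)
      (by simpa using i2))
    have e3 : (logDeriv (Delta1 χ ψ) (1 / 2 + t * I) + 2 * (ell D : ℂ) ^ 2).re =
        (logDeriv (Delta1 χ ψ) (1 / 2 + t * I)).re + 2 * ell D ^ 2 := by
      rw [show 2 * (ell D : ℂ) ^ 2 = ((2 * ell D ^ 2 : ℝ) : ℂ) by push_cast; ring, add_re, ofReal_re]
    rw [e3] at e2
    have e4 : 36 * (ell D * Real.log (ell D)) ≤ ell D ^ 2 / 1000 := by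
      have h := log_ell_pow_le hD
      have h' : Real.log (ell D) ^ 2 ≤ ell D := by
        calc Real.log (ell D) ^ 2 ≤ Real.log (ell D) ^ 20 :=
              pow_le_pow_right₀ (by linarith) (by norm_num)
          _ ≤ ell D ^ (1 / 100 : ℝ) := h
          _ ≤ ell D ^ (1 : ℝ) := Real.rpow_le_rpow_of_exponent_le (by linarith) (by norm_num)
          _ = ell D := Real.rpow_one _
      have h'' : 36000 * Real.log (ell D) ≤ Real.log (ell D) ^ 2 := by nlinarith
      have := mul_le_mul_of_nonneg_left (h''.trans h') hL0.le
      linarith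
    have e5 : 30 * ell D ≤ ell D ^ 2 / 1000 := by nlinarith
    rw [abs_le] at e1 e2
    simp only [hw]
    linarith [e1.1, e2.2]
  have hunit : ‖F χ ψ (1 / 2 + a * I) /
      (Delta1 χ ψ (1 / 2 + a * I) * starRingEnd ℂ (F χ ψ (1 / 2 + a * I)))‖ = 1 := by
    have haa : a ∈ Set.Icc a b := ⟨le_rfl, hab.le⟩
    rw [norm_div, norm_mul, norm_Delta1_half hψ (ht0 a haa), one_mul, norm_conj,
      div_self (norm_ne_zero_iff.mpr (hF0 a haa))]
  obtain ⟨ω, hωd, hω⟩ := exists_phase hab.le hwc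
    (fun t ht => hasDerivAt_phase hψ (ht0 t ht) (hF0 t ht)) hunit
  have hωc : ContinuousOn ω (Set.Icc a b) := fun t ht =>
    (hωd t ht).continuousAt.continuousWithinAt
  have hmono : StrictMonoOn ω (Set.Icc a b) := by
    refine strictMonoOn_of_deriv_pos (convex_Icc a b) hωc fun t ht => ?_
    have ht' := interior_subset ht
    rw [(hωd t ht').deriv]
    exact lt_of_lt_of_le (by positivity) (hwlow t ht')
  have hincr : 99 / 100 * ell D ^ 2 * (b - a) ≤ ω b - ω a := by
    refine (convex_Icc a b).mul_sub_le_image_sub_of_le_deriv hωc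
      (fun t ht => (hωd t (interior_subset ht)).differentiableAt.differentiableWithinAt)
      (fun t ht => ?_) a ⟨le_rfl, hab.le⟩ b ⟨hab.le, le_rfl⟩ hab.le
    rw [(hωd t (interior_subset ht)).deriv]
    exact hwlow t (interior_subset ht)
  set Zc : ℝ → ℂ := fun t => LL χ ψ (1 / 2 + t * I) * exp (I * ω t) / F χ ψ (1 / 2 + t * I) with hZc
  have hid := fun t ht => phase_identities (hF0 t ht) (hB0 t ht)
    (LL_eq_Delta1_mul_conj hreal hq1 hψ (ht0 t ht)) (hω t ht)
  have hZcont : ContinuousOn (fun t => (Zc t).re) (Set.Icc a b) := by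
    refine continuous_re.comp_continuousOn ?_
    refine ContinuousOn.div (ContinuousOn.mul ?_ ?_) ?_ hF0
    · exact ((differentiable_LL hq1 hψ).continuous.comp hlinec).continuousOn
    · exact (continuousOn_const.mul (continuous_ofReal.comp_continuousOn hωc)).cexp
    · exact ((differentiable_F (χ := χ) (ψ := ψ)).continuous.comp hlinec).continuousOn
  -- After division by `F` the error of (I3) must stay below 2. As `2|F| ≥ (ℒ³ log ℒ)⁻¹ ≥ ℒ⁻⁴`, the
  -- bound `ℒ^{-24/5}` is sufficient.
  have hclose : ∀ t ∈ Set.Icc a b, |(Zc t).re - 2 * Real.cos (ω t)| < 2 := by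
    intro t ht
    obtain ⟨M, hM, h3⟩ := h3
    have e1 := (h3 _ (hO2 t ht)).trans_lt hM
    have e2 : (Zc t).re - 2 * Real.cos (ω t) = (Zc t - 2 * Real.cos (ω t)).re := by
      rw [sub_re]; congr 1
      exact_mod_cast (ofReal_re (2 * Real.cos (ω t))).symm
    have e3 : Zc t - 2 * Real.cos (ω t) = (LL χ ψ (1 / 2 + t * I) - calF χ ψ (1 / 2 + t * I)) *
        exp (I * ω t) / F χ ψ (1 / 2 + t * I) := by
      rw [← (hid t ht).2, calF, F_inv_one_sub hreal]
      simp only [hZc]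
      ring
    rw [e2]
    refine (abs_re_le_norm _).trans_lt ?_
    rw [e3, norm_div, norm_mul, mul_comm I, norm_exp_ofReal_mul_I, mul_one,
      div_lt_iff₀ (hlow.trans_le (hFlow t ht))]
    refine e1.trans_le (le_trans ?_ (mul_le_mul_of_nonneg_left (hFlow t ht) (by norm_num)))
    have e4 : 2 * (1 / (2 * (ell D ^ 3 * Real.log (ell D)))) =
        (ell D ^ 3 * Real.log (ell D))⁻¹ := by field_simp
    rw [e4, Real.rpow_neg hL0.le]
    apply inv_anti₀ (by positivity)
    calc ell D ^ 3 * Real.log (ell D) ≤ ell D ^ 3 * ell D :=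
          mul_le_mul_of_nonneg_left (log_ell_le hD) (by positivity)
      _ = ell D ^ (4 : ℝ) := by
          rw [← pow_succ]; exact_mod_cast (Real.rpow_natCast _ 4).symm
      _ ≤ _ := Real.rpow_le_rpow_of_exponent_le (by linarith) (by norm_num)
  obtain ⟨T, hT, hcard⟩ := exists_zeros hab.le hZcont hωc hmono hclose
  refine ⟨T, fun t ht => ⟨hnear t (hT t ht).1, ?_⟩, ?_⟩
  · obtain ⟨e1, e2⟩ := hT t ht
    have e3 : (Zc t).im = 0 := conj_eq_iff_im.mp (hid t e1).1
    have e4 : Zc t = 0 := Complex.ext e2 e3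
    rcases div_eq_zero_iff.mp e4 with e5 | e5
    · exact (mul_eq_zero.mp e5).resolve_right (exp_ne_zero _)
    · exact absurd e5 (hF0 t e1)
  · refine le_trans ?_ hcard
    -- Numerically `0.99 · 1.98 > 0.62 · 3.15`, and `0.62 ℒ² - 2` still exceeds `3/5 · ℒ²`.
    have e1 : 99 / 100 * ell D ^ 2 * (198 / 100) ≤ ω b - ω a := by
      have : b - a = 198 / 100 := by rw [ha, hb]; ring
      rwa [this] at hincr
    have e2 : 62 / 100 * ell D ^ 2 ≤ (ω b - ω a) / Real.pi := by
      rw [le_div_iff₀ Real.pi_pos]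
      have := Real.pi_lt_d2
      have : 62 / 100 * ell D ^ 2 * Real.pi ≤ 62 / 100 * ell D ^ 2 * 3.15 := by gcongr
      have h0 : 0 ≤ ell D ^ 2 := by positivity
      linarith
    have e3 : 100 ≤ ell D ^ 2 := by nlinarith
    linarith

end Zeros

/-! ### Finiteness -/

section Finite

variable {D : ℕ} [NeZero D] {χ : DirichletCharacter ℂ D} {q : ℕ} [NeZero q]
  {ψ : DirichletCharacter ℂ q}

theorem LL_ne_zero_of_one_le_re (hq : q ≠ 1) (hψ : ψ ∈ PsiMod χ q) {s : ℂ} (hs : 1 ≤ s.re) :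
    LL χ ψ s ≠ 0 :=
  mul_ne_zero
    (LFunction_ne_zero_of_one_le_re ψ (Or.inl (ne_one_of_isPrimitive hψ.1 hq)) hs)
    (LFunction_ne_zero_of_one_le_re (twist χ ψ) (Or.inl (twist_ne_one hq hψ)) hs)

/-- The product of `L`-functions does not vanish for `Re s ≥ 1`, and the functional equation
transports this to `Re s ≤ 0`. The zeros in question lie in a compact rectangle, where infinitely
many would accumulate and force the entire function to be zero. -/
theorem finite_S (hreal : ∀ a : ZMod D, (χ a).im = 0) (hD : 1 < D) (hq : q ≠ 1)
    (hψ : ψ ∈ PsiMod χ q) : (S χ ψ).Finite := by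
  have hD' : (1 : ℝ) < D := by exact_mod_cast hD
  have hsub : S χ ψ ⊆ Set.Icc (0 : ℝ) 1 ×ℂ Set.Icc ((D : ℝ) - 1) (D + 1) := by
    rintro ρ ⟨h0, him⟩
    rw [abs_lt] at him
    have hne : ρ.im ≠ 0 := fun h => by rw [h] at him; linarith [him.1]
    refine mem_reProdIm.mpr ⟨⟨?_, ?_⟩, ⟨by linarith, by linarith⟩⟩
    · by_contra h
      rw [LL_eq_Delta1_mul hreal hψ hne] at h0
      refine mul_ne_zero (Delta1_ne_zero hψ hne)
        (LL_ne_zero_of_one_le_re hq (inv_mem_PsiMod hreal hψ) ?_) h0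
      rw [sub_re, one_re]; linarith
    · by_contra h
      exact LL_ne_zero_of_one_le_re hq hψ (by linarith) h0
  by_contra hinf
  obtain ⟨x, _, hx⟩ := Set.Infinite.exists_accPt_of_subset_isCompact hinf
    (isCompact_Icc.reProdIm isCompact_Icc) hsub
  have hA : AnalyticOnNhd ℂ (LL χ ψ) Set.univ := fun z _ => (differentiable_LL hq hψ).analyticAt z
  have hfreq : ∃ᶠ z in nhdsWithin x {x}ᶜ, LL χ ψ z = 0 :=
    (accPt_iff_frequently_nhdsNE.mp hx).mono fun z hz => hz.1
  have h0 := hA.eqOn_zero_of_preconnected_of_frequently_eq_zero isPreconnected_univ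
    (Set.mem_univ x) hfreq (Set.mem_univ (1 : ℂ))
  exact LL_ne_zero_of_one_le_re hq hψ le_rfl h0

end Finite

end LandauSiegel

/-! ### Assembly: good characters times critical zeros. -/

theorem proposition13p1 (D : ℕ) [NeZero D]
    (hD : Real.exp (Real.exp (Real.exp (10 ^ 6))) ≤ (D : ℝ))
    (χ : DirichletCharacter ℂ D) (hprim : χ.IsPrimitive) (hreal : ∀ a : ZMod D, (χ a).im = 0)
    (hA1 : LandauSiegel.A1 χ) :
    (LandauSiegel.pairs χ).Finite ∧
      (1 / 100 : ℝ) * LandauSiegel.ell D ^ 2 * LandauSiegel.Q D ^ 2 ≤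
        ((LandauSiegel.pairs χ).ncard : ℝ) := by
  classical
  open LandauSiegel in
  have hD6 := million_le_cast hD
  have hD1 : 1 < D := by
    have : (1 : ℝ) < D := by linarith
    exact_mod_cast this
  have hχ : χ ≠ 1 := ne_one_of_isPrimitive hprim hD1.ne'
  have hfin : (pairs χ).Finite := by
    have hsub : pairs χ ⊆ ⋃ x ∈ Psi χ ∩ PsiStar χ, (fun ρ => (x, ρ)) '' S χ x.2 := by
      rintro ⟨x, ρ⟩ ⟨h1, h2⟩
      exact Set.mem_biUnion (⟨h1.1, h1⟩ : x ∈ Psi χ ∩ PsiStar χ) ⟨ρ, h2, rfl⟩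
    refine Set.Finite.subset (Set.Finite.biUnion ((finite_Psi χ).inter_of_left _) ?_) hsub
    rintro x ⟨hx, -⟩
    exact (finite_S hreal hD1 (ne_one_of_mem_calQ hx.1) hx.2).image _
  refine ⟨hfin, ?_⟩
  set P := (finite_Psi χ).toFinset with hPdef
  have hP : ∀ x ∈ P, x ∈ Psi χ := fun x hx => (finite_Psi χ).mem_toFinset.mp hx
  set g := P.filter fun x => x ∈ PsiStar χ with hg
  -- Here `47/1000 = 1/20 - 3/1000`: the family minus the three exceptional sets.
  have hcard : 47 / 1000 * Q D ^ 2 ≤ (g.card : ℝ) := by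
    have h1 := card_not_I1_le hD hP hreal
    have h2 := card_not_I2_le hD hreal hP hχ hA1
    have h3 := card_not_I3_le hD hreal hP hχ hA1
    have h4 := card_Psi_ge hD hprim
    rw [Set.ncard_eq_toFinset_card _ (finite_Psi χ)] at h4
    have hsub : P ⊆ g ∪ ((P.filter fun y => ¬ I1 χ y.2) ∪ ((P.filter fun y => ¬ I2 χ y.2) ∪
        (P.filter fun y => ¬ I3 χ y.2))) := by
      intro x hx
      by_cases hs : x ∈ PsiStar χ
      · exact Finset.mem_union_left _ (Finset.mem_filter.mpr ⟨hx, hs⟩)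
      · have hs' : ¬ (I1 χ x.2 ∧ I2 χ x.2 ∧ I3 χ x.2) := fun h => hs ⟨hP x hx, h⟩
        refine Finset.mem_union_right _ ?_
        simp only [Finset.mem_union, Finset.mem_filter, hx, true_and]
        tauto
    have h5 := (Finset.card_le_card hsub).trans ((Finset.card_union_le _ _).trans
      (add_le_add_right ((Finset.card_union_le _ _).trans
        (add_le_add_right (Finset.card_union_le _ _) _)) _))
    have h6 : (P.card : ℝ) ≤ g.card + ((P.filter fun y => ¬ I1 χ y.2).card +
        ((P.filter fun y => ¬ I2 χ y.2).card + (P.filter fun y => ¬ I3 χ y.2).card)) := by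
      exact_mod_cast h5
    linarith
  have hex : ∀ x : Σ q : ℕ+, DirichletCharacter ℂ (q : ℕ), ∃ T : Finset ℝ, x ∈ PsiStar χ →
      (∀ t ∈ T, |t - D| < 1 ∧ LL χ x.2 (1 / 2 + t * I) = 0) ∧ 3 / 5 * ell D ^ 2 ≤ T.card := by
    intro x
    by_cases hx : x ∈ PsiStar χ
    · obtain ⟨T, hT⟩ := exists_critical_zeros hD hreal hx.1.1 hx.1.2 hx.2.1 hx.2.2.1 hx.2.2.2
      exact ⟨T, fun _ => hT⟩
    · exact ⟨∅, fun h => absurd h hx⟩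
  choose T hT using hex
  set W : Finset ((Σ q : ℕ+, DirichletCharacter ℂ (q : ℕ)) × ℂ) :=
    (g.sigma T).image fun y => (y.1, (1 / 2 + y.2 * I : ℂ)) with hW
  have hWsub : (W : Set _) ⊆ pairs χ := by
    rintro _ hy
    obtain ⟨⟨x, t⟩, hx, rfl⟩ := Finset.mem_image.mp hy
    obtain ⟨h1, h2⟩ := Finset.mem_sigma.mp hx
    have h3 := (Finset.mem_filter.mp h1).2
    obtain ⟨h4, h5⟩ := (hT x h3).1 t h2
    exact ⟨h3, h5, by simpa using h4⟩
  have hWcard : W.card = ∑ x ∈ g, (T x).card := by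
    rw [hW, Finset.card_image_of_injective, Finset.card_sigma]
    rintro ⟨x, t⟩ ⟨y, u⟩ h
    simp only [Prod.mk.injEq] at h
    obtain ⟨rfl, h2⟩ := h
    have := congrArg Complex.im h2
    simp at this
    rw [this]
  have h1 : (W.card : ℝ) ≤ (pairs χ).ncard := by
    have := Set.ncard_le_ncard hWsub hfin
    rw [Set.ncard_coe_finset] at this
    exact_mod_cast this
  have h2 : (g.card : ℝ) * (3 / 5 * ell D ^ 2) ≤ W.card := by
    rw [hWcard, Nat.cast_sum, ← nsmul_eq_mul]
    exact Finset.card_nsmul_le_sum _ _ _ fun x hx => (hT x (Finset.mem_filter.mp hx).2).2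
  have h3 : 0 ≤ ell D ^ 2 := sq_nonneg _
  have h4 := mul_le_mul_of_nonneg_right hcard (by positivity : 0 ≤ 3 / 5 * ell D ^ 2)
  have h5 : 0 ≤ ell D ^ 2 * Q D ^ 2 := by positivity
  -- The product `47/1000 · 3/5 = 0.0282` exceeds `1/100`.
  linarith
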